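/- For $f:\mathbb R^2\to\mathbb R$, $y,\alpha\in\mathbb R^2$, $\alpha\ne0$, put $\Delta_\alpha f(y)=\frac{f(y)-f(y-\alpha)}{|\alpha|}$, and let $$\mathcal T[f_1,f_2](y)=\frac1{2\pi}\int_{\mathbb R^2}\alpha\cdot\nabla_y\Delta_\alpha f_1(y)\left(\left(1+(\Delta_\alpha f_2(y))^2\right)^{-3/2}-1\right)\frac{d\alpha}{|\alpha|^2},\qquad \mathcal T[f]=\mathcal T[f,f].$$ Here $\mathcal T[f_1,f_2]$ is understood as a function modulo additive constants: the integral over $|\alpha|<R$ converges absolutely for all $y$ and $R$, and $\mathcal T[f_1,f_2](y)$ is the limit of these integrals minus $c(R)$ as $R\to\infty$, for some $c(R)\in\mathbb R$ independent of $y$. For $s\in\mathbb R$ let $$k^{Lin}_s(|y|)=s\left(\sqrt{|y|^2+1}-\log\left(\sqrt{|y|^2+1}+1\right)\right),\qquad y\in\mathbb R^2.$$ For $t\ge0$ and $m=\lfloor t\rfloor$, a real function $f$ that is a tempered distribution lies in $\dot H^t=\dot H^t(\mathbb R^2)$ if $\nabla^m f\in\dot H^{t-m}$, that is, if the Fourier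 transforms of the partial derivatives of $f$ of order $m$ are locally integrable functions which are square integrable with weight $|\xi|^{2(t-m)}$; its seminorm is $\|f\|_{\dot H^t}=\||\xi|^{t-m}\,|\widehat{\nabla^m f}|\,\|_{L^2}$ (that is, $\|\Lambda^tf\|_{L^2}$, up to a constant fixed by the convention for the Fourier transform), and $\|f\|_{\dot H^{a}\cap\dot H^{b}}=\|f\|_{\dot H^a}+\|f\|_{\dot H^b}$. **Proposition.** For every $t_1\in(3/2,2)$ there are $t^{**}=t^{**}(t_1)\in(2,t_1+1)$ and a constant $C=C(t_1)$ such that the following holds. (1) For all $s\in\mathbb R$ and $f\in\dot H^{t^{**}}\cap\dot H^{t_1+1}$, the function $f$ has a $C^1$ representative; for this representative $\mathcal T[f,k^{Lin}_s]$ exists in the above sense, and $$\left\|\mathcal T[f(\cdot),k^{Lin}_s(|\cdot|)]\right\|_{\dot H^{t_1}}\le C\,s^2\,\|f\|_{\dot H^{t^{**}}\cap\dot H^{t_1+1}}.$$ (2) Consequently, for all $s\in\mathbb R$, $\mathcal T[k^{Lin}_s]$ exists in the above sense, and $$\left\|\mathcal T[k^{Lin}_s(|\cdot|)]\right\|_{\dot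 H^{t_1}}\le C\,|s|^3.$$ -/

import Mathlib

open MeasureTheory Filter Topology
open scoped SchwartzMap FourierTransform LineDeriv ENNReal NNReal

noncomputable section

namespace Muskat

/-- The Euclidean plane `ℝ²`. -/
abbrev Plane : Type := EuclideanSpace ℝ (Fin 2)

/-! ### Homogeneous Sobolev seminorms on `ℝ²` -/

/-- The tempered distribution `u` is (integration against) the function `v`. Testing with a
Gaussian shows that such a `v` is locally integrable; it is determined by `u` up to null sets. -/
def IsFunction (u : 𝓢'(Plane, ℂ)) (v : Plane → ℂ) : Prop :=
  AEStronglyMeasurable v volume ∧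
    ∀ φ : 𝓢(Plane, ℂ), Integrable (fun x => φ x * v x) volume ∧ u φ = ∫ x, φ x * v x

/-- The partial derivative `∂_{i 0} ∂_{i 1} ⋯ ∂_{i (m-1)} u` in the sense of distributions. -/
def partialDeriv {m : ℕ} (i : Fin m → Fin 2) (u : 𝓢'(Plane, ℂ)) : 𝓢'(Plane, ℂ) :=
  LineDeriv.iteratedLineDerivOp
    (fun k => (EuclideanSpace.single (i k) (1 : ℝ) : Plane)) u

/-- The seminorm of the homogeneous Sobolev space `Ḣ^t(ℝ²)`, `t ≥ 0`, with the value `∞` off the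
space. Let `m = ⌊t⌋`. The real function `f` belongs to `Ḣ^t` if it is a tempered distribution whose
partial derivatives `∂^i f` of order `m` have Fourier transforms that are locally integrable
functions `w i` with `|2πξ|^(t-m) w i ∈ L²`; that is, `∇^m f ∈ Ḣ^(t-m)`, where `0 ≤ t - m < 1`.
The functions `w i` are unique up to null sets, so the infimum is over at most one value, which is
`(∫ |2πξ|^(2t) |𝓕 f(ξ)|² dξ)^(1/2) = ‖Λ^t f‖_{L²}`, because `∑ i, ∏ k, ξ_(i k) ^ 2 = |ξ|^(2m)`. -/
def homSobolev (t : ℝ) (f : Plane → ℝ) : ℝ≥0∞ :=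
  ⨅ (u : 𝓢'(Plane, ℂ)) (_ : IsFunction u (fun x => (f x : ℂ)))
    (w : (Fin ⌊t⌋₊ → Fin 2) → Plane → ℂ)
    (_ : ∀ i, IsFunction (𝓕 (partialDeriv i u)) (w i)),
      (∑ i, eLpNorm (fun ξ => ((2 * Real.pi * ‖ξ‖) ^ (t - (⌊t⌋₊ : ℝ)) : ℝ) • w i ξ) 2 volume ^ 2)
        ^ (1 / 2 : ℝ)

/-! ### The nonlinear operator -/

/-- The finite difference quotient `Δ_α f(y) = (f(y) - f(y - α)) / |α|`. -/
def diffQuot (α : Plane) (f : Plane → ℝ) (y : Plane) : ℝ :=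
  (f y - f (y - α)) / ‖α‖

/-- The integrand
`(1/2π) (α · ∇_y Δ_α f₁)(y) ((1 + (Δ_α f₂(y))²)^(-3/2) - 1) / |α|²`. -/
def kernel (f₁ f₂ : Plane → ℝ) (y α : Plane) : ℝ :=
  1 / (2 * Real.pi) *
    (fderiv ℝ (diffQuot α f₁) y α * ((1 + diffQuot α f₂ y ^ 2) ^ (-(3 / 2) : ℝ) - 1) / ‖α‖ ^ 2)

/-- `T` is a version of `𝒯[f₁, f₂] = ∫ kernel f₁ f₂ y α dα`, a function that is defined up to an
additive constant. The integral converges absolutely on bounded sets of `α`. At infinity it is the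
limit of the integrals over the balls `|α| < R` as `R → ∞`, modulo constants `c R` that do not
depend on `y`: this is the meaning of the integral in a homogeneous space such as `Ḣ^t`, `t > 1`,
whose elements are functions modulo constants. For instance the integral that defines
`𝒯[kLin s, kLin s](y)` diverges logarithmically at infinity for every `y` if `s ≠ 0`, but the
diverging part is the same for all `y`. -/
def IsT (f₁ f₂ T : Plane → ℝ) : Prop :=
  (∀ y : Plane, ∀ R : ℝ, IntegrableOn (kernel f₁ f₂ y) (Metric.ball 0 R) volume) ∧
    ∃ c : ℝ → ℝ, ∀ y : Plane,
      Tendsto (fun R : ℝ => (∫ α in Metric.ball (0 : Plane) R, kernel f₁ f₂ y α) - c R)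
        atTop (𝓝 (T y))

/-- Where the integral converges absolutely, it is a version of `𝒯[f₁, f₂]`. -/
theorem isT_of_integrable {f₁ f₂ : Plane → ℝ} (h : ∀ y, Integrable (kernel f₁ f₂ y) volume) :
    IsT f₁ f₂ (fun y => ∫ α, kernel f₁ f₂ y α) := by
  refine ⟨fun y R => (h y).integrableOn, fun _ => 0, fun y => ?_⟩
  simpa using (aecover_ball (μ := (volume : Measure Plane)) (x := 0)
    (tendsto_id (α := ℝ) (x := atTop))).integral_tendsto_of_countably_generated (h y)

/-- Two versions of `𝒯[f₁, f₂]` differ by a constant. -/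
theorem IsT.sub_eq_const {f₁ f₂ T T' : Plane → ℝ} (h : IsT f₁ f₂ T) (h' : IsT f₁ f₂ T')
    (y z : Plane) : T y - T' y = T z - T' z := by
  obtain ⟨-, c, hc⟩ := h
  obtain ⟨-, c', hc'⟩ := h'
  have h1 := (hc y).sub (hc' y)
  have h2 := (hc z).sub (hc' z)
  refine tendsto_nhds_unique h1 (h2.congr fun R => ?_)
  ring

/-- The function `k^Lin_s(|y|) = s (√(|y|² + 1) - log (√(|y|² + 1) + 1))`. -/
def kLin (s : ℝ) (y : Plane) : ℝ :=
  s * (√(‖y‖ ^ 2 + 1) - Real.log (√(‖y‖ ^ 2 + 1) + 1))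

end Muskat

end

noncomputable section

namespace Muskat


/-! Put a = t₁ - 1, so that 0 < a < 1, and take t** = 2 + a/4. With c(α, y) = `coef s α y`, the
integrand of 𝒯[f, k] is (2π)⁻¹ (∇f(y) - ∇f(y - α))·α c(α, y) / |α|³. The factor s² comes from c: the
nonlinearity `nl` vanishes to second order at 0, and the difference quotients of the profile are
bounded by |s|.

Duality. A function T lies in Ḣ^(1+a) as soon as its pairing with ∂_e 𝓕φ is bounded by a constant
times the L² norm of |ξ|^(-a) φ, for coordinate vectors e; `exists_riesz` then produces the Fourier
transform of ∂_e T. On the other side, f is, up to an affine function that the kernel does not see,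
a renormalised inverse transform `rep F` of a density F (`exists_rep`). After an integration by
parts the derivative falls either on c or on f. Every resulting term is brought to the form of a
superposition over p of b_p(y) `invF` (Q_p)(y), where b_p is a bounded, slowly varying coefficient
and Q_p is dominated by (|ξ|² + |ξ|^(2-a/4)) |F|.

Multipliers. The key estimate is `enorm_pairing_mul_le`: multiplication by a coefficient b, with |b|
≤ A and local Lipschitz constant B(|y|^(-1/2) + |y - z|^(-1/2)), maps Ḣ^a ∩ Ḣ^(a/2) to Ḣ^a with norm
controlled by A + A^(1-a) B^a. In the Gagliardo seminorm, the differences of b produce the weights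
|y|^(-a) and |y - z|^(-a), which Hardy's inequality (`hardy`) absorbs into the Ḣ^(a/2) seminorm. The
lowest regularity of f that is needed is therefore a/2 + 2 - a/4 = 2 + a/4.

Convergence in α. If the derivative falls on c, then c loses |α|^(-a) near 0 and gains |α|^(-1) at
infinity, and the integrals converge absolutely. If it falls on f, then near 0 the coefficient is
compared with its limit `coef₀` along rays. The difference gains a power of |α|; `coef₀` is even in
α, so the difference quotients may be symmetrised, and their radial integral is the bounded function
`sinInt`. For |α| ≥ 1 the term with ∇f(y - α)·α is a radial derivative and is integrated by parts in
|α|, while the term with ∇f(y)·α sees only the odd part of c, whose integral `annCoef` over annuli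
is bounded and slowly varying uniformly in the outer radius. All bounds are uniform in the
truncation radius R (`enorm_integral_truncT_mul_le`).

Existence. The same radial integration by parts, applied to f with Hölder continuous gradient, shows
that the truncated integral at y minus its value at 0 converges as R → ∞, with quadratic growth in y
(`HolderGrad.exists_limit`). The subtracted constant is harmless because constants pair to zero with
derivatives. General densities are approximated by bounded ones with bounded support.

The profile. The second derivatives of k decay like 1/⟨y⟩ with differences of the corresponding size
(`symbolDecay_kHess`), so their Gagliardo seminorms of every order in (0, 1) are finite. Hence k
lies in Ḣ^(2+a/4) ∩ Ḣ^(2+a) with norm O(|s|), and the linear estimate gives |s|³. -/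

/-! ### Polar coordinates -/

/-- The arc length on the unit circle. -/
abbrev arc : Measure (Metric.sphere (0 : Plane) 1) := (volume : Measure Plane).toSphere

lemma lintegral_polar {f : Plane → ℝ≥0∞} (hf : Measurable f) :
    ∫⁻ x, f x = ∫⁻ θ, (∫⁻ r in Set.Ioi (0 : ℝ), ENNReal.ofReal r * f (r • (θ : Plane))) ∂arc := by
  have hd : Module.finrank ℝ Plane - 1 = 1 := by simp
  have h1 : ∫⁻ x, f x = ∫⁻ x : ({(0 : Plane)}ᶜ : Set Plane), f x.1
      ∂((volume : Measure Plane).comap (↑)) := by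
    rw [lintegral_subtype_comap (measurableSet_singleton _).compl f, restrict_compl_singleton]
  have h2 := (volume : Measure Plane).measurePreserving_homeomorphUnitSphereProd
  rw [h1, ← (h2.symm (homeomorphUnitSphereProd Plane).toMeasurableEquiv).lintegral_comp
    (by fun_prop)]
  have h3 : Measurable fun p : Metric.sphere (0 : Plane) 1 × Set.Ioi (0 : ℝ) =>
      f ((p.2 : ℝ) • (p.1 : Plane)) := by fun_prop
  have h4 : ∀ p, f ((homeomorphUnitSphereProd Plane).toMeasurableEquiv.symm p).1
      = f ((p.2 : ℝ) • (p.1 : Plane)) := fun p => rfl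
  simp only [h4]
  rw [lintegral_prod _ h3.aemeasurable]
  refine lintegral_congr fun θ => ?_
  rw [Measure.volumeIoiPow, lintegral_withDensity_eq_lintegral_mul _ (by fun_prop) (by fun_prop),
    hd]
  simp only [Pi.mul_apply, pow_one]
  rw [← lintegral_subtype_comap measurableSet_Ioi
    (fun r => ENNReal.ofReal r * f (r • (θ : Plane)))]

/-- This form has no subtype in the radial factor, so that the Bochner versions below follow from
the rules for `Measure.map` and `withDensity`. -/
lemma volume_eq_map_polar : (volume : Measure Plane) =
    ((arc.prod (volume.restrict (Set.Ioi (0 : ℝ)))).withDensity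
      (fun p => (p.2.toNNReal : ℝ≥0∞))).map
      (fun p : Metric.sphere (0 : Plane) 1 × ℝ => p.2 • (p.1 : Plane)) := by
  have hm : Measurable fun p : Metric.sphere (0 : Plane) 1 × ℝ => p.2 • (p.1 : Plane) := by
    fun_prop
  ext s hs
  rw [Measure.map_apply hm hs, withDensity_apply _ (hm hs), ← lintegral_indicator (hm hs),
    ← lintegral_indicator_one hs, lintegral_polar (measurable_one.indicator hs),
    lintegral_prod _ (by
      refine Measurable.aemeasurable (Measurable.indicator (by fun_prop) (hm hs)))]
  refine lintegral_congr fun θ => lintegral_congr fun r => ?_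
  by_cases h : r • (θ : Plane) ∈ s
  · simp [h, ENNReal.ofReal]
  · simp [h]

lemma integrable_polar {E : Type*} [NormedAddCommGroup E] [NormedSpace ℝ E] {f : Plane → E}
    (hf : Integrable f) :
    Integrable (fun p : Metric.sphere (0 : Plane) 1 × ℝ => p.2 • f (p.2 • (p.1 : Plane)))
      (arc.prod (volume.restrict (Set.Ioi 0))) := by
  have hm : Measurable fun p : Metric.sphere (0 : Plane) 1 × ℝ => p.2 • (p.1 : Plane) := by
    fun_prop
  rw [volume_eq_map_polar] at hf
  have h1 := hf.comp_measurable hm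
  rw [integrable_withDensity_iff_integrable_smul (by fun_prop)] at h1
  refine h1.congr ?_
  have : ∀ᵐ p ∂(arc.prod (volume.restrict (Set.Ioi (0:ℝ)))), p.2 ∈ Set.Ioi (0:ℝ) :=
    Measure.quasiMeasurePreserving_snd.ae (ae_restrict_mem measurableSet_Ioi)
  filter_upwards [this] with p hp
  have : (0:ℝ) ≤ p.2 := le_of_lt hp
  simp [NNReal.smul_def, this]

lemma integral_polar {E : Type*} [NormedAddCommGroup E] [NormedSpace ℝ E] [CompleteSpace E]
    {f : Plane → E} (hf : Integrable f) :
    ∫ x, f x = ∫ θ, (∫ r in Set.Ioi (0 : ℝ), r • f (r • (θ : Plane))) ∂arc := by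
  have hm : Measurable fun p : Metric.sphere (0 : Plane) 1 × ℝ => p.2 • (p.1 : Plane) := by
    fun_prop
  have h0 := integrable_polar hf
  rw [← integral_prod _ h0]
  have hf' := hf
  rw [volume_eq_map_polar] at hf'
  conv_lhs => rw [volume_eq_map_polar]
  rw [integral_map hm.aemeasurable hf'.aestronglyMeasurable,
    integral_withDensity_eq_integral_smul (by fun_prop)]
  refine integral_congr_ae ?_
  have : ∀ᵐ p ∂(arc.prod (volume.restrict (Set.Ioi (0:ℝ)))), p.2 ∈ Set.Ioi (0:ℝ) :=
    Measure.quasiMeasurePreserving_snd.ae (ae_restrict_mem measurableSet_Ioi)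
  filter_upwards [this] with p hp
  have : (0:ℝ) ≤ p.2 := le_of_lt hp
  simp [NNReal.smul_def, this]

lemma arc_univ : arc Set.univ = ENNReal.ofReal (2 * Real.pi) := by
  rw [Measure.toSphere_apply_univ]
  simp [EuclideanSpace.volume_ball_fin_two]

lemma lintegral_radial {f : ℝ → ℝ≥0∞} (hf : Measurable f) :
    ∫⁻ x : Plane, f ‖x‖ =
      ENNReal.ofReal (2 * Real.pi) * ∫⁻ r in Set.Ioi (0 : ℝ), ENNReal.ofReal r * f r := by
  rw [lintegral_polar (by fun_prop)]
  have : ∀ θ : Metric.sphere (0 : Plane) 1,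
      ∫⁻ r in Set.Ioi (0 : ℝ), ENNReal.ofReal r * f ‖r • (θ : Plane)‖ =
      ∫⁻ r in Set.Ioi (0 : ℝ), ENNReal.ofReal r * f r := by
    intro θ
    refine setLIntegral_congr_fun measurableSet_Ioi fun r hr => ?_
    have : (0:ℝ) < r := hr
    simp [norm_smul, abs_of_pos this]
  simp only [this, lintegral_const, arc_univ]
  rw [mul_comm]

lemma lintegral_rpow_Ioc {p c : ℝ} (hp : -1 < p) (hc : 0 ≤ c) :
    ∫⁻ r in Set.Ioc 0 c, ENNReal.ofReal (r ^ p) = ENNReal.ofReal (c ^ (p + 1) / (p + 1)) := by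
  rw [← ofReal_integral_eq_lintegral_ofReal]
  · rw [← intervalIntegral.integral_of_le hc, integral_rpow (Or.inl hp),
      Real.zero_rpow (by linarith), sub_zero]
  · exact (intervalIntegrable_iff_integrableOn_Ioc_of_le hc).1
      (intervalIntegral.intervalIntegrable_rpow' hp)
  · filter_upwards [ae_restrict_mem measurableSet_Ioc] with r hr
    exact Real.rpow_nonneg hr.1.le _

lemma lintegral_rpow_Ioi {p c : ℝ} (hp : p < -1) (hc : 0 < c) :
    ∫⁻ r in Set.Ioi c, ENNReal.ofReal (r ^ p) = ENNReal.ofReal (c ^ (p + 1) / (-(p + 1))) := by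
  rw [← ofReal_integral_eq_lintegral_ofReal]
  · rw [integral_Ioi_rpow_of_lt hp hc, neg_div, ← div_neg]
  · exact integrableOn_Ioi_rpow_of_lt hp hc
  · filter_upwards [ae_restrict_mem measurableSet_Ioi] with r hr
    exact Real.rpow_nonneg (hc.trans hr).le _

/-- The constant in `lintegral_min_le`. -/
def minConst (a : ℝ) : ℝ := 2 * Real.pi * (1 / (2 - 2 * a) + 1 / (2 * a))

lemma minConst_nonneg {a : ℝ} (ha : 0 < a) (ha1 : a < 1) : 0 ≤ minConst a := by
  have : 0 < 2 - 2 * a := by linarith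
  unfold minConst; positivity

/-- The branches of the minimum cross at |h| = A/B. Below, the integrand is B² |h|^(-2a); above, it
is A² |h|^(-2-2a); by scaling each half is a multiple of A^(2-2a) B^(2a). This is how a sup bound
and a Lipschitz bound are interpolated inside Gagliardo seminorms. -/
lemma lintegral_min_le {a A B : ℝ} (ha : 0 < a) (ha1 : a < 1) (hA : 0 ≤ A) (hB : 0 ≤ B) :
    ∫⁻ h : Plane, ENNReal.ofReal (min A (B * ‖h‖) ^ 2 * ‖h‖ ^ (-(2 + 2 * a))) ≤
      ENNReal.ofReal (minConst a * (A ^ (2 - 2 * a) * B ^ (2 * a))) := by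
  have ha2 : 0 < 2 - 2 * a := by linarith
  rcases hA.eq_or_lt with rfl | hA
  · have : ∀ h : Plane, min 0 (B * ‖h‖) = 0 := fun h => min_eq_left (by positivity)
    simp [this]
  rcases hB.eq_or_lt with rfl | hB
  · simp [min_eq_right hA.le]
  rw [lintegral_radial (f := fun r => ENNReal.ofReal (min A (B * r) ^ 2 * r ^ (-(2 + 2 * a))))
    (by fun_prop)]
  set c := A / B with hc
  have hc0 : 0 < c := by positivity
  rw [← Set.Ioc_union_Ioi_eq_Ioi hc0.le,
    lintegral_union measurableSet_Ioi (Set.Ioc_disjoint_Ioi le_rfl)]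
  have e1 : ∫⁻ r in Set.Ioc 0 c, ENNReal.ofReal r *
      ENNReal.ofReal (min A (B * r) ^ 2 * r ^ (-(2 + 2 * a))) ≤
      ENNReal.ofReal (B ^ 2 * (c ^ (2 - 2 * a) / (2 - 2 * a))) := by
    calc _ ≤ ∫⁻ r in Set.Ioc 0 c, ENNReal.ofReal (B ^ 2) * ENNReal.ofReal (r ^ (1 - 2 * a)) := by
          refine setLIntegral_mono (by fun_prop) fun r hr => ?_
          have hr0 := hr.1
          rw [← ENNReal.ofReal_mul hr0.le, ← ENNReal.ofReal_mul (by positivity)]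
          refine ENNReal.ofReal_le_ofReal ?_
          have : r ^ (1 - 2 * a) = r * (r ^ 2 * r ^ (-(2 + 2 * a))) := by
            have e : r * (r ^ 2 * r ^ (-(2 + 2 * a))) = r ^ (3 : ℝ) * r ^ (-(2 + 2 * a)) := by
              rw [← mul_assoc, show (3 : ℝ) = ((3 : ℕ) : ℝ) by norm_num, Real.rpow_natCast]; ring
            rw [e, ← Real.rpow_add hr0]
            congr 1; ring
          rw [this]
          have h2 : min A (B * r) ^ 2 ≤ (B * r) ^ 2 :=
            pow_le_pow_left₀ (le_min hA.le (by positivity)) (min_le_right _ _) 2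
          have h3 : 0 ≤ r * r ^ (-(2 + 2 * a)) := by positivity
          nlinarith
      _ = _ := by
          rw [lintegral_const_mul _ (by fun_prop), lintegral_rpow_Ioc (by linarith) hc0.le,
            ← ENNReal.ofReal_mul (by positivity)]
          congr 3 <;> ring_nf
  have e2 : ∫⁻ r in Set.Ioi c, ENNReal.ofReal r *
      ENNReal.ofReal (min A (B * r) ^ 2 * r ^ (-(2 + 2 * a))) ≤
      ENNReal.ofReal (A ^ 2 * (c ^ (-(2 * a)) / (2 * a))) := by
    calc _ ≤ ∫⁻ r in Set.Ioi c, ENNReal.ofReal (A ^ 2) * ENNReal.ofReal (r ^ (-1 - 2 * a)) := by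
          refine setLIntegral_mono (by fun_prop) fun r hr => ?_
          have hr0 : 0 < r := hc0.trans hr
          rw [← ENNReal.ofReal_mul hr0.le, ← ENNReal.ofReal_mul (by positivity)]
          refine ENNReal.ofReal_le_ofReal ?_
          have : r ^ (-1 - 2 * a) = r * r ^ (-(2 + 2 * a)) := by
            rw [← Real.rpow_one_add' hr0.le (by linarith)]
            congr 1; ring
          rw [this]
          have h2 : min A (B * r) ^ 2 ≤ A ^ 2 :=
            pow_le_pow_left₀ (le_min hA.le (by positivity)) (min_le_left _ _) 2
          have h3 : 0 ≤ r * r ^ (-(2 + 2 * a)) := by positivity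
          nlinarith
      _ = _ := by
          rw [lintegral_const_mul _ (by fun_prop), lintegral_rpow_Ioi (by linarith) hc0,
            ← ENNReal.ofReal_mul (by positivity)]
          congr 3 <;> ring_nf
  refine (mul_le_mul_right (add_le_add e1 e2) _).trans ?_
  rw [← ENNReal.ofReal_add (by positivity) (by positivity), ← ENNReal.ofReal_mul (by positivity)]
  refine ENNReal.ofReal_le_ofReal (le_of_eq ?_)
  have k1 : B ^ 2 * c ^ (2 - 2 * a) = A ^ (2 - 2 * a) * B ^ (2 * a) := by
    rw [hc, Real.div_rpow hA.le hB.le, ← Real.rpow_natCast B 2, div_eq_mul_inv,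
      ← Real.rpow_neg hB.le, mul_left_comm, ← Real.rpow_add hB]
    congr 2; push_cast; ring
  have k2 : A ^ 2 * c ^ (-(2 * a)) = A ^ (2 - 2 * a) * B ^ (2 * a) := by
    rw [hc, Real.div_rpow hA.le hB.le, ← Real.rpow_natCast A 2, div_eq_mul_inv,
      ← Real.rpow_neg hB.le, ← mul_assoc, ← Real.rpow_add hA]
    congr 2; ring
  rw [mul_div_assoc', mul_div_assoc', k1, k2, minConst]
  ring


/-! ### Functions as tempered distributions -/

lemma exists_schwartz_bump (x : Plane) {R : ℝ} (hR : 0 < R) :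
    ∃ φ : 𝓢(Plane, ℂ), (∀ y ∈ Metric.ball x R, φ y = 1) := by
  let b : ContDiffBump x := ⟨R, R + 1, hR, by linarith⟩
  have hg₁ : HasCompactSupport (Complex.ofRealCLM ∘ b) := b.hasCompactSupport.comp_left rfl
  have hg₂ : ContDiff ℝ (↑(⊤ : ℕ∞)) (Complex.ofRealCLM ∘ b) :=
    Complex.ofRealCLM.contDiff.comp b.contDiff
  refine ⟨hg₁.toSchwartzMap hg₂, fun y hy => ?_⟩
  have : b y = 1 := b.one_of_mem_closedBall (Metric.ball_subset_closedBall hy)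
  simp [this]

lemma locallyIntegrable_of_schwartz {v : Plane → ℂ}
    (h : ∀ φ : 𝓢(Plane, ℂ), Integrable (fun x => φ x * v x)) : LocallyIntegrable v := by
  intro x
  obtain ⟨φ, hφ⟩ := exists_schwartz_bump x one_pos
  refine ⟨Metric.ball x 1, Metric.ball_mem_nhds x one_pos, ?_⟩
  refine (h φ).integrableOn.congr_fun (fun y hy => ?_) measurableSet_ball
  simp [hφ y hy]

lemma ae_eq_of_schwartz {v w : Plane → ℂ} (hv : LocallyIntegrable v) (hw : LocallyIntegrable w)
    (h : ∀ φ : 𝓢(Plane, ℂ), ∫ x, φ x * v x = ∫ x, φ x * w x) : v =ᵐ[volume] w := by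
  refine ae_eq_of_integral_contDiff_smul_eq hv hw fun g hg hgc => ?_
  have hg₁ : HasCompactSupport (Complex.ofRealCLM ∘ g) := hgc.comp_left rfl
  have hg₂ : ContDiff ℝ (↑(⊤ : ℕ∞)) (Complex.ofRealCLM ∘ g) :=
    Complex.ofRealCLM.contDiff.comp hg
  simpa using h (hg₁.toSchwartzMap hg₂)

lemma IsFunction.ae_eq {u : 𝓢'(Plane, ℂ)} {v w : Plane → ℂ} (hv : IsFunction u v)
    (hw : IsFunction u w) : v =ᵐ[volume] w :=
  ae_eq_of_schwartz (locallyIntegrable_of_schwartz fun φ => (hv.2 φ).1)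
    (locallyIntegrable_of_schwartz fun φ => (hw.2 φ).1)
    fun φ => by rw [← (hv.2 φ).2, ← (hw.2 φ).2]

lemma IsFunction.unique {u u' : 𝓢'(Plane, ℂ)} {v : Plane → ℂ} (hu : IsFunction u v)
    (hu' : IsFunction u' v) : u = u' := by
  ext φ
  rw [(hu.2 φ).2, (hu'.2 φ).2]

/-! ### Plane waves and the `L²` Fourier transform -/

/-- The plane wave `e^{2πi ξ·y}`. -/
def wave (ξ y : Plane) : ℂ := Complex.exp (((2 * Real.pi * inner ℝ ξ y : ℝ) : ℂ) * Complex.I)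

@[simp] lemma norm_wave (ξ y : Plane) : ‖wave ξ y‖ = 1 := Complex.norm_exp_ofReal_mul_I _

lemma wave_add (ξ y z : Plane) : wave ξ (y + z) = wave ξ y * wave ξ z := by
  rw [wave, wave, wave, ← Complex.exp_add, inner_add_right]
  congr 1; push_cast; ring

lemma wave_sub (ξ y z : Plane) : wave ξ (y - z) = wave ξ y * wave ξ (-z) := by
  rw [sub_eq_add_neg, wave_add]

@[simp] lemma wave_zero (ξ : Plane) : wave ξ 0 = 1 := by simp [wave]

lemma continuous_wave : Continuous fun p : Plane × Plane => wave p.1 p.2 := by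
  unfold wave; fun_prop

@[fun_prop] lemma continuous_wave_comp {X : Type*} [TopologicalSpace X] {f g : X → Plane}
    (hf : Continuous f) (hg : Continuous g) : Continuous fun x => wave (f x) (g x) :=
  continuous_wave.comp (hf.prodMk hg)

@[fun_prop] lemma measurable_wave_comp {X : Type*} [MeasurableSpace X] {f g : X → Plane}
    (hf : Measurable f) (hg : Measurable g) : Measurable fun x => wave (f x) (g x) := by
  unfold wave; fun_prop

lemma norm_wave_sub_one_le (ξ y : Plane) : ‖wave ξ y - 1‖ ≤ 2 * Real.pi * (‖ξ‖ * ‖y‖) := by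
  rw [wave, mul_comm]
  refine (Real.norm_exp_I_mul_ofReal_sub_one_le (x := 2 * Real.pi * inner ℝ ξ y)).trans ?_
  rw [Real.norm_eq_abs, abs_mul, abs_of_pos (by positivity)]
  gcongr
  exact abs_real_inner_le_norm ξ y

lemma norm_wave_sub_one_le_two (ξ y : Plane) : ‖wave ξ y - 1‖ ≤ 2 := by
  refine (norm_sub_le _ _).trans ?_
  simp; norm_num

lemma fourierInv_eq_wave (f : Plane → ℂ) (y : Plane) : 𝓕⁻ f y = ∫ ξ, wave ξ y * f ξ := by
  rw [Real.fourierInv_eq']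
  simp [wave]

/-- The `L²` Fourier transform, characterized by its pairing with Schwartz functions. -/
lemma exists_fourier_L2 {q : Plane → ℂ} (hq : MemLp q 2) :
    ∃ Q : Plane → ℂ, MemLp Q 2 ∧ eLpNorm Q 2 volume = eLpNorm q 2 volume ∧
      ∀ ψ : 𝓢(Plane, ℂ), ∫ y, q y * (𝓕 ψ) y = ∫ ξ, Q ξ * ψ ξ := by
  let q' : Lp ℂ 2 (volume : Measure Plane) := hq.toLp q
  let Q := (𝓕 q' : Lp ℂ 2 (volume : Measure Plane))
  have h1 : ‖Q‖ = ‖q'‖ := Lp.norm_fourier_eq q'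
  refine ⟨Q, Lp.memLp Q, ?_, fun ψ => ?_⟩
  · rw [Lp.norm_def, Lp.norm_def, ENNReal.toReal_eq_toReal_iff' (Lp.eLpNorm_ne_top _)
      (Lp.eLpNorm_ne_top _)] at h1
    rw [h1]
    exact eLpNorm_congr_ae hq.coeFn_toLp
  · have h2 := congrArg (fun u : 𝓢'(Plane, ℂ) => u ψ) (Lp.fourier_toTemperedDistribution_eq q')
    simp only [TemperedDistribution.fourier_apply, Lp.toTemperedDistribution_apply,
      smul_eq_mul] at h2
    have h3 : ∫ y, q y * (𝓕 ψ) y = ∫ y, (𝓕 ψ) y * q' y := by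
      refine integral_congr_ae ?_
      filter_upwards [hq.coeFn_toLp] with y hy
      rw [hy, mul_comm]
    rw [h3, h2]
    simp only [mul_comm, Q]

lemma exists_fourierInv_L2 {Q : Plane → ℂ} (hQ : MemLp Q 2) :
    ∃ q : Plane → ℂ, MemLp q 2 ∧ eLpNorm q 2 volume = eLpNorm Q 2 volume ∧
      ∀ ψ : 𝓢(Plane, ℂ), ∫ y, ψ y * q y = ∫ ξ, (𝓕⁻ ψ) ξ * Q ξ := by
  let Q' : Lp ℂ 2 (volume : Measure Plane) := hQ.toLp Q
  let q := (𝓕⁻ Q' : Lp ℂ 2 (volume : Measure Plane))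
  have h1 : ‖q‖ = ‖Q'‖ := (Lp.fourierTransformₗᵢ Plane ℂ).symm.norm_map Q'
  refine ⟨q, Lp.memLp q, ?_, fun ψ => ?_⟩
  · rw [Lp.norm_def, Lp.norm_def, ENNReal.toReal_eq_toReal_iff' (Lp.eLpNorm_ne_top _)
      (Lp.eLpNorm_ne_top _)] at h1
    rw [h1]
    exact eLpNorm_congr_ae hQ.coeFn_toLp
  · have h2 := congrArg (fun u : 𝓢'(Plane, ℂ) => u ψ) (Lp.fourierInv_toTemperedDistribution_eq Q')
    simp only [TemperedDistribution.fourierInv_apply, Lp.toTemperedDistribution_apply,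
      smul_eq_mul] at h2
    rw [← h2]
    refine integral_congr_ae ?_
    filter_upwards [hQ.coeFn_toLp] with y hy
    rw [hy]

/-- Multiplication formula. -/
lemma integral_mul_fourierInv {Q : Plane → ℂ} (hQ : Integrable Q) (ψ : 𝓢(Plane, ℂ)) :
    ∫ y, ψ y * (∫ ξ, wave ξ y * Q ξ) = ∫ ξ, (𝓕⁻ ψ) ξ * Q ξ := by
  simp_rw [SchwartzMap.fourierInv_coe, fourierInv_eq_wave, ← integral_const_mul,
    ← integral_mul_const]
  rw [integral_integral_swap]
  · refine integral_congr_ae (.of_forall fun ξ => integral_congr_ae (.of_forall fun y => ?_))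
    simp only [wave, real_inner_comm]; ring
  · have h := (ψ.integrable (μ := volume)).mul_prod hQ
    refine (h.bdd_mul (c := 1) (f := fun p : Plane × Plane => wave p.2 p.1)
      (by fun_prop) (.of_forall fun p => by simp)).congr (.of_forall fun p => ?_)
    simp only [Function.uncurry]; ring

lemma continuous_integral_wave {Q : Plane → ℂ} (hQ : Integrable Q) :
    Continuous fun y => ∫ ξ, wave ξ y * Q ξ := by
  refine continuous_of_dominated (bound := fun ξ => ‖Q ξ‖) (fun y => ?_) (fun y => ?_) hQ.norm ?_
  · exact AEStronglyMeasurable.mul (by fun_prop) hQ.aestronglyMeasurable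
  · exact .of_forall fun ξ => by simp
  · exact .of_forall fun ξ => by fun_prop

/-- Plancherel's theorem on `L¹ ∩ L²`. -/
lemma eLpNorm_integral_wave {Q : Plane → ℂ} (hQ : Integrable Q) (hQ2 : MemLp Q 2) :
    eLpNorm (fun y => ∫ ξ, wave ξ y * Q ξ) 2 volume = eLpNorm Q 2 volume := by
  obtain ⟨q, hq, hn, hp⟩ := exists_fourierInv_L2 hQ2
  rw [← hn]
  -- The pointwise integral and the `L²` inverse transform have the same pairings with Schwartz
  -- functions, so they agree almost everywhere.
  refine eLpNorm_congr_ae (ae_eq_of_schwartz ?_ ?_ fun ψ => ?_)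
  · exact (continuous_integral_wave hQ).locallyIntegrable
  · exact hq.locallyIntegrable (by norm_num)
  · rw [hp, integral_mul_fourierInv hQ]


/-! ### Weighted `L²` norms on the Fourier side, and Gagliardo seminorms -/

/-- The norm of `|ξ|^a Q` in `L²`. -/
def wnorm (a : ℝ) (Q : Plane → ℂ) : ℝ≥0∞ :=
  (∫⁻ ξ, ENNReal.ofReal (‖ξ‖ ^ (2 * a)) * ‖Q ξ‖ₑ ^ 2) ^ (1 / 2 : ℝ)

lemma wnorm_sq (a : ℝ) (Q : Plane → ℂ) :
    wnorm a Q ^ 2 = ∫⁻ ξ, ENNReal.ofReal (‖ξ‖ ^ (2 * a)) * ‖Q ξ‖ₑ ^ 2 := by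
  rw [wnorm, ← ENNReal.rpow_natCast, ← ENNReal.rpow_mul]
  norm_num

lemma eLpNorm_two_sq {X E : Type*} [MeasurableSpace X] {μ : Measure X} [NormedAddCommGroup E]
    (f : X → E) : eLpNorm f 2 μ ^ 2 = ∫⁻ x, ‖f x‖ₑ ^ 2 ∂μ := by
  rw [eLpNorm_eq_lintegral_rpow_enorm_toReal (by norm_num) (by norm_num), ← ENNReal.rpow_natCast,
    ← ENNReal.rpow_mul]
  norm_num

lemma le_of_sq_le {x y : ℝ≥0∞} (h : x ^ 2 ≤ y ^ 2) : x ≤ y :=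
  (ENNReal.pow_le_pow_left_iff two_ne_zero).1 h

lemma wnorm_eq_eLpNorm (a : ℝ) (Q : Plane → ℂ) :
    wnorm a Q = eLpNorm (fun ξ => (‖ξ‖ ^ a : ℝ) • Q ξ) 2 volume := by
  apply (ENNReal.pow_right_strictMono two_ne_zero).injective
  show wnorm a Q ^ 2 = _ ^ 2
  rw [wnorm_sq, eLpNorm_two_sq]
  refine lintegral_congr fun ξ => ?_
  rw [enorm_smul, mul_pow]
  congr 1
  rw [Real.enorm_eq_ofReal (by positivity), ← ENNReal.ofReal_pow (by positivity),
    ← Real.rpow_natCast, ← Real.rpow_mul (norm_nonneg _)]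
  congr 2; push_cast; ring

/-- The squared Gagliardo seminorm of order `a`. -/
def gag (a : ℝ) (q : Plane → ℝ) : ℝ≥0∞ :=
  ∫⁻ h, ∫⁻ y, ENNReal.ofReal ((q y - q (y - h)) ^ 2 * ‖h‖ ^ (-(2 + 2 * a)))

lemma ofReal_mul_sq {x w : ℝ} : ENNReal.ofReal (x ^ 2 * w) = ENNReal.ofReal w * ‖x‖ₑ ^ 2 := by
  rw [ENNReal.ofReal_mul (sq_nonneg x), mul_comm, Real.enorm_eq_ofReal_abs,
    ← ENNReal.ofReal_pow (abs_nonneg _), sq_abs]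

lemma gag_eq (a : ℝ) (q : Plane → ℝ) : gag a q =
    ∫⁻ h, ENNReal.ofReal (‖h‖ ^ (-(2 + 2 * a))) * ∫⁻ y, ‖q y - q (y - h)‖ₑ ^ 2 := by
  unfold gag
  refine lintegral_congr fun h => ?_
  simp_rw [ofReal_mul_sq]
  rw [lintegral_const_mul' _ _ ENNReal.ofReal_ne_top]

lemma lintegral_wave_le {a : ℝ} (ha : 0 < a) (ha1 : a < 1) (ξ : Plane) :
    ∫⁻ h, ENNReal.ofReal (‖h‖ ^ (-(2 + 2 * a))) * ‖1 - wave ξ (-h)‖ₑ ^ 2 ≤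
      ENNReal.ofReal (minConst a * (2 ^ (2 - 2 * a) * (2 * Real.pi) ^ (2 * a)) *
        ‖ξ‖ ^ (2 * a)) := by
  have h1 := lintegral_min_le ha ha1 (A := 2) (B := 2 * Real.pi * ‖ξ‖) (by norm_num)
    (by positivity)
  rw [Real.mul_rpow (by positivity) (norm_nonneg _)] at h1
  refine (lintegral_mono fun h => ?_).trans (h1.trans (le_of_eq ?_))
  · rw [ENNReal.ofReal_mul (by positivity), mul_comm]
    gcongr
    rw [← ofReal_norm, ← ENNReal.ofReal_pow (norm_nonneg _), norm_sub_rev]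
    gcongr
    refine le_min (norm_wave_sub_one_le_two _ _) ((norm_wave_sub_one_le _ _).trans (le_of_eq ?_))
    rw [norm_neg]; ring
  · congr 1; ring

/-- Only the ball of radius 1/(8|ξ|) around h₀ = ξ/(2|ξ|²) is kept. There ξ·h is within 1/8 of 1/2,
so cos(2πξ·h) ≤ 0 and |1 - e^(-2πiξ·h)|² ≥ 2, while |h| ≤ 1/|ξ|. The area π/(64|ξ|²) of the ball
gives the constant π/32. -/
lemma le_lintegral_wave (a : ℝ) (ha : 0 < a) {ξ : Plane} (hξ : ξ ≠ 0) :
    ENNReal.ofReal (Real.pi / 32 * ‖ξ‖ ^ (2 * a)) ≤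
      ∫⁻ h, ENNReal.ofReal (‖h‖ ^ (-(2 + 2 * a))) * ‖1 - wave ξ (-h)‖ₑ ^ 2 := by
  have hn : 0 < ‖ξ‖ := norm_pos_iff.2 hξ
  set h₀ : Plane := (1 / (2 * ‖ξ‖ ^ 2)) • ξ with hh₀
  have hnh : ‖h₀‖ = 1 / (2 * ‖ξ‖) := by
    rw [hh₀, norm_smul, Real.norm_of_nonneg (by positivity)]; field_simp
  have hin : inner ℝ ξ h₀ = 1 / 2 := by
    rw [hh₀, inner_smul_right, real_inner_self_eq_norm_sq]; field_simp
  have key : ∀ h ∈ Metric.ball h₀ (1 / (8 * ‖ξ‖)),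
      ENNReal.ofReal (‖ξ‖ ^ (2 + 2 * a) * 2) ≤
        ENNReal.ofReal (‖h‖ ^ (-(2 + 2 * a))) * ‖1 - wave ξ (-h)‖ₑ ^ 2 := by
    intro h hh
    rw [mem_ball_iff_norm] at hh
    have b1 : |inner ℝ ξ h - 1 / 2| ≤ 1 / 8 := by
      rw [← hin, ← inner_sub_right]
      refine (abs_real_inner_le_norm _ _).trans ?_
      calc ‖ξ‖ * ‖h - h₀‖ ≤ ‖ξ‖ * (1 / (8 * ‖ξ‖)) := by gcongr
        _ = 1 / 8 := by field_simp
    have b2 : ‖h‖ ≤ 1 / ‖ξ‖ := by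
      calc ‖h‖ = ‖(h - h₀) + h₀‖ := by simp
        _ ≤ 1 / (8 * ‖ξ‖) + 1 / (2 * ‖ξ‖) := by
          rw [← hnh]; exact (norm_add_le _ _).trans (by gcongr)
        _ ≤ _ := by field_simp; norm_num
    have b3 : 0 < ‖h‖ := by
      rw [norm_pos_iff]; rintro rfl
      rw [inner_zero_right, abs_le] at b1
      linarith [b1.1]
    rw [← ofReal_norm, ← ENNReal.ofReal_pow (norm_nonneg _),
      ← ENNReal.ofReal_mul (by positivity)]
    refine ENNReal.ofReal_le_ofReal (mul_le_mul ?_ ?_ (by norm_num) (by positivity))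
    · rw [Real.rpow_neg b3.le, ← Real.inv_rpow b3.le]
      refine Real.rpow_le_rpow hn.le ?_ (by linarith)
      rw [le_inv_comm₀ hn b3]; simpa using b2
    · have e : ‖1 - wave ξ (-h)‖ ^ 2 = 2 - 2 * Real.cos (2 * Real.pi * inner ℝ ξ h) := by
        rw [wave, Complex.exp_mul_I, ← Complex.normSq_eq_norm_sq, Complex.normSq_apply,
          ← Complex.ofReal_cos, ← Complex.ofReal_sin]
        simp only [Complex.sub_re, Complex.one_re, Complex.add_re, Complex.ofReal_re,
          Complex.mul_re, Complex.ofReal_im, Complex.I_re, Complex.I_im, Complex.sub_im,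
          Complex.one_im, Complex.add_im, Complex.mul_im, inner_neg_right]
        rw [mul_neg, Real.cos_neg, Real.sin_neg]
        nlinarith [Real.sin_sq_add_cos_sq (2 * Real.pi * inner ℝ ξ h)]
      rw [e]
      have : Real.cos (2 * Real.pi * inner ℝ ξ h) ≤ 0 := by
        rw [abs_le] at b1
        have := Real.pi_pos
        refine Real.cos_nonpos_of_pi_div_two_le_of_le ?_ ?_ <;> nlinarith [b1.1, b1.2]
      linarith
  calc _ = ENNReal.ofReal (‖ξ‖ ^ (2 + 2 * a) * 2) *
        volume (Metric.ball h₀ (1 / (8 * ‖ξ‖))) := by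
        rw [EuclideanSpace.volume_ball_fin_two, ← ENNReal.ofReal_pow (by positivity)]
        rw [← ENNReal.ofReal_mul (by positivity), ← ENNReal.ofReal_mul (by positivity)]
        congr 1
        rw [Real.rpow_add hn, Real.rpow_two]
        field_simp; norm_num
    _ ≤ ∫⁻ h in Metric.ball h₀ (1 / (8 * ‖ξ‖)),
        ENNReal.ofReal (‖h‖ ^ (-(2 + 2 * a))) * ‖1 - wave ξ (-h)‖ₑ ^ 2 := by
        rw [← setLIntegral_const]
        exact setLIntegral_mono' measurableSet_ball key
    _ ≤ _ := setLIntegral_le_lintegral _ _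

/-- The real part of the inverse Fourier transform. -/
def invF (Q : Plane → ℂ) (y : Plane) : ℝ := (∫ ξ, wave ξ y * Q ξ).re

lemma integrable_wave_mul {Q : Plane → ℂ} (hQ : Integrable Q) (y : Plane) :
    Integrable fun ξ => wave ξ y * Q ξ :=
  hQ.bdd_mul (c := 1) (by fun_prop) (.of_forall fun p => by simp)

lemma invF_sub_translate {Q : Plane → ℂ} (hQ : Integrable Q) (y h : Plane) :
    invF Q y - invF Q (y - h) = invF (fun ξ => (1 - wave ξ (-h)) * Q ξ) y := by
  rw [invF, invF, invF, ← Complex.sub_re,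
    ← integral_sub (integrable_wave_mul hQ _) (integrable_wave_mul hQ _)]
  congr 2; ext ξ
  rw [wave_sub]; ring

lemma continuous_invF {Q : Plane → ℂ} (hQ : Integrable Q) : Continuous (invF Q) :=
  Complex.continuous_re.comp (continuous_integral_wave hQ)

lemma lintegral_invF_sq_le {Q : Plane → ℂ} (hQ : Integrable Q) (hQ2 : MemLp Q 2) :
    ∫⁻ y, ‖invF Q y‖ₑ ^ 2 ≤ ∫⁻ ξ, ‖Q ξ‖ₑ ^ 2 := by
  rw [← eLpNorm_two_sq Q, ← eLpNorm_integral_wave hQ hQ2, eLpNorm_two_sq]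
  refine lintegral_mono fun y => ?_
  gcongr
  rw [← ofReal_norm, ← ofReal_norm]
  exact ENNReal.ofReal_le_ofReal (Complex.abs_re_le_norm _)

lemma memLp_invF {Q : Plane → ℂ} (hQ : Integrable Q) (hQ2 : MemLp Q 2) : MemLp (invF Q) 2 := by
  refine ⟨(continuous_invF hQ).aestronglyMeasurable, ?_⟩
  have h := lintegral_invF_sq_le hQ hQ2
  rw [← eLpNorm_two_sq, ← eLpNorm_two_sq] at h
  exact (le_of_sq_le h).trans_lt hQ2.2

lemma abs_invF_le {Q : Plane → ℂ} (y : Plane) : |invF Q y| ≤ ∫ ξ, ‖Q ξ‖ := by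
  refine (Complex.abs_re_le_norm _).trans ((norm_integral_le_integral_norm _).trans ?_)
  simp

/-- The constant in `gag_invF_le`. -/
def gagConst (a : ℝ) : ℝ := minConst a * (2 ^ (2 - 2 * a) * (2 * Real.pi) ^ (2 * a))

lemma gagConst_nonneg {a : ℝ} (ha : 0 < a) (ha1 : a < 1) : 0 ≤ gagConst a := by
  have := minConst_nonneg ha ha1
  unfold gagConst; positivity

/-- Tonelli's theorem. After Plancherel has turned a translation difference into a multiplier, the
integral over h acts on the multiplier alone, where `lintegral_wave_le` and `le_lintegral_wave`
compare it with |ξ|^(2a). -/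
lemma lintegral_wave_mul_sq (a : ℝ) {Q : Plane → ℂ} (hQ : AEStronglyMeasurable Q) :
    ∫⁻ h : Plane, ENNReal.ofReal (‖h‖ ^ (-(2 + 2 * a))) *
      ∫⁻ ξ, ‖(1 - wave ξ (-h)) * Q ξ‖ₑ ^ 2 =
    ∫⁻ ξ, (∫⁻ h, ENNReal.ofReal (‖h‖ ^ (-(2 + 2 * a))) * ‖1 - wave ξ (-h)‖ₑ ^ 2) *
      ‖Q ξ‖ₑ ^ 2 := by
  have e : ∀ h : Plane, ENNReal.ofReal (‖h‖ ^ (-(2 + 2 * a))) *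
      ∫⁻ ξ, ‖(1 - wave ξ (-h)) * Q ξ‖ₑ ^ 2 =
      ∫⁻ ξ, ENNReal.ofReal (‖h‖ ^ (-(2 + 2 * a))) * ‖1 - wave ξ (-h)‖ₑ ^ 2 * ‖Q ξ‖ₑ ^ 2 := by
    intro h
    rw [← lintegral_const_mul' _ _ ENNReal.ofReal_ne_top]
    refine lintegral_congr fun ξ => ?_
    rw [enorm_mul, mul_pow, mul_assoc]
  simp_rw [e]
  rw [lintegral_lintegral_swap]
  · refine lintegral_congr fun ξ => ?_
    rw [lintegral_mul_const' _ _ (by finiteness)]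
  · have : AEMeasurable (fun p : Plane × Plane => ‖Q p.2‖ₑ ^ 2) (volume.prod volume) :=
      (hQ.enorm.pow_const 2).comp_snd
    exact AEMeasurable.mul (Measurable.aemeasurable (by fun_prop)) this

lemma gag_invF_le {a : ℝ} (ha : 0 < a) (ha1 : a < 1) {Q : Plane → ℂ} (hQ : Integrable Q)
    (hQ2 : MemLp Q 2) : gag a (invF Q) ≤ ENNReal.ofReal (gagConst a) * wnorm a Q ^ 2 := by
  rw [gag_eq]
  calc _ ≤ ∫⁻ h : Plane, ENNReal.ofReal (‖h‖ ^ (-(2 + 2 * a))) *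
      ∫⁻ ξ, ‖(1 - wave ξ (-h)) * Q ξ‖ₑ ^ 2 := by
        refine lintegral_mono fun h => mul_le_mul_right ?_ _
        simp_rw [invF_sub_translate hQ]
        refine lintegral_invF_sq_le ?_ ?_
        · refine hQ.bdd_mul (c := 2) (by fun_prop) (.of_forall fun p => ?_)
          rw [norm_sub_rev]; exact norm_wave_sub_one_le_two _ _
        · refine MemLp.of_le_mul (c := 2) hQ2 (AEStronglyMeasurable.mul (by fun_prop) hQ2.1)
            (.of_forall fun p => ?_)
          rw [norm_mul, norm_sub_rev]
          gcongr; exact norm_wave_sub_one_le_two _ _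
    _ = _ := lintegral_wave_mul_sq a hQ.aestronglyMeasurable
    _ ≤ ∫⁻ ξ, ENNReal.ofReal (gagConst a) *
        (ENNReal.ofReal (‖ξ‖ ^ (2 * a)) * ‖Q ξ‖ₑ ^ 2) := by
        refine lintegral_mono fun ξ => ?_
        rw [← mul_assoc, ← ENNReal.ofReal_mul (gagConst_nonneg ha ha1)]
        gcongr
        exact lintegral_wave_le ha ha1 ξ
    _ = _ := by rw [lintegral_const_mul' _ _ ENNReal.ofReal_ne_top, wnorm_sq]


/-! ### Duality -/

lemma wave_comm (ξ y : Plane) : wave ξ y = wave y ξ := by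
  simp only [wave, real_inner_comm]

lemma memLp_translate {E : Type*} [NormedAddCommGroup E] {q : Plane → E} (hq : MemLp q 2)
    (h : Plane) : MemLp (fun y => q (y - h)) 2 :=
  hq.comp_measurePreserving (measurePreserving_sub_right volume h)

/-- On the Fourier side, a translation is a multiplication with a plane wave. -/
lemma lintegral_sub_translate {q Q : Plane → ℂ} (hq : MemLp q 2) (hQ : MemLp Q 2)
    (hp : ∀ ψ : 𝓢(Plane, ℂ), ∫ y, q y * (𝓕 ψ) y = ∫ ξ, Q ξ * ψ ξ) (h : Plane) :
    ∫⁻ y, ‖q y - q (y - h)‖ₑ ^ 2 = ∫⁻ ξ, ‖(1 - wave ξ (-h)) * Q ξ‖ₑ ^ 2 := by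
  obtain ⟨D, hD, hDn, hDp⟩ := exists_fourier_L2 (hq.sub (memLp_translate hq h))
  have hwQ : MemLp (fun ξ => wave ξ (-h) * Q ξ) 2 :=
    MemLp.of_le hQ (AEStronglyMeasurable.mul (by fun_prop) hQ.1) (.of_forall fun p => by simp)
  have hint : ∀ {f : Plane → ℂ}, MemLp f 2 → ∀ ψ : 𝓢(Plane, ℂ), Integrable fun y => f y * ψ y :=
    fun hf ψ => hf.integrable_mul (ψ.memLp 2)
  have hae : D =ᵐ[volume] fun ξ => Q ξ - wave ξ (-h) * Q ξ := by
    refine ae_eq_of_schwartz (hD.locallyIntegrable (by norm_num))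
      ((hQ.sub hwQ).locallyIntegrable (by norm_num)) fun ψ => ?_
    -- The translation is moved from q to the test function: the transform of ψ' is a translate of
    -- that of ψ, and ψ' itself is ψ times a plane wave.
    let ψ' : 𝓢(Plane, ℂ) := 𝓕⁻ (SchwartzMap.compSubConstCLM ℂ (-h) (𝓕 ψ))
    have e1 : ∀ y, (𝓕 ψ') y = (𝓕 ψ) (y + h) := by
      intro y
      simp [ψ']
    have e2 : ∀ ξ, ψ' ξ = wave ξ (-h) * ψ ξ := by
      intro ξ
      have : ψ ξ = ∫ y, wave y ξ * (𝓕 ψ) y := by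
        rw [← fourierInv_eq_wave, ← SchwartzMap.fourierInv_coe]; simp
      rw [this, ← integral_const_mul]
      have e3 : ψ' ξ = ∫ y, wave y ξ * (𝓕 ψ) (y + h) := by
        simp only [ψ']
        rw [SchwartzMap.fourierInv_coe, fourierInv_eq_wave]
        simp
      rw [e3, ← integral_sub_right_eq_self _ h]
      refine integral_congr_ae (.of_forall fun y => ?_)
      simp only [sub_add_cancel]
      rw [wave_comm (y - h), wave_sub, wave_comm ξ y]; ring
    have e4 : ∫ y, q (y - h) * (𝓕 ψ) y = ∫ ξ, Q ξ * ψ' ξ := by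
      rw [← hp ψ']
      refine Eq.trans ?_ (integral_sub_right_eq_self (fun y => q y * (𝓕 ψ') y) h)
      refine integral_congr_ae (.of_forall fun y => ?_)
      simp [e1]
    calc ∫ ξ, ψ ξ * D ξ = ∫ ξ, D ξ * ψ ξ := by simp only [mul_comm]
      _ = ∫ y, (q y * (𝓕 ψ) y - q (y - h) * (𝓕 ψ) y) := by
        rw [← hDp]; simp only [Pi.sub_apply, sub_mul]
      _ = ∫ ξ, (Q ξ * ψ ξ - Q ξ * ψ' ξ) := by
        rw [integral_sub (hint hq _) (hint (memLp_translate hq h) _), hp, e4,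
          integral_sub (hint hQ _) (hint hQ _)]
      _ = _ := by
        refine integral_congr_ae (.of_forall fun ξ => ?_)
        simp only [e2]; ring
  calc _ = eLpNorm D 2 volume ^ 2 := by rw [hDn, eLpNorm_two_sq]; rfl
    _ = ∫⁻ ξ, ‖D ξ‖ₑ ^ 2 := eLpNorm_two_sq _
    _ = _ := by
      refine lintegral_congr_ae ?_
      filter_upwards [hae] with ξ hξ
      rw [hξ]; congr 2; ring

/-- Cauchy–Schwarz after inserting |ξ|^a |ξ|^(-a) = 1, which holds off the origin. -/
lemma lintegral_mul_le_wnorm (a : ℝ) {P Q : Plane → ℂ} (hP : AEStronglyMeasurable P)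
    (hQ : AEStronglyMeasurable Q) :
    ∫⁻ ξ, ‖P ξ‖ₑ * ‖Q ξ‖ₑ ≤ wnorm a P * wnorm (-a) Q := by
  have hm : ∀ c : ℝ, Measurable (fun ξ : Plane => ENNReal.ofReal (‖ξ‖ ^ c)) := by
    intro c; fun_prop
  have h := ENNReal.lintegral_mul_le_Lp_mul_Lq volume Real.HolderConjugate.two_two
    ((hm a).aemeasurable.mul hP.enorm) ((hm (-a)).aemeasurable.mul hQ.enorm)
  have hw : ∀ (c : ℝ) (F : Plane → ℂ),
      (∫⁻ ξ, ((fun ξ : Plane => ENNReal.ofReal (‖ξ‖ ^ c)) * fun ξ => ‖F ξ‖ₑ) ξ ^ (2 : ℝ)) ^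
        (1 / 2 : ℝ) = wnorm c F := by
    intro c F
    rw [wnorm]
    congr 1
    refine lintegral_congr fun ξ => ?_
    rw [Pi.mul_apply, ENNReal.mul_rpow_of_nonneg _ _ (by norm_num),
      ENNReal.ofReal_rpow_of_nonneg (by positivity) (by norm_num), ← Real.rpow_mul (norm_nonneg _),
      mul_comm c 2]
    norm_num
  rw [hw, hw] at h
  refine le_trans (lintegral_mono_ae ?_) h
  have : ∀ᵐ ξ : Plane, ξ ≠ 0 := by simp [ae_iff]
  filter_upwards [this] with ξ hξ
  have hn : 0 < ‖ξ‖ := norm_pos_iff.2 hξ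
  simp only [Pi.mul_apply]
  rw [mul_mul_mul_comm, ← ENNReal.ofReal_mul (by positivity), ← Real.rpow_add hn]
  simp

/-- The converse of `gag_invF_le`, from the lower bound on the multiplier. It is needed for products
b·v that are merely in `L²`, so Q is given only through its pairings and not as an integrable
density. -/
lemma wnorm_sq_le_gag {a : ℝ} (ha : 0 < a) {q : Plane → ℝ} {Q : Plane → ℂ} (hq : MemLp q 2)
    (hQ : MemLp Q 2)
    (hp : ∀ ψ : 𝓢(Plane, ℂ), ∫ y, (q y : ℂ) * (𝓕 ψ) y = ∫ ξ, Q ξ * ψ ξ) :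
    wnorm a Q ^ 2 ≤ ENNReal.ofReal (32 / Real.pi) * gag a q := by
  have e : gag a q = ∫⁻ ξ, (∫⁻ h, ENNReal.ofReal (‖h‖ ^ (-(2 + 2 * a))) *
      ‖1 - wave ξ (-h)‖ₑ ^ 2) * ‖Q ξ‖ₑ ^ 2 := by
    rw [gag_eq, ← lintegral_wave_mul_sq a hQ.1]
    refine lintegral_congr fun h => ?_
    rw [← lintegral_sub_translate hq.ofReal hQ hp h]
    congr 1
    refine lintegral_congr fun y => ?_
    congr 1
    rw [RCLike.ofReal_eq_complex_ofReal, ← Complex.ofReal_sub,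
      ← ofReal_norm, ← ofReal_norm, Complex.norm_real]
  rw [e, wnorm_sq, ← lintegral_const_mul' _ _ ENNReal.ofReal_ne_top]
  refine lintegral_mono_ae ?_
  have : ∀ᵐ ξ : Plane, ξ ≠ 0 := by simp [ae_iff]
  filter_upwards [this] with ξ hξ
  rw [← mul_assoc]
  gcongr
  calc ENNReal.ofReal (‖ξ‖ ^ (2 * a)) =
      ENNReal.ofReal (32 / Real.pi) * ENNReal.ofReal (Real.pi / 32 * ‖ξ‖ ^ (2 * a)) := by
        rw [← ENNReal.ofReal_mul (by positivity)]
        congr 1; field_simp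
    _ ≤ _ := by gcongr; exact le_lintegral_wave a ha hξ

/-- The pairing of a function with a Schwartz function is bounded by dual Sobolev norms. -/
lemma enorm_pairing_le {a : ℝ} (ha : 0 < a) {q : Plane → ℝ} (hq : MemLp q 2) (φ : 𝓢(Plane, ℂ)) :
    ‖∫ y, (q y : ℂ) * (𝓕 φ) y‖ₑ ≤
      (ENNReal.ofReal (32 / Real.pi) * gag a q) ^ (1 / 2 : ℝ) * wnorm (-a) φ := by
  obtain ⟨Q, hQ, -, hp⟩ := exists_fourier_L2 hq.ofReal
  have hp' : ∀ ψ : 𝓢(Plane, ℂ), ∫ y, (q y : ℂ) * (𝓕 ψ) y = ∫ ξ, Q ξ * ψ ξ := hp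
  rw [hp']
  refine (enorm_integral_le_lintegral_enorm _).trans ?_
  simp_rw [enorm_mul]
  refine (lintegral_mul_le_wnorm a hQ.1 φ.continuous.aestronglyMeasurable).trans ?_
  gcongr
  refine le_of_sq_le ((wnorm_sq_le_gag ha hq hQ hp').trans (le_of_eq ?_))
  rw [← ENNReal.rpow_natCast, ← ENNReal.rpow_mul]
  norm_num


/-! ### Hardy's inequality -/

lemma volume_ball_ofReal (x : Plane) {r : ℝ} (hr : 0 ≤ r) :
    volume (Metric.ball x r) = ENNReal.ofReal (Real.pi * r ^ 2) := by
  rw [EuclideanSpace.volume_ball_fin_two, ← ENNReal.ofReal_pow hr,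
    ENNReal.ofReal_mul Real.pi_pos.le, mul_comm]

lemma enorm_sq_le_two (x y : ℝ) : ‖x‖ₑ ^ 2 ≤ 2 * ‖x - y‖ₑ ^ 2 + 2 * ‖y‖ₑ ^ 2 := by
  simp only [Real.enorm_eq_ofReal_abs, ← ENNReal.ofReal_pow (abs_nonneg _), sq_abs]
  rw [show (2 : ℝ≥0∞) = ENNReal.ofReal 2 by simp, ← ENNReal.ofReal_mul (by norm_num),
    ← ENNReal.ofReal_mul (by norm_num), ← ENNReal.ofReal_add (by positivity) (by positivity)]
  refine ENNReal.ofReal_le_ofReal ?_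
  nlinarith [sq_nonneg (x - y - y)]

/-- The value v(y) is compared with v(y - h) for h in the ball of radius 500|y| around 1000y, where
|h| is comparable with |y|. The differences are controlled by the Gagliardo seminorm. The values v(y
- h) sit at points much farther from the origin, where the weight is much smaller, so they return
only a small fraction of the left-hand side, which is absorbed. The large factor 1000 beats all
constants at once, with 2 + 2a ≤ 3. -/
lemma hardy_zero {a : ℝ} (ha : 0 < a) (ha1 : a ≤ 1 / 2) {v : Plane → ℝ} (hv : Measurable v)
    (hfin : ∫⁻ y, ENNReal.ofReal (‖y‖ ^ (-(2 * a))) * ‖v y‖ₑ ^ 2 ≠ ∞) :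
    ∫⁻ y, ENNReal.ofReal (‖y‖ ^ (-(2 * a))) * ‖v y‖ₑ ^ 2 ≤ ENNReal.ofReal 100000 * gag a v := by
  set W := ∫⁻ y, ENNReal.ofReal (‖y‖ ^ (-(2 * a))) * ‖v y‖ₑ ^ 2 with hW
  let S : Set (Plane × Plane) := {p | ‖p.2 - (1000 : ℝ) • p.1‖ < 500 * ‖p.1‖}
  have hS : MeasurableSet S := measurableSet_lt (by fun_prop) (by fun_prop)
  let k : Plane × Plane → ℝ≥0∞ :=
    S.indicator fun p => ENNReal.ofReal (‖p.1‖ ^ (-(2 + 2 * a)))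
  have hk : Measurable k := Measurable.indicator (by fun_prop) hS
  have hae : ∀ᵐ y : Plane, y ≠ 0 := by simp [ae_iff]
  -- The weight depends on y alone, so integrating in h only produces the area π(500|y|)² of the
  -- ball.
  have e0 : ENNReal.ofReal (250000 * Real.pi) * W =
      ∫⁻ y, ∫⁻ h, k (y, h) * ‖v y‖ₑ ^ 2 := by
    rw [hW, ← lintegral_const_mul' _ _ ENNReal.ofReal_ne_top]
    refine lintegral_congr_ae ?_
    filter_upwards [hae] with y hy
    have hn : 0 < ‖y‖ := norm_pos_iff.2 hy
    rw [lintegral_mul_const' _ _ (by finiteness), ← mul_assoc]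
    congr 1
    have : (fun h => k (y, h)) = (Metric.ball ((1000 : ℝ) • y) (500 * ‖y‖)).indicator
        fun _ => ENNReal.ofReal (‖y‖ ^ (-(2 + 2 * a))) := by
      ext h
      simp only [k, S, Set.indicator_apply (α := Plane × Plane), Set.mem_ofPred_eq]
      by_cases hh : ‖h - (1000 : ℝ) • y‖ < 500 * ‖y‖
      · rw [if_pos hh, Set.indicator_of_mem (mem_ball_iff_norm.2 hh)]
      · rw [if_neg hh, Set.indicator_of_notMem (fun hc => hh (mem_ball_iff_norm.1 hc))]
    rw [this, lintegral_indicator measurableSet_ball, setLIntegral_const,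
      volume_ball_ofReal _ (by positivity), ← ENNReal.ofReal_mul (by positivity),
      ← ENNReal.ofReal_mul (by positivity)]
    congr 1
    rw [show -(2 * a) = -(2 + 2 * a) + 2 by ring, Real.rpow_add hn, Real.rpow_two]
    ring
  have hge : ∀ y h : Plane, (y, h) ∈ S → 500 * ‖y‖ < ‖h‖ ∧ ‖h‖ < 1500 * ‖y‖ := by
    intro y h hh
    have h1 : ‖h - (1000 : ℝ) • y‖ < 500 * ‖y‖ := hh
    have h2 : ‖(1000 : ℝ) • y‖ = 1000 * ‖y‖ := by simp [norm_smul]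
    have h3 := norm_sub_norm_le h ((1000 : ℝ) • y)
    have h4 := norm_sub_norm_le ((1000 : ℝ) • y) h
    rw [norm_sub_rev] at h4
    constructor <;> linarith
  have e1 : ∫⁻ y, ∫⁻ h, k (y, h) * ‖v y - v (y - h)‖ₑ ^ 2 ≤
      ENNReal.ofReal (1500 ^ 3) * gag a v := by
    rw [lintegral_lintegral_swap (by
      refine Measurable.aemeasurable (Measurable.mul ?_ ?_)
      · exact hk
      · fun_prop), gag_eq, ← lintegral_const_mul' _ _ ENNReal.ofReal_ne_top]
    refine lintegral_mono fun h => ?_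
    rw [← mul_assoc, ← lintegral_const_mul' _ _ (by finiteness)]
    refine lintegral_mono fun y => mul_le_mul_left ?_ _
    by_cases hh : (y, h) ∈ S
    · simp only [k, Set.indicator_of_mem hh]
      obtain ⟨b1, b2⟩ := hge y h hh
      have hn : 0 < ‖y‖ := by
        by_contra hc
        have : ‖y‖ = 0 := le_antisymm (not_lt.1 hc) (norm_nonneg _)
        rw [this] at b2
        linarith [norm_nonneg h]
      have hn' : 0 < ‖h‖ := by linarith
      rw [← ENNReal.ofReal_mul (by positivity)]
      refine ENNReal.ofReal_le_ofReal ?_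
      calc ‖y‖ ^ (-(2 + 2 * a)) ≤ (‖h‖ / 1500) ^ (-(2 + 2 * a)) := by
            refine Real.rpow_le_rpow_of_nonpos (by positivity) (by linarith) (by linarith)
        _ = 1500 ^ (2 + 2 * a) * ‖h‖ ^ (-(2 + 2 * a)) := by
            rw [Real.div_rpow hn'.le (by norm_num), Real.rpow_neg (x := 1500) (by norm_num)]
            field_simp
        _ ≤ _ := by
            gcongr
            calc (1500 : ℝ) ^ (2 + 2 * a) ≤ 1500 ^ (3 : ℝ) :=
                  Real.rpow_le_rpow_of_exponent_le (by norm_num) (by linarith)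
              _ = _ := by norm_num
    · simp [k, hh]
  -- With w = y - h fixed, the admissible y satisfy |w|/1501 ≤ |y| < |w|/499; the small area of this
  -- region produces 1501³/499² < 20000.
  have e2 : ∫⁻ y, ∫⁻ h, k (y, h) * ‖v (y - h)‖ₑ ^ 2 ≤
      ENNReal.ofReal (20000 * Real.pi) * W := by
    have : ∀ y, ∫⁻ h, k (y, h) * ‖v (y - h)‖ₑ ^ 2 = ∫⁻ w, k (y, y - w) * ‖v w‖ₑ ^ 2 := by
      intro y
      rw [← lintegral_sub_left_eq_self (fun h => k (y, h) * ‖v (y - h)‖ₑ ^ 2) y]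
      simp
    simp_rw [this]
    rw [lintegral_lintegral_swap (by
      refine Measurable.aemeasurable (Measurable.mul ?_ ?_)
      · exact hk.comp (by fun_prop)
      · fun_prop), hW, ← lintegral_const_mul' _ _ ENNReal.ofReal_ne_top]
    refine lintegral_mono_ae ?_
    filter_upwards [hae] with w hw
    have hn : 0 < ‖w‖ := norm_pos_iff.2 hw
    rw [lintegral_mul_const' _ _ (by finiteness), ← mul_assoc]
    refine mul_le_mul_left ?_ _
    calc ∫⁻ y, k (y, y - w) ≤ ∫⁻ y, (Metric.ball (0 : Plane) (‖w‖ / 499)).indicator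
          (fun _ => ENNReal.ofReal ((‖w‖ / 1501) ^ (-(2 + 2 * a)))) y := by
          refine lintegral_mono fun y => ?_
          by_cases hh : (y, y - w) ∈ S
          · obtain ⟨b1, b2⟩ := hge _ _ hh
            have c1 : ‖y - w‖ ≤ ‖y‖ + ‖w‖ := norm_sub_le _ _
            have c2 : ‖w‖ ≤ ‖y‖ + ‖y - w‖ := by
              calc ‖w‖ = ‖y - (y - w)‖ := by simp
                _ ≤ _ := norm_sub_le _ _
            have d1 : ‖y‖ < ‖w‖ / 499 := by linarith
            have d2 : ‖w‖ / 1501 ≤ ‖y‖ := by linarith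
            simp only [k, Set.indicator_of_mem hh]
            rw [Set.indicator_of_mem (by simpa using d1)]
            exact ENNReal.ofReal_le_ofReal
              (Real.rpow_le_rpow_of_nonpos (by positivity) d2 (by linarith))
          · simp [k, hh]
      _ = ENNReal.ofReal ((‖w‖ / 1501) ^ (-(2 + 2 * a)) * (Real.pi * (‖w‖ / 499) ^ 2)) := by
          rw [lintegral_indicator measurableSet_ball, setLIntegral_const,
            volume_ball_ofReal _ (by positivity), ← ENNReal.ofReal_mul (by positivity)]
      _ ≤ ENNReal.ofReal (20000 * Real.pi * ‖w‖ ^ (-(2 * a))) := by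
          refine ENNReal.ofReal_le_ofReal ?_
          have c1 : (‖w‖ / 1501) ^ (-(2 + 2 * a)) =
              1501 ^ (2 + 2 * a) * ‖w‖ ^ (-(2 + 2 * a)) := by
            rw [Real.div_rpow hn.le (by norm_num), Real.rpow_neg (x := 1501) (by norm_num)]
            field_simp
          have c2 : (1501 : ℝ) ^ (2 + 2 * a) ≤ 1501 ^ 3 := by
            calc (1501 : ℝ) ^ (2 + 2 * a) ≤ 1501 ^ (3 : ℝ) :=
                  Real.rpow_le_rpow_of_exponent_le (by norm_num) (by linarith)
              _ = _ := by norm_num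
          have c3 : ‖w‖ ^ (-(2 * a)) = ‖w‖ ^ (-(2 + 2 * a)) * ‖w‖ ^ 2 := by
            rw [show -(2 * a) = -(2 + 2 * a) + 2 by ring, Real.rpow_add hn, Real.rpow_two]
          rw [c1, c3]
          have c4 : 0 ≤ ‖w‖ ^ (-(2 + 2 * a)) * ‖w‖ ^ 2 * Real.pi := by positivity
          calc _ = (1501 : ℝ) ^ (2 + 2 * a) / 499 ^ 2 *
                (‖w‖ ^ (-(2 + 2 * a)) * ‖w‖ ^ 2 * Real.pi) := by ring
            _ ≤ 20000 * (‖w‖ ^ (-(2 + 2 * a)) * ‖w‖ ^ 2 * Real.pi) := by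
                gcongr
                rw [div_le_iff₀ (by norm_num)]
                exact c2.trans (by norm_num)
            _ = _ := by ring
      _ = _ := ENNReal.ofReal_mul (by positivity)
  have e3 : ENNReal.ofReal (250000 * Real.pi) * W ≤
      2 * (ENNReal.ofReal (1500 ^ 3) * gag a v) + 2 * (ENNReal.ofReal (20000 * Real.pi) * W) := by
    rw [e0]
    refine le_trans ?_ (add_le_add (mul_le_mul_right e1 2) (mul_le_mul_right e2 2))
    have m1 : Measurable fun p : Plane × Plane => k p * ‖v p.1 - v (p.1 - p.2)‖ₑ ^ 2 :=
      hk.mul (by fun_prop)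
    have m2 : Measurable fun p : Plane × Plane => k p * ‖v (p.1 - p.2)‖ₑ ^ 2 :=
      hk.mul (by fun_prop)
    rw [← lintegral_const_mul _ m1.lintegral_prod_right', 
      ← lintegral_const_mul _ m2.lintegral_prod_right',
      ← lintegral_add_left (m1.lintegral_prod_right'.const_mul 2)]
    refine lintegral_mono fun y => ?_
    have n1 : Measurable fun h : Plane => k (y, h) * ‖v y - v (y - h)‖ₑ ^ 2 :=
      m1.comp measurable_prodMk_left
    have n2 : Measurable fun h : Plane => k (y, h) * ‖v (y - h)‖ₑ ^ 2 :=
      m2.comp measurable_prodMk_left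
    simp only
    rw [← lintegral_const_mul _ n1, ← lintegral_const_mul _ n2,
      ← lintegral_add_left (n1.const_mul 2)]
    refine lintegral_mono fun h => ?_
    calc _ ≤ k (y, h) * (2 * ‖v y - v (y - h)‖ₑ ^ 2 + 2 * ‖v (y - h)‖ₑ ^ 2) :=
          mul_le_mul_right (enorm_sq_le_two _ _) _
      _ = _ := by ring
  -- In `e3` the coefficient of W is 250000π on the left and 40000π on the right. Subtraction is
  -- legitimate because W is finite by `hfin`; what remains is the passage to real numbers.
  rcases eq_or_ne (gag a v) ∞ with hg | hg
  · rw [hg, ENNReal.mul_top (by norm_num)]; exact le_top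
  clear e0 e1 e2 hW
  clear_value W
  lift W to ℝ≥0 using hfin
  lift gag a v to ℝ≥0 using hg with g
  rw [ENNReal.ofReal, ENNReal.ofReal, ENNReal.ofReal] at e3
  rw [ENNReal.ofReal]
  norm_cast at e3 ⊢
  rw [← NNReal.coe_le_coe] at e3 ⊢
  push_cast at e3 ⊢
  rw [Real.coe_toNNReal _ (by positivity), Real.coe_toNNReal _ (by positivity)] at e3
  have hpi := Real.pi_gt_three
  have hg0 := g.coe_nonneg
  have hW0 := W.coe_nonneg
  norm_num at e3 ⊢
  rw [max_eq_left (by positivity)] at e3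
  nlinarith [mul_nonneg (sub_nonneg.2 hpi.le) hW0]

lemma gag_translate (a : ℝ) (v : Plane → ℝ) (z : Plane) :
    gag a (fun y => v (y + z)) = gag a v := by
  unfold gag
  refine lintegral_congr fun h => ?_
  refine Eq.trans ?_ (lintegral_add_right_eq_self
    (fun y => ENNReal.ofReal ((v y - v (y - h)) ^ 2 * ‖h‖ ^ (-(2 + 2 * a)))) z)
  refine lintegral_congr fun y => ?_
  simp only [sub_add_eq_add_sub]

lemma hardy {a : ℝ} (ha : 0 < a) (ha1 : a ≤ 1 / 2) {v : Plane → ℝ} (hv : Measurable v) (z : Plane)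
    (hfin : ∫⁻ y, ENNReal.ofReal (‖y - z‖ ^ (-(2 * a))) * ‖v y‖ₑ ^ 2 ≠ ∞) :
    ∫⁻ y, ENNReal.ofReal (‖y - z‖ ^ (-(2 * a))) * ‖v y‖ₑ ^ 2 ≤
      ENNReal.ofReal 100000 * gag a v := by
  have h := hardy_zero ha ha1 (v := fun y => v (y + z)) (by fun_prop)
  have e : ∫⁻ y, ENNReal.ofReal (‖y - z‖ ^ (-(2 * a))) * ‖v y‖ₑ ^ 2 =
      ∫⁻ y, ENNReal.ofReal (‖y‖ ^ (-(2 * a))) * ‖v (y + z)‖ₑ ^ 2 := by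
    rw [← lintegral_add_right_eq_self _ z]
    simp
  rw [e] at hfin ⊢
  rw [← gag_translate a v z]
  exact h hfin


/-! ### Multipliers with slowly varying coefficients -/

lemma lintegral_lintegral_add_mul {F G : Plane × Plane → ℝ≥0∞} (hF : Measurable F)
    (hG : Measurable G) (c d : ℝ≥0∞) :
    ∫⁻ h, ∫⁻ y, (c * F (h, y) + d * G (h, y)) =
      c * (∫⁻ h, ∫⁻ y, F (h, y)) + d * ∫⁻ h, ∫⁻ y, G (h, y) := by
  rw [← lintegral_const_mul _ hF.lintegral_prod_right',
    ← lintegral_const_mul _ hG.lintegral_prod_right',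
    ← lintegral_add_left (hF.lintegral_prod_right'.const_mul c)]
  refine lintegral_congr fun h => ?_
  have n1 : Measurable fun y => F (h, y) := hF.comp measurable_prodMk_left
  have n2 : Measurable fun y => G (h, y) := hG.comp measurable_prodMk_left
  rw [← lintegral_const_mul _ n1, ← lintegral_const_mul _ n2,
    ← lintegral_add_left (n1.const_mul c)]

/-- A difference of bv is b(y - h) times a difference of v, plus (b(y) - b(y - h)) v(y). In the
second term y is frozen and the integral over h is the one of `lintegral_min_le`, with sup bound 2A
and slope Bω(y). -/
lemma gag_mul_le {a : ℝ} (ha : 0 < a) (ha1 : a < 1) {b v ω : Plane → ℝ} {A B : ℝ}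
    (hA : ∀ y, |b y| ≤ A) (hB : 0 ≤ B) (hω : ∀ y, 0 ≤ ω y)
    (hb : ∀ᵐ y, ∀ x, |b x - b y| ≤ B * ‖x - y‖ * ω y)
    (hbm : Measurable b) (hv : Measurable v) :
    gag a (fun y => b y * v y) ≤ ENNReal.ofReal (2 * A ^ 2) * gag a v +
      2 * ∫⁻ y, ENNReal.ofReal (minConst a * ((2 * A) ^ (2 - 2 * a) * (B * ω y) ^ (2 * a))) *
        ‖v y‖ₑ ^ 2 := by
  have hA0 : 0 ≤ A := (abs_nonneg _).trans (hA 0)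
  have m1 : Measurable fun p : Plane × Plane =>
      ENNReal.ofReal (‖p.1‖ ^ (-(2 + 2 * a))) * ‖(b p.2 - b (p.2 - p.1)) * v p.2‖ₑ ^ 2 := by
    fun_prop
  have m2 : Measurable fun p : Plane × Plane =>
      ENNReal.ofReal (‖p.1‖ ^ (-(2 + 2 * a))) * ‖v p.2 - v (p.2 - p.1)‖ₑ ^ 2 := by
    fun_prop
  calc gag a (fun y => b y * v y)
      ≤ ∫⁻ h, ∫⁻ y, (ENNReal.ofReal (2 * A ^ 2) *
          (ENNReal.ofReal (‖h‖ ^ (-(2 + 2 * a))) * ‖v y - v (y - h)‖ₑ ^ 2) +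
          2 * (ENNReal.ofReal (‖h‖ ^ (-(2 + 2 * a))) * ‖(b y - b (y - h)) * v y‖ₑ ^ 2)) := by
        refine lintegral_mono fun h => lintegral_mono fun y => ?_
        simp only
        rw [ofReal_mul_sq]
        have h1 := enorm_sq_le_two (b y * v y - b (y - h) * v (y - h)) ((b y - b (y - h)) * v y)
        have h2 : b y * v y - b (y - h) * v (y - h) - (b y - b (y - h)) * v y =
          b (y - h) * (v y - v (y - h)) := by ring
        rw [h2, enorm_mul (b (y - h)), mul_pow] at h1
        have h3 : ‖b (y - h)‖ₑ ^ 2 ≤ ENNReal.ofReal (A ^ 2) := by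
          rw [Real.enorm_eq_ofReal_abs, ← ENNReal.ofReal_pow (abs_nonneg _)]
          exact ENNReal.ofReal_le_ofReal (pow_le_pow_left₀ (abs_nonneg _) (hA _) 2)
        rw [ENNReal.ofReal_mul (by norm_num : (0 : ℝ) ≤ 2), ENNReal.ofReal_ofNat]
        calc _ ≤ ENNReal.ofReal (‖h‖ ^ (-(2 + 2 * a))) *
              (2 * (ENNReal.ofReal (A ^ 2) * ‖v y - v (y - h)‖ₑ ^ 2) +
                2 * ‖(b y - b (y - h)) * v y‖ₑ ^ 2) := by
              refine mul_le_mul_right (h1.trans ?_) _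
              gcongr
          _ = _ := by ring
    _ = ENNReal.ofReal (2 * A ^ 2) * gag a v +
        2 * ∫⁻ h, ∫⁻ y, ENNReal.ofReal (‖h‖ ^ (-(2 + 2 * a))) *
          ‖(b y - b (y - h)) * v y‖ₑ ^ 2 := by
        have := lintegral_lintegral_add_mul m2 m1 (ENNReal.ofReal (2 * A ^ 2)) 2
        simp only at this
        rw [this, gag]
        simp_rw [ofReal_mul_sq]
    _ ≤ _ := by
        refine add_le_add le_rfl (mul_le_mul_right ?_ 2)
        rw [lintegral_lintegral_swap m1.aemeasurable]
        refine lintegral_mono_ae ?_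
        filter_upwards [hb] with y hy
        refine le_trans ?_ (mul_le_mul_left (lintegral_min_le ha ha1 (A := 2 * A) (B := B * ω y)
          (by positivity) (mul_nonneg hB (hω y))) _)
        rw [← lintegral_mul_const' _ _ (by finiteness)]
        refine lintegral_mono fun h => ?_
        rw [enorm_mul, mul_pow, ← mul_assoc]
        refine mul_le_mul_left ?_ _
        rw [← ofReal_mul_sq]
        refine ENNReal.ofReal_le_ofReal ?_
        rw [← sq_abs]
        refine mul_le_mul_of_nonneg_right (pow_le_pow_left₀ (abs_nonneg _) ?_ 2) (by positivity)
        refine le_min ?_ ?_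
        · calc |b y - b (y - h)| ≤ |b y| + |b (y - h)| := abs_sub _ _
            _ ≤ _ := by linarith [hA y, hA (y - h)]
        · have := hy (y - h)
          rw [abs_sub_comm] at this
          refine this.trans (le_of_eq ?_)
          rw [sub_sub_cancel_left, norm_neg]; ring

/-- Purely qualitative: boundedness of v handles the singularity at z, and square integrability the
rest. It supplies the finiteness that the absorption in Hardy's inequality requires. -/
lemma lintegral_weight_ne_top {a : ℝ} (ha : 0 < a) (ha1 : a < 1) {v : Plane → ℝ} {M : ℝ}
    (hM : ∀ y, |v y| ≤ M) (hv : MemLp v 2) (z : Plane) :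
    ∫⁻ y, ENNReal.ofReal (‖y - z‖ ^ (-(2 * a))) * ‖v y‖ₑ ^ 2 ≠ ∞ := by
  have h1 : ∫⁻ y, ‖v y‖ₑ ^ 2 ≠ ∞ := by
    rw [← eLpNorm_two_sq]; exact ENNReal.pow_ne_top hv.2.ne
  have h2 : ∫⁻ y : Plane, ENNReal.ofReal (M ^ 2) *
      (Set.Ioc (0 : ℝ) 1).indicator (fun r => ENNReal.ofReal (r ^ (-(2 * a)))) ‖y‖ ≠ ∞ := by
    rw [lintegral_const_mul' _ _ ENNReal.ofReal_ne_top, lintegral_radial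
      ((Measurable.indicator (by fun_prop) measurableSet_Ioc))]
    have : ∫⁻ r in Set.Ioi (0 : ℝ), ENNReal.ofReal r *
        (Set.Ioc (0 : ℝ) 1).indicator (fun r => ENNReal.ofReal (r ^ (-(2 * a)))) r =
        ∫⁻ r in Set.Ioc (0 : ℝ) 1, ENNReal.ofReal (r ^ (1 - 2 * a)) := by
      rw [← lintegral_indicator measurableSet_Ioi, ← lintegral_indicator measurableSet_Ioc]
      refine lintegral_congr fun r => ?_
      by_cases hr : r ∈ Set.Ioc (0 : ℝ) 1
      · rw [Set.indicator_of_mem (show r ∈ Set.Ioi (0 : ℝ) from hr.1), Set.indicator_of_mem hr,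
          Set.indicator_of_mem hr, ← ENNReal.ofReal_mul hr.1.le, sub_eq_add_neg,
          Real.rpow_add hr.1, Real.rpow_one]
      · rw [Set.indicator_of_notMem hr]
        simp [Set.indicator_of_notMem hr]
    rw [this, lintegral_rpow_Ioc (by linarith) zero_le_one]
    finiteness
  refine ne_top_of_le_ne_top (ENNReal.add_ne_top.2 ⟨h1, h2⟩) ?_
  rw [← lintegral_sub_right_eq_self (fun y : Plane => ENNReal.ofReal (M ^ 2) *
      (Set.Ioc (0 : ℝ) 1).indicator (fun r => ENNReal.ofReal (r ^ (-(2 * a)))) ‖y‖) z,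
    ← lintegral_add_left' (by have := hv.1.enorm; fun_prop)]
  refine lintegral_mono fun y => ?_
  by_cases hy : ‖y - z‖ ∈ Set.Ioc (0 : ℝ) 1
  · rw [Set.indicator_of_mem hy, mul_comm]
    refine le_add_left (mul_le_mul_left ?_ _)
    rw [Real.enorm_eq_ofReal_abs, ← ENNReal.ofReal_pow (abs_nonneg _)]
    exact ENNReal.ofReal_le_ofReal (pow_le_pow_left₀ (abs_nonneg _) (hM _) 2)
  · refine le_add_right ?_
    refine mul_le_of_le_one_left (by simp) (ENNReal.ofReal_le_one.2 ?_)
    rcases (norm_nonneg (y - z)).eq_or_lt with h0 | h0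
    · rw [← h0, Real.zero_rpow (by linarith)]; norm_num
    · have : 1 < ‖y - z‖ := by
        by_contra hc
        exact hy ⟨h0, not_lt.1 hc⟩
      exact Real.rpow_le_one_of_one_le_of_nonpos this.le (by linarith)

/-- The constant in `enorm_pairing_mul_le`. -/
def mulConst (a : ℝ) : ℝ :=
  √(32 / Real.pi * (2 * gagConst a + 6400000 * minConst a * gagConst (a / 2)))

lemma mulConst_nonneg (a : ℝ) : 0 ≤ mulConst a := Real.sqrt_nonneg _

/-- The coefficient `b` varies slowly at infinity. -/
def SlowCoeff (a : ℝ) (b : Plane → ℝ) (M : ℝ) : Prop :=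
  Measurable b ∧ ∃ A B : ℝ, ∃ z : Plane, (∀ y, |b y| ≤ A) ∧ 0 ≤ B ∧
    (∀ x y, y ≠ 0 → y ≠ z → |b x - b y| ≤
      B * ‖x - y‖ * (‖y‖ ^ (-(1 / 2) : ℝ) + ‖y - z‖ ^ (-(1 / 2) : ℝ))) ∧
    A ≤ M ∧ A ^ (1 - a) * B ^ a ≤ M

/-- By `gag_mul_le` the slope of b enters to the power 2a, so the weights |y|^(-1/2) and |y -
z|^(-1/2) become |y|^(-a) and |y - z|^(-a). This is Hardy's inequality of order a/2, which stays in
the range a/2 ≤ 1/2 for every a < 1 and accounts for the second norm of Q. -/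
theorem enorm_pairing_mul_le {a : ℝ} (ha : 0 < a) (ha1 : a < 1) {Q : Plane → ℂ}
    (hQ : Integrable Q) (hQ2 : MemLp Q 2) {b : Plane → ℝ} {M : ℝ} (hb : SlowCoeff a b M)
    (φ : 𝓢(Plane, ℂ)) :
    ‖∫ y, ((b y * invF Q y : ℝ) : ℂ) * (𝓕 φ) y‖ₑ ≤
      ENNReal.ofReal (mulConst a * M) * (wnorm a Q + wnorm (a / 2) Q) * wnorm (-a) φ := by
  obtain ⟨hbm, A, B, z, hA, hB, hL, hAM, hABM⟩ := hb
  have hA0 : 0 ≤ A := (abs_nonneg _).trans (hA 0)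
  have hM0 : 0 ≤ M := hA0.trans hAM
  have hvm : Measurable (invF Q) := (continuous_invF hQ).measurable
  have hmem : MemLp (fun y => b y * invF Q y) 2 := by
    refine MemLp.of_le_mul (c := A) (memLp_invF hQ hQ2) (by fun_prop) (.of_forall fun y => ?_)
    rw [norm_mul]
    gcongr
    exact hA y
  refine (enorm_pairing_le ha hmem φ).trans ?_
  gcongr
  have hmc := minConst_nonneg ha ha1
  have hg1 := gagConst_nonneg ha ha1
  have hg2 := gagConst_nonneg (a := a / 2) (by linarith) (by linarith)
  have hardyz : ∀ z : Plane, ∫⁻ y, ENNReal.ofReal (‖y - z‖ ^ (-a)) * ‖invF Q y‖ₑ ^ 2 ≤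
      ENNReal.ofReal (100000 * gagConst (a / 2)) * wnorm (a / 2) Q ^ 2 := by
    intro z
    have h := hardy (a := a / 2) (by linarith) (by linarith) hvm z
    rw [show -(2 * (a / 2)) = -a by ring] at h
    have h3 := lintegral_weight_ne_top (a := a / 2) (by linarith) (by linarith) (fun y => abs_invF_le (Q := Q) y)
      (memLp_invF hQ hQ2) z
    rw [show -(2 * (a / 2)) = -a by ring] at h3
    refine (h h3).trans ?_
    rw [ENNReal.ofReal_mul (by norm_num), mul_assoc]
    gcongr
    exact gag_invF_le (by linarith) (by linarith) hQ hQ2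
  have hG : gag a (fun y => b y * invF Q y) ≤
      ENNReal.ofReal (M ^ 2 * (2 * gagConst a + 6400000 * minConst a * gagConst (a / 2))) *
        (wnorm a Q + wnorm (a / 2) Q) ^ 2 := by
    refine (gag_mul_le ha ha1 hA hB
      (ω := fun y => ‖y‖ ^ (-(1 / 2) : ℝ) + ‖y - z‖ ^ (-(1 / 2) : ℝ)) (fun y => by positivity)
      ?_ hbm hvm).trans ?_
    · have h1 : ∀ᵐ y : Plane, y ≠ 0 := by simp [ae_iff]
      have h2 : ∀ᵐ y : Plane, y ≠ z := by simp [ae_iff]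
      filter_upwards [h1, h2] with y h1 h2 x using hL x y h1 h2
    have e1 : ENNReal.ofReal (2 * A ^ 2) * gag a (invF Q) ≤
        ENNReal.ofReal (M ^ 2 * (2 * gagConst a)) * (wnorm a Q + wnorm (a / 2) Q) ^ 2 := by
      calc _ ≤ ENNReal.ofReal (2 * M ^ 2) *
            (ENNReal.ofReal (gagConst a) * (wnorm a Q + wnorm (a / 2) Q) ^ 2) := by
            gcongr
            refine (gag_invF_le ha ha1 hQ hQ2).trans ?_
            gcongr
            exact le_self_add
        _ = _ := by
            rw [← mul_assoc, ← ENNReal.ofReal_mul (by positivity)]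
            congr 2; ring
    have e2 : 2 * ∫⁻ y, ENNReal.ofReal (minConst a * ((2 * A) ^ (2 - 2 * a) *
        (B * (‖y‖ ^ (-(1 / 2) : ℝ) + ‖y - z‖ ^ (-(1 / 2) : ℝ))) ^ (2 * a))) * ‖invF Q y‖ₑ ^ 2 ≤
        ENNReal.ofReal (M ^ 2 * (6400000 * minConst a * gagConst (a / 2))) *
          (wnorm a Q + wnorm (a / 2) Q) ^ 2 := by
      have pt : ∀ y : Plane, ENNReal.ofReal (minConst a * ((2 * A) ^ (2 - 2 * a) *
          (B * (‖y‖ ^ (-(1 / 2) : ℝ) + ‖y - z‖ ^ (-(1 / 2) : ℝ))) ^ (2 * a))) ≤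
          ENNReal.ofReal (minConst a * (16 * M ^ 2)) *
            (ENNReal.ofReal (‖y - 0‖ ^ (-a)) + ENNReal.ofReal (‖y - z‖ ^ (-a))) := by
        intro y
        rw [← ENNReal.ofReal_add (by positivity) (by positivity),
          ← ENNReal.ofReal_mul (by positivity)]
        refine ENNReal.ofReal_le_ofReal ?_
        rw [mul_assoc (minConst a)]
        refine mul_le_mul_of_nonneg_left ?_ hmc
        have p1 : (2 * A) ^ (2 - 2 * a) ≤ 4 * A ^ (2 - 2 * a) := by
          rw [Real.mul_rpow (by norm_num) hA0]
          gcongr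
          calc (2 : ℝ) ^ (2 - 2 * a) ≤ 2 ^ (2 : ℝ) :=
                Real.rpow_le_rpow_of_exponent_le (by norm_num) (by linarith)
            _ = 4 := by norm_num
        have p2 : A ^ (2 - 2 * a) * B ^ (2 * a) ≤ M ^ 2 := by
          have : A ^ (2 - 2 * a) * B ^ (2 * a) = (A ^ (1 - a) * B ^ a) ^ 2 := by
            rw [mul_pow, ← Real.rpow_natCast, ← Real.rpow_natCast, ← Real.rpow_mul hA0,
              ← Real.rpow_mul hB]
            congr 2 <;> push_cast <;> ring
          rw [this]
          exact pow_le_pow_left₀ (by positivity) hABM 2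
        have p3 : ∀ x w : ℝ, 0 ≤ x → 0 ≤ w → (x + w) ^ (2 * a) ≤
            4 * (x ^ (2 * a) + w ^ (2 * a)) := by
          intro x w hx hw
          have : ∀ x w : ℝ, 0 ≤ x → x ≤ w → (x + w) ^ (2 * a) ≤
              4 * (x ^ (2 * a) + w ^ (2 * a)) := by
            intro x w hx hxw
            have hw : 0 ≤ w := hx.trans hxw
            calc (x + w) ^ (2 * a) ≤ (2 * w) ^ (2 * a) := by gcongr; linarith
              _ = 2 ^ (2 * a) * w ^ (2 * a) := Real.mul_rpow (by norm_num) hw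
              _ ≤ 2 ^ (2 : ℝ) * w ^ (2 * a) := by
                  gcongr
                  · norm_num
                  · linarith
              _ ≤ _ := by
                  have := Real.rpow_nonneg hx (2 * a)
                  norm_num
                  linarith
          rcases le_total x w with h | h
          · exact this x w hx h
          · rw [add_comm x w, add_comm (x ^ _)]; exact this w x hw h
        have p4 : ∀ y : Plane, (‖y‖ ^ (-(1 / 2) : ℝ)) ^ (2 * a) = ‖y‖ ^ (-a) := by
          intro y
          rw [← Real.rpow_mul (norm_nonneg _)]; congr 1; ring
        rw [Real.mul_rpow hB (by positivity)]
        have p5 := p3 (‖y‖ ^ (-(1 / 2) : ℝ)) (‖y - z‖ ^ (-(1 / 2) : ℝ)) (by positivity)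
          (by positivity)
        rw [p4, p4] at p5
        rw [sub_zero]
        calc _ ≤ 4 * A ^ (2 - 2 * a) * (B ^ (2 * a) * (4 * (‖y‖ ^ (-a) + ‖y - z‖ ^ (-a)))) := by
              gcongr
          _ = 16 * (A ^ (2 - 2 * a) * B ^ (2 * a)) * (‖y‖ ^ (-a) + ‖y - z‖ ^ (-a)) := by ring
          _ ≤ _ := by gcongr
      calc _ ≤ 2 * ∫⁻ y, ENNReal.ofReal (minConst a * (16 * M ^ 2)) *
            (ENNReal.ofReal (‖y - 0‖ ^ (-a)) * ‖invF Q y‖ₑ ^ 2 +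
              ENNReal.ofReal (‖y - z‖ ^ (-a)) * ‖invF Q y‖ₑ ^ 2) := by
            refine mul_le_mul_right (lintegral_mono fun y => ?_) _
            refine (mul_le_mul_left (pt y) _).trans (le_of_eq ?_)
            ring
        _ ≤ 2 * (ENNReal.ofReal (minConst a * (16 * M ^ 2)) *
            (ENNReal.ofReal (100000 * gagConst (a / 2)) * (wnorm a Q + wnorm (a / 2) Q) ^ 2 +
              ENNReal.ofReal (100000 * gagConst (a / 2)) *
                (wnorm a Q + wnorm (a / 2) Q) ^ 2)) := by
            rw [lintegral_const_mul' _ _ ENNReal.ofReal_ne_top, lintegral_add_left (by fun_prop)]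
            have : wnorm (a / 2) Q ^ 2 ≤ (wnorm a Q + wnorm (a / 2) Q) ^ 2 := by
              gcongr; exact le_add_self
            gcongr
            · exact (hardyz 0).trans (by gcongr)
            · exact (hardyz z).trans (by gcongr)
        _ = _ := by
            rw [← two_mul, show (2 : ℝ≥0∞) = ENNReal.ofReal 2 by simp]
            simp only [← mul_assoc]
            rw [← ENNReal.ofReal_mul (by norm_num), ← ENNReal.ofReal_mul (by positivity),
              ← ENNReal.ofReal_mul (by positivity)]
            congr 2; ring
    refine (add_le_add e1 e2).trans (le_of_eq ?_)
    rw [← add_mul, ← ENNReal.ofReal_add (by positivity) (by positivity)]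
    congr 2; ring
  refine le_of_sq_le ?_
  rw [← ENNReal.rpow_natCast, ← ENNReal.rpow_mul]
  norm_num only [one_div, Nat.cast_ofNat, inv_mul_cancel₀, ENNReal.rpow_one]
  refine (mul_le_mul_right hG _).trans (le_of_eq ?_)
  rw [mul_pow, ← ENNReal.ofReal_pow (mul_nonneg (mulConst_nonneg a) hM0), ← mul_assoc,
    ← ENNReal.ofReal_mul (by positivity), mul_pow, mulConst, Real.sq_sqrt (by positivity)]
  congr 2; ring

/-! ### Riesz representation -/

lemma memLp_weight_schwartz {a : ℝ} (ha : 0 < a) (ha1 : a < 1) (φ : 𝓢(Plane, ℂ)) :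
    MemLp (fun ξ => (‖ξ‖ ^ (-a) : ℝ) • φ ξ) 2 := by
  have hm : AEStronglyMeasurable (fun ξ : Plane => (‖ξ‖ ^ (-a) : ℝ)) :=
    Measurable.aestronglyMeasurable (by fun_prop)
  refine ⟨hm.smul φ.continuous.aestronglyMeasurable, ?_⟩
  obtain ⟨M, hM⟩ : ∃ M, ∀ ξ, ‖φ ξ‖ ≤ M := ⟨_, fun ξ => φ.toBoundedContinuousFunction.norm_coe_le_norm ξ⟩
  have h := lintegral_weight_ne_top ha ha1 (v := fun ξ => ‖φ ξ‖) (M := M)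
    (fun y => by simpa using hM y) (φ.memLp 2).norm 0
  rw [← wnorm_eq_eLpNorm, wnorm, lt_top_iff_ne_top]
  refine ENNReal.rpow_ne_top_of_nonneg (by norm_num) ?_
  simpa using h

/-- The map φ ↦ |ξ|^(-a) φ sends Schwartz functions into `L²` since a < 1, and ℓ factors through its
image with norm at most K. A bounded extension is represented by some v in `L²`, and w = |ξ|^(-a)
times the conjugate of v. -/
theorem exists_riesz {a : ℝ} (ha : 0 < a) (ha1 : a < 1) (ℓ : 𝓢(Plane, ℂ) →ₗ[ℂ] ℂ) {K : ℝ≥0∞}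
    (hK : K ≠ ∞) (hℓ : ∀ φ, ‖ℓ φ‖ₑ ≤ K * wnorm (-a) φ) :
    ∃ w : Plane → ℂ, AEStronglyMeasurable w ∧
      (∀ φ : 𝓢(Plane, ℂ), Integrable (fun x => φ x * w x) ∧ ℓ φ = ∫ x, φ x * w x) ∧
      wnorm a w ≤ K := by
  let E := Lp ℂ 2 (volume : Measure Plane)
  let ι : 𝓢(Plane, ℂ) →ₗ[ℂ] E :=
    { toFun := fun φ => (memLp_weight_schwartz ha ha1 φ).toLp _
      map_add' := fun φ ψ => by
        rw [← MemLp.toLp_add]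
        refine MemLp.toLp_congr _ _ (.of_forall fun x => ?_)
        simp
      map_smul' := fun c φ => by
        rw [RingHom.id_apply, ← MemLp.toLp_const_smul]
        refine MemLp.toLp_congr _ _ (.of_forall fun x => ?_)
        simp [mul_left_comm] }
  have hι : ∀ φ, ‖ι φ‖ₑ = wnorm (-a) φ := by
    intro φ
    rw [wnorm_eq_eLpNorm]
    exact Lp.enorm_toLp (memLp_weight_schwartz ha ha1 φ)
  have hk : ι.ker ≤ ℓ.ker := by
    intro φ hφ
    rw [LinearMap.mem_ker] at hφ ⊢
    have := hℓ φ
    rw [← hι, hφ] at this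
    simpa using this
  let f₀ : ι.range →ₗ[ℂ] ℂ := (ι.ker.liftQ ℓ hk).comp ι.quotKerEquivRange.symm.toLinearMap
  have hf₀ : ∀ φ, f₀ ⟨ι φ, φ, rfl⟩ = ℓ φ := by
    intro φ
    have : ι.quotKerEquivRange.symm ⟨ι φ, φ, rfl⟩ = Submodule.Quotient.mk φ := by
      rw [LinearEquiv.symm_apply_eq]; rfl
    simp only [f₀, LinearMap.comp_apply, LinearEquiv.coe_coe]
    rw [this]; rfl
  have hb : ∀ x, ‖f₀ x‖ ≤ K.toReal * ‖x‖ := by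
    rintro ⟨x, φ, rfl⟩
    rw [hf₀]
    have := hℓ φ
    rw [← hι] at this
    have := ENNReal.toReal_mono (by finiteness) this
    simpa [ENNReal.toReal_mul] using this
  -- Hahn–Banach makes it unnecessary to know that the image of the Schwartz space is dense.
  obtain ⟨g, hg, hgn⟩ := exists_extension_norm_eq (𝕜 := ℂ) ι.range (f₀.mkContinuous _ hb)
  have hgn' : ‖g‖ ≤ K.toReal := hgn ▸ f₀.mkContinuous_norm_le (by simp) hb
  let v : E := (InnerProductSpace.toDual ℂ E).symm g
  have hv : ‖v‖ ≤ K.toReal := ((InnerProductSpace.toDual ℂ E).symm.norm_map g).le.trans hgn'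
  have hvφ : ∀ φ, ℓ φ = inner ℂ v (ι φ) := by
    intro φ
    rw [InnerProductSpace.toDual_symm_apply, ← hf₀ φ]
    exact (hg ⟨ι φ, φ, rfl⟩).symm
  have hvm := (Lp.memLp v)
  have hm : AEStronglyMeasurable (fun ξ : Plane => (‖ξ‖ ^ (-a) : ℝ)) :=
    Measurable.aestronglyMeasurable (by fun_prop)
  have hvc : AEStronglyMeasurable (fun ξ => (starRingEnd ℂ) (v ξ)) :=
    Complex.continuous_conj.comp_aestronglyMeasurable hvm.1
  refine ⟨fun ξ => (‖ξ‖ ^ (-a) : ℝ) • (starRingEnd ℂ) (v ξ), hm.smul hvc, fun φ => ⟨?_, ?_⟩, ?_⟩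
  · have h1 := (memLp_weight_schwartz ha ha1 φ).integrable_mul
      (hvm.of_le (g := v) hvc (.of_forall fun ξ => by simp))
    refine h1.congr (.of_forall fun ξ => ?_)
    simp [mul_assoc, mul_left_comm (φ ξ)]
  · rw [hvφ, L2.inner_def]
    refine integral_congr_ae ?_
    filter_upwards [(memLp_weight_schwartz ha ha1 φ).coeFn_toLp] with ξ hξ
    have : (ι φ : Plane → ℂ) ξ = (‖ξ‖ ^ (-a) : ℝ) • φ ξ := hξ
    rw [this]
    simp [mul_assoc, mul_left_comm (φ ξ)]
  · rw [wnorm_eq_eLpNorm]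
    calc _ = eLpNorm v 2 volume := by
          refine eLpNorm_congr_norm_ae ?_
          have h1 : ∀ᵐ y : Plane, y ≠ 0 := by simp [ae_iff]
          filter_upwards [h1] with ξ hξ
          have hn : 0 < ‖ξ‖ := norm_pos_iff.2 hξ
          rw [smul_smul, ← Real.rpow_add hn]
          simp
      _ = ‖v‖ₑ := (Lp.enorm_def v).symm
      _ ≤ K := by
          rw [← ofReal_norm, ← ENNReal.ofReal_toReal hK]
          exact ENNReal.ofReal_le_ofReal hv


/-! ### The profile `kLin` -/

/-- The Japanese bracket. -/
def jap (y : Plane) : ℝ := √(‖y‖ ^ 2 + 1)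

lemma jap_sq (y : Plane) : jap y ^ 2 = ‖y‖ ^ 2 + 1 := Real.sq_sqrt (by positivity)

lemma one_le_jap (y : Plane) : 1 ≤ jap y := by
  rw [jap, Real.one_le_sqrt]; nlinarith [norm_nonneg y]

lemma jap_pos (y : Plane) : 0 < jap y := one_pos.trans_le (one_le_jap y)

lemma norm_le_jap (y : Plane) : ‖y‖ ≤ jap y := by
  rw [jap]; exact Real.le_sqrt_of_sq_le (by linarith)

lemma abs_jap_sub_le (x y : Plane) : |jap x - jap y| ≤ ‖x - y‖ := by
  have h1 := abs_norm_sub_norm_le x y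
  have hx := jap_pos x
  have hy := jap_pos y
  have h2 : (jap x - jap y) * (jap x + jap y) = (‖x‖ - ‖y‖) * (‖x‖ + ‖y‖) := by
    have := jap_sq x; have := jap_sq y; ring_nf at *; linarith
  have h3 : |jap x - jap y| * (jap x + jap y) ≤ ‖x - y‖ * (jap x + jap y) := by
    rw [← abs_of_pos (add_pos hx hy), ← abs_mul, h2, abs_mul,
      abs_of_nonneg (by positivity : 0 ≤ ‖x‖ + ‖y‖), abs_of_pos (add_pos hx hy)]
    exact mul_le_mul h1 (add_le_add (norm_le_jap x) (norm_le_jap y)) (by positivity)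
      (norm_nonneg _)
  exact le_of_mul_le_mul_right h3 (add_pos hx hy)

lemma continuous_jap : Continuous jap := by unfold jap; fun_prop

@[fun_prop] lemma measurable_jap : Measurable jap := continuous_jap.measurable

/-- The gradient of `kLin 1`. -/
def kGrad (y : Plane) : Plane := (1 / (jap y + 1)) • y

@[fun_prop] lemma continuous_kGrad : Continuous kGrad := by
  unfold kGrad
  refine Continuous.smul (continuous_const.div (continuous_jap.add continuous_const) fun y => ?_)
    continuous_id
  have := jap_pos y
  show jap y + 1 ≠ 0
  positivity

@[fun_prop] lemma measurable_kGrad : Measurable kGrad := continuous_kGrad.measurable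

lemma norm_kGrad_le (y : Plane) : ‖kGrad y‖ ≤ 1 := by
  have := jap_pos y
  rw [kGrad, norm_smul, Real.norm_of_nonneg (by positivity), div_mul_eq_mul_div, one_mul,
    div_le_one (by linarith)]
  linarith [norm_le_jap y]

/-- The decay is in y alone, with x arbitrary. This asymmetric form is what `SlowCoeff` asks for,
and it avoids any case distinction on the relative position of x and y. -/
lemma norm_kGrad_sub_le (x y : Plane) : ‖kGrad x - kGrad y‖ ≤ 2 * ‖x - y‖ / jap y := by
  have hx := jap_pos x
  have hy := jap_pos y
  have e : kGrad x - kGrad y = (1 / (jap y + 1)) • (x - y) +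
      ((jap y - jap x) / ((jap x + 1) * (jap y + 1))) • x := by
    rw [kGrad, kGrad, smul_sub, ← sub_eq_zero]
    have : (jap y - jap x) / ((jap x + 1) * (jap y + 1)) = 1 / (jap x + 1) - 1 / (jap y + 1) := by
      field_simp; ring
    rw [this, sub_smul]; abel
  have h1 : ‖(1 / (jap y + 1)) • (x - y)‖ ≤ ‖x - y‖ / jap y := by
    rw [norm_smul, Real.norm_of_nonneg (by positivity), div_mul_eq_mul_div, one_mul]
    gcongr; linarith
  have h2 : ‖((jap y - jap x) / ((jap x + 1) * (jap y + 1))) • x‖ ≤ ‖x - y‖ / jap y := by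
    rw [norm_smul, Real.norm_eq_abs, abs_div, abs_of_pos (a := (jap x + 1) * (jap y + 1))
      (by positivity), div_mul_eq_mul_div, div_le_div_iff₀ (by positivity) hy]
    have h3 := abs_jap_sub_le y x
    rw [norm_sub_rev] at h3
    have h4 := norm_le_jap x
    calc |jap y - jap x| * ‖x‖ * jap y ≤ ‖x - y‖ * (jap x + 1) * (jap y + 1) := by
          gcongr <;> linarith
      _ = _ := by ring
  rw [e]
  refine (norm_add_le _ _).trans ((add_le_add h1 h2).trans (le_of_eq ?_))
  ring

lemma hasFDerivAt_kLin (s : ℝ) (y : Plane) :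
    HasFDerivAt (kLin s) (s • innerSL ℝ (kGrad y)) y := by
  have hq := jap_pos y
  have h1 : HasFDerivAt (fun y : Plane => ‖y‖ ^ 2 + 1) (2 • innerSL ℝ y) y :=
    (hasStrictFDerivAt_norm_sq y).hasFDerivAt.add_const 1
  have h2 : HasFDerivAt jap ((1 / (2 * jap y)) • (2 • innerSL ℝ y)) y :=
    h1.sqrt (by positivity)
  have h3 : HasFDerivAt (fun y => Real.log (jap y + 1)) _ y :=
    (h2.add_const 1).log (by positivity)
  refine ((h2.sub h3).const_mul s).congr_fderiv ?_
  ext v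
  simp [kGrad]
  left
  field_simp
  ring

lemma kLin_eq_mul (s : ℝ) (y : Plane) : kLin s y = s * kLin 1 y := by simp [kLin]

lemma kLin_neg (s : ℝ) (y : Plane) : kLin s (-y) = kLin s y := by simp [kLin]

lemma continuous_kLin (s : ℝ) : Continuous (kLin s) :=
  continuous_iff_continuousAt.2 fun y => (hasFDerivAt_kLin s y).continuousAt

lemma abs_kLin_sub_sub_le {x y z : Plane} {C : ℝ}
    (hC : ∀ w ∈ segment ℝ y x, ‖kGrad w - kGrad z‖ ≤ C) :
    |kLin 1 x - kLin 1 y - inner ℝ (kGrad z) (x - y)| ≤ C * ‖x - y‖ := by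
  have h : ∀ w ∈ segment ℝ y x, HasFDerivWithinAt (fun w => kLin 1 w - inner ℝ (kGrad z) w)
      ((1 : ℝ) • innerSL ℝ (kGrad w) - innerSL ℝ (kGrad z)) (segment ℝ y x) w := fun w _ =>
    ((hasFDerivAt_kLin 1 w).sub (innerSL ℝ (kGrad z)).hasFDerivAt).hasFDerivWithinAt
  have := Convex.norm_image_sub_le_of_norm_hasFDerivWithin_le h (C := C) (fun w hw => ?_)
    (convex_segment y x) (left_mem_segment ℝ y x) (right_mem_segment ℝ y x)
  · rw [Real.norm_eq_abs] at this
    rw [inner_sub_right]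
    refine le_trans (le_of_eq ?_) this
    congr 1; ring
  · rw [one_smul, ← map_sub, innerSL_apply_norm]
    exact hC w hw

lemma abs_kLin_sub_le (x y : Plane) : |kLin 1 x - kLin 1 y| ≤ ‖x - y‖ := by
  have h : ∀ w ∈ Set.univ, HasFDerivWithinAt (kLin 1)
      ((1 : ℝ) • innerSL ℝ (kGrad w)) Set.univ w := fun w _ =>
    (hasFDerivAt_kLin 1 w).hasFDerivWithinAt
  have := Convex.norm_image_sub_le_of_norm_hasFDerivWithin_le h (C := 1) (fun w hw => ?_)
    convex_univ (Set.mem_univ y) (Set.mem_univ x)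
  · simpa using this
  · rw [one_smul, innerSL_apply_norm]
    exact norm_kGrad_le w

lemma norm_sub_le_of_mem_segment {x y w : Plane} (hw : w ∈ segment ℝ y x) :
    ‖w - y‖ ≤ ‖x - y‖ := by
  rw [segment_eq_image'] at hw
  obtain ⟨t, ht, rfl⟩ := hw
  rw [add_sub_cancel_left, norm_smul, Real.norm_of_nonneg ht.1]
  exact mul_le_of_le_one_left (norm_nonneg _) ht.2

lemma abs_kLin_taylor_le (x y : Plane) :
    |kLin 1 x - kLin 1 y - inner ℝ (kGrad y) (x - y)| ≤ 2 * ‖x - y‖ / jap y * ‖x - y‖ := by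
  refine abs_kLin_sub_sub_le fun w hw => (norm_kGrad_sub_le w y).trans ?_
  have := jap_pos y
  gcongr
  exact norm_sub_le_of_mem_segment hw

/-! ### The nonlinearity -/

/-- The function `(1 + x²)^(-3/2) - 1`. -/
def nl (x : ℝ) : ℝ := (1 + x ^ 2) ^ (-(3 / 2) : ℝ) - 1

/-- The derivative of `nl`. -/
def nl' (x : ℝ) : ℝ := -3 * x * (1 + x ^ 2) ^ (-(5 / 2) : ℝ)

lemma hasDerivAt_nl (x : ℝ) : HasDerivAt nl (nl' x) x := by
  have h1 : HasDerivAt (fun x : ℝ => 1 + x ^ 2) (2 * x) x := by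
    simpa using (hasDerivAt_pow 2 x).const_add 1
  have h2 := (h1.rpow_const (p := -(3 / 2)) (Or.inl (by positivity))).sub_const 1
  refine h2.congr_deriv ?_
  rw [nl', show (-(3 / 2) - 1 : ℝ) = -(5 / 2) by norm_num]; ring

lemma rpow_le_one_of_neg (x : ℝ) {p : ℝ} (hp : p ≤ 0) : (1 + x ^ 2) ^ p ≤ 1 :=
  Real.rpow_le_one_of_one_le_of_nonpos (by nlinarith [sq_nonneg x]) hp

lemma abs_nl'_le (x : ℝ) : |nl' x| ≤ 3 * |x| := by
  rw [nl', abs_mul, abs_mul, abs_of_nonneg (a := (1 + x ^ 2) ^ _) (by positivity)]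
  norm_num
  have := rpow_le_one_of_neg x (p := -(5 / 2)) (by norm_num)
  nlinarith [abs_nonneg x]

lemma abs_nl'_sub_le (x y : ℝ) : |nl' x - nl' y| ≤ 18 * |x - y| := by
  have hd : ∀ x : ℝ, HasDerivAt nl'
      (-3 * (1 + x ^ 2) ^ (-(5 / 2) : ℝ) + 15 * (x ^ 2 * (1 + x ^ 2) ^ (-(7 / 2) : ℝ))) x := by
    intro x
    have h1 : HasDerivAt (fun x : ℝ => 1 + x ^ 2) (2 * x) x := by
      simpa using (hasDerivAt_pow 2 x).const_add 1
    have h2 := ((hasDerivAt_id x).const_mul (-3)).mul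
      (h1.rpow_const (p := -(5 / 2)) (Or.inl (by positivity)))
    refine h2.congr_deriv ?_
    rw [show (-(5 / 2) - 1 : ℝ) = -(7 / 2) by norm_num]
    simp only [id]; ring
  have := Convex.norm_image_sub_le_of_norm_hasDerivWithin_le (f := nl') (s := Set.univ) (C := 18)
    (fun x _ => (hd x).hasDerivWithinAt) (fun x _ => ?_) convex_univ (Set.mem_univ y)
    (Set.mem_univ x)
  · simpa using this
  · have h1 := rpow_le_one_of_neg x (p := -(5 / 2)) (by norm_num)
    have h2 : x ^ 2 * (1 + x ^ 2) ^ (-(7 / 2) : ℝ) ≤ 1 := by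
      have : (0 : ℝ) < 1 + x ^ 2 := by positivity
      rw [show (-(7 / 2) : ℝ) = -(5 / 2) + -1 by norm_num, Real.rpow_add this, Real.rpow_neg_one,
        mul_left_comm]
      refine mul_le_one₀ h1 (by positivity) ?_
      rw [← div_eq_mul_inv, div_le_one this]
      linarith
    have h3 : (0 : ℝ) ≤ (1 + x ^ 2) ^ (-(5 / 2) : ℝ) := by positivity
    have h4 : (0 : ℝ) ≤ x ^ 2 * (1 + x ^ 2) ^ (-(7 / 2) : ℝ) := by positivity
    rw [Real.norm_eq_abs, abs_le]
    constructor <;> linarith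

lemma abs_nl_sub_le {x y m : ℝ} (hx : |x| ≤ m) (hy : |y| ≤ m) :
    |nl x - nl y| ≤ 3 * m * |x - y| := by
  have := Convex.norm_image_sub_le_of_norm_hasDerivWithin_le (f := nl) (s := Set.Icc (-m) m)
    (C := 3 * m) (fun x _ => (hasDerivAt_nl x).hasDerivWithinAt) (fun x hx => ?_)
    (convex_Icc _ _) (abs_le.1 hy) (abs_le.1 hx)
  · simpa using this
  · exact (abs_nl'_le x).trans (by gcongr; exact abs_le.2 hx)

@[simp] lemma nl_zero : nl 0 = 0 := by simp [nl]

lemma nl_neg (x : ℝ) : nl (-x) = nl x := by simp [nl]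

lemma abs_nl_le (x : ℝ) : |nl x| ≤ 3 * x ^ 2 := by
  have := abs_nl_sub_le (x := x) (y := 0) (m := |x|) le_rfl (by simp)
  simpa [mul_assoc, ← sq] using this

@[fun_prop] lemma continuous_nl : Continuous nl :=
  continuous_iff_continuousAt.2 fun x => (hasDerivAt_nl x).continuousAt

@[fun_prop] lemma continuous_nl' : Continuous nl' := by
  unfold nl'
  refine Continuous.mul (by fun_prop) (Continuous.rpow_const (by fun_prop) fun x => Or.inl ?_)
  positivity


/-! ### Coefficients -/

/-- The difference quotient of `kLin 1`. -/
def kQuot (α y : Plane) : ℝ := (kLin 1 y - kLin 1 (y - α)) / ‖α‖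

lemma diffQuot_kLin (s : ℝ) (α y : Plane) : diffQuot α (kLin s) y = s * kQuot α y := by
  rw [diffQuot, kQuot, kLin_eq_mul s y, kLin_eq_mul s (y - α)]; ring

@[fun_prop] lemma measurable_kQuot : Measurable fun p : Plane × Plane => kQuot p.1 p.2 := by
  have := (continuous_kLin 1).measurable
  unfold kQuot; fun_prop

lemma abs_kQuot_le (α y : Plane) : |kQuot α y| ≤ 1 := by
  rw [kQuot, abs_div, abs_norm]
  refine div_le_one_of_le₀ ?_ (norm_nonneg _)
  simpa using abs_kLin_sub_le y (y - α)

lemma abs_kQuot_sub_le (α x y : Plane) : |kQuot α x - kQuot α y| ≤ 2 * ‖x - y‖ / ‖α‖ := by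
  rw [kQuot, kQuot, ← sub_div, abs_div, abs_norm]
  gcongr
  have h1 := abs_kLin_sub_le x y
  have h2 := abs_kLin_sub_le (x - α) (y - α)
  rw [sub_sub_sub_cancel_right] at h2
  rw [abs_le] at *
  constructor <;> linarith [h1.1, h1.2, h2.1, h2.2]

lemma hasFDerivAt_kQuot (α y : Plane) : HasFDerivAt (kQuot α)
    ((1 / ‖α‖) • innerSL ℝ (kGrad y - kGrad (y - α))) y := by
  have h1 : HasFDerivAt (fun y => kLin 1 (y - α)) _ y :=
    HasFDerivAt.comp (g := kLin 1) (f := fun y => y - α) y (hasFDerivAt_kLin 1 (y - α))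
      ((hasFDerivAt_id y).sub_const α)
  have h2 := ((hasFDerivAt_kLin 1 y).sub h1).mul_const (1 / ‖α‖)
  refine (h2.congr_fderiv ?_).congr_of_eventuallyEq (.of_forall fun y => ?_)
  · simp
  · simp only [kQuot, Pi.sub_apply]; rw [mul_one_div]

lemma norm_fderiv_kQuot_le (α y : Plane) :
    ‖(1 / ‖α‖) • innerSL ℝ (kGrad y - kGrad (y - α))‖ ≤ 2 / jap y := by
  have hj := jap_pos y
  rcases eq_or_ne α 0 with rfl | hα
  · simp; positivity
  have hn : 0 < ‖α‖ := norm_pos_iff.2 hα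
  rw [norm_smul, innerSL_apply_norm, Real.norm_of_nonneg (by positivity), norm_sub_rev]
  have := norm_kGrad_sub_le (y - α) y
  rw [sub_sub_cancel_left, norm_neg] at this
  calc 1 / ‖α‖ * ‖kGrad (y - α) - kGrad y‖ ≤ 1 / ‖α‖ * (2 * ‖α‖ / jap y) := by gcongr
    _ = _ := by field_simp

/-- If |x - y| ≥ ⟨y⟩/2, the bound by 2 suffices. Otherwise the bracket stays above ⟨y⟩/2 on the
whole segment, and the derivative bound applies there. The estimate is uniform in α. -/
lemma abs_kQuot_sub_le_jap (α x y : Plane) : |kQuot α x - kQuot α y| ≤ 4 * ‖x - y‖ / jap y := by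
  have hj := jap_pos y
  rcases le_or_gt (jap y / 2) ‖x - y‖ with h | h
  · calc |kQuot α x - kQuot α y| ≤ |kQuot α x| + |kQuot α y| := abs_sub _ _
      _ ≤ 1 + 1 := add_le_add (abs_kQuot_le _ _) (abs_kQuot_le _ _)
      _ ≤ _ := by rw [le_div_iff₀ hj]; linarith
  · have := Convex.norm_image_sub_le_of_norm_hasFDerivWithin_le (f := kQuot α) (C := 4 / jap y)
      (fun w (_ : w ∈ segment ℝ y x) => (hasFDerivAt_kQuot α w).hasFDerivWithinAt)
      (fun w hw => ?_) (convex_segment y x) (left_mem_segment ℝ y x) (right_mem_segment ℝ y x)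
    · rw [Real.norm_eq_abs] at this
      refine this.trans (le_of_eq (by ring))
    · refine (norm_fderiv_kQuot_le α w).trans ?_
      have h1 := norm_sub_le_of_mem_segment hw
      have h2 := abs_le.1 (abs_jap_sub_le w y)
      have h3 : jap y / 2 ≤ jap w := by linarith [h2.1]
      calc 2 / jap w ≤ 2 / (jap y / 2) := by gcongr
        _ = _ := by field_simp; norm_num

lemma abs_kQuot_sub_inner_le {α : Plane} (hα : α ≠ 0) (y z : Plane) {C : ℝ}
    (hC : ∀ w ∈ segment ℝ (y - α) y, ‖kGrad w - kGrad z‖ ≤ C) :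
    |kQuot α y - inner ℝ (kGrad z) ((1 / ‖α‖) • α)| ≤ C := by
  have hn : 0 < ‖α‖ := norm_pos_iff.2 hα
  have h := abs_kLin_sub_sub_le (x := y) (y := y - α) (z := z) hC
  rw [sub_sub_cancel] at h
  have e : kQuot α y - inner ℝ (kGrad z) ((1 / ‖α‖) • α) =
      (kLin 1 y - kLin 1 (y - α) - inner ℝ (kGrad z) α) / ‖α‖ := by
    rw [kQuot, inner_smul_right]; field_simp
  rw [e, abs_div, abs_norm, div_le_iff₀ hn]
  exact h

/-- The coefficient `(1 + (Δ_α k)²)^(-3/2) - 1` of the operator. -/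
def coef (s : ℝ) (α y : Plane) : ℝ := nl (s * kQuot α y)

/-- The derivative of `nl` vanishes at 0, so on [-|s|, |s|] it is O(|s|), and the inner factor s
contributes the second power. The factors s² in the bounds of the coefficients have this origin. -/
lemma abs_nl_mul_sub_le (s : ℝ) {x y : ℝ} (hx : |x| ≤ 1) (hy : |y| ≤ 1) :
    |nl (s * x) - nl (s * y)| ≤ 3 * s ^ 2 * |x - y| := by
  have := abs_nl_sub_le (x := s * x) (y := s * y) (m := |s|)
    (by rw [abs_mul]; exact mul_le_of_le_one_right (abs_nonneg _) hx)
    (by rw [abs_mul]; exact mul_le_of_le_one_right (abs_nonneg _) hy)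
  refine this.trans (le_of_eq ?_)
  rw [← mul_sub, abs_mul, ← sq_abs s]; ring

lemma abs_coef_le (s : ℝ) (α y : Plane) : |coef s α y| ≤ 3 * s ^ 2 := by
  refine (abs_nl_le _).trans ?_
  rw [mul_pow]
  have := sq_le_one_iff_abs_le_one _ |>.2 (abs_kQuot_le α y)
  nlinarith [sq_nonneg s]

lemma abs_coef_sub_le (s : ℝ) (α x y : Plane) :
    |coef s α x - coef s α y| ≤ 12 * s ^ 2 * ‖x - y‖ / jap y := by
  have := jap_pos y
  refine (abs_nl_mul_sub_le s (abs_kQuot_le _ _) (abs_kQuot_le _ _)).trans ?_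
  calc _ ≤ 3 * s ^ 2 * (4 * ‖x - y‖ / jap y) := by
        gcongr; exact abs_kQuot_sub_le_jap α x y
    _ = _ := by ring

lemma abs_coef_sub_le' (s : ℝ) (α x y : Plane) :
    |coef s α x - coef s α y| ≤ 6 * s ^ 2 * ‖x - y‖ / ‖α‖ := by
  refine (abs_nl_mul_sub_le s (abs_kQuot_le _ _) (abs_kQuot_le _ _)).trans ?_
  calc _ ≤ 3 * s ^ 2 * (2 * ‖x - y‖ / ‖α‖) := by
        gcongr; exact abs_kQuot_sub_le α x y
    _ = _ := by ring

/-- The limit of `coef` as `α → 0` in the direction `θ`. -/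
def coef₀ (s : ℝ) (θ y : Plane) : ℝ := nl (s * inner ℝ (kGrad y) θ)

lemma abs_inner_kGrad_le {θ : Plane} (hθ : ‖θ‖ ≤ 1) (y : Plane) : |inner ℝ (kGrad y) θ| ≤ 1 :=
  (abs_real_inner_le_norm _ _).trans (mul_le_one₀ (norm_kGrad_le y) (norm_nonneg _) hθ)

lemma abs_inner_kGrad_sub_le {θ : Plane} (hθ : ‖θ‖ ≤ 1) (x y : Plane) :
    |inner ℝ (kGrad x) θ - inner ℝ (kGrad y) θ| ≤ 2 * ‖x - y‖ / jap y := by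
  rw [← inner_sub_left]
  refine (abs_real_inner_le_norm _ _).trans ?_
  refine (mul_le_of_le_one_right (norm_nonneg _) hθ).trans (norm_kGrad_sub_le x y)

lemma abs_coef₀_le (s : ℝ) {θ : Plane} (hθ : ‖θ‖ ≤ 1) (y : Plane) :
    |coef₀ s θ y| ≤ 3 * s ^ 2 := by
  refine (abs_nl_le _).trans ?_
  rw [mul_pow]
  have := sq_le_one_iff_abs_le_one _ |>.2 (abs_inner_kGrad_le hθ y)
  nlinarith [sq_nonneg s]

lemma abs_coef₀_sub_le (s : ℝ) {θ : Plane} (hθ : ‖θ‖ ≤ 1) (x y : Plane) :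
    |coef₀ s θ x - coef₀ s θ y| ≤ 6 * s ^ 2 * ‖x - y‖ / jap y := by
  refine (abs_nl_mul_sub_le s (abs_inner_kGrad_le hθ _) (abs_inner_kGrad_le hθ _)).trans ?_
  calc _ ≤ 3 * s ^ 2 * (2 * ‖x - y‖ / jap y) := by
        gcongr; exact abs_inner_kGrad_sub_le hθ x y
    _ = _ := by ring

lemma norm_unit_le (α : Plane) : ‖(1 / ‖α‖) • α‖ ≤ 1 := by
  rw [norm_smul, Real.norm_of_nonneg (by positivity), one_div]
  exact inv_mul_le_one

lemma abs_coef_sub_coef₀_le (s : ℝ) {α : Plane} (hα : α ≠ 0) (y : Plane) :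
    |coef s α y - coef₀ s ((1 / ‖α‖) • α) y| ≤ 6 * s ^ 2 * ‖α‖ := by
  refine (abs_nl_mul_sub_le s (abs_kQuot_le _ _) (abs_inner_kGrad_le (norm_unit_le α) _)).trans ?_
  have : |kQuot α y - inner ℝ (kGrad y) ((1 / ‖α‖) • α)| ≤ 2 * ‖α‖ := by
    refine abs_kQuot_sub_inner_le hα y y fun w hw => (norm_kGrad_sub_le w y).trans ?_
    rw [segment_symm] at hw
    have h1 := norm_sub_le_of_mem_segment hw
    rw [sub_sub_cancel_left, norm_neg] at h1
    refine (div_le_self (by positivity) (one_le_jap y)).trans (by linarith)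
  calc _ ≤ 3 * s ^ 2 * (2 * ‖α‖) := by gcongr
    _ = _ := by ring

/-- As `nl` is even, the quotient for -α may be compared with minus the quotient for α. Their
first-order Taylor terms at y cancel, leaving a second-order remainder divided by |α|. -/
lemma abs_coef_sub_coef_neg_le (s : ℝ) {α : Plane} (hα : α ≠ 0) (y : Plane) :
    |coef s α y - coef s (-α) y| ≤ 12 * s ^ 2 * ‖α‖ / jap y := by
  have hn : 0 < ‖α‖ := norm_pos_iff.2 hα
  have hj := jap_pos y
  rw [coef, ← nl_neg, ← mul_neg, coef]
  refine (abs_nl_mul_sub_le s (by rw [abs_neg]; exact abs_kQuot_le _ _) (abs_kQuot_le _ _)).trans ?_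
  have h1 := abs_kLin_taylor_le (y - α) y
  have h2 := abs_kLin_taylor_le (y + α) y
  rw [sub_sub_cancel_left, norm_neg, inner_neg_right] at h1
  rw [add_sub_cancel_left] at h2
  have : |-kQuot α y - kQuot (-α) y| ≤ 4 * ‖α‖ / jap y := by
    rw [kQuot, kQuot, norm_neg, ← neg_div, ← sub_div, abs_div, abs_norm, div_le_iff₀ hn,
      sub_neg_eq_add]
    rw [abs_le] at *
    have e : 4 * ‖α‖ / jap y * ‖α‖ = 2 * (2 * ‖α‖ / jap y * ‖α‖) := by ring
    rw [e]
    constructor <;> linarith [h1.1, h1.2, h2.1, h2.2]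
  calc _ ≤ 3 * s ^ 2 * (4 * ‖α‖ / jap y) := by gcongr
    _ = _ := by ring

/-- As the profile is even, k(y - α) = k(α - y), whose argument differs from α + y by 2y only. This
bound wins for |α| > ⟨y⟩, the previous one for |α| < ⟨y⟩. -/
lemma abs_coef_sub_coef_neg_le' (s : ℝ) (α y : Plane) :
    |coef s α y - coef s (-α) y| ≤ 6 * s ^ 2 * ‖y‖ / ‖α‖ := by
  refine (abs_nl_mul_sub_le s (abs_kQuot_le _ _) (abs_kQuot_le _ _)).trans ?_
  have h1 := abs_kLin_sub_le (α + y) (α - y)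
  have : |kQuot α y - kQuot (-α) y| ≤ 2 * ‖y‖ / ‖α‖ := by
    rw [kQuot, kQuot, norm_neg, ← sub_div, abs_div, abs_norm]
    gcongr
    rw [← kLin_neg 1 (y - α), neg_sub, sub_neg_eq_add, add_comm y α]
    calc _ = |kLin 1 (α + y) - kLin 1 (α - y)| := by congr 1; ring
      _ ≤ _ := h1
      _ = ‖(2 : ℝ) • y‖ := by congr 1; rw [two_smul]; abel
      _ = _ := by simp [norm_smul]
  calc _ ≤ 3 * s ^ 2 * (2 * ‖y‖ / ‖α‖) := by gcongr
    _ = _ := by ring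

/-- The derivative of `coef` in the direction `e`. -/
def coefD (s : ℝ) (e α y : Plane) : ℝ :=
  s * nl' (s * kQuot α y) * (inner ℝ (kGrad y - kGrad (y - α)) e / ‖α‖)

lemma hasFDerivAt_coef (s : ℝ) (α y : Plane) : HasFDerivAt (coef s α)
    ((s * nl' (s * kQuot α y)) • ((1 / ‖α‖) • innerSL ℝ (kGrad y - kGrad (y - α)))) y := by
  have := (hasDerivAt_nl (s * kQuot α y)).comp_hasFDerivAt y
    ((hasFDerivAt_kQuot α y).const_mul s)
  refine this.congr_fderiv ?_
  rw [smul_smul, mul_comm]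

lemma fderiv_coef_apply (s : ℝ) (e α y : Plane) :
    fderiv ℝ (coef s α) y e = coefD s e α y := by
  rw [(hasFDerivAt_coef s α y).fderiv]
  simp only [coefD, FunLike.coe_smul, Pi.smul_apply, innerSL_apply_apply, smul_eq_mul]
  ring

lemma abs_mul_nl'_le (s : ℝ) {x : ℝ} (hx : |x| ≤ 1) : |s * nl' (s * x)| ≤ 3 * s ^ 2 := by
  rw [abs_mul]
  calc |s| * |nl' (s * x)| ≤ |s| * (3 * |s * x|) := by gcongr; exact abs_nl'_le _
    _ = 3 * |s| ^ 2 * |x| := by rw [abs_mul]; ring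
    _ ≤ 3 * |s| ^ 2 * 1 := by gcongr
    _ = _ := by rw [sq_abs]; ring

lemma abs_mul_nl'_sub_le (s x y : ℝ) :
    |s * nl' (s * x) - s * nl' (s * y)| ≤ 18 * s ^ 2 * |x - y| := by
  rw [← mul_sub, abs_mul]
  calc |s| * |nl' (s * x) - nl' (s * y)| ≤ |s| * (18 * |s * x - s * y|) := by
        gcongr; exact abs_nl'_sub_le _ _
    _ = _ := by rw [← mul_sub, abs_mul, ← sq_abs s]; ring

/-- A product of a bounded Lipschitz coefficient with another one. -/
lemma abs_mul_sub_mul_le {a a' b b' A B : ℝ} {δa δb : ℝ} (ha : |a| ≤ A) (hb : |b'| ≤ B)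
    (h1 : |a - a'| ≤ δa) (h2 : |b - b'| ≤ δb) (hA : 0 ≤ A) (hδ : 0 ≤ δa) :
    |a * b - a' * b'| ≤ A * δb + δa * B := by
  have e : a * b - a' * b' = a * (b - b') + (a - a') * b' := by ring
  rw [e]
  refine (abs_add_le _ _).trans ?_
  rw [abs_mul, abs_mul]
  gcongr

lemma abs_inner_kGrad_diff_le {e : Plane} (he : ‖e‖ ≤ 1) (α y : Plane) :
    |inner ℝ (kGrad y - kGrad (y - α)) e / ‖α‖| ≤ 2 * min 1 (1 / ‖α‖) := by
  rcases eq_or_ne α 0 with rfl | hα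
  · simp
  have hn : 0 < ‖α‖ := norm_pos_iff.2 hα
  have h1 : |inner ℝ (kGrad y - kGrad (y - α)) e| ≤ ‖kGrad y - kGrad (y - α)‖ :=
    (abs_real_inner_le_norm _ _).trans (mul_le_of_le_one_right (norm_nonneg _) he)
  have h2 : ‖kGrad y - kGrad (y - α)‖ ≤ 2 :=
    (norm_sub_le _ _).trans (by linarith [norm_kGrad_le y, norm_kGrad_le (y - α)])
  have h3 : ‖kGrad y - kGrad (y - α)‖ ≤ 2 * ‖α‖ := by
    have h := norm_kGrad_sub_le y (y - α)
    rw [sub_sub_cancel] at h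
    exact h.trans (div_le_self (by positivity) (one_le_jap _))
  rw [abs_div, abs_norm, mul_min_of_nonneg _ _ (by norm_num)]
  refine le_min ?_ ?_
  · rw [div_le_iff₀ hn]; linarith
  · rw [div_le_iff₀ hn]; field_simp; linarith

lemma abs_coefD_le (s : ℝ) {e : Plane} (he : ‖e‖ ≤ 1) (α y : Plane) :
    |coefD s e α y| ≤ 6 * s ^ 2 * min 1 (1 / ‖α‖) := by
  rw [coefD, abs_mul]
  calc _ ≤ 3 * s ^ 2 * (2 * min 1 (1 / ‖α‖)) := by
        gcongr
        · exact abs_mul_nl'_le s (abs_kQuot_le _ _)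
        · exact abs_inner_kGrad_diff_le he α y
    _ = _ := by ring

/-- The gradient of the profile is evaluated at y and at y - α, so decay is available relative to
two centres, 0 and α. This is the reason for the second centre z in `SlowCoeff`. -/
lemma abs_coefD_sub_le (s : ℝ) {e : Plane} (he : ‖e‖ ≤ 1) (α x y : Plane) :
    |coefD s e α x - coefD s e α y| ≤
      150 * s ^ 2 / ‖α‖ * ‖x - y‖ * (1 / jap y + 1 / jap (y - α)) := by
  have hj := jap_pos y
  have hj' := jap_pos (y - α)
  have h1 : |inner ℝ (kGrad x - kGrad (x - α)) e / ‖α‖ -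
      inner ℝ (kGrad y - kGrad (y - α)) e / ‖α‖| ≤
      (2 * ‖x - y‖ / jap y + 2 * ‖x - y‖ / jap (y - α)) / ‖α‖ := by
    rw [← sub_div, abs_div, abs_norm]
    gcongr
    have h2 := abs_inner_kGrad_sub_le he x y
    have h3 := abs_inner_kGrad_sub_le he (x - α) (y - α)
    rw [sub_sub_sub_cancel_right] at h3
    rw [inner_sub_left, inner_sub_left]
    rw [abs_le] at *
    constructor <;> linarith [h2.1, h2.2, h3.1, h3.2]
  refine (abs_mul_sub_mul_le (abs_mul_nl'_le s (abs_kQuot_le α x))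
    ((abs_inner_kGrad_diff_le he α y).trans (mul_le_mul_of_nonneg_left (min_le_right _ _)
      (by norm_num))) ((abs_mul_nl'_sub_le s _ _).trans (mul_le_mul_of_nonneg_left
      (abs_kQuot_sub_le_jap α x y) (by positivity))) h1 (by positivity) (by positivity)).trans ?_
  have e1 : 3 * s ^ 2 * ((2 * ‖x - y‖ / jap y + 2 * ‖x - y‖ / jap (y - α)) / ‖α‖) +
      18 * s ^ 2 * (4 * ‖x - y‖ / jap y) * (2 * (1 / ‖α‖)) =
      s ^ 2 / ‖α‖ * ‖x - y‖ * (150 * (1 / jap y) + 6 * (1 / jap (y - α))) := by ring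
  rw [e1]
  have e2 : 150 * s ^ 2 / ‖α‖ * ‖x - y‖ * (1 / jap y + 1 / jap (y - α)) =
      s ^ 2 / ‖α‖ * ‖x - y‖ * (150 * (1 / jap y) + 150 * (1 / jap (y - α))) := by ring
  rw [e2]
  gcongr
  norm_num

/-- The radial derivative `r ∂_r` of `coef` with respect to `α`. -/
def coefR (s : ℝ) (α y : Plane) : ℝ :=
  s * nl' (s * kQuot α y) * (inner ℝ (kGrad (y - α)) ((1 / ‖α‖) • α) - kQuot α y)

lemma abs_coefR_le (s : ℝ) (α y : Plane) : |coefR s α y| ≤ 6 * s ^ 2 := by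
  rw [coefR, abs_mul]
  have h1 := abs_inner_kGrad_le (norm_unit_le α) (y - α)
  have h2 := abs_kQuot_le α y
  calc _ ≤ 3 * s ^ 2 * 2 := by
        gcongr
        · exact abs_mul_nl'_le s (abs_kQuot_le _ _)
        · exact (abs_sub _ _).trans (by linarith)
    _ = _ := by ring

lemma abs_coefR_sub_le (s : ℝ) (α x y : Plane) :
    |coefR s α x - coefR s α y| ≤
      160 * s ^ 2 * ‖x - y‖ * (1 / jap y + 1 / jap (y - α)) := by
  have hj := jap_pos y
  have hj' := jap_pos (y - α)
  have h1 : |inner ℝ (kGrad (x - α)) ((1 / ‖α‖) • α) - kQuot α x -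
      (inner ℝ (kGrad (y - α)) ((1 / ‖α‖) • α) - kQuot α y)| ≤
      2 * ‖x - y‖ / jap (y - α) + 4 * ‖x - y‖ / jap y := by
    have h2 := abs_kQuot_sub_le_jap α x y
    have h3 := abs_inner_kGrad_sub_le (norm_unit_le α) (x - α) (y - α)
    rw [sub_sub_sub_cancel_right] at h3
    rw [abs_le] at *
    constructor <;> linarith [h2.1, h2.2, h3.1, h3.2]
  have h4 : |inner ℝ (kGrad (y - α)) ((1 / ‖α‖) • α) - kQuot α y| ≤ 2 :=
    (abs_sub _ _).trans (by
      linarith [abs_inner_kGrad_le (norm_unit_le α) (y - α), abs_kQuot_le α y])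
  refine (abs_mul_sub_mul_le (abs_mul_nl'_le s (abs_kQuot_le α x)) h4
    ((abs_mul_nl'_sub_le s _ _).trans (mul_le_mul_of_nonneg_left
      (abs_kQuot_sub_le_jap α x y) (by positivity))) h1 (by positivity) (by positivity)).trans ?_
  have e1 : 3 * s ^ 2 * (2 * ‖x - y‖ / jap (y - α) + 4 * ‖x - y‖ / jap y) +
      18 * s ^ 2 * (4 * ‖x - y‖ / jap y) * 2 =
      s ^ 2 * ‖x - y‖ * (156 * (1 / jap y) + 6 * (1 / jap (y - α))) := by ring
  rw [e1]
  have e2 : 160 * s ^ 2 * ‖x - y‖ * (1 / jap y + 1 / jap (y - α)) =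
      s ^ 2 * ‖x - y‖ * (160 * (1 / jap y) + 160 * (1 / jap (y - α))) := by ring
  rw [e2]
  gcongr <;> norm_num

lemma one_div_jap_le {y : Plane} (hy : y ≠ 0) : 1 / jap y ≤ ‖y‖ ^ (-(1 / 2) : ℝ) := by
  have hn : 0 < ‖y‖ := norm_pos_iff.2 hy
  have hj := jap_pos y
  rw [Real.rpow_neg hn.le, one_div]
  refine inv_anti₀ (by positivity) ?_
  rw [← Real.sqrt_eq_rpow, Real.sqrt_le_left hj.le]
  nlinarith [norm_le_jap y, one_le_jap y]

lemma SlowCoeff.of_jap {a : ℝ} {b : Plane → ℝ} {A B M : ℝ} {z : Plane} (hb : Measurable b)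
    (hA : ∀ y, |b y| ≤ A) (hB : 0 ≤ B)
    (hL : ∀ x y, |b x - b y| ≤ B * ‖x - y‖ * (1 / jap y + 1 / jap (y - z)))
    (hAM : A ≤ M) (hABM : A ^ (1 - a) * B ^ a ≤ M) : SlowCoeff a b M := by
  refine ⟨hb, A, B, z, hA, hB, fun x y hy hyz => (hL x y).trans ?_, hAM, hABM⟩
  gcongr
  · exact one_div_jap_le hy
  · exact one_div_jap_le (sub_ne_zero.2 hyz)

lemma SlowCoeff.of_jap' {a : ℝ} {b : Plane → ℝ} {A B M : ℝ} (hb : Measurable b)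
    (hA : ∀ y, |b y| ≤ A) (hB : 0 ≤ B) (hL : ∀ x y, |b x - b y| ≤ B * ‖x - y‖ / jap y)
    (hAM : A ≤ M) (hABM : A ^ (1 - a) * B ^ a ≤ M) : SlowCoeff a b M := by
  refine .of_jap (z := 0) hb hA hB (fun x y => (hL x y).trans ?_) hAM hABM
  have := jap_pos y
  rw [sub_zero, mul_add, mul_one_div]
  exact le_add_of_nonneg_right (by positivity)

/-- Interpolation of two bounds. -/
lemma rpow_mul_rpow_le {a A B M : ℝ} (ha : 0 < a) (ha1 : a < 1) (hA : 0 ≤ A) (hB : 0 ≤ B)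
    (hAM : A ≤ M) (hBM : B ≤ M) : A ^ (1 - a) * B ^ a ≤ M := by
  have hM : 0 ≤ M := hA.trans hAM
  calc A ^ (1 - a) * B ^ a ≤ M ^ (1 - a) * M ^ a := by
        gcongr
    _ = M := by
        rw [← Real.rpow_add_of_nonneg hM (by linarith) ha.le]; simp


/-! ### Integrals over balls and annuli -/

lemma lintegral_norm_rpow_ball {a R : ℝ} (ha : -2 < a) (hR : 0 ≤ R) :
    ∫⁻ α in Metric.ball (0 : Plane) R, ENNReal.ofReal (‖α‖ ^ a) ≤
      ENNReal.ofReal (2 * Real.pi * (R ^ (a + 2) / (a + 2))) := by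
  have e : ∫⁻ α in Metric.ball (0 : Plane) R, ENNReal.ofReal (‖α‖ ^ a) =
      ∫⁻ α : Plane, (Set.Iio R).indicator (fun r => ENNReal.ofReal (r ^ a)) ‖α‖ := by
    rw [← lintegral_indicator Metric.isOpen_ball.measurableSet]
    refine lintegral_congr fun α => ?_
    simp [Set.indicator]
  rw [e, lintegral_radial (Measurable.indicator (by fun_prop) measurableSet_Iio),
    ENNReal.ofReal_mul (p := 2 * Real.pi) (by positivity)]
  refine mul_le_mul_right ?_ _
  rw [show a + 2 = (a + 1) + 1 by ring, ← lintegral_rpow_Ioc (by linarith) hR,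
    ← lintegral_indicator measurableSet_Ioi, ← lintegral_indicator measurableSet_Ioc]
  refine lintegral_mono fun r => ?_
  by_cases hr : 0 < r
  · by_cases hrR : r < R
    · simp only [Set.indicator, Set.mem_Ioi, hr, Set.mem_Iio, hrR, Set.mem_Ioc, hrR.le, if_true,
        and_self]
      rw [← ENNReal.ofReal_mul hr.le, Real.rpow_add hr, Real.rpow_one, mul_comm]
    · simp [Set.indicator, hrR]
  · simp [Set.indicator, hr]

lemma lintegral_norm_rpow_compl {a : ℝ} (ha : a < -2) :
    ∫⁻ α in (Metric.ball (0 : Plane) 1)ᶜ, ENNReal.ofReal (‖α‖ ^ a) =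
      ENNReal.ofReal (2 * Real.pi * (1 / (-(a + 2)))) := by
  have e : ∫⁻ α in (Metric.ball (0 : Plane) 1)ᶜ, ENNReal.ofReal (‖α‖ ^ a) =
      ∫⁻ α : Plane, (Set.Ici 1).indicator (fun r => ENNReal.ofReal (r ^ a)) ‖α‖ := by
    rw [← lintegral_indicator Metric.isOpen_ball.measurableSet.compl]
    refine lintegral_congr fun α => ?_
    simp [Set.indicator]
  rw [e, lintegral_radial (Measurable.indicator (by fun_prop) measurableSet_Ici),
    ENNReal.ofReal_mul (p := 2 * Real.pi) (by positivity)]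
  congr 1
  have h := lintegral_rpow_Ioi (p := a + 1) (c := 1) (by linarith) one_pos
  rw [Real.one_rpow, show a + 1 + 1 = a + 2 by ring] at h
  rw [← h, ← setLIntegral_congr (Ioi_ae_eq_Ici (a := (1 : ℝ))).symm,
    ← lintegral_indicator measurableSet_Ioi, ← lintegral_indicator measurableSet_Ici]
  refine lintegral_congr fun r => ?_
  by_cases hr1 : 1 ≤ r
  · have hr : 0 < r := by linarith
    simp only [Set.indicator, Set.mem_Ioi, hr, Set.mem_Ici, hr1, if_true]
    rw [← ENNReal.ofReal_mul hr.le, Real.rpow_add hr, Real.rpow_one, mul_comm]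
  · simp [Set.indicator, hr1]

lemma integrableOn_norm_rpow_ball {a : ℝ} (ha : -2 < a) (R : ℝ) :
    IntegrableOn (fun α : Plane => ‖α‖ ^ a) (Metric.ball 0 R) := by
  refine ⟨(measurable_norm.pow_const a).aestronglyMeasurable, ?_⟩
  rcases le_or_gt R 0 with hR | hR
  · simp [Metric.ball_eq_empty.2 hR]
  rw [hasFiniteIntegral_iff_ofReal (.of_forall fun α => by positivity)]
  exact (lintegral_norm_rpow_ball ha hR.le).trans_lt ENNReal.ofReal_lt_top

lemma integrableOn_norm_rpow_compl {a : ℝ} (ha : a < -2) :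
    IntegrableOn (fun α : Plane => ‖α‖ ^ a) (Metric.ball 0 1)ᶜ := by
  refine ⟨(measurable_norm.pow_const a).aestronglyMeasurable, ?_⟩
  rw [hasFiniteIntegral_iff_ofReal (.of_forall fun α => by positivity),
    lintegral_norm_rpow_compl ha]
  exact ENNReal.ofReal_lt_top

/-- The annulus `1 ≤ |α| < R`. -/
def ann (R : ℝ) : Set Plane := Metric.ball 0 R \ Metric.ball 0 1

lemma mem_ann {R : ℝ} {α : Plane} : α ∈ ann R ↔ 1 ≤ ‖α‖ ∧ ‖α‖ < R := by
  simp [ann, and_comm]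

lemma measurableSet_ann (R : ℝ) : MeasurableSet (ann R) :=
  Metric.isOpen_ball.measurableSet.diff Metric.isOpen_ball.measurableSet

lemma ann_subset (R : ℝ) : ann R ⊆ (Metric.ball 0 1)ᶜ := fun _ h => h.2

lemma integral_ball_eq_add {R : ℝ} (hR : 1 ≤ R) {F : Plane → ℝ}
    (hF : IntegrableOn F (Metric.ball 0 R)) :
    ∫ α in Metric.ball 0 R, F α = (∫ α in Metric.ball 0 1, F α) + ∫ α in ann R, F α := by
  rw [ann, ← setIntegral_union Set.disjoint_sdiff_right
    (Metric.isOpen_ball.measurableSet.diff Metric.isOpen_ball.measurableSet)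
    (hF.mono_set (Metric.ball_subset_ball hR)) (hF.mono_set Set.sdiff_subset),
    Set.union_sdiff_cancel (Metric.ball_subset_ball hR)]

lemma integrableOn_compl_of_le {a K : ℝ} (ha : a < -2) {F : Plane → ℝ} (hF : Measurable F)
    (hK : ∀ α, 1 ≤ ‖α‖ → |F α| ≤ K * ‖α‖ ^ a) : IntegrableOn F (Metric.ball 0 1)ᶜ := by
  refine ((integrableOn_norm_rpow_compl ha).const_mul K).mono' hF.aestronglyMeasurable ?_
  filter_upwards [ae_restrict_mem Metric.isOpen_ball.measurableSet.compl] with α hα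
  exact hK α (by simpa using hα)

lemma tendsto_integral_ann {a K : ℝ} (ha : a < -2) {F : Plane → ℝ} (hF : Measurable F)
    (hK : ∀ α, 1 ≤ ‖α‖ → |F α| ≤ K * ‖α‖ ^ a) :
    Tendsto (fun R => ∫ α in ann R, F α) atTop (𝓝 (∫ α in (Metric.ball 0 1)ᶜ, F α)) := by
  have h := (aecover_ball (μ := (volume : Measure Plane).restrict (Metric.ball 0 1)ᶜ) (x := 0)
    (tendsto_id (α := ℝ) (x := atTop))).integral_tendsto_of_countably_generated
    (integrableOn_compl_of_le ha hF hK)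
  refine h.congr fun R => ?_
  rw [Measure.restrict_restrict Metric.isOpen_ball.measurableSet, ann, Set.sdiff_eq]
  rfl

lemma abs_integral_ann_le {a K : ℝ} (ha : a < -2) (hK0 : 0 ≤ K) {F : Plane → ℝ}
    (hK : ∀ α, 1 ≤ ‖α‖ → |F α| ≤ K * ‖α‖ ^ a) (R : ℝ) :
    |∫ α in ann R, F α| ≤ K * ∫ α in (Metric.ball (0 : Plane) 1)ᶜ, ‖α‖ ^ a := by
  have hi : IntegrableOn (fun α : Plane => K * ‖α‖ ^ a) (Metric.ball 0 1)ᶜ :=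
    (integrableOn_norm_rpow_compl ha).const_mul K
  rw [← integral_const_mul]
  refine (norm_integral_le_of_norm_le (f := F) (hi.mono_set (ann_subset R)) ?_).trans
    (setIntegral_mono_set hi (.of_forall fun α => by positivity) (ann_subset R).eventuallyLE)
  filter_upwards [ae_restrict_mem (measurableSet_ann R)] with α hα
  exact hK α (mem_ann.1 hα).1

/-! ### The kernel -/

@[fun_prop] lemma measurable_coef_comp {X : Type*} [MeasurableSpace X] (s : ℝ) {f g : X → Plane}
    (hf : Measurable f) (hg : Measurable g) : Measurable fun x => coef s (f x) (g x) := by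
  have h1 := measurable_kQuot.comp (hf.prodMk hg)
  simp only [Function.comp_def] at h1
  unfold coef
  fun_prop

@[fun_prop] lemma measurable_coefR_comp {X : Type*} [MeasurableSpace X] (s : ℝ) {f g : X → Plane}
    (hf : Measurable f) (hg : Measurable g) : Measurable fun x => coefR s (f x) (g x) := by
  have h1 := measurable_kQuot.comp (hf.prodMk hg)
  have h2 := continuous_kGrad.measurable
  have h3 := continuous_nl'.measurable
  simp only [Function.comp_def] at h1
  unfold coefR
  fun_prop

@[fun_prop] lemma measurable_coefD_comp {X : Type*} [MeasurableSpace X] (s : ℝ) (e : Plane)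
    {f g : X → Plane}
    (hf : Measurable f) (hg : Measurable g) : Measurable fun x => coefD s e (f x) (g x) := by
  have h1 := measurable_kQuot.comp (hf.prodMk hg)
  have h2 := continuous_kGrad.measurable
  have h3 := continuous_nl'.measurable
  simp only [Function.comp_def] at h1
  unfold coefD
  fun_prop

@[fun_prop] lemma measurable_coef₀_comp {X : Type*} [MeasurableSpace X] (s : ℝ)
    {f g : X → Plane}
    (hf : Measurable f) (hg : Measurable g) : Measurable fun x => coef₀ s (f x) (g x) := by
  have h2 := continuous_kGrad.measurable
  unfold coef₀
  fun_prop

/-- Only differences of the gradient of f enter, so affine functions do not contribute to the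
operator. -/
lemma kernel_eq {f : Plane → ℝ} (hf : Differentiable ℝ f) (s : ℝ) (y α : Plane) :
    kernel f (kLin s) y α = 1 / (2 * Real.pi) *
      ((fderiv ℝ f y α - fderiv ℝ f (y - α) α) * coef s α y / ‖α‖ ^ 3) := by
  have h1 : HasFDerivAt (fun y => f (y - α)) (fderiv ℝ f (y - α)) y :=
    HasFDerivAt.comp (g := f) (f := fun y => y - α) y (hf (y - α)).hasFDerivAt
      ((hasFDerivAt_id y).sub_const α)
  have h2 := ((hf y).hasFDerivAt.sub h1).mul_const (1 / ‖α‖)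
  have h3 : HasFDerivAt (diffQuot α f)
      ((1 / ‖α‖) • (fderiv ℝ f y - fderiv ℝ f (y - α))) y := by
    refine h2.congr_of_eventuallyEq (.of_forall fun y => ?_)
    simp only [diffQuot, Pi.sub_apply]; rw [mul_one_div]
  have hc : (1 + (s * kQuot α y) ^ 2) ^ (-(3 / 2) : ℝ) - 1 = coef s α y := rfl
  rw [kernel, h3.fderiv, diffQuot_kLin, hc]
  simp only [FunLike.coe_smul, Pi.smul_apply, smul_eq_mul, sub_apply]
  ring

/-- A continuously differentiable function whose gradient is Hölder continuous of order `b` with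
constant `L`. -/
structure HolderGrad (b L : ℝ) (f : Plane → ℝ) : Prop where
  contDiff : ContDiff ℝ 1 f
  nonneg : 0 ≤ L
  le : ∀ x y, ‖fderiv ℝ f x - fderiv ℝ f y‖ ≤ L * ‖x - y‖ ^ b

lemma measurable_kernel {f : Plane → ℝ} (hf : ContDiff ℝ 1 f) (s : ℝ) :
    Measurable fun p : Plane × Plane => kernel f (kLin s) p.1 p.2 := by
  simp only [kernel_eq (hf.differentiable one_ne_zero)]
  have h : Continuous fun p : Plane × Plane => fderiv ℝ f p.1 p.2 :=
    hf.continuous_fderiv_apply one_ne_zero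
  have h1 : Measurable fun p : Plane × Plane => fderiv ℝ f p.1 p.2 := h.measurable
  have h2 : Measurable fun p : Plane × Plane => fderiv ℝ f (p.1 - p.2) p.2 :=
    h1.comp (by fun_prop : Measurable fun p : Plane × Plane => (p.1 - p.2, p.2))
  fun_prop

lemma norm_pow_mul_rpow {α : Plane} (hα : α ≠ 0) (b : ℝ) (n m : ℕ) :
    ‖α‖ ^ b * ‖α‖ ^ n / ‖α‖ ^ m = ‖α‖ ^ (b + n - m) := by
  have hn : 0 < ‖α‖ := norm_pos_iff.2 hα
  rw [Real.rpow_sub_natCast hn.ne', Real.rpow_add_natCast hn.ne']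

/-- For b > 0 this power is integrable near the origin of the plane, but never at infinity: there
cancellation between different y is needed. -/
lemma HolderGrad.abs_kernel_le {b L : ℝ} {f : Plane → ℝ} (hf : HolderGrad b L f) (s : ℝ)
    (y α : Plane) : |kernel f (kLin s) y α| ≤ s ^ 2 * L * ‖α‖ ^ (b - 2) := by
  have hL := hf.nonneg
  rw [kernel_eq (hf.contDiff.differentiable one_ne_zero)]
  rcases eq_or_ne α 0 with rfl | hα
  · simp; positivity
  have hn : 0 < ‖α‖ := norm_pos_iff.2 hα
  have h1 : |fderiv ℝ f y α - fderiv ℝ f (y - α) α| ≤ L * ‖α‖ ^ b * ‖α‖ := by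
    have := hf.le y (y - α)
    rw [sub_sub_cancel] at this
    exact ((fderiv ℝ f y - fderiv ℝ f (y - α)).le_opNorm α).trans (by gcongr)
  have hp : 1 / (2 * Real.pi) ≤ 1 / 3 :=
    one_div_le_one_div_of_le (by norm_num) (by linarith [Real.pi_gt_three])
  rw [abs_mul, abs_of_pos (a := 1 / (2 * Real.pi)) (by positivity), abs_div, abs_mul,
    abs_of_pos (a := ‖α‖ ^ 3) (by positivity)]
  calc _ ≤ 1 / 3 * ((L * ‖α‖ ^ b * ‖α‖) * (3 * s ^ 2) / ‖α‖ ^ 3) := by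
        gcongr
        exact abs_coef_le s α y
    _ = s ^ 2 * L * (‖α‖ ^ b * ‖α‖ ^ 1 / ‖α‖ ^ 3) := by ring
    _ = _ := by rw [norm_pow_mul_rpow hα]; norm_num; left; ring_nf

lemma HolderGrad.integrableOn_kernel {b L : ℝ} {f : Plane → ℝ} (hf : HolderGrad b L f)
    (hb : 0 < b) (s : ℝ) (y : Plane) (R : ℝ) :
    IntegrableOn (kernel f (kLin s) y) (Metric.ball 0 R) := by
  refine ((integrableOn_norm_rpow_ball (a := b - 2) (by linarith) R).const_mul
    (s ^ 2 * L)).mono' ?_ (.of_forall fun α => hf.abs_kernel_le s y α)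
  exact ((measurable_kernel hf.contDiff s).comp measurable_prodMk_left).aestronglyMeasurable


/-! ### Radial integration by parts -/

lemma norm_smul_sphere {r : ℝ} (hr : 0 ≤ r) (θ : Metric.sphere (0 : Plane) 1) :
    ‖r • (θ : Plane)‖ = r := by simp [norm_smul, abs_of_nonneg hr]

lemma hasDerivAt_kQuot_smul (θ : Metric.sphere (0 : Plane) 1) (y : Plane) {r : ℝ} (hr : 0 < r) :
    HasDerivAt (fun r : ℝ => kQuot (r • (θ : Plane)) y)
      ((inner ℝ (kGrad (y - r • (θ : Plane))) (θ : Plane) - kQuot (r • (θ : Plane)) y) / r) r := by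
  have h0 : HasDerivAt (fun r : ℝ => y - r • (θ : Plane)) (-(θ : Plane)) r := by
    simpa using ((hasDerivAt_id r).smul_const (θ : Plane)).const_sub y
  have h1 : HasDerivAt (fun r : ℝ => kLin 1 (y - r • (θ : Plane))) _ r :=
    HasFDerivAt.comp_hasDerivAt (l := kLin 1) (f := fun r : ℝ => y - r • (θ : Plane)) r
      (hasFDerivAt_kLin 1 (y - r • (θ : Plane))) h0
  have h2 := (h1.const_sub (kLin 1 y)).div (hasDerivAt_id r) hr.ne'
  refine (h2.congr_of_eventuallyEq ?_).congr_deriv ?_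
  · filter_upwards [lt_mem_nhds hr] with t ht
    simp only [kQuot, norm_smul_sphere ht.le, id, Pi.div_apply]
  simp only [kQuot, norm_smul_sphere hr.le, id, FunLike.coe_smul, Pi.smul_apply,
    innerSL_apply_apply, inner_neg_right, smul_eq_mul]
  field_simp

lemma hasDerivAt_coef_smul (s : ℝ) (θ : Metric.sphere (0 : Plane) 1) (y : Plane) {r : ℝ}
    (hr : 0 < r) :
    HasDerivAt (fun r : ℝ => coef s (r • (θ : Plane)) y) (coefR s (r • (θ : Plane)) y / r) r := by
  have h := (hasDerivAt_nl (s * kQuot (r • (θ : Plane)) y)).comp r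
    ((hasDerivAt_kQuot_smul θ y hr).const_mul s)
  refine h.congr_deriv ?_
  rw [coefR, norm_smul_sphere hr.le, smul_smul, one_div_mul_cancel hr.ne', one_smul]
  ring

lemma volume_ann_lt_top (R : ℝ) : volume (ann R) < ∞ :=
  (measure_mono Set.sdiff_subset).trans_lt measure_ball_lt_top

lemma integrableOn_ann {R C : ℝ} {F : Plane → ℝ} (hF : Measurable F)
    (hC : ∀ α ∈ ann R, |F α| ≤ C) : IntegrableOn F (ann R) :=
  Measure.integrableOn_of_bounded (volume_ann_lt_top R).ne hF.aestronglyMeasurable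
    ((ae_restrict_mem (measurableSet_ann R)).mono hC)

lemma exists_abs_le_ball {u : Plane → ℝ} (hu : Continuous u) (R : ℝ) :
    ∃ C, 0 ≤ C ∧ ∀ α, ‖α‖ ≤ R → |u α| ≤ C := by
  obtain ⟨C, hC⟩ := (isCompact_closedBall (0 : Plane) R).exists_bound_of_continuousOn
    hu.continuousOn
  exact ⟨|C|, abs_nonneg C, fun α hα => (hC α (by simpa using hα)).trans (le_abs_self C)⟩

lemma integrableOn_ann_fderiv_mul {u : Plane → ℝ} (hu : ContDiff ℝ 1 u) (s R : ℝ) (y : Plane) :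
    IntegrableOn (fun α => fderiv ℝ u (-α) α * coef s α y / ‖α‖ ^ 3) (ann R) := by
  have h : Continuous fun α : Plane => fderiv ℝ u (-α) α :=
    (hu.continuous_fderiv_apply one_ne_zero).comp
      (by fun_prop : Continuous fun α : Plane => (-α, α))
  obtain ⟨C, hC0, hC⟩ := exists_abs_le_ball h R
  have hm := h.measurable
  refine integrableOn_ann (C := C * (3 * s ^ 2)) (by fun_prop) fun α hα => ?_
  obtain ⟨h1, h2⟩ := mem_ann.1 hα
  rw [abs_div, abs_mul, abs_of_nonneg (a := ‖α‖ ^ 3) (by positivity)]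
  refine (div_le_self (by positivity) (one_le_pow₀ h1)).trans ?_
  gcongr
  · exact hC α h2.le
  · exact abs_coef_le s α y

lemma integrableOn_ann_mul_coefR {u : Plane → ℝ} (hu : Continuous u) (s R : ℝ) (y : Plane) :
    IntegrableOn (fun α => u (-α) * (coefR s α y - coef s α y) / ‖α‖ ^ 3) (ann R) := by
  obtain ⟨C, hC0, hC⟩ := exists_abs_le_ball hu R
  have hm := hu.measurable
  refine integrableOn_ann (C := C * (6 * s ^ 2 + 3 * s ^ 2)) (by fun_prop) fun α hα => ?_
  obtain ⟨h1, h2⟩ := mem_ann.1 hα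
  rw [abs_div, abs_mul, abs_of_nonneg (a := ‖α‖ ^ 3) (by positivity)]
  refine (div_le_self (by positivity) (one_le_pow₀ h1)).trans ?_
  gcongr
  · exact hC (-α) (by rw [norm_neg]; exact h2.le)
  · exact (abs_sub _ _).trans (add_le_add (abs_coefR_le s α y) (abs_coef_le s α y))

/-- Along a ray, ∇u(-α)·α is minus r∂_r of u(-α). Integrating by parts in r replaces the gradient of
u by u itself, at the cost of boundary terms on the circles of radius 1 and R and of r∂_r of the
coefficient, which is the bounded function `coefR`. -/
lemma integral_ann_fderiv_mul {u : Plane → ℝ} (hu : ContDiff ℝ 1 u) (s : ℝ) {R : ℝ} (hR : 1 ≤ R)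
    (y : Plane) :
    ∫ α in ann R, fderiv ℝ u (-α) α * coef s α y / ‖α‖ ^ 3 =
      (∫ θ : Metric.sphere (0 : Plane) 1, (u (-θ) * coef s θ y -
        u (-(R • (θ : Plane))) * coef s (R • (θ : Plane)) y / R) ∂arc) +
      ∫ α in ann R, u (-α) * (coefR s α y - coef s α y) / ‖α‖ ^ 3 := by
  have h1 := integrableOn_ann_fderiv_mul hu s R y
  have h2 := integrableOn_ann_mul_coefR hu.continuous s R y
  rw [← sub_eq_iff_eq_add, ← integral_sub h1 h2]
  have h3 : IntegrableOn (fun α => fderiv ℝ u (-α) α * coef s α y / ‖α‖ ^ 3 -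
      u (-α) * (coefR s α y - coef s α y) / ‖α‖ ^ 3) (ann R) := h1.sub h2
  rw [← integrable_indicator_iff (measurableSet_ann R)] at h3
  rw [← integral_indicator (measurableSet_ann R)]
  have hp := integrable_polar h3
  refine (integral_polar h3).trans (integral_congr_ae ?_)
  filter_upwards [hp.prod_right_ae] with θ hθ
  -- The antiderivative along the ray; the polar density r turns |α|^(-3) into r^(-2), which is
  -- matched by differentiating 1/r.
  set w : ℝ → ℝ := fun r => -(u (-(r • (θ : Plane))) * coef s (r • (θ : Plane)) y / r) with hw
  set w' : ℝ → ℝ := fun r => r • (fderiv ℝ u (-(r • (θ : Plane))) (r • (θ : Plane)) *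
    coef s (r • (θ : Plane)) y / ‖r • (θ : Plane)‖ ^ 3 - u (-(r • (θ : Plane))) *
    (coefR s (r • (θ : Plane)) y - coef s (r • (θ : Plane)) y) / ‖r • (θ : Plane)‖ ^ 3) with hw'
  have hd : ∀ r ∈ Set.uIcc 1 R, HasDerivAt w (w' r) r := by
    intro r hr
    rw [Set.uIcc_of_le hR] at hr
    have hr0 : 0 < r := one_pos.trans_le hr.1
    have h0 : HasDerivAt (fun r : ℝ => -(r • (θ : Plane))) (-(θ : Plane)) r := by
      simpa using ((hasDerivAt_id r).smul_const (θ : Plane)).fun_neg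
    have hu1 : HasDerivAt (fun r : ℝ => u (-(r • (θ : Plane)))) _ r :=
      HasFDerivAt.comp_hasDerivAt (l := u) (f := fun r : ℝ => -(r • (θ : Plane))) r
      (hu.differentiable one_ne_zero _).hasFDerivAt h0
    refine (((hu1.fun_mul (hasDerivAt_coef_smul s θ y hr0)).fun_div (hasDerivAt_id r) hr0.ne').fun_neg
      ).congr_deriv ?_
    simp only [hw', norm_smul_sphere hr0.le, id, map_neg, map_smul, smul_eq_mul]
    field_simp
    ring
  have e1 : ∀ r : ℝ, 0 < r → r • (ann R).indicator (fun α => fderiv ℝ u (-α) α * coef s α y /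
      ‖α‖ ^ 3 - u (-α) * (coefR s α y - coef s α y) / ‖α‖ ^ 3) (r • (θ : Plane)) =
      (Set.Ico 1 R).indicator w' r := by
    intro r hr
    simp only [Set.indicator, mem_ann, norm_smul_sphere hr.le, Set.mem_Ico, hw']
    split_ifs <;> simp
  have hint : IntegrableOn w' (Set.Ico 1 R) := by
    rw [← integrable_indicator_iff measurableSet_Ico]
    have : IntegrableOn ((Set.Ico 1 R).indicator w') (Set.Ioi 0) := by
      refine Integrable.congr hθ ?_
      filter_upwards [ae_restrict_mem measurableSet_Ioi] with r hr
      exact e1 r hr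
    refine (integrableOn_iff_integrable_of_support_subset fun r hr => ?_).1 this
    have : r ∈ Set.Ico 1 R := by
      by_contra h
      exact hr (Set.indicator_of_notMem h _)
    exact one_pos.trans_le this.1
  have hsub : Set.Ico (1 : ℝ) R ⊆ Set.Ioi 0 := fun r hr => one_pos.trans_le hr.1
  rw [setIntegral_congr_fun measurableSet_Ioi fun r hr => e1 r hr,
    setIntegral_indicator measurableSet_Ico, Set.inter_eq_right.2 hsub, setIntegral_congr_set Ico_ae_eq_Ioc,
    ← intervalIntegral.integral_of_le hR, intervalIntegral.integral_eq_sub_of_hasDerivAt hd]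
  · simp only [hw, one_smul, div_one]; ring
  · rw [intervalIntegrable_iff_integrableOn_Ico_of_le hR]; exact hint


/-! ### Existence of the operator -/

/-- The truncated integral. -/
def truncT (f : Plane → ℝ) (s R : ℝ) (y : Plane) : ℝ :=
  ∫ α in Metric.ball (0 : Plane) R, kernel f (kLin s) y α

lemma measurable_truncT {f : Plane → ℝ} (hf : ContDiff ℝ 1 f) (s R : ℝ) :
    Measurable (truncT f s R) :=
  (measurable_kernel hf s).stronglyMeasurable.integral_prod_right'.measurable

lemma integral_ann_neg (F : Plane → ℝ) (R : ℝ) : ∫ α in ann R, F (-α) = ∫ α in ann R, F α := by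
  rw [← integral_indicator (measurableSet_ann R), ← integral_indicator (measurableSet_ann R),
    ← integral_neg_eq_self]
  refine integral_congr_ae (.of_forall fun α => ?_)
  simp [Set.indicator, mem_ann]

/-- The finite difference in the variable `y` that is integrated by parts. -/
def diffAt (f : Plane → ℝ) (y x : Plane) : ℝ := f (y + x) - f x - fderiv ℝ f 0 y

lemma contDiff_diffAt {f : Plane → ℝ} (hf : ContDiff ℝ 1 f) (y : Plane) :
    ContDiff ℝ 1 (diffAt f y) := by
  unfold diffAt; fun_prop

lemma fderiv_diffAt {f : Plane → ℝ} (hf : Differentiable ℝ f) (y x : Plane) :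
    fderiv ℝ (diffAt f y) x = fderiv ℝ f (y + x) - fderiv ℝ f x := by
  have h1 : HasFDerivAt (fun x => f (y + x)) (fderiv ℝ f (y + x)) x :=
    HasFDerivAt.comp (g := f) (f := fun x => y + x) x (hf (y + x)).hasFDerivAt
      ((hasFDerivAt_id x).const_add y)
  exact ((h1.sub (hf x).hasFDerivAt).sub_const _).fderiv

/-- Mean value theorem in the y variable. Because ∇f(0)·y has been subtracted, the relevant
derivative is ∇f(z + x) - ∇f(0), which grows only like |x|^b. -/
lemma HolderGrad.abs_diffAt_le {b L : ℝ} {f : Plane → ℝ} (hf : HolderGrad b L f) (hb : 0 ≤ b)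
    (hb1 : b ≤ 1) (y : Plane) {x : Plane} (hx : 1 ≤ ‖x‖) :
    |diffAt f y x| ≤ L * (1 + ‖y‖) ^ 2 * ‖x‖ ^ b := by
  have hL := hf.nonneg
  have hd := hf.contDiff.differentiable one_ne_zero
  have h := Convex.norm_image_sub_le_of_norm_hasFDerivWithin_le (s := segment ℝ 0 y)
    (f := fun z => f (z + x) - fderiv ℝ f 0 z) (f' := fun z => fderiv ℝ f (z + x) - fderiv ℝ f 0)
    (C := L * (1 + ‖y‖) * ‖x‖ ^ b) (fun z _ => ?_) (fun z hz => ?_)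
    (convex_segment 0 y) (left_mem_segment ℝ 0 y) (right_mem_segment ℝ 0 y)
  · have e : diffAt f y x =
        f (y + x) - fderiv ℝ f 0 y - (f (0 + x) - fderiv ℝ f 0 0) := by
      simp only [diffAt, zero_add, map_zero]; ring
    rw [e]
    refine h.trans ?_
    rw [sub_zero]
    calc L * (1 + ‖y‖) * ‖x‖ ^ b * ‖y‖ ≤ L * (1 + ‖y‖) * ‖x‖ ^ b * (1 + ‖y‖) := by
          gcongr; linarith
      _ = _ := by ring
  · have h1 : HasFDerivAt (fun z => f (z + x)) (fderiv ℝ f (z + x)) z :=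
      HasFDerivAt.comp (g := f) (f := fun z => z + x) z (hd (z + x)).hasFDerivAt
        ((hasFDerivAt_id z).add_const x)
    exact (h1.sub (fderiv ℝ f 0).hasFDerivAt).hasFDerivWithinAt
  · have h1 := norm_sub_le_of_mem_segment hz
    simp only [sub_zero] at h1
    refine (hf.le (z + x) 0).trans ?_
    rw [sub_zero]
    calc L * ‖z + x‖ ^ b ≤ L * ((1 + ‖y‖) * ‖x‖) ^ b := by
          gcongr
          have := norm_add_le z x
          nlinarith [norm_nonneg y]
      _ = L * ((1 + ‖y‖) ^ b * ‖x‖ ^ b) := by rw [Real.mul_rpow (by positivity) (by positivity)]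
      _ ≤ L * ((1 + ‖y‖) ^ (1 : ℝ) * ‖x‖ ^ b) := by
          gcongr
          linarith [norm_nonneg y]
      _ = _ := by rw [Real.rpow_one]; ring

/-- The absolutely convergent part of `truncT f s R y - truncT f s R 0` on `1 ≤ |α| < R`. -/
def farPart (f : Plane → ℝ) (s : ℝ) (y α : Plane) : ℝ :=
  (fderiv ℝ f 0 α - fderiv ℝ f (-α) α) * (coef s α y - coef s α 0) / ‖α‖ ^ 3 +
  (fderiv ℝ f y - fderiv ℝ f 0) α * (coef s α y - coef s (-α) y) / (2 * ‖α‖ ^ 3) -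
  diffAt f y (-α) * (coefR s α y - coef s α y) / ‖α‖ ^ 3

lemma measurable_farPart {f : Plane → ℝ} (hf : ContDiff ℝ 1 f) (s : ℝ) (y : Plane) :
    Measurable (farPart f s y) := by
  have h1 : Continuous fun α : Plane => fderiv ℝ f (-α) α :=
    (hf.continuous_fderiv_apply one_ne_zero).comp
      (by fun_prop : Continuous fun α : Plane => (-α, α))
  have h2 := h1.measurable
  have h3 := (contDiff_diffAt hf y).continuous.measurable
  unfold farPart
  fun_prop

/-- Each of the three terms gains a full power of |α| over the kernel: from the dependence of `coef`
on y, from the odd part of `coef`, and from the integration by parts. The power b - 3 is integrable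
at infinity when b < 1. -/
lemma HolderGrad.abs_farPart_le {b L : ℝ} {f : Plane → ℝ} (hf : HolderGrad b L f) (hb : 0 ≤ b)
    (hb1 : b ≤ 1) (s : ℝ) (y : Plane) {α : Plane} (hα : 1 ≤ ‖α‖) :
    |farPart f s y α| ≤ 18 * s ^ 2 * L * (1 + ‖y‖) ^ 2 * ‖α‖ ^ (b - 3) := by
  have hL := hf.nonneg
  have hn : 0 < ‖α‖ := one_pos.trans_le hα
  have hr : ‖α‖ ^ (b - 3) = ‖α‖ ^ b / ‖α‖ ^ 3 := by
    rw [← Real.rpow_sub_natCast hn.ne']; norm_num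
  have hy : ‖y‖ ≤ (1 + ‖y‖) ^ 2 := by nlinarith [norm_nonneg y]
  have hb0 : 1 ≤ ‖α‖ ^ b := Real.one_le_rpow hα hb
  have h1 : |(fderiv ℝ f 0 α - fderiv ℝ f (-α) α) * (coef s α y - coef s α 0) / ‖α‖ ^ 3| ≤
      6 * s ^ 2 * L * (1 + ‖y‖) ^ 2 * (‖α‖ ^ b / ‖α‖ ^ 3) := by
    have e1 : |fderiv ℝ f 0 α - fderiv ℝ f (-α) α| ≤ L * ‖α‖ ^ b * ‖α‖ := by
      have := hf.le 0 (-α)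
      rw [zero_sub, neg_neg] at this
      exact ((fderiv ℝ f 0 - fderiv ℝ f (-α)).le_opNorm α).trans (by gcongr)
    have e2 := abs_coef_sub_le' s α y 0
    rw [sub_zero] at e2
    rw [abs_div, abs_mul, abs_of_pos (a := ‖α‖ ^ 3) (by positivity)]
    calc _ ≤ L * ‖α‖ ^ b * ‖α‖ * (6 * s ^ 2 * ‖y‖ / ‖α‖) / ‖α‖ ^ 3 := by gcongr
      _ = 6 * s ^ 2 * L * ‖y‖ * (‖α‖ ^ b / ‖α‖ ^ 3) := by field_simp
      _ ≤ _ := by gcongr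
  have h2 : |(fderiv ℝ f y - fderiv ℝ f 0) α * (coef s α y - coef s (-α) y) / (2 * ‖α‖ ^ 3)| ≤
      3 * s ^ 2 * L * (1 + ‖y‖) ^ 2 * (‖α‖ ^ b / ‖α‖ ^ 3) := by
    have e1 : |(fderiv ℝ f y - fderiv ℝ f 0) α| ≤ L * (1 + ‖y‖) * ‖α‖ := by
      have := hf.le y 0
      rw [sub_zero] at this
      refine ((fderiv ℝ f y - fderiv ℝ f 0).le_opNorm α).trans ?_
      gcongr
      refine this.trans ?_
      gcongr
      calc ‖y‖ ^ b ≤ (1 + ‖y‖) ^ b := by gcongr; linarith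
        _ ≤ (1 + ‖y‖) ^ (1 : ℝ) := by gcongr; linarith [norm_nonneg y]
        _ = _ := Real.rpow_one _
    have e2 := abs_coef_sub_coef_neg_le' s α y
    rw [abs_div, abs_mul, abs_of_pos (a := 2 * ‖α‖ ^ 3) (by positivity)]
    calc _ ≤ L * (1 + ‖y‖) * ‖α‖ * (6 * s ^ 2 * ‖y‖ / ‖α‖) / (2 * ‖α‖ ^ 3) := by gcongr
      _ = 3 * s ^ 2 * L * ((1 + ‖y‖) * ‖y‖) * (1 / ‖α‖ ^ 3) := by field_simp; ring
      _ ≤ 3 * s ^ 2 * L * ((1 + ‖y‖) ^ 2) * (‖α‖ ^ b / ‖α‖ ^ 3) := by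
          gcongr; nlinarith [norm_nonneg y]
  have h3 : |diffAt f y (-α) * (coefR s α y - coef s α y) / ‖α‖ ^ 3| ≤
      9 * s ^ 2 * L * (1 + ‖y‖) ^ 2 * (‖α‖ ^ b / ‖α‖ ^ 3) := by
    have e1 := hf.abs_diffAt_le hb hb1 y (x := -α) (by rwa [norm_neg])
    rw [norm_neg] at e1
    have e2 : |coefR s α y - coef s α y| ≤ 6 * s ^ 2 + 3 * s ^ 2 :=
      (abs_sub _ _).trans (add_le_add (abs_coefR_le s α y) (abs_coef_le s α y))
    rw [abs_div, abs_mul, abs_of_pos (a := ‖α‖ ^ 3) (by positivity)]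
    calc _ ≤ L * (1 + ‖y‖) ^ 2 * ‖α‖ ^ b * (6 * s ^ 2 + 3 * s ^ 2) / ‖α‖ ^ 3 := by gcongr
      _ = _ := by ring
  rw [farPart, hr]
  refine (abs_sub _ _).trans ((add_le_add (abs_add_le _ _) le_rfl).trans ?_)
  linarith

/-- The boundary terms. -/
def bdPart (f : Plane → ℝ) (s : ℝ) (y : Plane) (R : ℝ) : ℝ :=
  ∫ θ : Metric.sphere (0 : Plane) 1,
    diffAt f y (-(R • (θ : Plane))) * coef s (R • (θ : Plane)) y / R ∂arc

lemma HolderGrad.abs_bdPart_le {b L : ℝ} {f : Plane → ℝ} (hf : HolderGrad b L f) (hb : 0 ≤ b)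
    (hb1 : b ≤ 1) (s : ℝ) (y : Plane) {R : ℝ} (hR : 1 ≤ R) :
    |bdPart f s y R| ≤ 6 * Real.pi * s ^ 2 * L * (1 + ‖y‖) ^ 2 * R ^ (b - 1) := by
  have hR0 : 0 < R := one_pos.trans_le hR
  have := norm_integral_le_of_norm_le_const (μ := arc)
    (f := fun θ : Metric.sphere (0 : Plane) 1 =>
      diffAt f y (-(R • (θ : Plane))) * coef s (R • (θ : Plane)) y / R)
    (C := 3 * s ^ 2 * L * (1 + ‖y‖) ^ 2 * R ^ (b - 1)) (.of_forall fun θ => ?_)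
  · refine this.trans (le_of_eq ?_)
    rw [measureReal_def, arc_univ, ENNReal.toReal_ofReal (by positivity)]; ring
  · have e1 := hf.abs_diffAt_le hb hb1 y (x := -(R • (θ : Plane)))
      (by rwa [norm_neg, norm_smul_sphere hR0.le])
    rw [norm_neg, norm_smul_sphere hR0.le] at e1
    rw [Real.norm_eq_abs, abs_div, abs_mul, abs_of_pos hR0, Real.rpow_sub_one hR0.ne']
    have hL := hf.nonneg
    calc _ ≤ L * (1 + ‖y‖) ^ 2 * R ^ b * (3 * s ^ 2) / R := by
          gcongr; exact abs_coef_le _ _ _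
      _ = _ := by ring

lemma integrable_bdPart {f : Plane → ℝ} (hf : ContDiff ℝ 1 f) (s : ℝ) (y : Plane) {R : ℝ}
    (hR : 1 ≤ R) : Integrable (fun θ : Metric.sphere (0 : Plane) 1 =>
      diffAt f y (-(R • (θ : Plane))) * coef s (R • (θ : Plane)) y / R) arc := by
  have hR0 : 0 < R := one_pos.trans_le hR
  obtain ⟨C, hC0, hC⟩ := exists_abs_le_ball (contDiff_diffAt hf y).continuous R
  have hm := (contDiff_diffAt hf y).continuous.measurable
  refine Integrable.of_bound (C := C * (3 * s ^ 2))
    (by fun_prop : Measurable _).aestronglyMeasurable (.of_forall fun θ => ?_)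
  rw [Real.norm_eq_abs, abs_div, abs_mul, abs_of_pos hR0]
  refine (div_le_self (by positivity) hR).trans ?_
  gcongr
  · exact hC _ (by rw [norm_neg, norm_smul_sphere hR0.le])
  · exact abs_coef_le _ _ _

lemma integral_add_sub {X : Type*} [MeasurableSpace X] {μ : Measure X} {A B C : X → ℝ}
    (hA : Integrable A μ) (hB : Integrable B μ) (hC : Integrable C μ) :
    ∫ x, A x + B x - C x ∂μ = (∫ x, A x ∂μ) + (∫ x, B x ∂μ) - ∫ x, C x ∂μ := by
  rw [integral_sub (f := fun x => A x + B x) (hA.add hB) hC, integral_add hA hB]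

/-- The difference of the kernels at y and 0 has three parts. One contains the difference of the
coefficients. In one the vector ∇f(y) - ∇f(0) is constant in α, so that only the odd part of the
coefficient survives. The last is the gradient of `diffAt f y`, which is integrated by parts along
rays; constants may be subtracted from that function beforehand. -/
lemma HolderGrad.truncT_sub_eq {b L : ℝ} {f : Plane → ℝ} (hf : HolderGrad b L f) (hb : 0 < b)
    (s : ℝ) (y : Plane) {R : ℝ} (hR : 1 ≤ R) :
    truncT f s R y - truncT f s R 0 =
      (truncT f s 1 y - truncT f s 1 0) +
        1 / (2 * Real.pi) * ((∫ α in ann R, farPart f s y α) - bdPart f s y 1 + bdPart f s y R) := by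
  have hd := hf.contDiff.differentiable one_ne_zero
  have hc := contDiff_diffAt hf.contDiff y
  have hg : Continuous fun α : Plane => fderiv ℝ f (-α) α :=
    (hf.contDiff.continuous_fderiv_apply one_ne_zero).comp
      (by fun_prop : Continuous fun α : Plane => (-α, α))
  have i0 := hf.integrableOn_kernel hb s y R
  have i0' := hf.integrableOn_kernel hb s 0 R
  have j0 : IntegrableOn (kernel f (kLin s) y) (ann R) := i0.mono_set Set.sdiff_subset
  have j0' : IntegrableOn (kernel f (kLin s) 0) (ann R) := i0'.mono_set Set.sdiff_subset
  have i1 : IntegrableOn (fun α => (fderiv ℝ f 0 α - fderiv ℝ f (-α) α) *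
      (coef s α y - coef s α 0) / ‖α‖ ^ 3) (ann R) := by
    obtain ⟨C, hC0, hC⟩ := exists_abs_le_ball (u := fun α => fderiv ℝ f 0 α - fderiv ℝ f (-α) α)
      (by fun_prop) R
    have hm := hg.measurable
    refine integrableOn_ann (C := C * (3 * s ^ 2 + 3 * s ^ 2)) (by fun_prop) fun α hα => ?_
    obtain ⟨h1, h2⟩ := mem_ann.1 hα
    rw [abs_div, abs_mul, abs_of_nonneg (a := ‖α‖ ^ 3) (by positivity)]
    refine (div_le_self (by positivity) (one_le_pow₀ h1)).trans ?_
    gcongr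
    · exact hC α h2.le
    · exact (abs_sub _ _).trans (add_le_add (abs_coef_le s α y) (abs_coef_le s α 0))
  have i2 : ∀ σ : ℝ, IntegrableOn (fun α => (fderiv ℝ f y - fderiv ℝ f 0) α *
      coef s (σ • α) y / ‖α‖ ^ 3) (ann R) := by
    intro σ
    obtain ⟨C, hC0, hC⟩ := exists_abs_le_ball (u := fun α => (fderiv ℝ f y - fderiv ℝ f 0) α)
      (by fun_prop) R
    refine integrableOn_ann (C := C * (3 * s ^ 2)) (by fun_prop) fun α hα => ?_
    obtain ⟨h1, h2⟩ := mem_ann.1 hα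
    rw [abs_div, abs_mul, abs_of_nonneg (a := ‖α‖ ^ 3) (by positivity)]
    refine (div_le_self (by positivity) (one_le_pow₀ h1)).trans ?_
    gcongr
    · exact hC α h2.le
    · exact abs_coef_le s _ y
  have i2a : IntegrableOn (fun α => (fderiv ℝ f y - fderiv ℝ f 0) α *
      coef s α y / ‖α‖ ^ 3) (ann R) := by simpa using i2 1
  have i2b : IntegrableOn (fun α => (fderiv ℝ f y - fderiv ℝ f 0) α *
      coef s (-α) y / ‖α‖ ^ 3) (ann R) := by simpa using i2 (-1)
  have i3 := integrableOn_ann_fderiv_mul hc s R y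
  have i4 := integrableOn_ann_mul_coefR hc.continuous s R y
  have e2 : ∫ α in ann R, (fderiv ℝ f y - fderiv ℝ f 0) α * (coef s α y - coef s (-α) y) /
      (2 * ‖α‖ ^ 3) = ∫ α in ann R, (fderiv ℝ f y - fderiv ℝ f 0) α * coef s α y / ‖α‖ ^ 3 := by
    have h1 := integral_ann_neg (fun α => (fderiv ℝ f y - fderiv ℝ f 0) α * coef s α y / ‖α‖ ^ 3) R
    have h2 : ∀ α, (fderiv ℝ f y - fderiv ℝ f 0) α * (coef s α y - coef s (-α) y) /
      (2 * ‖α‖ ^ 3) = 1 / 2 * ((fderiv ℝ f y - fderiv ℝ f 0) α * coef s α y / ‖α‖ ^ 3 -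
        (fderiv ℝ f y - fderiv ℝ f 0) α * coef s (-α) y / ‖α‖ ^ 3) := fun α => by ring
    simp only [h2]
    rw [integral_const_mul, integral_sub i2a i2b]
    simp only [map_neg, norm_neg, neg_mul, neg_div, integral_neg] at h1
    rw [← h1]; rw [h1]
    linarith
  have i2c : IntegrableOn (fun α => (fderiv ℝ f y - fderiv ℝ f 0) α *
      (coef s α y - coef s (-α) y) / (2 * ‖α‖ ^ 3)) (ann R) := by
    refine ((i2a.sub i2b).const_mul (1 / 2)).congr (.of_forall fun α => ?_)
    simp only [Pi.sub_apply]; ring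
  have e3 := integral_ann_fderiv_mul hc s hR y
  rw [integral_sub] at e3
  rotate_left
  · simpa using integrable_bdPart hf.contDiff s y le_rfl
  · exact integrable_bdPart hf.contDiff s y hR
  have e4 : ∫ θ : Metric.sphere (0 : Plane) 1, diffAt f y (-θ) * coef s θ y ∂arc =
      bdPart f s y 1 := by simp [bdPart]
  have e5 : ∫ α in ann R, farPart f s y α =
      (∫ α in ann R, (fderiv ℝ f 0 α - fderiv ℝ f (-α) α) *
        (coef s α y - coef s α 0) / ‖α‖ ^ 3) +
      (∫ α in ann R, (fderiv ℝ f y - fderiv ℝ f 0) α * coef s α y / ‖α‖ ^ 3) -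
      ∫ α in ann R, diffAt f y (-α) * (coefR s α y - coef s α y) / ‖α‖ ^ 3 := by
    rw [← e2, ← integral_add_sub i1 i2c i4]
    rfl
  have e6 : (∫ α in ann R, kernel f (kLin s) y α) - ∫ α in ann R, kernel f (kLin s) 0 α =
      1 / (2 * Real.pi) * ((∫ α in ann R, (fderiv ℝ f 0 α - fderiv ℝ f (-α) α) *
        (coef s α y - coef s α 0) / ‖α‖ ^ 3) +
      (∫ α in ann R, (fderiv ℝ f y - fderiv ℝ f 0) α * coef s α y / ‖α‖ ^ 3) -
      ∫ α in ann R, fderiv ℝ (diffAt f y) (-α) α * coef s α y / ‖α‖ ^ 3) := by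
    rw [← integral_sub j0 j0', ← integral_add_sub i1 i2a i3, ← integral_const_mul]
    refine integral_congr_ae (.of_forall fun α => ?_)
    simp only [kernel_eq hd, fderiv_diffAt hd, zero_sub, sub_apply, ← sub_eq_add_neg]
    ring
  rw [truncT, truncT, integral_ball_eq_add hR i0, integral_ball_eq_add hR i0', e5, ← truncT,
    ← truncT]
  have e7 : bdPart f s y R = ∫ θ : Metric.sphere (0 : Plane) 1,
    diffAt f y (-(R • (θ : Plane))) * coef s (R • (θ : Plane)) y / R ∂arc := rfl
  rw [e4, ← e7] at e3
  rw [e3] at e6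
  linarith

lemma HolderGrad.abs_truncT_one_le {b L : ℝ} {f : Plane → ℝ} (hf : HolderGrad b L f) (hb : 0 < b)
    (s : ℝ) (y : Plane) :
    |truncT f s 1 y| ≤ s ^ 2 * L * ∫ α in Metric.ball (0 : Plane) 1, ‖α‖ ^ (b - 2) := by
  rw [← integral_const_mul]
  exact norm_integral_le_of_norm_le (f := kernel f (kLin s) y)
    ((integrableOn_norm_rpow_ball (a := b - 2) (by linarith) 1).const_mul _)
    (.of_forall fun α => hf.abs_kernel_le s y α)

/-- The value at y = 0 plays the role of the diverging constant c(R). The bound is uniform in R, so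
it serves both as a majorant when R → ∞ under pairings with Schwartz functions and as the
temperateness of the limit. -/
theorem HolderGrad.exists_limit {b L : ℝ} {f : Plane → ℝ} (hf : HolderGrad b L f) (hb : 0 < b)
    (hb1 : b < 1) (s : ℝ) : ∃ (T : Plane → ℝ) (K : ℝ),
      (∀ y, Tendsto (fun R => truncT f s R y - truncT f s R 0) atTop (𝓝 (T y))) ∧
      ∀ y R, 1 ≤ R → |truncT f s R y - truncT f s R 0| ≤ K * (1 + ‖y‖) ^ 2 := by
  have hL := hf.nonneg
  set K₁ := s ^ 2 * L * ∫ α in Metric.ball (0 : Plane) 1, ‖α‖ ^ (b - 2) with hK₁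
  set K₂ := 18 * s ^ 2 * L * ∫ α in (Metric.ball (0 : Plane) 1)ᶜ, ‖α‖ ^ (b - 3) with hK₂
  set K₃ := 6 * Real.pi * s ^ 2 * L with hK₃
  refine ⟨fun y => (truncT f s 1 y - truncT f s 1 0) +
        1 / (2 * Real.pi) * ((∫ α in (Metric.ball 0 1)ᶜ, farPart f s y α) - bdPart f s y 1 + 0),
    2 * K₁ + 1 / (2 * Real.pi) * (K₂ + K₃ + K₃), fun y => ?_, fun y R hR => ?_⟩
  · have h1 := tendsto_integral_ann (a := b - 3) (by linarith) (measurable_farPart hf.contDiff s y)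
      (fun α hα => hf.abs_farPart_le hb.le hb1.le s y hα)
    have h2 : Tendsto (fun R => bdPart f s y R) atTop (𝓝 0) := by
      have h3 : Tendsto (fun R : ℝ => 6 * Real.pi * s ^ 2 * L * (1 + ‖y‖) ^ 2 * R ^ (b - 1)) atTop
          (𝓝 0) := by
        have := (tendsto_rpow_neg_atTop (y := 1 - b) (by linarith)).const_mul
          (6 * Real.pi * s ^ 2 * L * (1 + ‖y‖) ^ 2)
        rw [mul_zero, neg_sub] at this
        exact this
      refine squeeze_zero_norm' ?_ h3
      filter_upwards [eventually_ge_atTop 1] with R hR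
      exact hf.abs_bdPart_le hb.le hb1.le s y hR
    refine (tendsto_const_nhds.add (((h1.sub tendsto_const_nhds).add h2).const_mul _)).congr' ?_
    filter_upwards [eventually_ge_atTop 1] with R hR
    exact (hf.truncT_sub_eq hb s y hR).symm
  · rw [hf.truncT_sub_eq hb s y hR]
    have h1 := hf.abs_truncT_one_le hb s y
    have h2 := hf.abs_truncT_one_le hb s 0
    have h3 := abs_integral_ann_le (a := b - 3) (K := 18 * s ^ 2 * L * (1 + ‖y‖) ^ 2)
      (by linarith) (by positivity) (fun α hα => hf.abs_farPart_le hb.le hb1.le s y hα) R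
    have h4 := hf.abs_bdPart_le hb.le hb1.le s y le_rfl
    have h5 := hf.abs_bdPart_le hb.le hb1.le s y hR
    rw [Real.one_rpow, mul_one] at h4
    have h6 : R ^ (b - 1) ≤ 1 := Real.rpow_le_one_of_one_le_of_nonpos hR (by linarith)
    have h7 : |bdPart f s y R| ≤ K₃ * (1 + ‖y‖) ^ 2 :=
      h5.trans (mul_le_of_le_one_right (by positivity) h6)
    have h8 : (1 : ℝ) ≤ (1 + ‖y‖) ^ 2 := by nlinarith [norm_nonneg y]
    have hK₁0 : 0 ≤ K₁ := (abs_nonneg _).trans h1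
    refine (abs_add_le _ _).trans ?_
    rw [abs_mul, abs_of_pos (a := 1 / (2 * Real.pi)) (by positivity)]
    have h9 : |(∫ α in ann R, farPart f s y α) - bdPart f s y 1 + bdPart f s y R| ≤
        (K₂ + K₃ + K₃) * (1 + ‖y‖) ^ 2 := by
      refine (abs_add_le _ _).trans ((add_le_add ((abs_sub _ _).trans (add_le_add h3 h4)) h7).trans
        (le_of_eq ?_))
      rw [hK₂, hK₃]; ring
    have h10 : |truncT f s 1 y - truncT f s 1 0| ≤ 2 * K₁ * (1 + ‖y‖) ^ 2 :=
      ((abs_sub _ _).trans (add_le_add h1 h2)).trans (by nlinarith)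
    have h11 := mul_le_mul_of_nonneg_left h9 (a := 1 / (2 * Real.pi)) (by positivity)
    refine (add_le_add h10 h11).trans (le_of_eq (by ring))


/-! ### Bounded densities with bounded support -/

/-- A bounded measurable function with bounded support. -/
def Nice (F : Plane → ℂ) : Prop :=
  Measurable F ∧ ∃ N : ℝ, 0 ≤ N ∧ ∀ ξ, ‖F ξ‖ ≤ N ∧ (F ξ ≠ 0 → ‖ξ‖ ≤ N)

lemma Nice.of_le {F G : Plane → ℂ} (hF : Nice F) (hG : Measurable G) {c : Plane → ℝ}
    (hc : Continuous c) (h : ∀ ξ, ‖G ξ‖ ≤ c ξ * ‖F ξ‖) : Nice G := by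
  obtain ⟨hFm, N, hN0, hN⟩ := hF
  obtain ⟨C, hC0, hC⟩ := exists_abs_le_ball hc N
  refine ⟨hG, max N (C * N), le_max_of_le_left hN0, fun ξ => ?_⟩
  by_cases h0 : F ξ = 0
  · have : G ξ = 0 := by simpa [h0] using h ξ
    simp [this, hN0]
  · have h1 := (hN ξ).2 h0
    refine ⟨((h ξ).trans ?_).trans (le_max_right _ _), fun _ => h1.trans (le_max_left _ _)⟩
    exact mul_le_mul ((le_abs_self _).trans (hC ξ h1)) (hN ξ).1 (norm_nonneg _) hC0

lemma Nice.integrableOn_aux {F : Plane → ℂ} (hF : Nice F) : ∃ N, 0 ≤ N ∧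
    F = (Metric.closedBall (0 : Plane) N).indicator F ∧ ∀ ξ, ‖F ξ‖ ≤ N := by
  obtain ⟨hFm, N, hN0, hN⟩ := hF
  refine ⟨N, hN0, ?_, fun ξ => (hN ξ).1⟩
  rw [eq_comm, Set.indicator_eq_self]
  exact fun ξ hξ => by simpa using (hN ξ).2 hξ

lemma Nice.memLp {F : Plane → ℂ} (hF : Nice F) (p : ℝ≥0∞) : MemLp F p := by
  obtain ⟨N, hN0, hN, hb⟩ := hF.integrableOn_aux
  rw [hN, memLp_indicator_iff_restrict Metric.isClosed_closedBall.measurableSet]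
  have : IsFiniteMeasure ((volume : Measure Plane).restrict (Metric.closedBall 0 N)) :=
    ⟨by simpa using measure_closedBall_lt_top (μ := (volume : Measure Plane)) (x := 0) (r := N)⟩
  exact MemLp.of_bound hF.1.aestronglyMeasurable N (.of_forall hb)

lemma Nice.integrable {F : Plane → ℂ} (hF : Nice F) : Integrable F :=
  memLp_one_iff_integrable.1 (hF.memLp 1)

/-- The weight `|ξ|² + |ξ|^(2 - a/4)`. -/
def wt (a : ℝ) (ξ : Plane) : ℝ := ‖ξ‖ ^ 2 + ‖ξ‖ ^ (2 - a / 4)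

lemma wt_nonneg (a : ℝ) (ξ : Plane) : 0 ≤ wt a ξ := by unfold wt; positivity

lemma continuous_wt {a : ℝ} (ha1 : a < 1) : Continuous (wt a) := by
  unfold wt
  exact (by fun_prop : Continuous fun ξ : Plane => ‖ξ‖ ^ 2).add
    (continuous_norm.rpow_const fun ξ => Or.inr (by linarith))

/-- The norm of the data. -/
def dataNorm (a : ℝ) (F : Plane → ℂ) : ℝ≥0∞ := wnorm (2 + a / 4) F + wnorm (2 + a) F

lemma rpow_le_add {x p q r : ℝ} (hx : 0 ≤ x) (hp : 0 < p) (hpq : p ≤ q) (hqr : q ≤ r) :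
    x ^ q ≤ x ^ p + x ^ r := by
  rcases le_or_gt x 1 with h | h
  · rcases hx.eq_or_lt with rfl | hx0
    · rw [Real.zero_rpow (by linarith), Real.zero_rpow (by linarith), Real.zero_rpow (by linarith)]
      simp
    · exact (Real.rpow_le_rpow_of_exponent_ge hx0 h hpq).trans
        (le_add_of_nonneg_right (by positivity))
  · exact (Real.rpow_le_rpow_of_exponent_le h.le hqr).trans
      (le_add_of_nonneg_left (by positivity))

lemma wnorm_le_of_le {a b c K : ℝ} {F Q : Plane → ℂ} (hF : AEStronglyMeasurable F) (hK : 0 ≤ K)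
    (h : ∀ ξ, ‖ξ‖ ^ a * ‖Q ξ‖ ≤ K * ((‖ξ‖ ^ b + ‖ξ‖ ^ c) * ‖F ξ‖)) :
    wnorm a Q ≤ ENNReal.ofReal K * (wnorm b F + wnorm c F) := by
  have hm : ∀ b : ℝ, AEStronglyMeasurable (fun ξ : Plane => ‖ξ‖ ^ b • F ξ) := fun b =>
    AEStronglyMeasurable.smul
      (by fun_prop : Measurable fun ξ : Plane => ‖ξ‖ ^ b).aestronglyMeasurable hF
  rw [wnorm_eq_eLpNorm, wnorm_eq_eLpNorm, wnorm_eq_eLpNorm]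
  calc eLpNorm (fun ξ => ‖ξ‖ ^ a • Q ξ) 2 volume
      ≤ eLpNorm (fun ξ => K • (‖‖ξ‖ ^ b • F ξ‖ + ‖‖ξ‖ ^ c • F ξ‖)) 2 volume := by
        refine eLpNorm_mono fun ξ => ?_
        have h1 : ∀ b : ℝ, ‖‖ξ‖ ^ b • F ξ‖ = ‖ξ‖ ^ b * ‖F ξ‖ := fun b => by
          rw [norm_smul, Real.norm_of_nonneg (by positivity)]
        rw [norm_smul, Real.norm_of_nonneg (by positivity), smul_eq_mul,
          Real.norm_of_nonneg (by positivity), h1, h1]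
        refine (h ξ).trans (le_of_eq (by ring))
    _ = ENNReal.ofReal K * eLpNorm (fun ξ => ‖‖ξ‖ ^ b • F ξ‖ + ‖‖ξ‖ ^ c • F ξ‖) 2 volume := by
        rw [← Pi.smul_def, eLpNorm_const_smul, Real.enorm_of_nonneg hK]
    _ ≤ ENNReal.ofReal K * (eLpNorm (fun ξ => ‖‖ξ‖ ^ b • F ξ‖) 2 volume +
          eLpNorm (fun ξ => ‖‖ξ‖ ^ c • F ξ‖) 2 volume) :=
        mul_le_mul_right (eLpNorm_add_le (hm b).norm (hm c).norm (by norm_num)) _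
    _ = _ := by rw [eLpNorm_norm, eLpNorm_norm]

/-- For b between a/2 and a, both b + 2 and b + 2 - a/4 lie in [2 + a/4, 2 + a]. The lower end is
reached at b = a/2 with the second exponent; this fixes t** = 2 + a/4. -/
lemma bracket_le {a K : ℝ} (ha : 0 < a) {F Q : Plane → ℂ}
    (hF : AEStronglyMeasurable F) (hK : 0 ≤ K) (h : ∀ ξ, ‖Q ξ‖ ≤ K * (wt a ξ * ‖F ξ‖)) :
    wnorm a Q + wnorm (a / 2) Q ≤ ENNReal.ofReal (4 * K) * dataNorm a F := by
  have key : ∀ b, a / 2 ≤ b → b ≤ a → wnorm b Q ≤ ENNReal.ofReal (2 * K) * dataNorm a F := by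
    intro b hb hb1
    refine wnorm_le_of_le hF (by positivity) fun ξ => ?_
    have h1 : ‖ξ‖ ^ b * wt a ξ ≤ 2 * (‖ξ‖ ^ (2 + a / 4) + ‖ξ‖ ^ (2 + a)) := by
      have hb0 : 0 < b := by linarith
      rcases eq_or_ne ξ 0 with rfl | hξ
      · rw [norm_zero, Real.zero_rpow hb0.ne', zero_mul]; positivity
      have hn : 0 < ‖ξ‖ := norm_pos_iff.2 hξ
      have e1 : ‖ξ‖ ^ b * wt a ξ = ‖ξ‖ ^ (b + 2) + ‖ξ‖ ^ (b + (2 - a / 4)) := by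
        rw [wt, mul_add, ← Real.rpow_natCast ‖ξ‖ 2, ← Real.rpow_add hn, ← Real.rpow_add hn]
        norm_num
      rw [e1, two_mul]
      refine add_le_add (rpow_le_add hn.le ?_ ?_ ?_) (rpow_le_add hn.le ?_ ?_ ?_) <;> linarith
    calc ‖ξ‖ ^ b * ‖Q ξ‖ ≤ ‖ξ‖ ^ b * (K * (wt a ξ * ‖F ξ‖)) := by gcongr; exact h ξ
      _ = K * ((‖ξ‖ ^ b * wt a ξ) * ‖F ξ‖) := by ring
      _ ≤ K * ((2 * (‖ξ‖ ^ (2 + a / 4) + ‖ξ‖ ^ (2 + a))) * ‖F ξ‖) := by gcongr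
      _ = _ := by ring
  refine (add_le_add (key a (by linarith) le_rfl) (key (a / 2) le_rfl (by linarith))).trans ?_
  rw [← add_mul, ← ENNReal.ofReal_add (by positivity) (by positivity)]
  refine le_of_eq ?_
  congr 2; ring

/-! ### Superpositions of products -/

lemma Nice.integrable_mul {F : Plane → ℂ} (hF : Nice F) {c : Plane → ℝ} (hc : Continuous c) :
    Integrable fun ξ => c ξ * ‖F ξ‖ := by
  have : Nice fun ξ => (c ξ : ℂ) * F ξ := by
    have := hF.1
    have := hc.measurable
    refine hF.of_le (by fun_prop) hc.abs fun ξ => ?_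
    rw [norm_mul, Complex.norm_real, Real.norm_eq_abs]
  refine this.integrable.norm.mono ?_ (.of_forall fun ξ => ?_)
  · exact hc.aestronglyMeasurable.mul hF.1.norm.aestronglyMeasurable
  · simp

/-- The hypotheses under which Fubini's theorem applies to `∫ b p y * invF (Q p) y dμ(p)`. -/
structure Superpos {P : Type*} [MeasurableSpace P] (μ : Measure P)
    (b : P → Plane → ℝ) (Q : P → Plane → ℂ) (A : ℝ) (κ : P → ℝ) (w : Plane → ℝ) : Prop where
  measurable_b : Measurable fun x : P × Plane => b x.1 x.2
  measurable_Q : Measurable fun x : P × Plane => Q x.1 x.2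
  abs_b_le : ∀ p y, |b p y| ≤ A
  integrable_κ : Integrable κ μ
  integrable_w : Integrable w
  norm_Q_le : ∀ᵐ p ∂μ, ∀ ξ, ‖Q p ξ‖ ≤ κ p * w ξ

section

variable {P : Type*} [MeasurableSpace P] {a : ℝ} {F : Plane → ℂ} {μ : Measure P}
  {b : P → Plane → ℝ} {Q : P → Plane → ℂ} {A : ℝ} {κ : P → ℝ} {w : Plane → ℝ}

lemma measurable_invF_uncurry (hQ : Measurable fun x : P × Plane => Q x.1 x.2) :
    Measurable fun x : P × Plane => invF (Q x.1) x.2 := by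
  unfold invF
  refine Complex.measurable_re.comp ?_
  have h : Measurable fun z : (P × Plane) × Plane => Q z.1.1 z.2 :=
    hQ.comp (by fun_prop : Measurable fun z : (P × Plane) × Plane => (z.1.1, z.2))
  have : Measurable fun z : (P × Plane) × Plane => wave z.2 z.1.2 * Q z.1.1 z.2 := by fun_prop
  exact this.stronglyMeasurable.integral_prod_right'.measurable

lemma Superpos.abs_invF_le (h : Superpos μ b Q A κ w) :
    ∀ᵐ p ∂μ, ∀ y, |invF (Q p) y| ≤ κ p * ∫ ξ, w ξ := by
  filter_upwards [h.norm_Q_le] with p hp y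
  refine (Muskat.abs_invF_le y).trans ?_
  rw [← integral_const_mul]
  exact integral_mono_of_nonneg (.of_forall fun ξ => norm_nonneg _)
    (h.integrable_w.const_mul _) (.of_forall hp)

lemma Superpos.nonneg (h : Superpos μ b Q A κ w) (p : P) : 0 ≤ A :=
  (abs_nonneg _).trans (h.abs_b_le p 0)

lemma Superpos.integrable (h : Superpos μ b Q A κ w) (y : Plane) :
    Integrable (fun p => b p y * invF (Q p) y) μ := by
  have h1 := measurable_invF_uncurry h.measurable_Q
  have h2 := h1.comp (measurable_prodMk_right (y := y) : Measurable fun p : P => (p, y))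
  have h3 := h.measurable_b.comp (measurable_prodMk_right (y := y) : Measurable fun p : P => (p, y))
  simp only [Function.comp_def] at h2 h3
  refine Integrable.mono' (h.integrable_κ.mul_const (A * ∫ ξ, w ξ))
    (h3.mul h2).aestronglyMeasurable ?_
  filter_upwards [h.abs_invF_le] with p hp
  rw [Real.norm_eq_abs, abs_mul]
  calc _ ≤ A * (κ p * ∫ ξ, w ξ) :=
        mul_le_mul (h.abs_b_le p y) (hp y) (abs_nonneg _) (h.nonneg p)
    _ = _ := by ring

lemma Superpos.integrable_prod [SFinite μ] (h : Superpos μ b Q A κ w) {Ψ : Plane → ℂ}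
    (hΨ : Integrable Ψ) :
    Integrable (fun x : P × Plane => ((b x.1 x.2 * invF (Q x.1) x.2 : ℝ) : ℂ) * Ψ x.2)
      (μ.prod volume) := by
  have h1 := measurable_invF_uncurry h.measurable_Q
  have h3 := h.measurable_b
  have hI := ((h.integrable_κ.mul_const (A * ∫ ξ, w ξ)).mul_prod hΨ.norm)
  refine Integrable.mono' hI ?_ ?_
  · exact (Complex.measurable_ofReal.comp (h3.mul h1)).aestronglyMeasurable.mul
      hΨ.aestronglyMeasurable.comp_snd
  · have := (Measure.quasiMeasurePreserving_fst (μ := μ) (ν := (volume : Measure Plane))).ae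
      h.abs_invF_le
    filter_upwards [this] with x hx
    rw [norm_mul, Complex.norm_real, Real.norm_eq_abs, abs_mul]
    refine mul_le_mul_of_nonneg_right ?_ (norm_nonneg _)
    calc _ ≤ A * (κ x.1 * ∫ ξ, w ξ) :=
          mul_le_mul (h.abs_b_le _ _) (hx _) (abs_nonneg _) (h.nonneg x.1)
      _ = _ := by ring

lemma Superpos.integral_swap [SFinite μ] (h : Superpos μ b Q A κ w) {Ψ : Plane → ℂ}
    (hΨ : Integrable Ψ) :
    ∫ y, ((∫ p, b p y * invF (Q p) y ∂μ : ℝ) : ℂ) * Ψ y =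
      ∫ p, (∫ y, ((b p y * invF (Q p) y : ℝ) : ℂ) * Ψ y) ∂μ := by
  rw [integral_integral_swap (h.integrable_prod hΨ)]
  refine integral_congr_ae (.of_forall fun y => ?_)
  simp only
  rw [integral_mul_const, integral_complex_ofReal]

lemma enorm_pairing_le_dataNorm (hF : Nice F) (ha : 0 < a) (ha1 : a < 1) {b : Plane → ℝ}
    {Q : Plane → ℂ} (hQ : Measurable Q) {K M : ℝ} (hK : 0 ≤ K)
    (h : ∀ ξ, ‖Q ξ‖ ≤ K * (wt a ξ * ‖F ξ‖)) (hb : SlowCoeff a b M) (φ : 𝓢(Plane, ℂ)) :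
    ‖∫ y, ((b y * invF Q y : ℝ) : ℂ) * (𝓕 φ) y‖ₑ ≤
      ENNReal.ofReal (M * K) *
        (ENNReal.ofReal (4 * mulConst a) * dataNorm a F * wnorm (-a) φ) := by
  have hc := mulConst_nonneg a
  have hN : Nice Q := hF.of_le hQ (c := fun ξ => K * wt a ξ)
    (continuous_const.mul (continuous_wt ha1)) fun ξ => (h ξ).trans (le_of_eq (by ring))
  have hM : 0 ≤ M := by
    obtain ⟨-, A, B, z, hA, -, -, hAM, -⟩ := hb
    exact ((abs_nonneg _).trans (hA 0)).trans hAM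
  refine (enorm_pairing_mul_le ha ha1 hN.integrable (hN.memLp 2) hb φ).trans ?_
  rw [← mul_assoc]
  refine mul_le_mul_left ?_ _
  refine (mul_le_mul_right (bracket_le ha hF.1.aestronglyMeasurable hK h) _).trans (le_of_eq ?_)
  rw [← mul_assoc, ← mul_assoc, ← ENNReal.ofReal_mul (by positivity),
    ← ENNReal.ofReal_mul (by positivity)]
  congr 2; ring

/-- Minkowski's inequality over the parameter. Estimating a term of the operator thereby reduces to
bounding the integral of M·κ, that is, to counting powers of |α|. -/
lemma enorm_superpos_le (hF : Nice F) (ha : 0 < a) (ha1 : a < 1)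
    (hQ : Measurable fun x : P × Plane => Q x.1 x.2) {κ M : P → ℝ} (hκ : ∀ p, 0 ≤ κ p)
    (hκm : Measurable κ) (hMm : Measurable M)
    (hQκ : ∀ᵐ p ∂μ, ∀ ξ, ‖Q p ξ‖ ≤ κ p * (wt a ξ * ‖F ξ‖))
    (hM : ∀ᵐ p ∂μ, SlowCoeff a (b p) (M p)) {K : ℝ}
    (hK : ∫⁻ p, ENNReal.ofReal (M p * κ p) ∂μ ≤ ENNReal.ofReal K) (φ : 𝓢(Plane, ℂ)) :
    ‖∫ p, (∫ y, ((b p y * invF (Q p) y : ℝ) : ℂ) * (𝓕 φ) y) ∂μ‖ₑ ≤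
      ENNReal.ofReal (4 * mulConst a * K) * (dataNorm a F * wnorm (-a) φ) := by
  have hc := mulConst_nonneg a
  refine (enorm_integral_le_lintegral_enorm _).trans ?_
  calc _ ≤ ∫⁻ p, ENNReal.ofReal (M p * κ p) *
        (ENNReal.ofReal (4 * mulConst a) * dataNorm a F * wnorm (-a) φ) ∂μ := by
        refine lintegral_mono_ae ?_
        filter_upwards [hM, hQκ] with p hp hq
        exact enorm_pairing_le_dataNorm hF ha ha1 (hQ.comp measurable_prodMk_left) (hκ p) hq hp φ
    _ ≤ ENNReal.ofReal K * (ENNReal.ofReal (4 * mulConst a) * dataNorm a F * wnorm (-a) φ) := by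
        have hm : Measurable (fun p => ENNReal.ofReal (M p * κ p)) :=
          (hMm.mul hκm).ennreal_ofReal
        rw [lintegral_mul_const _ hm]
        exact mul_le_mul_left hK _
    _ = _ := by
        rw [← mul_assoc, ← mul_assoc, ← mul_assoc, mul_comm (4 * mulConst a),
          ENNReal.ofReal_mul' (q := 4 * mulConst a) (by positivity)]

end


/-! ### Functions with an integrable density -/

lemma hasFDerivAt_wave (ξ y : Plane) : HasFDerivAt (wave ξ)
    ((2 * Real.pi * Complex.I * wave ξ y) • (Complex.ofRealCLM.comp (innerSL ℝ ξ))) y := by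
  have h1 : HasFDerivAt (fun y : Plane => ((2 * Real.pi * inner ℝ ξ y : ℝ) : ℂ) * Complex.I)
      ((2 * Real.pi * Complex.I) • (Complex.ofRealCLM.comp (innerSL ℝ ξ))) y := by
    have h2 := (Complex.ofRealCLM.comp ((2 * Real.pi) • innerSL ℝ ξ)).hasFDerivAt (x := y)
    refine (h2.mul_const Complex.I).congr_fderiv ?_
    ext a
    simp
    ring
  refine h1.cexp.congr_fderiv ?_
  rw [smul_smul, mul_comm]
  rfl

lemma norm_wave_sub_one_le_rpow {b : ℝ} (hb : 0 ≤ b) (hb1 : b ≤ 1) (ξ y : Plane) :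
    ‖wave ξ y - 1‖ ≤ 2 * Real.pi * (‖ξ‖ * ‖y‖) ^ b := by
  have h1 := norm_wave_sub_one_le ξ y
  have h2 := norm_wave_sub_one_le_two ξ y
  have hx : 0 ≤ ‖ξ‖ * ‖y‖ := by positivity
  rcases le_or_gt (‖ξ‖ * ‖y‖) 1 with h | h
  · refine h1.trans ?_
    gcongr
    rcases hx.eq_or_lt with h0 | h0
    · rw [← h0]; positivity
    · simpa using Real.rpow_le_rpow_of_exponent_ge h0 h hb1
  · have := Real.one_le_rpow h.le hb
    nlinarith [Real.pi_gt_three]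

lemma norm_wave_taylor_le {b : ℝ} (hb : 0 ≤ b) (hb1 : b ≤ 1) (ξ y : Plane) :
    ‖wave ξ y - 1 - 2 * Real.pi * Complex.I * (inner ℝ ξ y : ℝ)‖ ≤
      4 * Real.pi ^ 2 * (‖ξ‖ * ‖y‖) ^ b * (‖ξ‖ * ‖y‖) := by
  set L : Plane →L[ℝ] ℂ := (2 * Real.pi * Complex.I) • (Complex.ofRealCLM.comp (innerSL ℝ ξ))
    with hL
  have hLa : ∀ a, L a = 2 * Real.pi * Complex.I * (inner ℝ ξ a : ℝ) := fun a => by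
    simp [hL]
  have h := Convex.norm_image_sub_le_of_norm_hasFDerivWithin_le (s := segment ℝ 0 y)
    (f := fun z => wave ξ z - L z)
    (f' := fun z => (2 * Real.pi * Complex.I * wave ξ z) • (Complex.ofRealCLM.comp (innerSL ℝ ξ)) - L)
    (C := 4 * Real.pi ^ 2 * (‖ξ‖ * ‖y‖) ^ b * ‖ξ‖)
    (fun z _ => ((hasFDerivAt_wave ξ z).sub L.hasFDerivAt).hasFDerivWithinAt) (fun z hz => ?_)
    (convex_segment 0 y) (left_mem_segment ℝ 0 y) (right_mem_segment ℝ 0 y)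
  · rw [← hLa]
    simp only [map_zero, sub_zero, wave_zero] at h
    refine le_trans (le_of_eq ?_) (h.trans (le_of_eq (by ring)))
    congr 1; ring
  · have h1 := norm_sub_le_of_mem_segment hz
    simp only [sub_zero] at h1
    refine ContinuousLinearMap.opNorm_le_bound _ (by positivity) fun a => ?_
    have e : ((2 * Real.pi * Complex.I * wave ξ z) • (Complex.ofRealCLM.comp (innerSL ℝ ξ)) - L) a =
        2 * Real.pi * Complex.I * (inner ℝ ξ a : ℝ) * (wave ξ z - 1) := by
      simp [hL]; ring
    rw [e, norm_mul, norm_mul, norm_mul, norm_mul, Complex.norm_I, Complex.norm_real,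
      Complex.norm_real, Real.norm_of_nonneg Real.pi_pos.le, Complex.norm_ofNat]
    calc 2 * Real.pi * 1 * ‖inner ℝ ξ a‖ * ‖wave ξ z - 1‖
        ≤ 2 * Real.pi * 1 * (‖ξ‖ * ‖a‖) * (2 * Real.pi * (‖ξ‖ * ‖y‖) ^ b) := by
          gcongr
          · exact norm_inner_le_norm ξ a
          · exact (norm_wave_sub_one_le_rpow hb hb1 ξ z).trans (by gcongr)
      _ = _ := by ring

/-- The density of the derivative in the direction `a`. -/
def dmul (a : Plane) (F : Plane → ℂ) (ξ : Plane) : ℂ :=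
  2 * Real.pi * Complex.I * (inner ℝ ξ a : ℝ) * F ξ

lemma norm_dmul_le (a : Plane) (F : Plane → ℂ) (ξ : Plane) :
    ‖dmul a F ξ‖ ≤ 2 * Real.pi * ‖ξ‖ * ‖a‖ * ‖F ξ‖ := by
  rw [dmul, norm_mul, norm_mul, norm_mul, norm_mul, Complex.norm_I, Complex.norm_real,
    Complex.norm_real, Real.norm_of_nonneg Real.pi_pos.le, Complex.norm_ofNat]
  have : ‖inner ℝ ξ a‖ ≤ ‖ξ‖ * ‖a‖ := norm_inner_le_norm ξ a
  calc 2 * Real.pi * 1 * ‖inner ℝ ξ a‖ * ‖F ξ‖ ≤ 2 * Real.pi * 1 * (‖ξ‖ * ‖a‖) * ‖F ξ‖ := by gcongr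
    _ = _ := by ring

lemma aestronglyMeasurable_dmul (a : Plane) {F : Plane → ℂ} (hF : AEStronglyMeasurable F) :
    AEStronglyMeasurable (dmul a F) := by
  have : Measurable fun ξ : Plane => (2 * Real.pi * Complex.I * (inner ℝ ξ a : ℝ) : ℂ) := by
    fun_prop
  exact this.aestronglyMeasurable.mul hF

/-- The density `F` is integrable with the weight `|ξ|^(1 + b)`. -/
def GradInt (b : ℝ) (F : Plane → ℂ) : Prop :=
  AEStronglyMeasurable F ∧ Integrable fun ξ => ‖ξ‖ ^ b * ‖ξ‖ * ‖F ξ‖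

/-- The function with density `F`, up to an affine function. -/
def repC (F : Plane → ℂ) (y : Plane) : ℂ :=
  ∫ ξ, (wave ξ y - 1 - 2 * Real.pi * Complex.I * (inner ℝ ξ y : ℝ)) * F ξ

/-- The real part of `repC F`. -/
def rep (F : Plane → ℂ) (y : Plane) : ℝ := (repC F y).re

section

variable {b : ℝ} {F : Plane → ℂ}

lemma GradInt.norm_wave_sub_one_mul_le (hb : 0 ≤ b) (hb1 : b ≤ 1) (a y ξ : Plane) :
    ‖(wave ξ y - 1) * dmul a F ξ‖ ≤
      4 * Real.pi ^ 2 * ‖y‖ ^ b * ‖a‖ * (‖ξ‖ ^ b * ‖ξ‖ * ‖F ξ‖) := by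
  rw [norm_mul]
  calc _ ≤ (2 * Real.pi * (‖ξ‖ * ‖y‖) ^ b) * (2 * Real.pi * ‖ξ‖ * ‖a‖ * ‖F ξ‖) := by
        gcongr
        · exact norm_wave_sub_one_le_rpow hb hb1 ξ y
        · exact norm_dmul_le a F ξ
    _ = _ := by rw [Real.mul_rpow (by positivity) (by positivity)]; ring

lemma GradInt.integrable_wave_sub_one_mul (hF : GradInt b F) (hb : 0 ≤ b) (hb1 : b ≤ 1)
    (a y : Plane) : Integrable fun ξ => (wave ξ y - 1) * dmul a F ξ := by
  refine (hF.2.const_mul (4 * Real.pi ^ 2 * ‖y‖ ^ b * ‖a‖)).mono' ?_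
    (.of_forall fun ξ => GradInt.norm_wave_sub_one_mul_le hb hb1 a y ξ)
  have : Measurable fun ξ : Plane => wave ξ y - 1 := by fun_prop
  exact this.aestronglyMeasurable.mul (aestronglyMeasurable_dmul a hF.1)

lemma GradInt.integrable_taylor (hF : GradInt b F) (hb : 0 ≤ b) (hb1 : b ≤ 1) (y : Plane) :
    Integrable fun ξ => (wave ξ y - 1 - 2 * Real.pi * Complex.I * (inner ℝ ξ y : ℝ)) * F ξ := by
  refine (hF.2.const_mul (4 * Real.pi ^ 2 * ‖y‖ ^ b * ‖y‖)).mono' ?_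
    (.of_forall fun ξ => ?_)
  · have : Measurable fun ξ : Plane =>
        (wave ξ y - 1 - 2 * Real.pi * Complex.I * (inner ℝ ξ y : ℝ)) := by fun_prop
    exact this.aestronglyMeasurable.mul hF.1
  · rw [norm_mul]
    calc _ ≤ 4 * Real.pi ^ 2 * (‖ξ‖ * ‖y‖) ^ b * (‖ξ‖ * ‖y‖) * ‖F ξ‖ := by
          gcongr; exact norm_wave_taylor_le hb hb1 ξ y
      _ = _ := by rw [Real.mul_rpow (by positivity) (by positivity)]; ring

/-- Differentiation under the integral sign: the derivative of the Taylor-corrected wave is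
dominated, locally uniformly in y, by a multiple of |ξ|^(1+b) |F|. -/
lemma GradInt.hasFDerivAt_repC (hF : GradInt b F) (hb : 0 ≤ b) (hb1 : b ≤ 1) (y : Plane) :
    ∃ L : Plane →L[ℝ] ℂ, HasFDerivAt (repC F) L y ∧
      ∀ a, L a = ∫ ξ, (wave ξ y - 1) * dmul a F ξ := by
  set F' : Plane → Plane → Plane →L[ℝ] ℂ := fun z ξ =>
    (2 * Real.pi * Complex.I * (wave ξ z - 1) * F ξ) • (Complex.ofRealCLM.comp (innerSL ℝ ξ))
    with hF'
  have happ : ∀ z ξ a, F' z ξ a = (wave ξ z - 1) * dmul a F ξ := fun z ξ a => by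
    simp [hF', dmul]; ring
  have hbd : ∀ z ξ, ‖F' z ξ‖ ≤ 4 * Real.pi ^ 2 * ‖z‖ ^ b * (‖ξ‖ ^ b * ‖ξ‖ * ‖F ξ‖) := by
    intro z ξ
    refine ContinuousLinearMap.opNorm_le_bound _ (by positivity) fun a => ?_
    rw [happ]
    refine (GradInt.norm_wave_sub_one_mul_le hb hb1 a z ξ).trans (le_of_eq (by ring))
  have hm : AEStronglyMeasurable (F' y) := by
    have h1 : AEStronglyMeasurable fun ξ => 2 * Real.pi * Complex.I * (wave ξ y - 1) * F ξ :=
      (by fun_prop : Measurable fun ξ : Plane =>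
        2 * Real.pi * Complex.I * (wave ξ y - 1)).aestronglyMeasurable.mul hF.1
    have h2 : Continuous fun ξ : Plane => Complex.ofRealCLM.comp (innerSL ℝ ξ) := by fun_prop
    exact h1.smul h2.aestronglyMeasurable
  have hbi := hF.2.const_mul (4 * Real.pi ^ 2 * (‖y‖ + 1) ^ b)
  have h := hasFDerivAt_integral_of_dominated_of_fderiv_le (𝕜 := ℝ) (μ := volume)
    (s := Metric.ball y 1) (x₀ := y)
    (F := fun z ξ => (wave ξ z - 1 - 2 * Real.pi * Complex.I * (inner ℝ ξ z : ℝ)) * F ξ)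
    (F' := F') (Metric.ball_mem_nhds y one_pos)
    (.of_forall fun z => (hF.integrable_taylor hb hb1 z).aestronglyMeasurable)
    (hF.integrable_taylor hb hb1 y) hm (.of_forall fun ξ z hz => ?_) hbi
    (.of_forall fun ξ z _ => ?_)
  · refine ⟨_, h, fun a => ?_⟩
    have hi : Integrable (F' y) := by
      refine (hF.2.const_mul (4 * Real.pi ^ 2 * ‖y‖ ^ b)).mono' hm (.of_forall (hbd y))
    rw [ContinuousLinearMap.integral_apply hi]
    simp only [happ]
  · refine (hbd z ξ).trans ?_
    have : ‖z‖ ≤ ‖y‖ + 1 := by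
      have h1 := norm_sub_norm_le z y
      have h2 := mem_ball_iff_norm.1 hz
      linarith
    gcongr
  · have h1 : HasFDerivAt (fun z : Plane => (2 * Real.pi * Complex.I * (inner ℝ ξ z : ℝ) : ℂ))
        ((2 * Real.pi * Complex.I) • (Complex.ofRealCLM.comp (innerSL ℝ ξ))) z :=
      ((2 * Real.pi * Complex.I) • (Complex.ofRealCLM.comp (innerSL ℝ ξ))).hasFDerivAt
    refine ((((hasFDerivAt_wave ξ z).sub_const 1).sub h1).mul_const (F ξ)).congr_fderiv ?_
    ext a
    simp [hF']
    ring

lemma GradInt.hasFDerivAt_rep (hF : GradInt b F) (hb : 0 ≤ b) (hb1 : b ≤ 1) (y : Plane) :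
    DifferentiableAt ℝ (rep F) y ∧
      ∀ a, fderiv ℝ (rep F) y a = (∫ ξ, (wave ξ y - 1) * dmul a F ξ).re := by
  obtain ⟨L, hL, hLa⟩ := hF.hasFDerivAt_repC hb hb1 y
  have h : HasFDerivAt (rep F) (Complex.reCLM.comp L) y :=
    Complex.reCLM.hasFDerivAt.comp y hL
  refine ⟨h.differentiableAt, fun a => ?_⟩
  rw [h.fderiv, ← hLa]; rfl

lemma GradInt.fderiv_rep_sub (hF : GradInt b F) (hb : 0 ≤ b) (hb1 : b ≤ 1) (y α a : Plane) :
    fderiv ℝ (rep F) y a - fderiv ℝ (rep F) (y - α) a =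
      invF (fun ξ => (1 - wave ξ (-α)) * dmul a F ξ) y := by
  rw [(hF.hasFDerivAt_rep hb hb1 y).2, (hF.hasFDerivAt_rep hb hb1 (y - α)).2, ← Complex.sub_re,
    ← integral_sub (hF.integrable_wave_sub_one_mul hb hb1 a y)
      (hF.integrable_wave_sub_one_mul hb hb1 a (y - α)), invF]
  congr 2; ext ξ
  rw [wave_sub ξ y α]; ring

/-- The Hölder constant of the gradient of `rep F`. -/
def holderConst (b : ℝ) (F : Plane → ℂ) : ℝ := 4 * Real.pi ^ 2 * ∫ ξ, ‖ξ‖ ^ b * ‖ξ‖ * ‖F ξ‖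

lemma GradInt.holderGrad (hF : GradInt b F) (hb : 0 < b) (hb1 : b ≤ 1) :
    HolderGrad b (holderConst b F) (rep F) := by
  have h0 : 0 ≤ holderConst b F := by
    have : 0 ≤ ∫ ξ, ‖ξ‖ ^ b * ‖ξ‖ * ‖F ξ‖ := integral_nonneg fun ξ => by positivity
    unfold holderConst; positivity
  have hle : ∀ x y, ‖fderiv ℝ (rep F) x - fderiv ℝ (rep F) y‖ ≤
      holderConst b F * ‖x - y‖ ^ b := by
    intro x y
    refine ContinuousLinearMap.opNorm_le_bound _ (by positivity) fun a => ?_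
    have e := hF.fderiv_rep_sub hb.le hb1 x (x - y) a
    rw [sub_sub_cancel] at e
    rw [sub_apply, e, Real.norm_eq_abs]
    refine (abs_invF_le x).trans ?_
    rw [holderConst, ← integral_const_mul, ← integral_mul_const, ← integral_mul_const]
    refine integral_mono_of_nonneg (.of_forall fun ξ => norm_nonneg _) ?_ (.of_forall fun ξ => ?_)
    · exact (((hF.2.const_mul _).mul_const _).mul_const _)
    · have := GradInt.norm_wave_sub_one_mul_le (F := F) hb.le hb1 a (-(x - y)) ξ
      rw [norm_mul, norm_sub_rev, ← norm_mul, norm_neg] at this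
      exact this.trans (le_of_eq (by ring))
  refine ⟨contDiff_one_iff_fderiv.2 ⟨fun y => (hF.hasFDerivAt_rep hb.le hb1 y).1, ?_⟩, h0, hle⟩
  refine continuous_iff_continuousAt.2 fun y => ?_
  rw [ContinuousAt, tendsto_iff_norm_sub_tendsto_zero]
  have h1 : Tendsto (fun x => holderConst b F * ‖x - y‖ ^ b) (𝓝 y) (𝓝 0) := by
    have : ContinuousAt (fun x => holderConst b F * ‖x - y‖ ^ b) y :=
      continuousAt_const.mul
        ((by fun_prop : Continuous fun x : Plane => ‖x - y‖).continuousAt.rpow_const (Or.inr hb.le))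
    simpa [ContinuousAt, Real.zero_rpow hb.ne'] using this
  exact squeeze_zero (fun x => norm_nonneg _) (fun x => hle x y) h1

lemma Nice.gradInt (hF : Nice F) (hb : 0 ≤ b) : GradInt b F := by
  have : Nice fun ξ => ((‖ξ‖ ^ b * ‖ξ‖ : ℝ) : ℂ) * F ξ := by
    have := hF.1
    refine hF.of_le (by fun_prop) (c := fun ξ => ‖ξ‖ ^ b * ‖ξ‖)
      ((continuous_norm.rpow_const fun ξ => Or.inr hb).mul continuous_norm) fun ξ => ?_
    rw [norm_mul, Complex.norm_real, Real.norm_of_nonneg (by positivity)]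
  refine ⟨hF.1.aestronglyMeasurable, this.integrable.norm.congr (.of_forall fun ξ => ?_)⟩
  simp only [norm_mul, Complex.norm_real]
  simp [abs_of_nonneg (Real.rpow_nonneg (norm_nonneg ξ) b)]

lemma measurable_dmul (a : Plane) (hF : Measurable F) : Measurable (dmul a F) := by
  unfold dmul; fun_prop

lemma nice_dmul (hF : Nice F) (a : Plane) : Nice (dmul a F) :=
  hF.of_le (measurable_dmul a hF.1) (c := fun ξ => 2 * Real.pi * ‖ξ‖ * ‖a‖) (by fun_prop)
    fun ξ => norm_dmul_le a F ξ

lemma Nice.invF_eq (hF : Nice F) (y : Plane) :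
    invF F y = rep F y + (∫ ξ, F ξ).re + (∫ ξ, dmul y F ξ).re := by
  have h1 := (hF.gradInt zero_le_one).integrable_taylor zero_le_one le_rfl y
  rw [rep, repC, invF, ← Complex.add_re, ← Complex.add_re, ← integral_add h1 hF.integrable,
    ← integral_add (f := fun ξ => (wave ξ y - 1 - 2 * Real.pi * Complex.I * (inner ℝ ξ y : ℝ)) * F ξ
      + F ξ) (h1.add hF.integrable) (nice_dmul hF y).integrable]
  congr 2; ext ξ
  rw [dmul]; ring

lemma Nice.hasFDerivAt_invF (hF : Nice F) (y : Plane) :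
    DifferentiableAt ℝ (invF F) y ∧ ∀ a, fderiv ℝ (invF F) y a = invF (dmul a F) y := by
  have hG := hF.gradInt zero_le_one
  set ℓ : Plane →ₗ[ℝ] ℝ :=
    { toFun := fun y => (∫ ξ, dmul y F ξ).re
      map_add' := fun x y => by
        rw [← Complex.add_re, ← integral_add (nice_dmul hF x).integrable (nice_dmul hF y).integrable]
        congr 2; ext ξ; simp only [dmul, inner_add_right]; push_cast; ring
      map_smul' := fun c y => by
        simp only [RingHom.id_apply, smul_eq_mul]
        rw [← Complex.re_ofReal_mul, ← integral_const_mul]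
        congr 2; ext ξ; simp only [dmul, inner_smul_right]; push_cast; ring } with hℓ
  have h1 := (hG.hasFDerivAt_rep zero_le_one le_rfl y)
  have h2 : HasFDerivAt (invF F) (fderiv ℝ (rep F) y + LinearMap.toContinuousLinearMap ℓ) y := by
    have : invF F = fun y => rep F y + (∫ ξ, F ξ).re + LinearMap.toContinuousLinearMap ℓ y := by
      ext y; exact hF.invF_eq y
    rw [this]
    exact (h1.1.hasFDerivAt.add_const _).add (LinearMap.toContinuousLinearMap ℓ).hasFDerivAt
  refine ⟨h2.differentiableAt, fun a => ?_⟩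
  rw [h2.fderiv]
  have e : (fderiv ℝ (rep F) y + LinearMap.toContinuousLinearMap ℓ) a =
    fderiv ℝ (rep F) y a + (∫ ξ, dmul a F ξ).re := rfl
  rw [e, h1.2, ← Complex.add_re, ← integral_add
    (hG.integrable_wave_sub_one_mul zero_le_one le_rfl a y) (nice_dmul hF a).integrable, invF]
  congr 2; ext ξ; ring

lemma Nice.contDiff_invF (hF : Nice F) : ContDiff ℝ 1 (invF F) := by
  rw [contDiff_one_iff_fderiv]
  refine ⟨fun y => (hF.hasFDerivAt_invF y).1, ?_⟩
  refine continuous_clm_apply.2 fun a => ?_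
  simp only [(hF.hasFDerivAt_invF _).2]
  exact continuous_invF (nice_dmul hF a).integrable

end


/-! ### The densities of the difference quotients -/

/-- The density of `α ↦ |α|^(-3) α · (∇f(y) - ∇f(y - α))`, where `f` has density `F`. -/
def dQ (F : Plane → ℂ) (α ξ : Plane) : ℂ := (1 - wave ξ (-α)) * dmul α F ξ / (‖α‖ : ℂ) ^ 3

lemma measurable_dQ {F : Plane → ℂ} (hF : Measurable F) :
    Measurable fun x : Plane × Plane => dQ F x.1 x.2 := by
  unfold dQ dmul; fun_prop

/-- The exponent b trades decay in α against powers of ξ. Below it is 1 near the origin, 1 - a/4 far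
away, and 0 when F already carries an additional derivative. -/
lemma norm_dQ_le {b : ℝ} (hb : 0 ≤ b) (hb1 : b ≤ 1) (F : Plane → ℂ) (α ξ : Plane) :
    ‖dQ F α ξ‖ ≤ 4 * Real.pi ^ 2 * ‖α‖ ^ (b - 2) * (‖ξ‖ ^ b * ‖ξ‖ * ‖F ξ‖) := by
  rcases eq_or_ne α 0 with rfl | hα
  · simp only [dQ, norm_zero, Complex.ofReal_zero, ne_eq, OfNat.ofNat_ne_zero, not_false_eq_true,
      zero_pow, div_zero]
    positivity
  have h := GradInt.norm_wave_sub_one_mul_le (F := F) hb hb1 α (-α) ξ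
  rw [norm_mul, norm_sub_rev, ← norm_mul, norm_neg] at h
  have hn : 0 < ‖α‖ := norm_pos_iff.2 hα
  rw [dQ, norm_div, norm_pow, Complex.norm_real, norm_norm, div_le_iff₀ (by positivity)]
  refine h.trans (le_of_eq ?_)
  have : ‖α‖ ^ b * ‖α‖ ^ 1 / ‖α‖ ^ 3 = ‖α‖ ^ (b - 2) := by
    rw [norm_pow_mul_rpow hα]; congr 1; norm_num; ring
  rw [← this]
  field_simp

lemma invF_div_const (Q : Plane → ℂ) (c : ℝ) (y : Plane) :
    invF (fun ξ => Q ξ / (c : ℂ)) y = invF Q y / c := by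
  rw [invF, invF, ← Complex.div_ofReal_re, ← integral_div]
  congr 2; ext ξ; ring

lemma GradInt.invF_dQ {b : ℝ} {F : Plane → ℂ} (hF : GradInt b F) (hb : 0 ≤ b) (hb1 : b ≤ 1)
    (α y : Plane) :
    invF (dQ F α) y = (fderiv ℝ (rep F) y α - fderiv ℝ (rep F) (y - α) α) / ‖α‖ ^ 3 := by
  rw [hF.fderiv_rep_sub hb hb1, ← invF_div_const]
  congr 1; ext ξ; rw [dQ]; push_cast; rfl

lemma nice_dQ {F : Plane → ℂ} (hF : Nice F) (α : Plane) : Nice (dQ F α) := by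
  have := hF.1
  exact hF.of_le (by unfold dQ dmul; fun_prop)
    (c := fun ξ => 4 * Real.pi ^ 2 * ‖α‖ ^ (1 - 2 : ℝ) * (‖ξ‖ ^ (1 : ℝ) * ‖ξ‖))
    (by simp only [Real.rpow_one]; fun_prop)
    fun ξ => (norm_dQ_le zero_le_one le_rfl F α ξ).trans (le_of_eq (by ring))

lemma superpos_dQ {F : Plane → ℂ} (hF : Nice F) {b : Plane → Plane → ℝ}
    (hb : Measurable fun x : Plane × Plane => b x.1 x.2) {A : ℝ} (hA : ∀ α y, |b α y| ≤ A)
    {S : Set Plane} {R : ℝ} (hS : S ⊆ Metric.ball 0 R) :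
    Superpos (volume.restrict S) b (dQ F) A (fun α => ‖α‖ ^ (-1 : ℝ))
      (fun ξ => 4 * Real.pi ^ 2 * (‖ξ‖ ^ 2 * ‖F ξ‖)) where
  measurable_b := hb
  measurable_Q := measurable_dQ hF.1
  abs_b_le := hA
  integrable_κ := (integrableOn_norm_rpow_ball (by norm_num) R).mono_set hS
  integrable_w := (hF.integrable_mul (c := fun ξ => ‖ξ‖ ^ 2) (by fun_prop)).const_mul _
  norm_Q_le := .of_forall fun α ξ => by
    refine (norm_dQ_le zero_le_one le_rfl F α ξ).trans (le_of_eq ?_)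
    rw [Real.rpow_one, show (1 - 2 : ℝ) = -1 by norm_num]; ring

lemma sq_le_wt (a : ℝ) (ξ : Plane) : ‖ξ‖ ^ 2 ≤ wt a ξ :=
  le_add_of_nonneg_right (by positivity)

lemma rpow_mul_le_wt (a : ℝ) (ξ : Plane) :
    ‖ξ‖ ^ (1 - a / 4) * ‖ξ‖ ≤ wt a ξ := by
  rcases eq_or_ne ξ 0 with rfl | hξ
  · simpa using wt_nonneg a 0
  · rw [← Real.rpow_add_one (norm_ne_zero_iff.2 hξ), show 1 - a / 4 + 1 = 2 - a / 4 by ring]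
    exact le_add_of_nonneg_left (by positivity)

lemma rpow_one_sub_mul {a c x : ℝ} (ha : 0 < a) (ha1 : a ≤ 1) (hc : 0 ≤ c) (hx : 0 ≤ x) :
    c ^ (1 - a) * (c * x) ^ a = c * x ^ a := by
  rw [Real.mul_rpow hc hx, ← mul_assoc, ← Real.rpow_add_of_nonneg hc (by linarith) ha.le,
    sub_add_cancel, Real.rpow_one]

/-! ### The terms with absolutely convergent estimates -/

section

variable {a : ℝ} {F : Plane → ℂ} {e : Plane}

/-- The sup bound is of size s² and the slope of size s²/|α|; the interpolation A^(1-a) B^a loses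
only |α|^(-a). -/
lemma slowCoeff_coefD_near (ha : 0 < a) (ha1 : a < 1) (he : ‖e‖ ≤ 1) (s : ℝ) {α : Plane}
    (hα : α ≠ 0) (h1 : ‖α‖ ≤ 1) :
    SlowCoeff a (fun y => coefD s e α y) (150 * s ^ 2 * ‖α‖ ^ (-a)) := by
  have hn : 0 < ‖α‖ := norm_pos_iff.2 hα
  have hp : 1 ≤ ‖α‖ ^ (-a) := Real.one_le_rpow_of_pos_of_le_one_of_nonpos hn h1 (by linarith)
  refine .of_jap (A := 150 * s ^ 2) (B := 150 * s ^ 2 * (1 / ‖α‖)) (z := α) (by fun_prop)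
    (fun y => (abs_coefD_le s he α y).trans ?_) (by positivity) (fun x y => ?_) ?_ ?_
  · calc 6 * s ^ 2 * min 1 (1 / ‖α‖) ≤ 6 * s ^ 2 * 1 := by gcongr; exact min_le_left _ _
      _ ≤ _ := by nlinarith [sq_nonneg s]
  · refine (abs_coefD_sub_le s he α x y).trans (le_of_eq (by ring))
  · exact le_mul_of_one_le_right (by positivity) hp
  · rw [rpow_one_sub_mul ha ha1.le (by positivity) (by positivity), one_div, Real.inv_rpow hn.le,
      Real.rpow_neg hn.le]

lemma slowCoeff_coefD_far (ha : 0 < a) (ha1 : a < 1) (he : ‖e‖ ≤ 1) (s : ℝ) (α : Plane) :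
    SlowCoeff a (fun y => coefD s e α y) (150 * s ^ 2 * ‖α‖ ^ (-1 : ℝ)) := by
  rw [Real.rpow_neg_one]
  refine .of_jap (A := 150 * s ^ 2 * ‖α‖⁻¹) (B := 150 * s ^ 2 * ‖α‖⁻¹) (z := α) (by fun_prop)
    (fun y => (abs_coefD_le s he α y).trans ?_) (by positivity) (fun x y => ?_) le_rfl ?_
  · calc 6 * s ^ 2 * min 1 (1 / ‖α‖) ≤ 6 * s ^ 2 * (1 / ‖α‖) := by gcongr; exact min_le_right _ _
      _ = 6 * (s ^ 2 * ‖α‖⁻¹) := by ring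
      _ ≤ 150 * (s ^ 2 * ‖α‖⁻¹) := by gcongr; norm_num
      _ = _ := by ring
  · refine (abs_coefD_sub_le s he α x y).trans (le_of_eq (by ring))
  · exact rpow_mul_rpow_le ha ha1 (by positivity) (by positivity) le_rfl le_rfl

/-- The difference is O(|α|) in sup norm, while its slope is merely O(1) and does not improve as α →
0. Interpolation still leaves the positive power 1 - a. -/
lemma slowCoeff_coef_near (ha : 0 < a) (ha1 : a < 1) (s : ℝ) {α : Plane}
    (hα : α ≠ 0) (h1 : ‖α‖ ≤ 1) :
    SlowCoeff a (fun y => coef s α y - coef₀ s ((1 / ‖α‖) • α) y)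
      (18 * s ^ 2 * ‖α‖ ^ (1 - a)) := by
  have hn : 0 < ‖α‖ := norm_pos_iff.2 hα
  have hr : ‖α‖ ^ (1 - a) = ‖α‖ * (1 / ‖α‖) ^ a := by
    rw [one_div, Real.inv_rpow hn.le, Real.rpow_sub hn, Real.rpow_one]; rfl
  refine .of_jap' (A := 18 * s ^ 2 * ‖α‖) (B := 18 * s ^ 2 * ‖α‖ * (1 / ‖α‖)) (by fun_prop)
    (fun y => (abs_coef_sub_coef₀_le s hα y).trans ?_) (by positivity) (fun x y => ?_) ?_ ?_
  · gcongr; norm_num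
  · have h2 := abs_coef_sub_le s α x y
    have h3 := abs_coef₀_sub_le s (norm_unit_le α) x y
    have e1 : coef s α x - coef₀ s ((1 / ‖α‖) • α) x - (coef s α y - coef₀ s ((1 / ‖α‖) • α) y) =
      (coef s α x - coef s α y) - (coef₀ s ((1 / ‖α‖) • α) x - coef₀ s ((1 / ‖α‖) • α) y) := by ring
    rw [e1]
    refine (abs_sub _ _).trans ((add_le_add h2 h3).trans (le_of_eq ?_))
    field_simp; ring
  · rw [hr]
    gcongr
    refine le_mul_of_one_le_right hn.le (Real.one_le_rpow ?_ ha.le)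
    rw [one_div]; exact one_le_inv₀ hn |>.2 h1
  · rw [rpow_one_sub_mul ha ha1.le (by positivity) (by positivity), hr, mul_assoc]

lemma ae_ball_ne_zero (R : ℝ) : ∀ᵐ α ∂(volume : Measure Plane).restrict (Metric.ball 0 R),
    α ≠ 0 ∧ ‖α‖ < R := by
  have h0 : ∀ᵐ α : Plane, α ≠ 0 := by simp [ae_iff]
  filter_upwards [ae_restrict_of_ae h0, ae_restrict_mem Metric.isOpen_ball.measurableSet]
    with α h1 h2
  exact ⟨h1, by simpa using h2⟩

lemma lintegral_mul_rpow_ball_le {p q : ℝ} (hpq : -2 < p + q) {c d : ℝ} (hc : 0 ≤ c)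
    (hd : 0 ≤ d) :
    ∫⁻ α in Metric.ball (0 : Plane) 1, ENNReal.ofReal (c * ‖α‖ ^ p * (d * ‖α‖ ^ q)) ≤
      ENNReal.ofReal (c * d * (2 * Real.pi / (p + q + 2))) := by
  calc _ ≤ ∫⁻ α in Metric.ball (0 : Plane) 1,
        ENNReal.ofReal (c * d) * ENNReal.ofReal (‖α‖ ^ (p + q)) := by
        refine lintegral_mono_ae ?_
        filter_upwards [ae_ball_ne_zero 1] with α hα
        rw [← ENNReal.ofReal_mul (by positivity), Real.rpow_add (norm_pos_iff.2 hα.1)]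
        refine le_of_eq ?_
        congr 1; ring
    _ ≤ _ := by
        rw [lintegral_const_mul _ (by fun_prop), ENNReal.ofReal_mul (p := c * d) (by positivity)]
        refine mul_le_mul_right ((lintegral_norm_rpow_ball hpq zero_le_one).trans ?_) _
        rw [Real.one_rpow, mul_one_div]

lemma lintegral_mul_rpow_ann_le {p q : ℝ} (hpq : p + q < -2) {c d : ℝ} (hc : 0 ≤ c)
    (hd : 0 ≤ d) (R : ℝ) :
    ∫⁻ α in ann R, ENNReal.ofReal (c * ‖α‖ ^ p * (d * ‖α‖ ^ q)) ≤
      ENNReal.ofReal (c * d * (2 * Real.pi / (-(p + q + 2)))) := by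
  calc _ ≤ ∫⁻ α in (Metric.ball (0 : Plane) 1)ᶜ,
        ENNReal.ofReal (c * ‖α‖ ^ p * (d * ‖α‖ ^ q)) :=
        lintegral_mono_set (ann_subset R)
    _ ≤ ∫⁻ α in (Metric.ball (0 : Plane) 1)ᶜ,
        ENNReal.ofReal (c * d) * ENNReal.ofReal (‖α‖ ^ (p + q)) := by
        refine setLIntegral_mono (by fun_prop) fun α hα => ?_
        have hn : 0 < ‖α‖ := one_pos.trans_le (by simpa using hα)
        rw [← ENNReal.ofReal_mul (by positivity), Real.rpow_add hn]
        refine le_of_eq ?_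
        congr 1; ring
    _ ≤ _ := by
        rw [lintegral_const_mul _ (by fun_prop), ENNReal.ofReal_mul (p := c * d) (by positivity),
          lintegral_norm_rpow_compl hpq, mul_one_div]

/-- Power count at the origin: |α|^(-a) from the coefficient and |α|^(-1) from the density, with -a
- 1 > -2. -/
lemma enorm_coefD_near_le (hF : Nice F) (ha : 0 < a) (ha1 : a < 1) (he : ‖e‖ ≤ 1) (s : ℝ)
    (φ : 𝓢(Plane, ℂ)) :
    ‖∫ α in Metric.ball (0 : Plane) 1,
      (∫ y, ((coefD s e α y * invF (dQ F α) y : ℝ) : ℂ) * (𝓕 φ) y)‖ₑ ≤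
      ENNReal.ofReal (4 * mulConst a * (150 * s ^ 2 * (4 * Real.pi ^ 2) *
        (2 * Real.pi / (-a + -1 + 2)))) * (dataNorm a F * wnorm (-a) φ) := by
  refine enorm_superpos_le (b := coefD s e) hF ha ha1 (measurable_dQ hF.1)
    (κ := fun α => 4 * Real.pi ^ 2 * ‖α‖ ^ (-1 : ℝ)) (fun α => by positivity) (by fun_prop)
    (M := fun α => 150 * s ^ 2 * ‖α‖ ^ (-a)) (by fun_prop) (.of_forall fun α ξ => ?_) ?_
    (lintegral_mul_rpow_ball_le (by linarith) (by positivity) (by positivity)) φ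
  · refine (norm_dQ_le zero_le_one le_rfl F α ξ).trans ?_
    rw [Real.rpow_one, show (1 - 2 : ℝ) = -1 by norm_num, ← sq]
    gcongr
    exact sq_le_wt a ξ
  · filter_upwards [ae_ball_ne_zero 1] with α hα
    exact slowCoeff_coefD_near ha ha1 he s hα.1 hα.2.le

/-- The coefficient decays like |α|^(-1), which alone would leave the borderline power -2 if
combined with the full Taylor bound b = 1. Taking b = 1 - a/4 gives -2 - a/4, paid for by the lower
weight |ξ|^(2-a/4). -/
lemma enorm_coefD_far_le (hF : Nice F) (ha : 0 < a) (ha1 : a < 1) (he : ‖e‖ ≤ 1) (s R : ℝ)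
    (φ : 𝓢(Plane, ℂ)) :
    ‖∫ α in ann R, (∫ y, ((coefD s e α y * invF (dQ F α) y : ℝ) : ℂ) * (𝓕 φ) y)‖ₑ ≤
      ENNReal.ofReal (4 * mulConst a * (150 * s ^ 2 * (4 * Real.pi ^ 2) *
        (2 * Real.pi / (-(-1 + (-1 - a / 4) + 2))))) * (dataNorm a F * wnorm (-a) φ) := by
  refine enorm_superpos_le (b := coefD s e) hF ha ha1 (measurable_dQ hF.1)
    (κ := fun α => 4 * Real.pi ^ 2 * ‖α‖ ^ (-1 - a / 4)) (fun α => by positivity) (by fun_prop)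
    (M := fun α => 150 * s ^ 2 * ‖α‖ ^ (-1 : ℝ)) (by fun_prop) (.of_forall fun α ξ => ?_)
    (.of_forall fun α => slowCoeff_coefD_far ha ha1 he s α)
    (lintegral_mul_rpow_ann_le (by linarith) (by positivity) (by positivity) R) φ
  refine (norm_dQ_le (b := 1 - a / 4) (by linarith) (by linarith) F α ξ).trans ?_
  rw [show 1 - a / 4 - 2 = -1 - a / 4 by ring]
  gcongr
  exact rpow_mul_le_wt a ξ

/-- The extra derivative uses up both powers of ξ, so the density costs |α|^(-2), which is not
integrable. The factor |α|^(1-a) gained by subtracting the limit along rays restores convergence. -/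
lemma enorm_coef_near_le (hF : Nice F) (ha : 0 < a) (ha1 : a < 1) (he : ‖e‖ ≤ 1) (s : ℝ)
    (φ : 𝓢(Plane, ℂ)) :
    ‖∫ α in Metric.ball (0 : Plane) 1, (∫ y, (((coef s α y - coef₀ s ((1 / ‖α‖) • α) y) *
      invF (dQ (dmul e F) α) y : ℝ) : ℂ) * (𝓕 φ) y)‖ₑ ≤
      ENNReal.ofReal (4 * mulConst a * (18 * s ^ 2 * (8 * Real.pi ^ 3) *
        (2 * Real.pi / (1 - a + -2 + 2)))) * (dataNorm a F * wnorm (-a) φ) := by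
  refine enorm_superpos_le (b := fun α y => coef s α y - coef₀ s ((1 / ‖α‖) • α) y) hF ha ha1
    (measurable_dQ (measurable_dmul e hF.1))
    (κ := fun α => 8 * Real.pi ^ 3 * ‖α‖ ^ (-2 : ℝ)) (fun α => by positivity) (by fun_prop)
    (M := fun α => 18 * s ^ 2 * ‖α‖ ^ (1 - a)) (by fun_prop) (.of_forall fun α ξ => ?_) ?_
    (lintegral_mul_rpow_ball_le (by linarith) (by positivity) (by positivity)) φ
  · refine (norm_dQ_le le_rfl zero_le_one (dmul e F) α ξ).trans ?_
    rw [Real.rpow_zero, zero_sub, one_mul]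
    calc _ ≤ 4 * Real.pi ^ 2 * ‖α‖ ^ (-2 : ℝ) *
          (‖ξ‖ * (2 * Real.pi * ‖ξ‖ * ‖e‖ * ‖F ξ‖)) := by
          gcongr; exact norm_dmul_le e F ξ
      _ ≤ 4 * Real.pi ^ 2 * ‖α‖ ^ (-2 : ℝ) * (‖ξ‖ * (2 * Real.pi * ‖ξ‖ * 1 * ‖F ξ‖)) := by gcongr
      _ = 8 * Real.pi ^ 3 * ‖α‖ ^ (-2 : ℝ) * (‖ξ‖ ^ 2 * ‖F ξ‖) := by ring
      _ ≤ _ := by gcongr; exact sq_le_wt a ξ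
  · filter_upwards [ae_ball_ne_zero 1] with α hα
    exact slowCoeff_coef_near ha ha1 s hα.1 hα.2.le

end


/-! ### A bounded oscillatory integral -/

/-- The function `x ↦ ∫₀¹ sin(x r) / r dr`. -/
def sinInt (x : ℝ) : ℝ := ∫ r in Set.Ioo (0 : ℝ) 1, Real.sin (x * r) / r

lemma abs_sin_mul_div_le (x r : ℝ) : |Real.sin (x * r) / r| ≤ |x| := by
  rcases eq_or_ne r 0 with rfl | hr
  · simp
  · have : 0 < |r| := abs_pos.2 hr
    rw [abs_div, div_le_iff₀ this, ← abs_mul]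
    exact Real.abs_sin_le_abs

lemma abs_sinInt_le_of_abs_le_one {x : ℝ} (hx : |x| ≤ 1) : |sinInt x| ≤ 1 := by
  have := norm_setIntegral_le_of_norm_le_const (μ := volume) (s := Set.Ioo (0 : ℝ) 1)
    (f := fun r => Real.sin (x * r) / r) (C := 1) (by simp)
    (fun r _ => (abs_sin_mul_div_le x r).trans hx)
  simpa [sinInt] using this

/-- One integration by parts: the boundary terms are at most 1 each, and the remaining integral of
1/(x r²) over r ≥ 1/x is at most 1. -/
lemma abs_integral_sin_div_le {x : ℝ} (hx : 1 < x) :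
    |∫ r in x⁻¹..1, Real.sin (x * r) / r| ≤ 3 := by
  have hx0 : 0 < x := one_pos.trans hx
  have hi : x⁻¹ ≤ 1 := inv_le_one_of_one_le₀ hx.le
  have hpos : ∀ r ∈ Set.uIcc x⁻¹ 1, 0 < r := fun r hr => by
    rw [Set.uIcc_of_le hi] at hr
    exact (inv_pos.2 hx0).trans_le hr.1
  have hd : ∀ r ∈ Set.uIcc x⁻¹ 1, HasDerivAt (fun r => -(Real.cos (x * r) / (x * r)))
      (Real.sin (x * r) / r + Real.cos (x * r) / x * r ^ (-2 : ℤ)) r := by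
    intro r hr
    have hr0 := hpos r hr
    have h1 : HasDerivAt (fun r => x * r) x r := by simpa using (hasDerivAt_id r).const_mul x
    refine ((h1.cos.fun_div h1 (by positivity)).fun_neg).congr_deriv ?_
    rw [show (-2 : ℤ) = -(2 : ℕ) by norm_num, zpow_neg, zpow_natCast]
    field_simp
    ring
  have c1 : ContinuousOn (fun r => Real.sin (x * r) / r) (Set.uIcc x⁻¹ 1) :=
    (by fun_prop : Continuous fun r => Real.sin (x * r)).continuousOn.div continuousOn_id
      fun r hr => (hpos r hr).ne'
  have c0 : ContinuousOn (fun r : ℝ => r ^ (-2 : ℤ)) (Set.uIcc x⁻¹ 1) :=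
    continuousOn_id.zpow₀ _ fun r hr => Or.inl (hpos r hr).ne'
  have c2 : ContinuousOn (fun r => Real.cos (x * r) / x * r ^ (-2 : ℤ)) (Set.uIcc x⁻¹ 1) :=
    (by fun_prop : Continuous fun r => Real.cos (x * r) / x).continuousOn.mul c0
  have h := intervalIntegral.integral_eq_sub_of_hasDerivAt hd (c1.add c2).intervalIntegrable
  rw [intervalIntegral.integral_add c1.intervalIntegrable c2.intervalIntegrable] at h
  have h2 : |∫ r in x⁻¹..1, Real.cos (x * r) / x * r ^ (-2 : ℤ)| ≤
      ∫ r in x⁻¹..1, 1 / x * r ^ (-2 : ℤ) := by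
    refine intervalIntegral.norm_integral_le_of_norm_le
      (f := fun r => Real.cos (x * r) / x * r ^ (-2 : ℤ)) (μ := volume) hi (.of_forall fun r hr => ?_)
      (c0.intervalIntegrable.const_mul (1 / x))
    have hr0 : 0 < r := (inv_pos.2 hx0).trans hr.1
    rw [Real.norm_eq_abs, abs_mul, abs_div, abs_of_pos hx0,
      abs_of_pos (a := r ^ (-2 : ℤ)) (by positivity)]
    gcongr
    exact Real.abs_cos_le_one _
  rw [intervalIntegral.integral_const_mul, integral_zpow
    (Or.inr ⟨by norm_num, fun h0 => (hpos 0 h0).ne rfl⟩)] at h2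
  have h3 : 1 / x * ((1 ^ ((-2 : ℤ) + 1) - x⁻¹ ^ ((-2 : ℤ) + 1)) / (((-2 : ℤ) : ℝ) + 1)) ≤ 1 := by
    norm_num
    field_simp
    linarith
  have h4 : |Real.cos (x * 1) / (x * 1)| ≤ 1 := by
    rw [abs_div, mul_one, abs_of_pos hx0, div_le_one hx0]
    exact (Real.abs_cos_le_one _).trans hx.le
  have h5 : |Real.cos (x * x⁻¹) / (x * x⁻¹)| ≤ 1 := by
    rw [mul_inv_cancel₀ hx0.ne', div_one]; exact Real.abs_cos_le_one _
  have h6 := h2.trans h3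
  rw [abs_le] at *
  constructor <;> linarith [h4.1, h4.2, h5.1, h5.2, h6.1, h6.2]

lemma sinInt_neg (x : ℝ) : sinInt (-x) = -sinInt x := by
  simp [sinInt, neg_div, integral_neg]

lemma abs_sinInt_le (x : ℝ) : |sinInt x| ≤ 4 := by
  have key : ∀ x : ℝ, 1 < x → |sinInt x| ≤ 4 := by
    intro x hx
    have hx0 : 0 < x := one_pos.trans hx
    have hi : x⁻¹ ≤ 1 := inv_le_one_of_one_le₀ hx.le
    have hm : Measurable fun r : ℝ => Real.sin (x * r) / r := by fun_prop
    have hint : ∀ p q : ℝ, IntervalIntegrable (fun r => Real.sin (x * r) / r) volume p q :=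
      fun p q => (intervalIntegrable_const (c := |x|)).mono_fun hm.aestronglyMeasurable
        (.of_forall fun r => by
          simp only [Real.norm_eq_abs, abs_abs]; exact abs_sin_mul_div_le x r)
    have e : sinInt x = ∫ r in (0 : ℝ)..1, Real.sin (x * r) / r := by
      rw [sinInt, intervalIntegral.integral_of_le zero_le_one,
        setIntegral_congr_set Ioo_ae_eq_Ioc]
    rw [e, ← intervalIntegral.integral_add_adjacent_intervals (hint 0 x⁻¹) (hint x⁻¹ 1)]
    have h1 : |∫ r in (0 : ℝ)..x⁻¹, Real.sin (x * r) / r| ≤ |x| * |x⁻¹ - 0| :=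
      intervalIntegral.norm_integral_le_of_norm_le_const
        (f := fun r => Real.sin (x * r) / r) fun r _ => abs_sin_mul_div_le x r
    rw [sub_zero, ← abs_mul, mul_inv_cancel₀ hx0.ne', abs_one] at h1
    exact (abs_add_le _ _).trans (by linarith [abs_integral_sin_div_le hx])
  rcases le_or_gt |x| 1 with h | h
  · exact (abs_sinInt_le_of_abs_le_one h).trans (by norm_num)
  · rcases lt_abs.1 h with h | h
    · exact key x h
    · rw [← neg_neg x, sinInt_neg, abs_neg]; exact key _ h

lemma measurable_sinInt : Measurable sinInt := by
  have : Measurable fun p : ℝ × ℝ => Real.sin (p.1 * p.2) / p.2 := by fun_prop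
  exact this.stronglyMeasurable.integral_prod_right'.measurable

@[fun_prop] lemma measurable_sinInt_comp {X : Type*} [MeasurableSpace X] {f : X → ℝ}
    (hf : Measurable f) : Measurable fun x => sinInt (f x) := measurable_sinInt.comp hf

/-! ### The principal part near the diagonal -/

/-- The density of the integral of the symmetrized difference quotients over a ray. -/
def sQ (G : Plane → ℂ) (θ ξ : Plane) : ℂ :=
  ((-(2 * Real.pi * inner ℝ ξ θ * sinInt (2 * Real.pi * inner ℝ ξ θ)) : ℝ) : ℂ) * G ξ

lemma norm_sQ_le (G : Plane → ℂ) {θ : Plane} (hθ : ‖θ‖ ≤ 1) (ξ : Plane) :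
    ‖sQ G θ ξ‖ ≤ 8 * Real.pi * (‖ξ‖ * ‖G ξ‖) := by
  have h1 : |inner ℝ ξ θ| ≤ ‖ξ‖ :=
    (abs_real_inner_le_norm _ _).trans (mul_le_of_le_one_right (norm_nonneg _) hθ)
  rw [sQ, norm_mul, Complex.norm_real, Real.norm_eq_abs, abs_neg, abs_mul, abs_mul,
    abs_of_pos (a := 2 * Real.pi) (by positivity)]
  calc _ ≤ 2 * Real.pi * ‖ξ‖ * 4 * ‖G ξ‖ := by gcongr; exact abs_sinInt_le _
    _ = _ := by ring

/-- The density of the symmetrized difference quotients. -/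
def symQ (G : Plane → ℂ) (α ξ : Plane) : ℂ :=
  ((-(2 * Real.pi * inner ℝ ξ α * Real.sin (2 * Real.pi * inner ℝ ξ α)) / ‖α‖ ^ 3 : ℝ) : ℂ) * G ξ

/-- Symmetrisation replaces 1 - e^(-2πiξ·α) by a sine: the even part of the wave, which would make
the radial integral grow logarithmically in |ξ|, drops out. -/
lemma dQ_add_dQ_neg (G : Plane → ℂ) (α ξ : Plane) :
    dQ G α ξ + dQ G (-α) ξ = 2 * symQ G α ξ := by
  have h : wave ξ α - wave ξ (-α) =
      2 * Complex.I * (Real.sin (2 * Real.pi * inner ℝ ξ α) : ℂ) := by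
    rw [wave, wave, inner_neg_right, Complex.ofReal_sin, Complex.sin]
    have : Complex.I * Complex.I = -1 := Complex.I_mul_I
    push_cast
    rw [show 2 * Complex.I * ((Complex.exp (-(2 * Real.pi * (inner ℝ ξ α : ℝ)) * Complex.I) -
      Complex.exp (2 * Real.pi * (inner ℝ ξ α : ℝ) * Complex.I)) * Complex.I / 2) =
      (Complex.I * Complex.I) * (Complex.exp (-(2 * Real.pi * (inner ℝ ξ α : ℝ)) * Complex.I) -
      Complex.exp (2 * Real.pi * (inner ℝ ξ α : ℝ) * Complex.I)) by ring, this]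
    ring_nf
  have h2 : dQ G α ξ + dQ G (-α) ξ = (wave ξ α - wave ξ (-α)) *
      (2 * Real.pi * Complex.I * (inner ℝ ξ α : ℝ) * G ξ) / (‖α‖ : ℂ) ^ 3 := by
    simp only [dQ, dmul, norm_neg, neg_neg, inner_neg_right]
    push_cast
    ring
  rw [h2, h, symQ]
  have : Complex.I * Complex.I = -1 := Complex.I_mul_I
  push_cast
  linear_combination (4 * Real.pi * (inner ℝ ξ α : ℝ) *
    Complex.sin (2 * Real.pi * (inner ℝ ξ α : ℝ)) * G ξ / (‖α‖ : ℂ) ^ 3) * this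

lemma invF_add {P Q : Plane → ℂ} (hP : Integrable P) (hQ : Integrable Q) (y : Plane) :
    invF (fun ξ => P ξ + Q ξ) y = invF P y + invF Q y := by
  rw [invF, invF, invF, ← Complex.add_re,
    ← integral_add (integrable_wave_mul hP y) (integrable_wave_mul hQ y)]
  congr 2; ext ξ; ring

lemma invF_const_mul (c : ℝ) (Q : Plane → ℂ) (y : Plane) :
    invF (fun ξ => (c : ℂ) * Q ξ) y = c * invF Q y := by
  rw [invF, invF, ← Complex.re_ofReal_mul, ← integral_const_mul]
  congr 2; ext ξ; ring

lemma Nice.invF_symQ {G : Plane → ℂ} (hG : Nice G) (α y : Plane) :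
    invF (dQ G α) y + invF (dQ G (-α)) y = 2 * invF (symQ G α) y := by
  rw [← invF_add (nice_dQ hG α).integrable (nice_dQ hG (-α)).integrable, ← invF_const_mul]
  congr 1; ext ξ
  rw [dQ_add_dQ_neg]; simp

/-- Integration of the symmetrized difference quotients over a ray. -/
lemma Nice.integral_invF_symQ {G : Plane → ℂ} (hG : Nice G) (θ : Metric.sphere (0 : Plane) 1)
    (y : Plane) :
    ∫ r in Set.Ioo (0 : ℝ) 1, r * invF (symQ G (r • (θ : Plane))) y = invF (sQ G θ) y := by
  have hθ : ‖(θ : Plane)‖ = 1 := by simp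
  have hGm := hG.1
  set H : ℝ → Plane → ℂ := fun r ξ => wave ξ y *
    (((-(2 * Real.pi * inner ℝ ξ (θ : Plane)) : ℝ) : ℂ) *
      ((Real.sin (2 * Real.pi * inner ℝ ξ (θ : Plane) * r) / r : ℝ) : ℂ) * G ξ) with hH
  have hHm : Measurable fun p : ℝ × Plane => H p.1 p.2 := by simp only [hH]; fun_prop
  have e1 : ∀ r ∈ Set.Ioo (0 : ℝ) 1,
      r * invF (symQ G (r • (θ : Plane))) y = (∫ ξ, H r ξ).re := by
    intro r hr
    have hr0 := hr.1
    rw [← invF_const_mul, invF]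
    congr 2; ext ξ
    simp only [hH, symQ, inner_smul_right, norm_smul_sphere hr0.le]
    rw [show 2 * Real.pi * (r * inner ℝ ξ (θ : Plane)) =
      2 * Real.pi * inner ℝ ξ (θ : Plane) * r by ring]
    have : (r : ℂ) ≠ 0 := by exact_mod_cast hr0.ne'
    push_cast
    field_simp
  have hint : Integrable (fun p : ℝ × Plane => H p.1 p.2)
      ((volume.restrict (Set.Ioo 0 1)).prod volume) := by
    have h2 := hG.integrable_mul (c := fun ξ => 4 * Real.pi ^ 2 * ‖ξ‖ ^ 2) (by fun_prop)
    have h3 := (integrable_const (1 : ℝ)).mul_prod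
      (μ := (volume : Measure ℝ).restrict (Set.Ioo 0 1)) h2
    refine h3.mono' hHm.aestronglyMeasurable (.of_forall fun p => ?_)
    have h1 : |inner ℝ p.2 (θ : Plane)| ≤ ‖p.2‖ := by
      simpa [hθ] using abs_real_inner_le_norm p.2 (θ : Plane)
    have h4 := abs_sin_mul_div_le (2 * Real.pi * inner ℝ p.2 (θ : Plane)) p.1
    rw [abs_mul, abs_of_pos (a := 2 * Real.pi) (by positivity)] at h4
    simp only [hH]
    rw [norm_mul, norm_wave, one_mul, norm_mul, norm_mul, Complex.norm_real, Complex.norm_real,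
      Real.norm_eq_abs, Real.norm_eq_abs, abs_neg, abs_mul,
      abs_of_pos (a := 2 * Real.pi) (by positivity), one_mul]
    calc _ ≤ 2 * Real.pi * ‖p.2‖ * (2 * Real.pi * ‖p.2‖) * ‖G p.2‖ := by
          gcongr
          exact h4.trans (by gcongr)
      _ = _ := by ring
  rw [setIntegral_congr_fun measurableSet_Ioo e1]
  have h5 := integral_integral_swap (f := H) hint
  have h6 : ∫ r in Set.Ioo (0 : ℝ) 1, (∫ ξ, H r ξ).re =
      (∫ r in Set.Ioo (0 : ℝ) 1, ∫ ξ, H r ξ).re := by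
    exact integral_re hint.integral_prod_left
  rw [h6, h5, invF]
  congr 2; ext ξ
  simp only [hH]
  rw [integral_const_mul, integral_mul_const, integral_const_mul, sQ, integral_complex_ofReal,
    ← sinInt]
  push_cast
  ring

lemma coef₀_neg (s : ℝ) (θ y : Plane) : coef₀ s (-θ) y = coef₀ s θ y := by
  rw [coef₀, coef₀, inner_neg_right, mul_neg, nl_neg]

/-- `coef₀` is even and constant along rays. Evenness allows the density to be symmetrised under α ↦
-α, and constancy lets the coefficient leave the radial integral, which is then evaluated in closed
form through `sinInt`. -/
lemma Nice.integral_coef₀ {G : Plane → ℂ} (hG : Nice G) (s : ℝ) (y : Plane) :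
    ∫ α in Metric.ball (0 : Plane) 1, coef₀ s ((1 / ‖α‖) • α) y * invF (dQ G α) y =
      ∫ θ : Metric.sphere (0 : Plane) 1, coef₀ s θ y * invF (sQ G θ) y ∂arc := by
  have hS := (superpos_dQ hG (b := fun α y => coef₀ s ((1 / ‖α‖) • α) y) (by fun_prop)
    (A := 3 * s ^ 2) (fun α y => abs_coef₀_le s (norm_unit_le α) y) (S := Metric.ball 0 1)
    (R := 1) subset_rfl).integrable y
  have hS' := hS
  rw [← IntegrableOn, ← integrable_indicator_iff Metric.isOpen_ball.measurableSet] at hS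
  have hneg := hS.comp_neg
  have e1 : ∀ α, (Metric.ball (0 : Plane) 1).indicator
      (fun α => coef₀ s ((1 / ‖α‖) • α) y * invF (symQ G α) y) α = 1 / 2 *
      ((Metric.ball (0 : Plane) 1).indicator
        (fun α => coef₀ s ((1 / ‖α‖) • α) y * invF (dQ G α) y) α +
      (Metric.ball (0 : Plane) 1).indicator
        (fun α => coef₀ s ((1 / ‖α‖) • α) y * invF (dQ G α) y) (-α)) := by
    intro α
    simp only [Set.indicator, Metric.mem_ball, dist_zero_right, norm_neg, smul_neg, coef₀_neg]
    split_ifs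
    · linear_combination (-(1 / 2) * coef₀ s ((1 / ‖α‖) • α) y) * hG.invF_symQ α y
    · simp
  have hi : Integrable ((Metric.ball (0 : Plane) 1).indicator
      (fun α => coef₀ s ((1 / ‖α‖) • α) y * invF (symQ G α) y)) := by
    refine ((hS.add hneg).const_mul (1 / 2)).congr (.of_forall fun α => ?_)
    exact (e1 α).symm
  have e2 : ∫ α in Metric.ball (0 : Plane) 1, coef₀ s ((1 / ‖α‖) • α) y * invF (dQ G α) y =
      ∫ α, (Metric.ball (0 : Plane) 1).indicator
        (fun α => coef₀ s ((1 / ‖α‖) • α) y * invF (symQ G α) y) α := by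
    simp only [e1]
    rw [integral_const_mul, integral_add hS hneg, integral_neg_eq_self
      ((Metric.ball (0 : Plane) 1).indicator
        (fun α => coef₀ s ((1 / ‖α‖) • α) y * invF (dQ G α) y)),
      integral_indicator Metric.isOpen_ball.measurableSet]
    ring
  rw [e2, integral_polar hi]
  refine integral_congr_ae (.of_forall fun θ => ?_)
  simp only
  rw [← hG.integral_invF_symQ θ y, ← integral_const_mul]
  have e3 : ∀ r ∈ Set.Ioi (0 : ℝ), r • (Metric.ball (0 : Plane) 1).indicator
      (fun α => coef₀ s ((1 / ‖α‖) • α) y * invF (symQ G α) y) (r • (θ : Plane)) =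
      (Set.Ioo (0 : ℝ) 1).indicator
        (fun r => coef₀ s θ y * (r * invF (symQ G (r • (θ : Plane))) y)) r := by
    intro r hr
    have hr0 : 0 < r := hr
    simp only [Set.indicator, Metric.mem_ball, dist_zero_right, norm_smul_sphere hr0.le,
      Set.mem_Ioo, hr0, true_and, smul_smul, one_div_mul_cancel hr0.ne', one_smul, smul_eq_mul]
    split_ifs
    · ring
    · simp
  rw [setIntegral_congr_fun measurableSet_Ioi e3, setIntegral_indicator measurableSet_Ioo,
    Set.inter_eq_right.2 Set.Ioo_subset_Ioi_self]

instance : IsFiniteMeasure arc := ⟨by rw [arc_univ]; exact ENNReal.ofReal_lt_top⟩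

lemma lintegral_arc_const (c : ℝ) :
    ∫⁻ _ : Metric.sphere (0 : Plane) 1, ENNReal.ofReal c ∂arc =
      ENNReal.ofReal (c * (2 * Real.pi)) := by
  rw [lintegral_const, arc_univ, ENNReal.ofReal_mul' (q := 2 * Real.pi) (by positivity)]

lemma Nice.superpos_sQ {G : Plane → ℂ} (hG : Nice G) (s : ℝ) :
    Superpos arc (fun θ : Metric.sphere (0 : Plane) 1 => coef₀ s θ)
      (fun θ : Metric.sphere (0 : Plane) 1 => sQ G θ) (3 * s ^ 2) (fun _ => 1)
      (fun ξ => 8 * Real.pi * (‖ξ‖ * ‖G ξ‖)) where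
  measurable_b := by fun_prop
  measurable_Q := by have := hG.1; unfold sQ; fun_prop
  abs_b_le := fun θ y => abs_coef₀_le s (by simp) y
  integrable_κ := integrable_const _
  integrable_w := (hG.integrable_mul (c := fun ξ => ‖ξ‖) (by fun_prop)).const_mul _
  norm_Q_le := .of_forall fun θ ξ => by rw [one_mul]; exact norm_sQ_le G (by simp) ξ

/-- Boundedness of `sinInt` makes the density on each ray O(|ξ|² |F|); without it a logarithm of |ξ|
would be lost. -/
lemma enorm_coef₀_le {a : ℝ} {F : Plane → ℂ} {e : Plane} (hF : Nice F) (ha : 0 < a) (ha1 : a < 1)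
    (he : ‖e‖ ≤ 1) (s : ℝ) (φ : 𝓢(Plane, ℂ)) :
    ‖∫ θ : Metric.sphere (0 : Plane) 1, (∫ y, ((coef₀ s θ y *
      invF (sQ (dmul e F) θ) y : ℝ) : ℂ) * (𝓕 φ) y) ∂arc‖ₑ ≤
      ENNReal.ofReal (4 * mulConst a * (6 * s ^ 2 * (16 * Real.pi ^ 2) * (2 * Real.pi))) *
        (dataNorm a F * wnorm (-a) φ) := by
  refine enorm_superpos_le (b := fun θ : Metric.sphere (0 : Plane) 1 => coef₀ s θ)
    (Q := fun θ : Metric.sphere (0 : Plane) 1 => sQ (dmul e F) θ) hF ha ha1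
    ((nice_dmul hF e).superpos_sQ s).measurable_Q
    (κ := fun _ => 16 * Real.pi ^ 2) (fun θ => by positivity) (by fun_prop)
    (M := fun _ => 6 * s ^ 2) (by fun_prop) (.of_forall fun θ ξ => ?_) (.of_forall fun θ => ?_)
    (lintegral_arc_const _).le φ
  · refine (norm_sQ_le (dmul e F) (by simp) ξ).trans ?_
    calc _ ≤ 8 * Real.pi * (‖ξ‖ * (2 * Real.pi * ‖ξ‖ * 1 * ‖F ξ‖)) := by
          gcongr; exact (norm_dmul_le e F ξ).trans (by gcongr)
      _ = 16 * Real.pi ^ 2 * (‖ξ‖ ^ 2 * ‖F ξ‖) := by ring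
      _ ≤ _ := by gcongr; exact sq_le_wt a ξ
  · have hθ : ‖(θ : Plane)‖ ≤ 1 := by simp
    refine .of_jap' (A := 6 * s ^ 2) (B := 6 * s ^ 2) (by fun_prop)
      (fun y => (abs_coef₀_le s hθ y).trans (by nlinarith [sq_nonneg s])) (by positivity)
      (fun x y => abs_coef₀_sub_le s hθ x y) le_rfl
      (rpow_mul_rpow_le ha ha1 (by positivity) (by positivity) le_rfl le_rfl)


/-! ### The principal part far from the diagonal -/

/-- The density of the second difference quotient. -/
def tQ (G : Plane → ℂ) (α ξ : Plane) : ℂ := (1 - wave ξ (-α)) * G ξ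

lemma norm_tQ_le_two (G : Plane → ℂ) (α ξ : Plane) : ‖tQ G α ξ‖ ≤ 2 * ‖G ξ‖ := by
  rw [tQ, norm_mul, norm_sub_rev]
  gcongr
  exact norm_wave_sub_one_le_two _ _

/-- The exponent 1 - a/4 stays below 1, so that division by |α|³ leaves a power integrable at
infinity. -/
lemma norm_tQ_dmul_le {a : ℝ} (ha : 0 < a) (ha1 : a < 1) (F : Plane → ℂ) {e : Plane}
    (he : ‖e‖ ≤ 1) (α ξ : Plane) :
    ‖tQ (dmul e F) α ξ‖ ≤ 4 * Real.pi ^ 2 * ‖α‖ ^ (1 - a / 4) * (wt a ξ * ‖F ξ‖) := by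
  have h1 := norm_wave_sub_one_le_rpow (b := 1 - a / 4) (by linarith) (by linarith) ξ (-α)
  rw [norm_neg, Real.mul_rpow (by positivity) (by positivity)] at h1
  rw [tQ, norm_mul, norm_sub_rev]
  calc _ ≤ (2 * Real.pi * (‖ξ‖ ^ (1 - a / 4) * ‖α‖ ^ (1 - a / 4))) *
        (2 * Real.pi * ‖ξ‖ * 1 * ‖F ξ‖) := by
        gcongr
        exact (norm_dmul_le e F ξ).trans (by gcongr)
    _ = 4 * Real.pi ^ 2 * ‖α‖ ^ (1 - a / 4) * (‖ξ‖ ^ (1 - a / 4) * ‖ξ‖ * ‖F ξ‖) := by ring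
    _ ≤ _ := by gcongr; exact rpow_mul_le_wt a ξ

lemma Nice.superpos_bd {G : Plane → ℂ} (hG : Nice G) (s : ℝ) {r : ℝ} (hr : 1 ≤ r) :
    Superpos arc (fun θ : Metric.sphere (0 : Plane) 1 => coef s (r • (θ : Plane)))
      (fun (θ : Metric.sphere (0 : Plane) 1) ξ => tQ G (r • (θ : Plane)) ξ / (r : ℂ)) (3 * s ^ 2)
      (fun _ => 1) (fun ξ => 2 * ‖G ξ‖) where
  measurable_b := by fun_prop
  measurable_Q := by have := hG.1; unfold tQ; fun_prop
  abs_b_le := fun θ y => abs_coef_le s _ y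
  integrable_κ := integrable_const _
  integrable_w := hG.integrable.norm.const_mul 2
  norm_Q_le := .of_forall fun θ ξ => by
    rw [one_mul, norm_div, Complex.norm_real, Real.norm_of_nonneg (by linarith)]
    exact (div_le_self (norm_nonneg _) hr).trans (norm_tQ_le_two _ _ _)

lemma slowCoeff_coef {a : ℝ} (ha : 0 < a) (ha1 : a < 1) (s : ℝ) (α : Plane) :
    SlowCoeff a (fun y => coef s α y) (12 * s ^ 2) :=
  .of_jap' (A := 12 * s ^ 2) (B := 12 * s ^ 2) (by fun_prop)
    (fun y => (abs_coef_le s α y).trans (by nlinarith [sq_nonneg s])) (by positivity)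
    (fun x y => abs_coef_sub_le s α x y) le_rfl
    (rpow_mul_rpow_le ha ha1 (by positivity) (by positivity) le_rfl le_rfl)

/-- The growth r^(1-a/4) of the density is compensated by the factor 1/r. A bound uniform in r is
enough, for it is applied both at r = 1 and at r = R. -/
lemma enorm_bd_le {a : ℝ} {F : Plane → ℂ} {e : Plane} (hF : Nice F) (ha : 0 < a) (ha1 : a < 1)
    (he : ‖e‖ ≤ 1) (s : ℝ) {r : ℝ} (hr : 1 ≤ r) (φ : 𝓢(Plane, ℂ)) :
    ‖∫ θ : Metric.sphere (0 : Plane) 1, (∫ y, ((coef s (r • (θ : Plane)) y *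
      invF (fun ξ => tQ (dmul e F) (r • (θ : Plane)) ξ / (r : ℂ)) y : ℝ) : ℂ) * (𝓕 φ) y) ∂arc‖ₑ ≤
      ENNReal.ofReal (4 * mulConst a * (12 * s ^ 2 * (4 * Real.pi ^ 2) * (2 * Real.pi))) *
        (dataNorm a F * wnorm (-a) φ) := by
  have hr0 : 0 < r := one_pos.trans_le hr
  refine enorm_superpos_le (b := fun θ : Metric.sphere (0 : Plane) 1 => coef s (r • (θ : Plane)))
    (Q := fun (θ : Metric.sphere (0 : Plane) 1) ξ =>
      tQ (dmul e F) (r • (θ : Plane)) ξ / (r : ℂ)) hF ha ha1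
    ((nice_dmul hF e).superpos_bd s hr).measurable_Q
    (κ := fun _ => 4 * Real.pi ^ 2) (fun θ => by positivity) (by fun_prop)
    (M := fun _ => 12 * s ^ 2) (by fun_prop) (.of_forall fun θ ξ => ?_)
    (.of_forall fun θ => slowCoeff_coef ha ha1 s _)
    (lintegral_arc_const _).le φ
  have h1 := norm_tQ_dmul_le ha ha1 F he (r • (θ : Plane)) ξ
  rw [norm_smul_sphere hr0.le] at h1
  rw [norm_div, Complex.norm_real, Real.norm_of_nonneg hr0.le, div_le_iff₀ hr0]
  refine h1.trans ?_
  have h2 : r ^ (1 - a / 4) ≤ r := by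
    conv_rhs => rw [← Real.rpow_one r]
    exact Real.rpow_le_rpow_of_exponent_le hr (by linarith)
  have hw := wt_nonneg a ξ
  calc _ ≤ 4 * Real.pi ^ 2 * r * (wt a ξ * ‖F ξ‖) := by gcongr
    _ = _ := by ring

lemma Nice.superpos_far {G : Plane → ℂ} (hG : Nice G) (s R : ℝ) :
    Superpos (volume.restrict (ann R)) (fun α y => coefR s α y - coef s α y)
      (fun α ξ => tQ G α ξ / (‖α‖ : ℂ) ^ 3) (9 * s ^ 2) (fun _ => 1) (fun ξ => 2 * ‖G ξ‖) where
  measurable_b := by fun_prop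
  measurable_Q := by have := hG.1; unfold tQ; fun_prop
  abs_b_le := fun α y => (abs_sub _ _).trans
    ((add_le_add (abs_coefR_le s α y) (abs_coef_le s α y)).trans (le_of_eq (by ring)))
  integrable_κ := integrableOn_const (volume_ann_lt_top R).ne
  integrable_w := hG.integrable.norm.const_mul 2
  norm_Q_le := by
    filter_upwards [ae_restrict_mem (measurableSet_ann R)] with α hα ξ
    have h1 := (mem_ann.1 hα).1
    rw [one_mul, norm_div, norm_pow, Complex.norm_real, norm_norm]
    exact (div_le_self (norm_nonneg _) (one_le_pow₀ h1)).trans (norm_tQ_le_two _ _ _)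

lemma enorm_far_le {a : ℝ} {F : Plane → ℂ} {e : Plane} (hF : Nice F) (ha : 0 < a) (ha1 : a < 1)
    (he : ‖e‖ ≤ 1) (s R : ℝ) (φ : 𝓢(Plane, ℂ)) :
    ‖∫ α in ann R, (∫ y, (((coefR s α y - coef s α y) *
      invF (fun ξ => tQ (dmul e F) α ξ / (‖α‖ : ℂ) ^ 3) y : ℝ) : ℂ) * (𝓕 φ) y)‖ₑ ≤
      ENNReal.ofReal (4 * mulConst a * (172 * s ^ 2 * (4 * Real.pi ^ 2) *
        (2 * Real.pi / (-(0 + (-2 - a / 4) + 2))))) * (dataNorm a F * wnorm (-a) φ) := by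
  refine enorm_superpos_le (b := fun α y => coefR s α y - coef s α y)
    (Q := fun α ξ => tQ (dmul e F) α ξ / (‖α‖ : ℂ) ^ 3) hF ha ha1
    ((nice_dmul hF e).superpos_far s R).measurable_Q
    (κ := fun α => 4 * Real.pi ^ 2 * ‖α‖ ^ (-2 - a / 4)) (fun θ => by positivity) (by fun_prop)
    (M := fun α => 172 * s ^ 2 * ‖α‖ ^ (0 : ℝ)) (by fun_prop) ?_ (.of_forall fun α => ?_)
    (lintegral_mul_rpow_ann_le (by linarith) (by positivity) (by positivity) R) φ
  · filter_upwards [ae_restrict_mem (measurableSet_ann R)] with α hα ξ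
    have hn : 0 < ‖α‖ := one_pos.trans_le (mem_ann.1 hα).1
    rw [norm_div, norm_pow, Complex.norm_real, norm_norm, div_le_iff₀ (by positivity)]
    refine (norm_tQ_dmul_le ha ha1 F he α ξ).trans (le_of_eq ?_)
    have : ‖α‖ ^ (1 - a / 4) = ‖α‖ ^ (-2 - a / 4) * ‖α‖ ^ 3 := by
      rw [← Real.rpow_add_natCast hn.ne']; congr 1; push_cast; ring
    rw [this]; ring
  · rw [Real.rpow_zero, mul_one]
    refine .of_jap (A := 172 * s ^ 2) (B := 172 * s ^ 2) (z := α) (by fun_prop)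
      (fun y => (abs_sub _ _).trans ((add_le_add (abs_coefR_le s α y) (abs_coef_le s α y)).trans
        (by nlinarith [sq_nonneg s]))) (by positivity) (fun x y => ?_) le_rfl
      (rpow_mul_rpow_le ha ha1 (by positivity) (by positivity) le_rfl le_rfl)
    have hj := jap_pos y
    have hj' := jap_pos (y - α)
    have e1 : coefR s α x - coef s α x - (coefR s α y - coef s α y) =
      (coefR s α x - coefR s α y) - (coef s α x - coef s α y) := by ring
    rw [e1]
    refine (abs_sub _ _).trans ((add_le_add (abs_coefR_sub_le s α x y)
      (abs_coef_sub_le s α x y)).trans ?_)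
    calc _ = s ^ 2 * ‖x - y‖ * (172 * (1 / jap y) + 160 * (1 / jap (y - α))) := by ring
      _ ≤ s ^ 2 * ‖x - y‖ * (172 * (1 / jap y) + 172 * (1 / jap (y - α))) := by
          gcongr; norm_num
      _ = _ := by ring

/-- The integral of the odd part of the coefficient over the annulus. -/
def annCoef (s R : ℝ) (v y : Plane) : ℝ := ∫ α in ann R, inner ℝ α v * coef s α y / ‖α‖ ^ 3

lemma integrableOn_annCoef (s R : ℝ) (v y : Plane) (c : ℝ) :
    IntegrableOn (fun α => inner ℝ α v * coef s (c • α) y / ‖α‖ ^ 3) (ann R) := by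
  refine integrableOn_ann (C := ‖v‖ * (3 * s ^ 2)) (by fun_prop) fun α hα => ?_
  obtain ⟨h1, h2⟩ := mem_ann.1 hα
  have hn : 0 < ‖α‖ := one_pos.trans_le h1
  rw [abs_div, abs_mul, abs_of_pos (a := ‖α‖ ^ 3) (by positivity), div_le_iff₀ (by positivity)]
  have h3 : |inner ℝ α v| ≤ ‖α‖ * ‖v‖ := abs_real_inner_le_norm _ _
  have h4 : ‖α‖ ≤ ‖α‖ ^ 3 := le_self_pow₀ h1 (by norm_num)
  calc |inner ℝ α v| * |coef s (c • α) y| ≤ ‖α‖ * ‖v‖ * (3 * s ^ 2) := by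
        gcongr; exact abs_coef_le _ _ _
    _ ≤ ‖α‖ ^ 3 * ‖v‖ * (3 * s ^ 2) := by gcongr
    _ = _ := by ring

lemma measurable_annCoef (s R : ℝ) (v : Plane) : Measurable (annCoef s R v) := by
  have : Measurable fun p : Plane × Plane => inner ℝ p.2 v * coef s p.2 p.1 / ‖p.2‖ ^ 3 := by
    fun_prop
  exact this.stronglyMeasurable.integral_prod_right'.measurable

lemma annCoef_eq (s R : ℝ) (v y : Plane) : annCoef s R v y =
    ∫ α in ann R, inner ℝ α v * (coef s α y - coef s (-α) y) / (2 * ‖α‖ ^ 3) := by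
  have h1 := integral_ann_neg (fun α => inner ℝ α v * coef s α y / ‖α‖ ^ 3) R
  have i1 : IntegrableOn (fun α => inner ℝ α v * coef s α y / ‖α‖ ^ 3) (ann R) := by
    simpa using integrableOn_annCoef s R v y 1
  have i2 : IntegrableOn (fun α => inner ℝ α v * coef s (-α) y / ‖α‖ ^ 3) (ann R) := by
    simpa using integrableOn_annCoef s R v y (-1)
  have h2 : ∀ α, inner ℝ α v * (coef s α y - coef s (-α) y) / (2 * ‖α‖ ^ 3) =
      1 / 2 * (inner ℝ α v * coef s α y / ‖α‖ ^ 3 - inner ℝ α v * coef s (-α) y / ‖α‖ ^ 3) :=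
    fun α => by ring
  simp only [h2]
  rw [integral_const_mul, integral_sub i1 i2, annCoef]
  simp only [inner_neg_left, norm_neg, neg_mul, neg_div, integral_neg] at h1
  linarith

/-- The two bounds on the odd part of the coefficient combine to 12 s² min(|α|/⟨y⟩, ⟨y⟩/|α|), which
equals 12 s² ⟨y⟩ min(1, |α|/⟨y⟩)²/|α|. Integrated against |α|^(-2), this is an instance of
`lintegral_min_le` with a = 1/2; the powers of ⟨y⟩ cancel, so the bound depends neither on R nor on
y. -/
lemma abs_annCoef_le (s R : ℝ) {v : Plane} (hv : ‖v‖ ≤ 1) (y : Plane) :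
    |annCoef s R v y| ≤ 24 * Real.pi * s ^ 2 := by
  have hj := jap_pos y
  have hmin : minConst (1 / 2) = 4 * Real.pi := by rw [minConst]; norm_num; ring
  have h0 := lintegral_min_le (a := 1 / 2) (A := 1) (B := 1 / jap y) (by norm_num) (by norm_num)
    zero_le_one (by positivity)
  have x1 : (-(2 + 2 * (1 / 2)) : ℝ) = -3 := by norm_num
  have x2 : (2 - 2 * (1 / 2) : ℝ) = 1 := by norm_num
  have x3 : (2 * (1 / 2) : ℝ) = 1 := by norm_num
  rw [hmin, x1, x2, x3, Real.rpow_one, Real.rpow_one] at h0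
  rw [one_div, one_mul] at h0
  rw [annCoef_eq]
  have h1 : ‖∫ α in ann R, inner ℝ α v * (coef s α y - coef s (-α) y) / (2 * ‖α‖ ^ 3)‖ₑ ≤
      ENNReal.ofReal (24 * Real.pi * s ^ 2) := by
    refine (enorm_integral_le_lintegral_enorm _).trans ?_
    calc _ ≤ ∫⁻ α in ann R, ENNReal.ofReal (6 * s ^ 2 * jap y) *
          ENNReal.ofReal (min 1 ((jap y)⁻¹ * ‖α‖) ^ 2 * ‖α‖ ^ (-3 : ℝ)) := by
          refine setLIntegral_mono (by fun_prop) fun α hα => ?_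
          have hn : 0 < ‖α‖ := one_pos.trans_le (mem_ann.1 hα).1
          rw [Real.enorm_eq_ofReal_abs, ← ENNReal.ofReal_mul (by positivity)]
          refine ENNReal.ofReal_le_ofReal ?_
          rw [abs_div, abs_mul, abs_of_pos (a := 2 * ‖α‖ ^ 3) (by positivity),
            div_le_iff₀ (by positivity)]
          have h3 : |inner ℝ α v| ≤ ‖α‖ :=
            (abs_real_inner_le_norm _ _).trans (mul_le_of_le_one_right (norm_nonneg _) hv)
          have e3 : ‖α‖ ^ (-3 : ℝ) * ‖α‖ ^ 3 = 1 := by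
            rw [← Real.rpow_add_natCast hn.ne']; norm_num
          have h4 : |coef s α y - coef s (-α) y| ≤
              12 * s ^ 2 * (jap y * min 1 ((jap y)⁻¹ * ‖α‖) ^ 2 / ‖α‖) := by
            rcases le_total 1 ((jap y)⁻¹ * ‖α‖) with h | h
            · rw [min_eq_left h]
              refine (abs_coef_sub_coef_neg_le' s α y).trans ?_
              have := norm_le_jap y
              calc 6 * s ^ 2 * ‖y‖ / ‖α‖ ≤ 12 * s ^ 2 * jap y / ‖α‖ := by gcongr; norm_num
                _ = _ := by ring
            · rw [min_eq_right h]
              refine (abs_coef_sub_coef_neg_le s (norm_pos_iff.1 hn) y).trans (le_of_eq ?_)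
              field_simp
          calc _ ≤ ‖α‖ * (12 * s ^ 2 * (jap y * min 1 ((jap y)⁻¹ * ‖α‖) ^ 2 / ‖α‖)) := by gcongr
            _ = 12 * s ^ 2 * jap y * min 1 ((jap y)⁻¹ * ‖α‖) ^ 2 * 1 := by field_simp
            _ = 12 * s ^ 2 * jap y * min 1 ((jap y)⁻¹ * ‖α‖) ^ 2 * (‖α‖ ^ (-3 : ℝ) * ‖α‖ ^ 3) := by
                rw [e3]
            _ = _ := by ring
      _ ≤ ENNReal.ofReal (6 * s ^ 2 * jap y) * ENNReal.ofReal (4 * Real.pi * (jap y)⁻¹) := by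
          rw [lintegral_const_mul _ (by fun_prop)]
          refine mul_le_mul_right ((setLIntegral_le_lintegral _ _).trans h0) _
      _ = _ := by
          rw [← ENNReal.ofReal_mul (by positivity)]
          congr 1; field_simp; ring
  rw [Real.enorm_eq_ofReal_abs] at h1
  exact (ENNReal.ofReal_le_ofReal_iff (by positivity)).1 h1

/-- The slope of `coef` at y is controlled by 1/⟨y⟩ and by 1/|α|. The first bound alone would leave
a logarithmically divergent integral in R; the geometric mean |y|^(-1/2) |α|^(-1/2) converges. This
is what makes the exponent -1/2 in `SlowCoeff` the natural choice. -/
lemma abs_annCoef_sub_le (s R : ℝ) {v : Plane} (hv : ‖v‖ ≤ 1) (x : Plane) {y : Plane}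
    (hy : y ≠ 0) :
    |annCoef s R v x - annCoef s R v y| ≤
      48 * Real.pi * s ^ 2 * ‖x - y‖ * ‖y‖ ^ (-(1 / 2) : ℝ) := by
  have hyn : 0 < ‖y‖ := norm_pos_iff.2 hy
  have i1 : ∀ y, IntegrableOn (fun α => inner ℝ α v * coef s α y / ‖α‖ ^ 3) (ann R) := fun y => by
    simpa using integrableOn_annCoef s R v y 1
  rw [annCoef, annCoef, ← integral_sub (i1 x) (i1 y)]
  have h1 : ‖∫ α in ann R, (inner ℝ α v * coef s α x / ‖α‖ ^ 3 -
      inner ℝ α v * coef s α y / ‖α‖ ^ 3)‖ₑ ≤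
      ENNReal.ofReal (48 * Real.pi * s ^ 2 * ‖x - y‖ * ‖y‖ ^ (-(1 / 2) : ℝ)) := by
    refine (enorm_integral_le_lintegral_enorm _).trans ?_
    calc _ ≤ ∫⁻ α in (Metric.ball (0 : Plane) 1)ᶜ,
          ENNReal.ofReal (12 * s ^ 2 * ‖x - y‖ * ‖y‖ ^ (-(1 / 2) : ℝ)) *
          ENNReal.ofReal (‖α‖ ^ (-(5 / 2) : ℝ)) := by
          refine (setLIntegral_mono (by fun_prop) fun α hα => ?_).trans
            (lintegral_mono_set (ann_subset R))
          have hn : 0 < ‖α‖ := one_pos.trans_le (mem_ann.1 hα).1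
          rw [Real.enorm_eq_ofReal_abs, ← ENNReal.ofReal_mul (by positivity), ← sub_div, ← mul_sub]
          refine ENNReal.ofReal_le_ofReal ?_
          rw [abs_div, abs_mul, abs_of_pos (a := ‖α‖ ^ 3) (by positivity),
            div_le_iff₀ (by positivity)]
          have h3 : |inner ℝ α v| ≤ ‖α‖ :=
            (abs_real_inner_le_norm _ _).trans (mul_le_of_le_one_right (norm_nonneg _) hv)
          have e3 : ‖α‖ ^ (-(5 / 2) : ℝ) * ‖α‖ ^ 3 = ‖α‖ * ‖α‖ ^ (-(1 / 2) : ℝ) := by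
            rw [← Real.rpow_add_natCast hn.ne', mul_comm, ← Real.rpow_add_one hn.ne']; norm_num
          have h4 : |coef s α x - coef s α y| ≤
              12 * s ^ 2 * ‖x - y‖ * (‖y‖ ^ (-(1 / 2) : ℝ) * ‖α‖ ^ (-(1 / 2) : ℝ)) := by
            have key : ∀ t : ℝ, 0 < t → ∀ u : ℝ, 0 < u → u ≤ t →
                1 / t ≤ u ^ (-(1 / 2) : ℝ) * t ^ (-(1 / 2) : ℝ) := by
              intro t ht u hu hut
              have : t ^ (-(1 / 2) : ℝ) ≤ u ^ (-(1 / 2) : ℝ) :=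
                Real.rpow_le_rpow_of_nonpos hu hut (by norm_num)
              calc 1 / t = t ^ (-(1 / 2) : ℝ) * t ^ (-(1 / 2) : ℝ) := by
                    rw [← Real.rpow_add ht, one_div, ← Real.rpow_neg_one]; norm_num
                _ ≤ _ := by gcongr
            rcases le_total ‖y‖ ‖α‖ with h | h
            · refine (abs_coef_sub_le' s α x y).trans ?_
              calc 6 * s ^ 2 * ‖x - y‖ / ‖α‖ ≤ 12 * s ^ 2 * ‖x - y‖ / ‖α‖ := by gcongr; norm_num
                _ = 12 * s ^ 2 * ‖x - y‖ * (1 / ‖α‖) := by ring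
                _ ≤ _ := by gcongr; exact key _ hn _ hyn h
            · refine (abs_coef_sub_le s α x y).trans ?_
              calc 12 * s ^ 2 * ‖x - y‖ / jap y ≤ 12 * s ^ 2 * ‖x - y‖ / ‖y‖ := by
                    gcongr; exact norm_le_jap y
                _ = 12 * s ^ 2 * ‖x - y‖ * (1 / ‖y‖) := by ring
                _ ≤ _ := by gcongr; rw [mul_comm]; exact key _ hyn _ hn h
          calc _ ≤ ‖α‖ *
                (12 * s ^ 2 * ‖x - y‖ * (‖y‖ ^ (-(1 / 2) : ℝ) * ‖α‖ ^ (-(1 / 2) : ℝ))) := by gcongr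
            _ = 12 * s ^ 2 * ‖x - y‖ * ‖y‖ ^ (-(1 / 2) : ℝ) * (‖α‖ * ‖α‖ ^ (-(1 / 2) : ℝ)) := by ring
            _ = _ := by rw [← e3]; ring
      _ = _ := by
          rw [lintegral_const_mul _ (by fun_prop), lintegral_norm_rpow_compl (by norm_num),
            ← ENNReal.ofReal_mul (by positivity)]
          congr 1; norm_num; ring
  rw [Real.enorm_eq_ofReal_abs] at h1
  exact (ENNReal.ofReal_le_ofReal_iff (by positivity)).1 h1

lemma slowCoeff_annCoef {a : ℝ} (ha : 0 < a) (ha1 : a < 1) (s R : ℝ) {v : Plane}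
    (hv : ‖v‖ ≤ 1) : SlowCoeff a (annCoef s R v) (48 * Real.pi * s ^ 2) := by
  refine ⟨measurable_annCoef s R v, 48 * Real.pi * s ^ 2, 48 * Real.pi * s ^ 2, 0,
    fun y => (abs_annCoef_le s R hv y).trans ?_, by positivity, fun x y hy _ => ?_, le_rfl,
    rpow_mul_rpow_le ha ha1 (by positivity) (by positivity) le_rfl le_rfl⟩
  · have : 0 ≤ Real.pi * s ^ 2 := by positivity
    linarith
  · refine (abs_annCoef_sub_le s R hv x hy).trans ?_
    gcongr
    exact le_add_of_nonneg_right (by positivity)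

lemma enorm_annCoef_le {a : ℝ} {F : Plane → ℂ} {e v : Plane} (hF : Nice F) (ha : 0 < a)
    (ha1 : a < 1) (he : ‖e‖ ≤ 1) (hv : ‖v‖ ≤ 1) (s R : ℝ) (φ : 𝓢(Plane, ℂ)) :
    ‖∫ y, ((annCoef s R v y * invF (dmul v (dmul e F)) y : ℝ) : ℂ) * (𝓕 φ) y‖ₑ ≤
      ENNReal.ofReal (4 * mulConst a * (48 * Real.pi * s ^ 2 * (4 * Real.pi ^ 2))) *
        (dataNorm a F * wnorm (-a) φ) := by
  have hc := mulConst_nonneg a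
  refine (enorm_pairing_le_dataNorm hF ha ha1 (measurable_dmul v (measurable_dmul e hF.1))
    (K := 4 * Real.pi ^ 2) (by positivity) (fun ξ => ?_) (slowCoeff_annCoef ha ha1 s R hv)
    φ).trans (le_of_eq ?_)
  · refine (norm_dmul_le v _ ξ).trans ?_
    calc _ ≤ 2 * Real.pi * ‖ξ‖ * 1 * (2 * Real.pi * ‖ξ‖ * 1 * ‖F ξ‖) := by
          gcongr; exact (norm_dmul_le e F ξ).trans (by gcongr)
      _ = 4 * Real.pi ^ 2 * (‖ξ‖ ^ 2 * ‖F ξ‖) := by ring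
      _ ≤ _ := by gcongr; exact sq_le_wt a ξ
  · rw [mul_assoc (ENNReal.ofReal (4 * mulConst a)), ← mul_assoc, ← ENNReal.ofReal_mul (by positivity),
      mul_comm (4 * mulConst a)]

/-- The decomposition of the principal part on `1 ≤ |α| < R`. -/
lemma Nice.integral_ann_coef {G : Plane → ℂ} (hG : Nice G) (s : ℝ) {R : ℝ} (hR : 1 ≤ R)
    (y : Plane) :
    ∫ α in ann R, coef s α y * invF (dQ G α) y =
      (∑ i, annCoef s R (EuclideanSpace.single i 1) y *
        invF (dmul (EuclideanSpace.single i 1) G) y) +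
      (∫ θ : Metric.sphere (0 : Plane) 1, coef s ((1 : ℝ) • (θ : Plane)) y *
        invF (fun ξ => tQ G ((1 : ℝ) • (θ : Plane)) ξ / ((1 : ℝ) : ℂ)) y ∂arc) -
      (∫ θ : Metric.sphere (0 : Plane) 1, coef s (R • (θ : Plane)) y *
        invF (fun ξ => tQ G (R • (θ : Plane)) ξ / (R : ℂ)) y ∂arc) +
      ∫ α in ann R, (coefR s α y - coef s α y) *
        invF (fun ξ => tQ G α ξ / (‖α‖ : ℂ) ^ 3) y := by
  set ψ := invF G with hψ
  -- Subtracting the constant ψ(y) does not change the gradient, but turns the function left by the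
  -- integration by parts into a first difference with density `tQ`, which has the needed smallness
  -- at low frequencies.
  set u : Plane → ℝ := fun x => ψ (y + x) - ψ y with hu
  have hψ1 : ContDiff ℝ 1 ψ := hG.contDiff_invF
  have hψd := hψ1.differentiable one_ne_zero
  have hu1 : ContDiff ℝ 1 u := by simp only [hu]; fun_prop
  have hud : ∀ x, fderiv ℝ u x = fderiv ℝ ψ (y + x) := fun x => by
    have h1 : HasFDerivAt (fun x => ψ (y + x)) (fderiv ℝ ψ (y + x)) x :=
      HasFDerivAt.comp (g := ψ) (f := fun x => y + x) x (hψd (y + x)).hasFDerivAt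
        ((hasFDerivAt_id x).const_add y)
    exact (h1.sub_const _).fderiv
  have ht : ∀ α, u (-α) = -invF (tQ G α) y := fun α => by
    have := invF_sub_translate hG.integrable y α
    simp only [hu, ← sub_eq_add_neg]
    rw [← neg_sub, this]; rfl
  have hdQ : ∀ α, invF (dQ G α) y = (fderiv ℝ ψ y α - fderiv ℝ u (-α) α) / ‖α‖ ^ 3 := fun α => by
    rw [hud, (hG.hasFDerivAt_invF _).2, (hG.hasFDerivAt_invF _).2, ← sub_eq_add_neg,
      invF_sub_translate (nice_dmul hG α).integrable, ← invF_div_const]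
    congr 1; ext ξ; rw [dQ]; push_cast; rfl
  have h1 := integral_ann_fderiv_mul hu1 s hR y
  have i1 := integrableOn_ann_fderiv_mul hu1 s R y
  have i0 : ∀ i : Fin 2, IntegrableOn (fun α => inner ℝ α (EuclideanSpace.single i (1 : ℝ)) *
      coef s α y / ‖α‖ ^ 3) (ann R) := fun i => by
    simpa using integrableOn_annCoef s R (EuclideanSpace.single i (1 : ℝ)) y 1
  -- The gradient at y does not depend on α; expanding it in coordinates leaves integrals of the
  -- coefficient alone, namely `annCoef`.
  have hexp : ∀ α : Plane, fderiv ℝ ψ y α = ∑ i : Fin 2, inner ℝ α (EuclideanSpace.single i (1 : ℝ)) *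
      invF (dmul (EuclideanSpace.single i 1) G) y := fun α => by
    have h2 : α = ∑ i : Fin 2, inner ℝ α (EuclideanSpace.single i (1 : ℝ)) •
        (EuclideanSpace.single i (1 : ℝ) : Plane) := by
      ext j
      fin_cases j <;> simp [EuclideanSpace.inner_single_right]
    conv_lhs => rw [h2]
    simp only [map_sum, map_smul, smul_eq_mul]
    exact Finset.sum_congr rfl fun i _ => by rw [← (hG.hasFDerivAt_invF y).2]
  have e1 : ∀ α, coef s α y * invF (dQ G α) y =
      (∑ i : Fin 2, inner ℝ α (EuclideanSpace.single i (1 : ℝ)) * coef s α y / ‖α‖ ^ 3 *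
        invF (dmul (EuclideanSpace.single i 1) G) y) -
      fderiv ℝ u (-α) α * coef s α y / ‖α‖ ^ 3 := fun α => by
    rw [hdQ, hexp]
    simp only [Fin.sum_univ_two]
    ring
  have i2 : ∀ i ∈ (Finset.univ : Finset (Fin 2)), IntegrableOn (fun α =>
      inner ℝ α (EuclideanSpace.single i (1 : ℝ)) * coef s α y / ‖α‖ ^ 3 *
        invF (dmul (EuclideanSpace.single i 1) G) y) (ann R) := fun i _ =>
    (i0 i).mul_const _
  simp only [e1]
  rw [integral_sub (integrable_finsetSum _ i2) i1, integral_finsetSum _ i2, h1]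
  simp only [integral_mul_const, annCoef]
  have j1 := (hG.superpos_bd s le_rfl).integrable y
  have j2 := (hG.superpos_bd s hR).integrable y
  have e2 : ∫ θ : Metric.sphere (0 : Plane) 1, (u (-θ) * coef s θ y -
        u (-(R • (θ : Plane))) * coef s (R • (θ : Plane)) y / R) ∂arc =
      -(∫ θ : Metric.sphere (0 : Plane) 1, coef s ((1 : ℝ) • (θ : Plane)) y *
        invF (fun ξ => tQ G ((1 : ℝ) • (θ : Plane)) ξ / ((1 : ℝ) : ℂ)) y ∂arc) +
      (∫ θ : Metric.sphere (0 : Plane) 1, coef s (R • (θ : Plane)) y *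
        invF (fun ξ => tQ G (R • (θ : Plane)) ξ / (R : ℂ)) y ∂arc) := by
    rw [neg_add_eq_sub, ← integral_sub j2 j1]
    refine integral_congr_ae (.of_forall fun θ => ?_)
    simp only [ht, invF_div_const, one_smul, div_one]
    ring
  have e3 : ∫ α in ann R, u (-α) * (coefR s α y - coef s α y) / ‖α‖ ^ 3 =
      -∫ α in ann R, (coefR s α y - coef s α y) *
        invF (fun ξ => tQ G α ξ / (‖α‖ : ℂ) ^ 3) y := by
    rw [← integral_neg]
    refine integral_congr_ae (.of_forall fun α => ?_)
    have : invF (fun ξ => tQ G α ξ / (‖α‖ : ℂ) ^ 3) y = invF (tQ G α) y / ‖α‖ ^ 3 := by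
      rw [← invF_div_const]; push_cast; rfl
    simp only [ht, this]
    ring
  rw [e2, e3]
  abel

/-! ### The core estimate -/

lemma dmul_dQ (F : Plane → ℂ) (e α : Plane) : dmul e (dQ F α) = dQ (dmul e F) α := by
  ext ξ; simp only [dmul, dQ]; ring

lemma abs_coefD_le' (s : ℝ) {e : Plane} (he : ‖e‖ ≤ 1) (α y : Plane) :
    |coefD s e α y| ≤ 6 * s ^ 2 :=
  (abs_coefD_le s he α y).trans (mul_le_of_le_one_right (by positivity) (min_le_left _ _))

lemma integrable_mul_invF {c : Plane → ℝ} (hc : Measurable c) {A : ℝ} (hA : ∀ y, |c y| ≤ A)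
    {Q : Plane → ℂ} (hQ : Nice Q) (Φ : 𝓢(Plane, ℂ)) :
    Integrable fun y => ((c y * invF Q y : ℝ) : ℂ) * Φ y := by
  refine Φ.integrable.bdd_mul (c := A * ∫ ξ, ‖Q ξ‖) ?_ (.of_forall fun y => ?_)
  · exact (Complex.measurable_ofReal.comp
      (hc.mul (continuous_invF hQ.integrable).measurable)).aestronglyMeasurable
  · rw [Complex.norm_real, Real.norm_eq_abs, abs_mul]
    exact mul_le_mul (hA y) (abs_invF_le y) (abs_nonneg _) ((abs_nonneg _).trans (hA y))

/-- Integration by parts is done for each fixed α, where both factors are differentiable and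
bounded; no regularity of the α-integral itself is needed. -/
lemma integral_coef_invF_lineDeriv {F : Plane → ℂ} (hF : Nice F) (s : ℝ) {e : Plane}
    (he : ‖e‖ ≤ 1) (α : Plane) (Ψ : 𝓢(Plane, ℂ)) :
    ∫ y, ((coef s α y * invF (dQ F α) y : ℝ) : ℂ) * (∂_{e} Ψ) y =
      -((∫ y, ((coefD s e α y * invF (dQ F α) y : ℝ) : ℂ) * Ψ y) +
        ∫ y, ((coef s α y * invF (dQ (dmul e F) α) y : ℝ) : ℂ) * Ψ y) := by
  have hN := nice_dQ hF α
  have hN' := nice_dQ (nice_dmul hF e) α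
  have hc : Differentiable ℝ (coef s α) := fun y => (hasFDerivAt_coef s α y).differentiableAt
  have hi : Differentiable ℝ (invF (dQ F α)) := fun y => (hN.hasFDerivAt_invF y).1
  set q : Plane → ℝ := fun y => coef s α y * invF (dQ F α) y with hq
  have hqd : Differentiable ℝ q := hc.mul hi
  have hq' : ∀ y, fderiv ℝ (fun y => (q y : ℂ)) y e =
      ((coefD s e α y * invF (dQ F α) y : ℝ) : ℂ) +
        ((coef s α y * invF (dQ (dmul e F) α) y : ℝ) : ℂ) := fun y => by
    have h1 : HasFDerivAt (fun y => (q y : ℂ)) (Complex.ofRealCLM.comp (fderiv ℝ q y)) y :=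
      HasFDerivAt.comp (g := Complex.ofRealCLM) (f := q) y Complex.ofRealCLM.hasFDerivAt
        (hqd y).hasFDerivAt
    rw [h1.fderiv]
    have h2 : fderiv ℝ q y = coef s α y • fderiv ℝ (invF (dQ F α)) y +
        invF (dQ F α) y • fderiv ℝ (coef s α) y := fderiv_mul (hc y) (hi y)
    rw [ContinuousLinearMap.comp_apply, h2]
    simp only [add_apply, FunLike.coe_smul, Pi.smul_apply, smul_eq_mul,
      (hN.hasFDerivAt_invF y).2, fderiv_coef_apply, dmul_dQ, Complex.ofRealCLM_apply]
    push_cast; ring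
  have i1 := integrable_mul_invF (c := coefD s e α) (by fun_prop) (abs_coefD_le' s he α) hN Ψ
  have i2 := integrable_mul_invF (c := coef s α) (by fun_prop) (abs_coef_le s α) hN' Ψ
  have key := integral_mul_fderiv_eq_neg_fderiv_mul_of_integrable (μ := (volume : Measure Plane))
    (f := fun y => (q y : ℂ)) (g := Ψ) (v := e) ?_
    (integrable_mul_invF (c := coef s α) (by fun_prop) (abs_coef_le s α) hN (∂_{e} Ψ))
    (integrable_mul_invF (c := coef s α) (by fun_prop) (abs_coef_le s α) hN Ψ)
    (fun x _ => (Complex.ofRealCLM.differentiable.comp hqd) x)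
    (fun x _ => Ψ.differentiableAt)
  · rw [← integral_add i1 i2]
    refine key.trans ?_
    congr 1
    refine integral_congr_ae (.of_forall fun y => ?_)
    simp only [hq', add_mul]
  · refine (i1.add i2).congr (.of_forall fun y => ?_)
    simp only [hq', add_mul, Pi.add_apply]

lemma integral_ball_eq_add' {R : ℝ} (hR : 1 ≤ R) {F : Plane → ℂ}
    (hF : IntegrableOn F (Metric.ball 0 R)) :
    ∫ α in Metric.ball 0 R, F α = (∫ α in Metric.ball 0 1, F α) + ∫ α in ann R, F α := by
  rw [ann, ← setIntegral_union Set.disjoint_sdiff_right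
    (Metric.isOpen_ball.measurableSet.diff Metric.isOpen_ball.measurableSet)
    (hF.mono_set (Metric.ball_subset_ball hR)) (hF.mono_set Set.sdiff_subset),
    Set.union_sdiff_cancel (Metric.ball_subset_ball hR)]

lemma truncT_rep {F : Plane → ℂ} (hF : Nice F) (s R : ℝ) (y : Plane) :
    truncT (rep F) s R y =
      1 / (2 * Real.pi) * ∫ α in Metric.ball (0 : Plane) R, coef s α y * invF (dQ F α) y := by
  have hg : GradInt 1 F := hF.gradInt zero_le_one
  have hH := hg.holderGrad one_pos le_rfl
  rw [truncT, ← integral_const_mul]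
  refine integral_congr_ae (.of_forall fun α => ?_)
  simp only
  rw [kernel_eq (hH.contDiff.differentiable one_ne_zero), hg.invF_dQ zero_le_one le_rfl]
  ring

/-- The pairing of the truncated integral with a derivative, in three parts. -/
lemma integral_truncT_mul {F : Plane → ℂ} (hF : Nice F) (s : ℝ) {R : ℝ} (hR : 1 ≤ R) {e : Plane}
    (he : ‖e‖ ≤ 1) (Ψ : 𝓢(Plane, ℂ)) :
    ∫ y, (truncT (rep F) s R y : ℂ) * (∂_{e} Ψ) y = -(1 / (2 * Real.pi) : ℝ) * (
      (∫ α in Metric.ball (0 : Plane) 1,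
        (∫ y, ((coefD s e α y * invF (dQ F α) y : ℝ) : ℂ) * Ψ y)) +
      (∫ α in ann R, (∫ y, ((coefD s e α y * invF (dQ F α) y : ℝ) : ℂ) * Ψ y)) +
      (∫ α in Metric.ball (0 : Plane) 1,
        (∫ y, ((coef s α y * invF (dQ (dmul e F) α) y : ℝ) : ℂ) * Ψ y)) +
      ∫ α in ann R, (∫ y, ((coef s α y * invF (dQ (dmul e F) α) y : ℝ) : ℂ) * Ψ y)) := by
  have S0 := superpos_dQ hF (b := coef s) (by fun_prop) (abs_coef_le s)
    (subset_refl (Metric.ball (0 : Plane) R))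
  have S1 := superpos_dQ hF (b := coefD s e) (by fun_prop) (abs_coefD_le' s he)
    (subset_refl (Metric.ball (0 : Plane) R))
  have S2 := superpos_dQ (nice_dmul hF e) (b := coef s) (by fun_prop) (abs_coef_le s)
    (subset_refl (Metric.ball (0 : Plane) R))
  have j1 := (S1.integrable_prod Ψ.integrable).integral_prod_left
  have j2 := (S2.integrable_prod Ψ.integrable).integral_prod_left
  simp only at j1 j2
  have e1 : ∀ y, (truncT (rep F) s R y : ℂ) * (∂_{e} Ψ) y = ((1 / (2 * Real.pi) : ℝ) : ℂ) *
      (((∫ α in Metric.ball (0 : Plane) R, coef s α y * invF (dQ F α) y : ℝ) : ℂ) *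
        (∂_{e} Ψ) y) := fun y => by
    rw [truncT_rep hF, Complex.ofReal_mul, mul_assoc]
  simp only [e1]
  rw [integral_const_mul, S0.integral_swap (∂_{e} Ψ).integrable]
  simp only [integral_coef_invF_lineDeriv hF s he _ Ψ]
  rw [integral_neg, integral_add j1 j2, integral_ball_eq_add' hR j1,
    integral_ball_eq_add' hR j2]
  ring

lemma integral_near_eq {G : Plane → ℂ} (hG : Nice G) (s : ℝ) (Ψ : 𝓢(Plane, ℂ)) :
    ∫ α in Metric.ball (0 : Plane) 1,
        (∫ y, ((coef s α y * invF (dQ G α) y : ℝ) : ℂ) * Ψ y) =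
      (∫ α in Metric.ball (0 : Plane) 1, (∫ y, (((coef s α y - coef₀ s ((1 / ‖α‖) • α) y) *
        invF (dQ G α) y : ℝ) : ℂ) * Ψ y)) +
      ∫ θ : Metric.sphere (0 : Plane) 1,
        (∫ y, ((coef₀ s θ y * invF (sQ G θ) y : ℝ) : ℂ) * Ψ y) ∂arc := by
  have S1 := superpos_dQ hG (b := fun α y => coef s α y - coef₀ s ((1 / ‖α‖) • α) y)
    (by fun_prop) (A := 6 * s ^ 2) (fun α y => (abs_sub _ _).trans ((add_le_add
      (abs_coef_le s α y) (abs_coef₀_le s (norm_unit_le α) y)).trans (le_of_eq (by ring))))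
    (subset_refl (Metric.ball (0 : Plane) 1))
  have S2 := superpos_dQ hG (b := fun α y => coef₀ s ((1 / ‖α‖) • α) y)
    (by fun_prop) (fun α y => abs_coef₀_le s (norm_unit_le α) y)
    (subset_refl (Metric.ball (0 : Plane) 1))
  have p1 := S1.integrable_prod Ψ.integrable
  have p2 := S2.integrable_prod Ψ.integrable
  have j1 := p1.integral_prod_left
  have j2 := p2.integral_prod_left
  simp only at j1 j2
  rw [← (hG.superpos_sQ s).integral_swap Ψ.integrable]
  simp only [← hG.integral_coef₀ s]
  rw [S2.integral_swap Ψ.integrable, ← integral_add j1 j2]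
  refine integral_congr_ae ?_
  filter_upwards [p1.prod_right_ae, p2.prod_right_ae] with α h1 h2
  rw [← integral_add h1 h2]
  refine integral_congr_ae (.of_forall fun y => ?_)
  simp only
  push_cast; ring

lemma integral_far_eq {G : Plane → ℂ} (hG : Nice G) (s : ℝ) {R : ℝ} (hR : 1 ≤ R)
    (Ψ : 𝓢(Plane, ℂ)) :
    ∫ α in ann R, (∫ y, ((coef s α y * invF (dQ G α) y : ℝ) : ℂ) * Ψ y) =
      (∑ i, ∫ y, ((annCoef s R (EuclideanSpace.single i 1) y *
        invF (dmul (EuclideanSpace.single i 1) G) y : ℝ) : ℂ) * Ψ y) +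
      (∫ θ : Metric.sphere (0 : Plane) 1, (∫ y, ((coef s ((1 : ℝ) • (θ : Plane)) y *
        invF (fun ξ => tQ G ((1 : ℝ) • (θ : Plane)) ξ / ((1 : ℝ) : ℂ)) y : ℝ) : ℂ) * Ψ y) ∂arc) -
      (∫ θ : Metric.sphere (0 : Plane) 1, (∫ y, ((coef s (R • (θ : Plane)) y *
        invF (fun ξ => tQ G (R • (θ : Plane)) ξ / (R : ℂ)) y : ℝ) : ℂ) * Ψ y) ∂arc) +
      ∫ α in ann R, (∫ y, (((coefR s α y - coef s α y) *
        invF (fun ξ => tQ G α ξ / (‖α‖ : ℂ) ^ 3) y : ℝ) : ℂ) * Ψ y) := by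
  have S0 := superpos_dQ hG (b := coef s) (by fun_prop) (abs_coef_le s)
    (S := ann R) (R := R) Set.sdiff_subset
  have S1 := hG.superpos_bd s le_rfl
  have S2 := hG.superpos_bd s hR
  have S3 := hG.superpos_far s R
  have k1 := (S1.integrable_prod Ψ.integrable).integral_prod_right
  have k2 := (S2.integrable_prod Ψ.integrable).integral_prod_right
  have k3 := (S3.integrable_prod Ψ.integrable).integral_prod_right
  simp only [integral_mul_const, integral_complex_ofReal] at k1 k2 k3
  have k0 : ∀ i ∈ (Finset.univ : Finset (Fin 2)), Integrable fun y =>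
      ((annCoef s R (EuclideanSpace.single i 1) y *
        invF (dmul (EuclideanSpace.single i 1) G) y : ℝ) : ℂ) * Ψ y := fun i _ => by
    refine integrable_mul_invF (measurable_annCoef s R _) (abs_annCoef_le s R (by simp))
      (nice_dmul hG _) Ψ
  rw [← S0.integral_swap Ψ.integrable, ← S1.integral_swap Ψ.integrable,
    ← S2.integral_swap Ψ.integrable, ← S3.integral_swap Ψ.integrable,
    ← integral_finsetSum _ k0, ← integral_add (integrable_finsetSum _ k0) k1,
    ← integral_sub ((integrable_finsetSum _ k0).fun_add k1) k2]
  refine Eq.trans ?_ (integral_add (((integrable_finsetSum _ k0).fun_add k1).sub k2) k3)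
  refine integral_congr_ae (.of_forall fun y => ?_)
  simp only [hG.integral_ann_coef s hR y, Fin.sum_univ_two]
  push_cast
  ring

/-- The constant in `enorm_integral_truncT_mul_le`. -/
def coreConst (a : ℝ) : ℝ :=
  4 * mulConst a * (150 * (4 * Real.pi ^ 2) * (2 * Real.pi / (-a + -1 + 2))) +
  4 * mulConst a * (150 * (4 * Real.pi ^ 2) * (2 * Real.pi / (-(-1 + (-1 - a / 4) + 2)))) +
  (4 * mulConst a * (18 * (8 * Real.pi ^ 3) * (2 * Real.pi / (1 - a + -2 + 2))) +
    4 * mulConst a * (6 * (16 * Real.pi ^ 2) * (2 * Real.pi))) +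
  ((4 * mulConst a * (48 * Real.pi * (4 * Real.pi ^ 2)) +
        4 * mulConst a * (48 * Real.pi * (4 * Real.pi ^ 2))) +
      4 * mulConst a * (12 * (4 * Real.pi ^ 2) * (2 * Real.pi)) +
      4 * mulConst a * (12 * (4 * Real.pi ^ 2) * (2 * Real.pi)) +
    4 * mulConst a * (172 * (4 * Real.pi ^ 2) * (2 * Real.pi / (-(0 + (-2 - a / 4) + 2)))))

/-- The pairing is the sum of nine pieces: the derivative on the coefficient, near and far; the
derivative on f near 0, split into the error against `coef₀` and the symmetrised principal part;
and, far away, two coordinates of `annCoef`, two boundary circles and the integral left by the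
radial integration by parts. The constant is independent of R and F. -/
theorem enorm_integral_truncT_mul_le {a : ℝ} {F : Plane → ℂ} (hF : Nice F) (ha : 0 < a)
    (ha1 : a < 1) (s : ℝ) {R : ℝ} (hR : 1 ≤ R) {e : Plane} (he : ‖e‖ ≤ 1) (φ : 𝓢(Plane, ℂ)) :
    ‖∫ y, (truncT (rep F) s R y : ℂ) * (∂_{e} (𝓕 φ : 𝓢(Plane, ℂ))) y‖ₑ ≤
      ENNReal.ofReal (coreConst a * s ^ 2) * (dataNorm a F * wnorm (-a) φ) := by
  have hc := mulConst_nonneg a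
  set D := dataNorm a F * wnorm (-a) φ
  have conv : ∀ {X : ℂ} {c : ℝ} (k : ℝ), ‖X‖ₑ ≤ ENNReal.ofReal c * D → c = k * s ^ 2 →
      ‖X‖ₑ ≤ ENNReal.ofReal (k * s ^ 2) * D := fun k h h' => h' ▸ h
  have add : ∀ {X Y : ℂ} {k l : ℝ}, 0 ≤ k → 0 ≤ l → ‖X‖ₑ ≤ ENNReal.ofReal (k * s ^ 2) * D →
      ‖Y‖ₑ ≤ ENNReal.ofReal (l * s ^ 2) * D → ‖X + Y‖ₑ ≤ ENNReal.ofReal ((k + l) * s ^ 2) * D := by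
    intro X Y k l hk hl h1 h2
    refine (enorm_add_le _ _).trans ((add_le_add h1 h2).trans (le_of_eq ?_))
    rw [← add_mul, ← ENNReal.ofReal_add (by positivity) (by positivity), add_mul]
  have sub : ∀ {X Y : ℂ} {k l : ℝ}, 0 ≤ k → 0 ≤ l → ‖X‖ₑ ≤ ENNReal.ofReal (k * s ^ 2) * D →
      ‖Y‖ₑ ≤ ENNReal.ofReal (l * s ^ 2) * D → ‖X - Y‖ₑ ≤ ENNReal.ofReal ((k + l) * s ^ 2) * D := by
    intro X Y k l hk hl h1 h2
    rw [sub_eq_add_neg]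
    exact add hk hl h1 (by rwa [enorm_neg])
  have v : ∀ i : Fin 2, ‖(EuclideanSpace.single i 1 : Plane)‖ ≤ 1 := fun i => by simp
  have b1 := conv (4 * mulConst a * (150 * (4 * Real.pi ^ 2) * (2 * Real.pi / (-a + -1 + 2))))
    (enorm_coefD_near_le hF ha ha1 he s φ) (by ring)
  have b2 := conv
    (4 * mulConst a * (150 * (4 * Real.pi ^ 2) * (2 * Real.pi / (-(-1 + (-1 - a / 4) + 2)))))
    (enorm_coefD_far_le hF ha ha1 he s R φ) (by ring)
  have b3 := conv (4 * mulConst a * (18 * (8 * Real.pi ^ 3) * (2 * Real.pi / (1 - a + -2 + 2))))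
    (enorm_coef_near_le hF ha ha1 he s φ) (by ring)
  have b4 := conv (4 * mulConst a * (6 * (16 * Real.pi ^ 2) * (2 * Real.pi)))
    (enorm_coef₀_le hF ha ha1 he s φ) (by ring)
  have b5 := fun i => conv (4 * mulConst a * (48 * Real.pi * (4 * Real.pi ^ 2)))
    (enorm_annCoef_le hF ha ha1 he (v i) s R φ) (by ring)
  have b6 := conv (4 * mulConst a * (12 * (4 * Real.pi ^ 2) * (2 * Real.pi)))
    (enorm_bd_le hF ha ha1 he s le_rfl φ) (by ring)
  have b7 := conv (4 * mulConst a * (12 * (4 * Real.pi ^ 2) * (2 * Real.pi)))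
    (enorm_bd_le hF ha ha1 he s hR φ) (by ring)
  have b8 := conv
    (4 * mulConst a * (172 * (4 * Real.pi ^ 2) * (2 * Real.pi / (-(0 + (-2 - a / 4) + 2)))))
    (enorm_far_le hF ha ha1 he s R φ) (by ring)
  have p1 : 0 < -a + -1 + 2 := by linarith
  have p2 : 0 < -(-1 + (-1 - a / 4) + 2) := by linarith
  have p3 : 0 < 1 - a + -2 + 2 := by linarith
  have p4 : 0 < -(0 + (-2 - a / 4) + 2) := by linarith
  have hG := nice_dmul hF e
  rw [integral_truncT_mul hF s hR he, integral_near_eq hG, integral_far_eq hG s hR,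
    Fin.sum_univ_two, enorm_mul]
  have hpi : ‖(-((1 / (2 * Real.pi) : ℝ) : ℂ))‖ₑ ≤ 1 := by
    rw [enorm_neg, ← ofReal_norm, Complex.norm_real, Real.norm_of_nonneg (by positivity)]
    refine ENNReal.ofReal_le_one.2 ?_
    rw [div_le_one (by positivity)]
    linarith [Real.pi_gt_three]
  refine (mul_le_mul_left hpi _).trans ?_
  rw [one_mul, coreConst]
  exact add (by positivity) (by positivity)
    (add (by positivity) (by positivity) (add (by positivity) (by positivity) b1 b2)
      (add (by positivity) (by positivity) b3 b4))
    (add (by positivity) (by positivity) (sub (by positivity) (by positivity)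
      (add (by positivity) (by positivity) (add (by positivity) (by positivity) (b5 0) (b5 1)) b6)
      b7) b8)

lemma coreConst_nonneg {a : ℝ} (ha : 0 < a) (ha1 : a < 1) : 0 ≤ coreConst a := by
  have hc := mulConst_nonneg a
  have p1 : 0 < -a + -1 + 2 := by linarith
  have p2 : 0 < -(-1 + (-1 - a / 4) + 2) := by linarith
  have p3 : 0 < 1 - a + -2 + 2 := by linarith
  have p4 : 0 < -(0 + (-2 - a / 4) + 2) := by linarith
  unfold coreConst
  positivity

/-! ### Approximation of the density -/

/-- The truncation of a density. -/
def cutF (F : Plane → ℂ) (n : ℕ) : Plane → ℂ :=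
  ({ξ : Plane | ‖ξ‖ ≤ n} ∩ {ξ | ‖F ξ‖ ≤ n}).indicator F

lemma norm_cutF_le (F : Plane → ℂ) (n : ℕ) (ξ : Plane) : ‖cutF F n ξ‖ ≤ ‖F ξ‖ :=
  norm_indicator_le_norm_self _ _

lemma nice_cutF {F : Plane → ℂ} (hF : Measurable F) (n : ℕ) : Nice (cutF F n) := by
  refine ⟨hF.indicator ((measurableSet_le (by fun_prop) (by fun_prop)).inter
    (measurableSet_le (by fun_prop) (by fun_prop))), n, by positivity, fun ξ => ⟨?_, fun h => ?_⟩⟩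
  · by_cases h : ξ ∈ ({ξ : Plane | ‖ξ‖ ≤ n} ∩ {ξ | ‖F ξ‖ ≤ n})
    · rw [cutF, Set.indicator_of_mem h]; exact h.2
    · rw [cutF, Set.indicator_of_notMem h]; simp
  · exact (Set.mem_of_indicator_ne_zero h).1

lemma eventually_cutF_eq (F : Plane → ℂ) (ξ : Plane) : ∀ᶠ n in atTop, cutF F n ξ = F ξ := by
  obtain ⟨N, hN⟩ := exists_nat_ge (max ‖ξ‖ ‖F ξ‖)
  filter_upwards [eventually_ge_atTop N] with n hn
  have h1 : (N : ℝ) ≤ n := by exact_mod_cast hn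
  refine Set.indicator_of_mem ?_ _
  exact ⟨(le_max_left _ _).trans (hN.trans h1), (le_max_right _ _).trans (hN.trans h1)⟩

lemma wnorm_mono {a : ℝ} {P Q : Plane → ℂ} (h : ∀ ξ, ‖P ξ‖ ≤ ‖Q ξ‖) : wnorm a P ≤ wnorm a Q := by
  unfold wnorm
  gcongr with ξ
  exact enorm_le_iff_norm_le.2 (h ξ)

lemma dataNorm_cutF_le (a : ℝ) (F : Plane → ℂ) (n : ℕ) : dataNorm a (cutF F n) ≤ dataNorm a F :=
  add_le_add (wnorm_mono (norm_cutF_le F n)) (wnorm_mono (norm_cutF_le F n))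

section

variable {b : ℝ} {F : Plane → ℂ}

lemma holderConst_cutF_le (hG : GradInt b F) (n : ℕ) :
    holderConst b (cutF F n) ≤ holderConst b F := by
  unfold holderConst
  refine mul_le_mul_of_nonneg_left ?_ (by positivity)
  refine integral_mono_of_nonneg (.of_forall fun ξ => by positivity) hG.2 (.of_forall fun ξ => ?_)
  have := norm_cutF_le F n ξ
  simp only
  gcongr

lemma tendsto_fderiv_rep_cutF (hF : Measurable F) (hG : GradInt b F) (hb : 0 ≤ b) (hb1 : b ≤ 1)
    (y a : Plane) : Tendsto (fun n => fderiv ℝ (rep (cutF F n)) y a) atTop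
      (𝓝 (fderiv ℝ (rep F) y a)) := by
  simp only [(((nice_cutF hF _).gradInt hb).hasFDerivAt_rep hb hb1 y).2,
    (hG.hasFDerivAt_rep hb hb1 y).2]
  refine (Complex.continuous_re.tendsto _).comp ?_
  refine tendsto_integral_of_dominated_convergence
    (fun ξ => 4 * Real.pi ^ 2 * ‖y‖ ^ b * ‖a‖ * (‖ξ‖ ^ b * ‖ξ‖ * ‖F ξ‖)) (fun n => ?_)
    (hG.2.const_mul _) (fun n => .of_forall fun ξ => ?_) (.of_forall fun ξ => ?_)
  · exact (((nice_cutF hF _).gradInt hb).integrable_wave_sub_one_mul hb hb1 a y).1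
  · refine (GradInt.norm_wave_sub_one_mul_le hb hb1 a y ξ).trans ?_
    have := norm_cutF_le F n ξ
    gcongr
  · refine tendsto_const_nhds.congr' ?_
    filter_upwards [eventually_cutF_eq F ξ] with n hn
    simp only [dmul, hn]

lemma HolderGrad.mono {L L' : ℝ} {f : Plane → ℝ} (h : HolderGrad b L f) (hL : L ≤ L') :
    HolderGrad b L' f :=
  ⟨h.contDiff, h.nonneg.trans hL, fun x y => (h.le x y).trans (by gcongr)⟩

lemma holderGrad_cutF (hF : Measurable F) (hG : GradInt b F) (hb : 0 < b) (hb1 : b ≤ 1) (n : ℕ) :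
    HolderGrad b (holderConst b F) (rep (cutF F n)) :=
  (((nice_cutF hF n).gradInt hb.le).holderGrad hb hb1).mono (holderConst_cutF_le hG n)

lemma HolderGrad.abs_truncT_le {L : ℝ} {f : Plane → ℝ} (hf : HolderGrad b L f) (hb : 0 < b)
    (s R : ℝ) (y : Plane) :
    |truncT f s R y| ≤ s ^ 2 * L * ∫ α in Metric.ball (0 : Plane) R, ‖α‖ ^ (b - 2) := by
  rw [← integral_const_mul]
  exact norm_integral_le_of_norm_le (f := kernel f (kLin s) y)
    ((integrableOn_norm_rpow_ball (a := b - 2) (by linarith) R).const_mul _)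
    (.of_forall fun α => hf.abs_kernel_le s y α)

lemma tendsto_truncT_cutF (hF : Measurable F) (hG : GradInt b F) (hb : 0 < b) (hb1 : b ≤ 1)
    (s R : ℝ) (y : Plane) :
    Tendsto (fun n => truncT (rep (cutF F n)) s R y) atTop (𝓝 (truncT (rep F) s R y)) := by
  refine tendsto_integral_of_dominated_convergence
    (fun α => s ^ 2 * holderConst b F * ‖α‖ ^ (b - 2)) (fun n => ?_)
    ((integrableOn_norm_rpow_ball (a := b - 2) (by linarith) R).const_mul _)
    (fun n => .of_forall fun α => (holderGrad_cutF hF hG hb hb1 n).abs_kernel_le s y α)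
    (.of_forall fun α => ?_)
  · exact ((holderGrad_cutF hF hG hb hb1 n).integrableOn_kernel hb s y R).1
  · have h1 : ∀ n, Differentiable ℝ (rep (cutF F n)) := fun n =>
      (holderGrad_cutF hF hG hb hb1 n).contDiff.differentiable one_ne_zero
    have h2 : Differentiable ℝ (rep F) :=
      (hG.holderGrad hb hb1).contDiff.differentiable one_ne_zero
    simp only [kernel_eq (h1 _), kernel_eq h2]
    refine Tendsto.const_mul _ (Tendsto.div_const (Tendsto.mul_const _ ?_) _)
    exact (tendsto_fderiv_rep_cutF hF hG hb.le hb1 y α).sub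
      (tendsto_fderiv_rep_cutF hF hG hb.le hb1 (y - α) α)

lemma integrable_truncT_mul {L : ℝ} {f : Plane → ℝ} (hf : HolderGrad b L f) (hb : 0 < b)
    (s R : ℝ) (Ψ : 𝓢(Plane, ℂ)) : Integrable fun y => (truncT f s R y : ℂ) * Ψ y :=
  Ψ.integrable.bdd_mul (c := s ^ 2 * L * ∫ α in Metric.ball (0 : Plane) R, ‖α‖ ^ (b - 2))
    (Complex.measurable_ofReal.comp (measurable_truncT hf.contDiff s R)).aestronglyMeasurable
    (.of_forall fun y => by
      rw [Complex.norm_real]; exact hf.abs_truncT_le hb s R y)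

/-- Truncating F increases neither `dataNorm` nor the Hölder constant. The bound for truncated
densities is thus uniform, and for fixed R the pairings converge by dominated convergence. -/
lemma enorm_integral_truncT_mul_le' {a : ℝ} (ha : 0 < a) (ha1 : a < 1) (hF : Measurable F)
    (hG : GradInt b F) (hb : 0 < b) (hb1 : b ≤ 1) (s : ℝ) {R : ℝ} (hR : 1 ≤ R) {e : Plane}
    (he : ‖e‖ ≤ 1) (φ : 𝓢(Plane, ℂ)) :
    ‖∫ y, (truncT (rep F) s R y : ℂ) * (∂_{e} (𝓕 φ : 𝓢(Plane, ℂ))) y‖ₑ ≤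
      ENNReal.ofReal (coreConst a * s ^ 2) * (dataNorm a F * wnorm (-a) φ) := by
  set Ψ : 𝓢(Plane, ℂ) := ∂_{e} (𝓕 φ : 𝓢(Plane, ℂ))
  have h1 : Tendsto (fun n => ∫ y, (truncT (rep (cutF F n)) s R y : ℂ) * Ψ y) atTop
      (𝓝 (∫ y, (truncT (rep F) s R y : ℂ) * Ψ y)) := by
    refine tendsto_integral_of_dominated_convergence
      (fun y => s ^ 2 * holderConst b F * (∫ α in Metric.ball (0 : Plane) R, ‖α‖ ^ (b - 2)) *
        ‖Ψ y‖) (fun n => ?_) (Ψ.integrable.norm.const_mul _)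
      (fun n => .of_forall fun y => ?_) (.of_forall fun y => ?_)
    · exact (integrable_truncT_mul (holderGrad_cutF hF hG hb hb1 n) hb s R Ψ).1
    · rw [norm_mul, Complex.norm_real]
      gcongr
      exact (holderGrad_cutF hF hG hb hb1 n).abs_truncT_le hb s R y
    · exact ((Complex.continuous_ofReal.tendsto _).comp
        (tendsto_truncT_cutF hF hG hb hb1 s R y)).mul_const _
  refine le_of_tendsto ((continuous_enorm.tendsto _).comp h1) (.of_forall fun n => ?_)
  refine (enorm_integral_truncT_mul_le (nice_cutF hF n) ha ha1 s hR he φ).trans ?_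
  gcongr
  exact dataNorm_cutF_le a F n

lemma integral_lineDeriv_eq_zero (e : Plane) (Ψ : 𝓢(Plane, ℂ)) : ∫ y, (∂_{e} Ψ) y = 0 := by
  have h := integral_mul_fderiv_eq_neg_fderiv_mul_of_integrable (μ := (volume : Measure Plane))
    (f := fun _ => (1 : ℂ)) (g := Ψ) (v := e) (by simp) (by simpa using (∂_{e} Ψ).integrable)
    (by simpa using Ψ.integrable) (fun x _ => differentiableAt_const _)
    (fun x _ => Ψ.differentiableAt)
  simpa [SchwartzMap.lineDerivOp_apply_eq_fderiv] using h

lemma integrable_one_add_norm_sq_mul (Ψ : 𝓢(Plane, ℂ)) :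
    Integrable fun y => (1 + ‖y‖) ^ 2 * ‖Ψ y‖ := by
  have h0 := Ψ.integrable_pow_mul volume 0
  have h1 := Ψ.integrable_pow_mul volume 1
  have h2 := Ψ.integrable_pow_mul volume 2
  refine ((h0.add (h1.const_mul 2)).add h2).congr (.of_forall fun y => ?_)
  simp only [Pi.add_apply]; ring

/-- Passage to the limit R → ∞ along the integers, in the pairing with a derivative of a Schwartz
function; the quadratic bound of `HolderGrad.exists_limit` is the majorant. -/
theorem exists_limit_rep {a : ℝ} (ha : 0 < a) (ha1 : a < 1) (hF : Measurable F)
    (hG : GradInt b F) (hb : 0 < b) (hb1 : b < 1) (s : ℝ) :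
    ∃ (T : Plane → ℝ) (K : ℝ), Measurable T ∧ (∀ y, |T y| ≤ K * (1 + ‖y‖) ^ 2) ∧
      (∀ y, Tendsto (fun R => truncT (rep F) s R y - truncT (rep F) s R 0) atTop (𝓝 (T y))) ∧
      ∀ (e : Plane) (_ : ‖e‖ ≤ 1) (φ : 𝓢(Plane, ℂ)),
        ‖∫ y, (T y : ℂ) * (∂_{e} (𝓕 φ : 𝓢(Plane, ℂ))) y‖ₑ ≤
          ENNReal.ofReal (coreConst a * s ^ 2) * dataNorm a F * wnorm (-a) φ := by
  have hH := hG.holderGrad hb hb1.le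
  obtain ⟨T, K, hT, hK⟩ := hH.exists_limit hb hb1 s
  have hTn : ∀ y, Tendsto (fun n : ℕ => truncT (rep F) s n y - truncT (rep F) s n 0) atTop
      (𝓝 (T y)) := fun y => (hT y).comp tendsto_natCast_atTop_atTop
  have hTK : ∀ y, |T y| ≤ K * (1 + ‖y‖) ^ 2 := fun y => by
    refine le_of_tendsto (hT y).abs ?_
    filter_upwards [eventually_ge_atTop 1] with R hR
    exact hK y R hR
  refine ⟨T, K, ?_, hTK, hT, fun e he φ => ?_⟩
  · exact measurable_of_tendsto_metrizable
      (fun n : ℕ => (measurable_truncT hH.contDiff s n).sub_const _) (tendsto_pi_nhds.2 hTn)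
  set Ψ : 𝓢(Plane, ℂ) := ∂_{e} (𝓕 φ : 𝓢(Plane, ℂ)) with hΨ
  have h1 : Tendsto (fun n : ℕ => ∫ y, ((truncT (rep F) s n y - truncT (rep F) s n 0 : ℝ) : ℂ) *
      Ψ y) atTop (𝓝 (∫ y, (T y : ℂ) * Ψ y)) := by
    refine tendsto_integral_filter_of_dominated_convergence
      (fun y => K * ((1 + ‖y‖) ^ 2 * ‖Ψ y‖)) (.of_forall fun n => ?_) ?_
      ((integrable_one_add_norm_sq_mul Ψ).const_mul K) (.of_forall fun y => ?_)
    · exact (Complex.measurable_ofReal.comp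
        ((measurable_truncT hH.contDiff s n).sub_const _)).aestronglyMeasurable.mul
        Ψ.integrable.1
    · filter_upwards [eventually_ge_atTop 1] with n hn
      refine .of_forall fun y => ?_
      rw [norm_mul, Complex.norm_real, ← mul_assoc]
      gcongr
      exact hK y n (by exact_mod_cast hn)
    · exact ((Complex.continuous_ofReal.tendsto _).comp (hTn y)).mul_const _
  refine le_of_tendsto ((continuous_enorm.tendsto _).comp h1) ?_
  filter_upwards [eventually_ge_atTop 1] with n hn
  -- The renormalising constant disappears because Ψ is a derivative and has integral zero.
  have e1 : ∫ y, ((truncT (rep F) s n y - truncT (rep F) s n 0 : ℝ) : ℂ) * Ψ y =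
      ∫ y, (truncT (rep F) s n y : ℂ) * Ψ y := by
    simp only [Complex.ofReal_sub, sub_mul]
    rw [integral_sub (integrable_truncT_mul hH hb s n Ψ) (Ψ.integrable.const_mul _),
      integral_const_mul, integral_lineDeriv_eq_zero, mul_zero, sub_zero]
  rw [Function.comp_apply, e1, mul_assoc]
  exact enorm_integral_truncT_mul_le' ha ha1 hF hG hb hb1.le s (by exact_mod_cast hn) he φ

end

/-! ### Tempered distributions -/

/-- Dividing by 1 + |y|² gives an `L^∞` function, hence a tempered distribution; multiplying back by
this polynomial is continuous on Schwartz functions. -/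
lemma exists_isFunction {v : Plane → ℂ} (hv : AEStronglyMeasurable v) {K : ℝ}
    (hK : ∀ y, ‖v y‖ ≤ K * (1 + ‖y‖) ^ 2) : ∃ u : 𝓢'(Plane, ℂ), IsFunction u v := by
  set g : Plane → ℂ := fun y => ((1 + ‖y‖ ^ 2 : ℝ) : ℂ) with hg
  have hgt : g.HasTemperateGrowth := by
    simp only [hg]
    fun_prop
  have hgne : ∀ y, g y ≠ 0 := fun y => by
    simp only [hg]
    have : (0 : ℝ) < 1 + ‖y‖ ^ 2 := by positivity
    exact_mod_cast this.ne'
  have hgm : Measurable g := by simp only [hg]; fun_prop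
  set q : Plane → ℂ := fun y => (g y)⁻¹ * v y with hq
  have hqa : AEStronglyMeasurable q := hgm.inv.aestronglyMeasurable.mul hv
  have hqb : ∀ y, ‖q y‖ ≤ 2 * K := fun y => by
    have h1 : ‖g y‖ = 1 + ‖y‖ ^ 2 := by
      simp only [hg, Complex.norm_real]
      exact Real.norm_of_nonneg (by positivity)
    have hK0 : 0 ≤ K := by simpa using (norm_nonneg _).trans (hK 0)
    rw [hq, norm_mul, norm_inv, h1, inv_mul_le_iff₀ (by positivity)]
    refine (hK y).trans ?_
    nlinarith [mul_nonneg hK0 (sq_nonneg (1 - ‖y‖))]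
  have hqm : MemLp q ∞ := memLp_top_of_bound hqa (2 * K) (.of_forall hqb)
  refine ⟨TemperedDistribution.smulLeftCLM ℂ g (hqm.toLp q : Lp ℂ ∞ (volume : Measure Plane)),
    hv, fun φ => ⟨?_, ?_⟩⟩
  · have := (SchwartzMap.smulLeftCLM ℂ g φ).integrable (μ := (volume : Measure Plane))
    refine (this.mul_bdd (c := 2 * K) hqa (.of_forall hqb)).congr (.of_forall fun y => ?_)
    simp only [SchwartzMap.smulLeftCLM_apply_apply hgt, hq, smul_eq_mul]
    field_simp [hgne y]
  · rw [TemperedDistribution.smulLeftCLM_apply_apply, Lp.toTemperedDistribution_apply]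
    refine integral_congr_ae ?_
    filter_upwards [hqm.coeFn_toLp] with y hy
    rw [hy, SchwartzMap.smulLeftCLM_apply_apply hgt, hq, smul_eq_mul, smul_eq_mul]
    field_simp [hgne y]

/-- The multiplication of Schwartz functions with a coordinate. -/
def mulX (m : Plane) : 𝓢(Plane, ℂ) →L[ℂ] 𝓢(Plane, ℂ) :=
  SchwartzMap.smulLeftCLM ℂ (fun x : Plane => ((inner ℝ x m : ℝ) : ℂ))

lemma mulX_apply (m : Plane) (φ : 𝓢(Plane, ℂ)) (x : Plane) :
    mulX m φ x = ((inner ℝ x m : ℝ) : ℂ) * φ x := by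
  have : (fun x : Plane => ((inner ℝ x m : ℝ) : ℂ)).HasTemperateGrowth := by fun_prop
  rw [mulX, SchwartzMap.smulLeftCLM_apply_apply this, smul_eq_mul]

lemma mulX_comm (m n : Plane) (φ : 𝓢(Plane, ℂ)) : mulX m (mulX n φ) = mulX n (mulX m φ) := by
  ext x; simp only [mulX_apply]; ring

lemma fourier_lineDeriv_apply (u : 𝓢'(Plane, ℂ)) (m : Plane) (φ : 𝓢(Plane, ℂ)) :
    𝓕 (∂_{m} u) φ = 2 * Real.pi * Complex.I * (𝓕 u) (mulX m φ) := by
  rw [TemperedDistribution.fourier_lineDerivOp_eq]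
  rfl

/-- A coordinate vector. -/
abbrev basisVec (i : Fin 2) : Plane := EuclideanSpace.single i 1

lemma fourier_partialDeriv_two (u : 𝓢'(Plane, ℂ)) (i : Fin 2 → Fin 2) (φ : 𝓢(Plane, ℂ)) :
    𝓕 (partialDeriv i u) φ =
      -(4 * Real.pi ^ 2) * (𝓕 u) (mulX (basisVec (i 0)) (mulX (basisVec (i 1)) φ)) := by
  have : partialDeriv i u = ∂_{basisVec (i 0)} (∂_{basisVec (i 1)} u) := rfl
  rw [this, fourier_lineDeriv_apply, fourier_lineDeriv_apply, mulX_comm]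
  linear_combination (4 * Real.pi ^ 2 * (𝓕 u) (mulX (basisVec (i 0)) (mulX (basisVec (i 1)) φ))) *
    Complex.I_sq

lemma partialDeriv_one (u : 𝓢'(Plane, ℂ)) (i : Fin 1 → Fin 2) :
    partialDeriv i u = ∂_{basisVec (i 0)} u := rfl

/-- The value of `homSobolev t f` for given Fourier transforms of the derivatives of order `m`. -/
def sobNorm (m : ℕ) (c : ℝ) (W : (Fin m → Fin 2) → Plane → ℂ) : ℝ≥0∞ :=
  (∑ i, eLpNorm (fun ξ => ((2 * Real.pi * ‖ξ‖) ^ c : ℝ) • W i ξ) 2 volume ^ 2) ^ (1 / 2 : ℝ)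

lemma homSobolev_eq_iInf {t c : ℝ} {m : ℕ} (hm : ⌊t⌋₊ = m) (hc : t - m = c) (f : Plane → ℝ) :
    homSobolev t f = ⨅ (u : 𝓢'(Plane, ℂ)) (_ : IsFunction u (fun x => (f x : ℂ)))
      (W : (Fin m → Fin 2) → Plane → ℂ) (_ : ∀ i, IsFunction (𝓕 (partialDeriv i u)) (W i)),
      sobNorm m c W := by
  subst hm hc
  rfl

/-- The infimum ranges over a single value: u is determined by f, and the transforms of its
derivatives are determined up to null sets. -/
lemma homSobolev_eq {t c : ℝ} {m : ℕ} (hm : ⌊t⌋₊ = m) (hc : t - m = c) {f : Plane → ℝ}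
    {u : 𝓢'(Plane, ℂ)} (hu : IsFunction u (fun x => (f x : ℂ)))
    {W : (Fin m → Fin 2) → Plane → ℂ} (hW : ∀ i, IsFunction (𝓕 (partialDeriv i u)) (W i)) :
    homSobolev t f = sobNorm m c W := by
  rw [homSobolev_eq_iInf hm hc]
  refine le_antisymm (iInf₂_le_of_le u hu (iInf₂_le W hW)) ?_
  refine le_iInf₂ fun u' hu' => le_iInf₂ fun W' hW' => ?_
  obtain rfl := hu.unique hu'
  have h : ∀ i, W i =ᵐ[volume] W' i := fun i => (hW i).ae_eq (hW' i)
  refine le_of_eq ?_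
  unfold sobNorm
  congr 1
  refine Finset.sum_congr rfl fun i _ => ?_
  congr 1
  refine eLpNorm_congr_ae ?_
  filter_upwards [h i] with ξ hξ
  rw [hξ]

lemma exists_of_homSobolev_lt_top {t c : ℝ} {m : ℕ} (hm : ⌊t⌋₊ = m) (hc : t - m = c)
    {f : Plane → ℝ} (h : homSobolev t f < ∞) :
    ∃ u : 𝓢'(Plane, ℂ), IsFunction u (fun x => (f x : ℂ)) ∧
      ∃ W : (Fin m → Fin 2) → Plane → ℂ, (∀ i, IsFunction (𝓕 (partialDeriv i u)) (W i)) ∧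
        homSobolev t f = sobNorm m c W := by
  have h' := h
  rw [homSobolev_eq_iInf hm hc] at h'
  simp only [iInf_lt_iff] at h'
  obtain ⟨u, hu, W, hW, -⟩ := h'
  exact ⟨u, hu, W, hW, homSobolev_eq hm hc hu hW⟩

/-! ### The density of a function with second derivatives in a Sobolev space -/

section

variable {u : 𝓢'(Plane, ℂ)} {W : (Fin 2 → Fin 2) → Plane → ℂ}

lemma inner_basisVec (ξ : Plane) (i : Fin 2) : inner ℝ ξ (basisVec i) = ξ i := by
  simp [EuclideanSpace.inner_single_right]

lemma plane_norm_sq (ξ : Plane) : ‖ξ‖ ^ 2 = ξ 0 ^ 2 + ξ 1 ^ 2 := by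
  rw [EuclideanSpace.norm_sq_eq, Fin.sum_univ_two, Real.norm_eq_abs, Real.norm_eq_abs, sq_abs,
    sq_abs]

/-- Both sides represent the transform of the same fourth derivative of u, up to the common
constant. Multiplications by coordinates commute and can be moved to the test function. -/
lemma symm_of_isFunction (hW : ∀ i, IsFunction (𝓕 (partialDeriv i u)) (W i)) (i j : Fin 2 → Fin 2) :
    (fun ξ => ((ξ (j 0) * ξ (j 1) : ℝ) : ℂ) * W i ξ) =ᵐ[volume]
      fun ξ => ((ξ (i 0) * ξ (i 1) : ℝ) : ℂ) * W j ξ := by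
  have h1 : ∀ (i j : Fin 2 → Fin 2) (φ : 𝓢(Plane, ℂ)),
      (fun ξ => φ ξ * (((ξ (j 0) * ξ (j 1) : ℝ) : ℂ) * W i ξ)) =
        fun ξ => mulX (basisVec (j 0)) (mulX (basisVec (j 1)) φ) ξ * W i ξ := by
    intro i j φ
    ext ξ
    simp only [mulX_apply, inner_basisVec]
    push_cast; ring
  refine ae_eq_of_schwartz (locallyIntegrable_of_schwartz fun φ => ?_)
    (locallyIntegrable_of_schwartz fun φ => ?_) fun φ => ?_
  · rw [h1]; exact ((hW i).2 _).1
  · rw [h1]; exact ((hW j).2 _).1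
  · rw [h1, h1, ← ((hW i).2 _).2, ← ((hW j).2 _).2, fourier_partialDeriv_two,
      fourier_partialDeriv_two]
    congr 2
    ext ξ
    simp only [mulX_apply]
    ring

/-- Division by ξ_i ξ_j is singular on the axes, so F is read off from the Laplacian, dividing its
transform by -4π²|ξ|², which vanishes only at 0. The compatibility relations then recover every
second derivative. -/
theorem exists_density (hW : ∀ i, IsFunction (𝓕 (partialDeriv i u)) (W i)) :
    ∃ F : Plane → ℂ, Measurable F ∧
      ∀ i, W i =ᵐ[volume] fun ξ => -(4 * Real.pi ^ 2) * ((ξ (i 0) * ξ (i 1) : ℝ) : ℂ) * F ξ := by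
  set F₀ : Plane → ℂ := fun ξ =>
    -(W (fun _ => 0) ξ + W (fun _ => 1) ξ) / ((4 * Real.pi ^ 2 * ‖ξ‖ ^ 2 : ℝ) : ℂ) with hF₀
  have hm : AEStronglyMeasurable F₀ :=
    (((hW _).1.add (hW _).1).neg.aemeasurable.div
      (by fun_prop : Measurable fun ξ : Plane =>
        ((4 * Real.pi ^ 2 * ‖ξ‖ ^ 2 : ℝ) : ℂ)).aemeasurable).aestronglyMeasurable
  refine ⟨hm.mk F₀, hm.stronglyMeasurable_mk.measurable, fun i => ?_⟩
  have h0 : ∀ᵐ ξ : Plane, ξ ≠ 0 := by simp [ae_iff]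
  filter_upwards [hm.ae_eq_mk, h0, symm_of_isFunction hW i (fun _ => 0),
    symm_of_isFunction hW i (fun _ => 1)] with ξ h1 h2 h3 h4
  have h5 : (‖ξ‖ : ℂ) ≠ 0 := by simpa using h2
  have h6 : (‖ξ‖ : ℂ) ^ 2 = (ξ 0 : ℂ) ^ 2 + (ξ 1 : ℂ) ^ 2 := by exact_mod_cast plane_norm_sq ξ
  have hpi : (Real.pi : ℂ) ≠ 0 := by exact_mod_cast Real.pi_ne_zero
  rw [← h1, hF₀]
  push_cast at h3 h4 ⊢
  field_simp
  rw [h6]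
  linear_combination h3 + h4

/-- The two pure second derivatives suffice: the absolute values of their transforms add up to
4π²|ξ|² |F|, without cancellation. -/
lemma wnorm_density_le {F : Plane → ℂ}
    (hF : ∀ i, W i =ᵐ[volume] fun ξ => -(4 * Real.pi ^ 2) * ((ξ (i 0) * ξ (i 1) : ℝ) : ℂ) * F ξ)
    (hW : ∀ i, AEStronglyMeasurable (W i)) {c : ℝ} (hc : 0 < c) :
    wnorm (2 + c) F ≤ 2 * sobNorm 2 c W := by
  set V : (Fin 2 → Fin 2) → Plane → ℂ := fun i ξ => ((2 * Real.pi * ‖ξ‖) ^ c : ℝ) • W i ξ with hV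
  have hle : ∀ i, eLpNorm (V i) 2 volume ≤ sobNorm 2 c W := fun i => by
    have h1 : eLpNorm (V i) 2 volume ^ 2 ≤ ∑ j, eLpNorm (V j) 2 volume ^ 2 :=
      Finset.single_le_sum (f := fun j => eLpNorm (V j) 2 volume ^ 2) (fun _ _ => zero_le)
        (Finset.mem_univ i)
    calc eLpNorm (V i) 2 volume = (eLpNorm (V i) 2 volume ^ 2) ^ (1 / 2 : ℝ) := by
          rw [← ENNReal.rpow_natCast, ← ENNReal.rpow_mul]; norm_num
      _ ≤ _ := ENNReal.rpow_le_rpow h1 (by norm_num)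
  have hVm : ∀ i, AEStronglyMeasurable (V i) := fun i =>
    AEStronglyMeasurable.smul (by fun_prop : Measurable fun ξ : Plane =>
      ((2 * Real.pi * ‖ξ‖) ^ c : ℝ)).aestronglyMeasurable (hW i)
  rw [wnorm_eq_eLpNorm]
  calc _ ≤ eLpNorm (fun ξ => ‖V (fun _ => 0) ξ‖ + ‖V (fun _ => 1) ξ‖) 2 volume := by
        refine eLpNorm_mono_ae ?_
        filter_upwards [hF (fun _ => 0), hF (fun _ => 1)] with ξ h0 h1
        have e2 : ‖ξ‖ ^ (2 + c) = ‖ξ‖ ^ c * ‖ξ‖ ^ 2 := by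
          rcases eq_or_ne ξ 0 with rfl | hξ
          · rw [norm_zero, Real.zero_rpow (by linarith)]; simp
          · rw [add_comm, Real.rpow_add (norm_pos_iff.2 hξ), Real.rpow_two]
        have e1 : ‖W (fun _ => 0) ξ‖ + ‖W (fun _ => 1) ξ‖ = 4 * Real.pi ^ 2 * (‖ξ‖ ^ 2 * ‖F ξ‖) := by
          rw [h0, h1, plane_norm_sq]
          simp only [norm_mul, norm_neg, Complex.norm_real, norm_pow, Complex.norm_ofNat,
            Real.norm_of_nonneg Real.pi_pos.le, Real.norm_eq_abs, ← pow_two, sq_abs]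
          ring
        have hp : 1 ≤ (2 * Real.pi) ^ c :=
          Real.one_le_rpow (by linarith [Real.pi_gt_three]) hc.le
        have hp2 : 1 ≤ 4 * Real.pi ^ 2 := by nlinarith [Real.pi_gt_three]
        have e3 : (1 : ℝ) ≤ (2 * Real.pi) ^ c * (4 * Real.pi ^ 2) := by nlinarith
        rw [norm_smul, Real.norm_of_nonneg (by positivity), Real.norm_of_nonneg (by positivity), hV]
        simp only [norm_smul]
        rw [← mul_add, e1, Real.norm_of_nonneg (by positivity),
          Real.mul_rpow (by positivity) (by positivity), e2]
        calc _ = 1 * (‖ξ‖ ^ c * ‖ξ‖ ^ 2 * ‖F ξ‖) := by ring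
          _ ≤ (2 * Real.pi) ^ c * (4 * Real.pi ^ 2) * (‖ξ‖ ^ c * ‖ξ‖ ^ 2 * ‖F ξ‖) := by gcongr
          _ = _ := by ring
    _ ≤ eLpNorm (V (fun _ => 0)) 2 volume + eLpNorm (V (fun _ => 1)) 2 volume := by
        refine (eLpNorm_add_le (hVm _).norm (hVm _).norm (by norm_num)).trans ?_
        rw [eLpNorm_norm, eLpNorm_norm]
    _ ≤ _ := by rw [two_mul]; exact add_le_add (hle _) (hle _)

end

lemma lintegral_weight_le (c d : ℝ) {F : Plane → ℂ} (hF : Measurable F) (S : Set Plane) :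
    ∫⁻ ξ in S, ENNReal.ofReal (‖ξ‖ ^ d * (‖ξ‖ ^ c * ‖F ξ‖)) ≤
      (∫⁻ ξ in S, ENNReal.ofReal (‖ξ‖ ^ (2 * d))) ^ (1 / 2 : ℝ) * wnorm c F := by
  have hsq : ∀ (x : Plane) (e : ℝ), ENNReal.ofReal (‖x‖ ^ e) ^ (2 : ℝ) =
      ENNReal.ofReal (‖x‖ ^ (2 * e)) := fun x e => by
    rw [ENNReal.ofReal_rpow_of_nonneg (by positivity) (by norm_num), ← Real.rpow_mul (norm_nonneg x),
      mul_comm]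
  have h := ENNReal.lintegral_mul_le_Lp_mul_Lq (volume.restrict S) Real.HolderConjugate.two_two
    (f := fun ξ : Plane => ENNReal.ofReal (‖ξ‖ ^ d))
    (g := fun ξ => ENNReal.ofReal (‖ξ‖ ^ c * ‖F ξ‖)) (by fun_prop) (by fun_prop)
  calc _ ≤ _ := (le_of_eq ?_).trans h
    _ ≤ _ := ?_
  · refine lintegral_congr fun ξ => ?_
    rw [Pi.mul_apply, ENNReal.ofReal_mul (by positivity)]
  · simp only [hsq]
    refine mul_le_mul_right ?_ _
    rw [wnorm]
    refine ENNReal.rpow_le_rpow ((setLIntegral_le_lintegral _ _).trans (le_of_eq ?_)) (by norm_num)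
    refine lintegral_congr fun ξ => ?_
    rw [ENNReal.ofReal_mul (by positivity), ENNReal.mul_rpow_of_nonneg _ _ (by norm_num), hsq,
      ofReal_norm, ENNReal.rpow_two]

/-- Cauchy–Schwarz, split at |ξ| = 1. Against the norm of order 2 + a/4 the leftover weight is
|ξ|^(-2+a/2), integrable near 0; against the norm of order 2 + a it is |ξ|^(-2-a), integrable at
infinity. -/
theorem gradInt_of_dataNorm {a : ℝ} (ha : 0 < a) {F : Plane → ℂ} (hF : Measurable F)
    (h : dataNorm a F < ∞) : GradInt (a / 2) F := by
  obtain ⟨h1, h2⟩ := ENNReal.add_lt_top.1 h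
  refine ⟨hF.aestronglyMeasurable, ?_⟩
  have h0 : ∀ᵐ ξ : Plane, ξ ≠ 0 := by simp [ae_iff]
  rw [← integrableOn_univ, ← Set.union_compl_self (Metric.ball (0 : Plane) 1)]
  have key : ∀ (c : ℝ) (S : Set Plane), wnorm c F < ∞ → MeasurableSet S →
      ∫⁻ ξ in S, ENNReal.ofReal (‖ξ‖ ^ (2 * (1 + a / 2 - c))) < ∞ →
      IntegrableOn (fun ξ => ‖ξ‖ ^ (a / 2) * ‖ξ‖ * ‖F ξ‖) S := by
    intro c S hc hS hi
    refine ⟨by fun_prop, ?_⟩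
    rw [hasFiniteIntegral_iff_norm]
    calc _ = ∫⁻ ξ in S, ENNReal.ofReal (‖ξ‖ ^ (1 + a / 2 - c) * (‖ξ‖ ^ c * ‖F ξ‖)) := by
          refine lintegral_congr_ae ?_
          filter_upwards [ae_restrict_of_ae h0] with ξ hξ
          have hn := norm_pos_iff.2 hξ
          have e : ‖ξ‖ ^ (a / 2) * ‖ξ‖ = ‖ξ‖ ^ (1 + a / 2 - c) * ‖ξ‖ ^ c := by
            rw [← Real.rpow_add_one hn.ne', ← Real.rpow_add hn]; congr 1; ring
          rw [Real.norm_of_nonneg (by positivity), e, mul_assoc]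
      _ ≤ _ := lintegral_weight_le c _ hF S
      _ < ∞ := ENNReal.mul_lt_top (ENNReal.rpow_lt_top_of_nonneg (by norm_num) hi.ne) hc
  refine (key (2 + a / 4) _ h1 measurableSet_ball ?_).union
    (key (2 + a) _ h2 measurableSet_ball.compl ?_)
  · exact (lintegral_norm_rpow_ball (by linarith) (by norm_num)).trans_lt ENNReal.ofReal_lt_top
  · rw [lintegral_norm_rpow_compl (by linarith)]; exact ENNReal.ofReal_lt_top

/-! ### Functions with vanishing second derivatives -/

open ContinuousLinearMap in
lemma fderiv_convolution_apply {v ρ : Plane → ℝ} (hv : LocallyIntegrable v)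
    (hρ : ContDiff ℝ 1 ρ) (hc : HasCompactSupport ρ) (x m : Plane) :
    DifferentiableAt ℝ (convolution v ρ (lsmul ℝ ℝ).flip volume) x ∧
    fderiv ℝ (convolution v ρ (lsmul ℝ ℝ).flip volume) x m =
      convolution v (fun z => fderiv ℝ ρ z m) (lsmul ℝ ℝ).flip volume x := by
  have h := hc.hasFDerivAt_convolution_right (lsmul ℝ ℝ).flip hv hρ x
  refine ⟨h.differentiableAt, ?_⟩
  rw [h.fderiv, convolution_precompR_apply _ hv (hc.fderiv ℝ) (hρ.continuous_fderiv one_ne_zero)]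

lemma ext_basisVec {A B : Plane →L[ℝ] ℝ} (h : ∀ i, A (basisVec i) = B (basisVec i)) : A = B := by
  ext x
  have h2 : x = ∑ i : Fin 2, x i • (basisVec i) := by
    ext j
    fin_cases j <;> simp
  rw [h2, map_sum, map_sum]
  simp only [map_smul, h]

open ContinuousLinearMap in
-- Second derivatives of the mollified function at x are pairings of v with second derivatives of
-- the reflected and translated mollifier, and these vanish by assumption. Hence the gradient is
-- constant.
lemma convolution_affine {v ρ : Plane → ℝ} (hv : LocallyIntegrable v)
    (hρ : ContDiff ℝ (↑(⊤ : ℕ∞)) ρ) (hc : HasCompactSupport ρ)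
    (h : ∀ (i j : Fin 2) (σ : Plane → ℝ), ContDiff ℝ (↑(⊤ : ℕ∞)) σ → HasCompactSupport σ →
      ∫ t, fderiv ℝ (fun z => fderiv ℝ σ z (basisVec i)) t (basisVec j) * v t = 0) (x : Plane) :
    convolution v ρ (lsmul ℝ ℝ).flip volume x = convolution v ρ (lsmul ℝ ℝ).flip volume 0 +
      fderiv ℝ (convolution v ρ (lsmul ℝ ℝ).flip volume) 0 x := by
  set A := convolution v ρ (lsmul ℝ ℝ).flip volume with hA
  set D : Fin 2 → Plane → ℝ := fun i =>
    convolution v (fun z => fderiv ℝ ρ z (basisVec i)) (lsmul ℝ ℝ).flip volume with hD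
  have hρ1 : ContDiff ℝ 1 ρ := hρ.of_le (by simp)
  have hρ2 : ∀ i, ContDiff ℝ (↑(⊤ : ℕ∞)) (fun z => fderiv ℝ ρ z (basisVec i)) := fun i =>
    (hρ.fderiv_right (m := ↑(⊤ : ℕ∞)) (by simp)).clm_apply contDiff_const
  have hc2 : ∀ i, HasCompactSupport (fun z => fderiv ℝ ρ z (basisVec i)) := fun i =>
    hc.fderiv_apply ℝ (basisVec i)
  have h1 : ∀ x i, fderiv ℝ A x (basisVec i) = D i x := fun x i =>
    (fderiv_convolution_apply hv hρ1 hc x _).2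
  have h2 : ∀ i x, fderiv ℝ (D i) x = 0 := fun i x => by
    refine ext_basisVec fun j => ?_
    rw [(fderiv_convolution_apply hv ((hρ2 i).of_le (by simp)) (hc2 i) x _).2]
    have hσ : ContDiff ℝ (↑(⊤ : ℕ∞)) (fun t => ρ (x - t)) := hρ.comp (contDiff_const.sub contDiff_id)
    have hσc : HasCompactSupport (fun t => ρ (x - t)) :=
      hc.comp_homeomorph (Homeomorph.subLeft x)
    have key : ∀ (g : Plane → ℝ) (_ : Differentiable ℝ g) (t m : Plane),
        fderiv ℝ (fun t => g (x - t)) t m = -fderiv ℝ g (x - t) m := by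
      intro g hg t m
      have h1 : HasFDerivAt (fun t => g (x - t)) _ t :=
        HasFDerivAt.comp (g := g) (f := fun t => x - t) t (hg (x - t)).hasFDerivAt
          ((hasFDerivAt_id t).const_sub x)
      rw [h1.fderiv]; simp
    have := h i j _ hσ hσc
    simp only [key ρ (hρ1.differentiable one_ne_zero)] at this
    have e1 : ∀ t, fderiv ℝ (fun z => -fderiv ℝ ρ (x - z) (basisVec i)) t (basisVec j) =
        fderiv ℝ (fun z => fderiv ℝ ρ z (basisVec i)) (x - t) (basisVec j) := fun t => by
      rw [fderiv_fun_neg, neg_apply, key _ ((hρ2 i).differentiable (by simp)), neg_neg]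
    simp only [e1] at this
    rw [zero_apply, convolution_def, ← this]
    refine integral_congr_ae (.of_forall fun t => ?_)
    simp
  have h3 : ∀ x, fderiv ℝ A x = fderiv ℝ A 0 := fun x => ext_basisVec fun i => by
    rw [h1, h1]
    exact is_const_of_fderiv_eq_zero
      (fun x => (fderiv_convolution_apply hv ((hρ2 i).of_le (by simp)) (hc2 i) x 0).1) (h2 i) x 0
  have hAd : Differentiable ℝ A := fun x => (fderiv_convolution_apply hv hρ1 hc x 0).1
  have h4 : ∀ x, fderiv ℝ (fun x => A x - fderiv ℝ A 0 x) x = 0 := fun x => by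
    rw [fderiv_fun_sub (hAd x) (fderiv ℝ A 0).differentiableAt, h3,
      ContinuousLinearMap.fderiv, sub_self]
  have h5 := is_const_of_fderiv_eq_zero (hAd.sub (fderiv ℝ A 0).differentiable) h4 x 0
  simp only [Pi.sub_apply, map_zero, sub_zero] at h5
  linarith

/-- The mollifications are affine and converge to v almost everywhere, so it remains to see that
their coefficients converge. -/
theorem ae_affine {v : Plane → ℝ} (hv : LocallyIntegrable v)
    (h : ∀ (i j : Fin 2) (σ : Plane → ℝ), ContDiff ℝ (↑(⊤ : ℕ∞)) σ → HasCompactSupport σ →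
      ∫ t, fderiv ℝ (fun z => fderiv ℝ σ z (basisVec i)) t (basisVec j) * v t = 0) :
    ∃ (c : ℝ) (L : Plane →L[ℝ] ℝ), v =ᵐ[volume] fun y => c + L y := by
  set β : ℕ → ContDiffBump (0 : Plane) := fun n =>
    ⟨1 / (n + 1), 2 / (n + 1), by positivity, by gcongr; norm_num⟩ with hβ
  have ht : Tendsto (fun n => (β n).rOut) atTop (𝓝 0) := by
    have := (tendsto_one_div_add_atTop_nhds_zero_nat (𝕜 := ℝ)).const_mul 2
    rw [mul_zero] at this
    refine this.congr fun n => ?_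
    simp only [hβ]; ring
  have hae := ContDiffBump.ae_convolution_tendsto_right_of_locallyIntegrable (K := 2) ht
    (.of_forall fun n => le_of_eq (by simp only [hβ]; ring)) hv
  set A : ℕ → Plane → ℝ := fun n =>
    convolution v ((β n).normed volume) (ContinuousLinearMap.lsmul ℝ ℝ).flip volume with hA
  have hAeq : ∀ n, convolution ((β n).normed volume) v (ContinuousLinearMap.lsmul ℝ ℝ) volume =
      A n := fun n => (convolution_flip _).symm
  simp only [hAeq] at hae
  have hA1 : ∀ n x, A n x = A n 0 + fderiv ℝ (A n) 0 x := fun n x =>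
    convolution_affine hv (β n).contDiff_normed (β n).hasCompactSupport_normed h x
  have hsh : ∀ e : Plane, ∀ᵐ x : Plane, Tendsto (fun n => A n (x + e)) atTop (𝓝 (v (x + e))) :=
    fun e => (measurePreserving_add_right volume e).quasiMeasurePreserving.ae hae
  -- An affine function on the plane is determined by its values at x₀, x₀ + e₀ and x₀ + e₁; almost
  -- every x₀ has convergence at all three points.
  obtain ⟨x₀, h0, h1⟩ := (hae.and (ae_all_iff.2 fun i => hsh (basisVec i))).exists
  have hL : ∀ i, Tendsto (fun n => fderiv ℝ (A n) 0 (basisVec i)) atTop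
      (𝓝 (v (x₀ + basisVec i) - v x₀)) := fun i => by
    refine ((h1 i).sub h0).congr fun n => ?_
    rw [hA1 n (x₀ + _), hA1 n x₀, map_add]; ring
  set L : Plane →L[ℝ] ℝ := ∑ i, (v (x₀ + basisVec i) - v x₀) • EuclideanSpace.proj i with hLd
  refine ⟨v x₀ - L x₀, L, ?_⟩
  filter_upwards [hae] with x hx
  have hx2 : Tendsto (fun n => A n x) atTop (𝓝 (v x₀ + L (x - x₀))) := by
    have : Tendsto (fun n => ∑ i, (x - x₀) i * fderiv ℝ (A n) 0 (basisVec i)) atTop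
        (𝓝 (∑ i, (x - x₀) i * (v (x₀ + basisVec i) - v x₀))) :=
      tendsto_finsetSum _ fun i _ => (hL i).const_mul _
    have e1 : L (x - x₀) = ∑ i, (x - x₀) i * (v (x₀ + basisVec i) - v x₀) := by
      simp [hLd, mul_comm]
    rw [e1]
    refine (h0.add this).congr fun n => ?_
    have h2 : x - x₀ = ∑ i : Fin 2, (x - x₀) i • (basisVec i) := by
      ext j
      fin_cases j <;> simp
    have h3 : fderiv ℝ (A n) 0 (x - x₀) =
        ∑ i, (x - x₀) i * fderiv ℝ (A n) 0 (basisVec i) := by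
      conv_lhs => rw [h2]
      simp only [map_sum, map_smul, smul_eq_mul]
    rw [← h3, hA1 n x, hA1 n x₀, map_sub]; ring
  rw [tendsto_nhds_unique hx hx2, map_sub]; ring

/-! ### The representation of functions with second derivatives in a Sobolev space -/

lemma fourierInv_lineDeriv_lineDeriv (m n : Plane) (φ : 𝓢(Plane, ℂ)) (ξ : Plane) :
    (𝓕⁻ (∂_{m} (∂_{n} (𝓕 φ : 𝓢(Plane, ℂ)))) : 𝓢(Plane, ℂ)) ξ =
      -(4 * Real.pi ^ 2) * ((inner ℝ ξ m * inner ℝ ξ n : ℝ) : ℂ) * φ ξ := by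
  have hm : ∀ m : Plane, (inner ℝ · m : Plane → ℝ).HasTemperateGrowth := fun m => by fun_prop
  rw [SchwartzMap.lineDerivOp_fourier_eq, SchwartzMap.lineDerivOp_fourier_eq,
    FourierTransform.fourierInv_fourier_eq]
  simp only [smul_apply, SchwartzMap.smulLeftCLM_apply_apply (hm _), smul_eq_mul,
    Complex.real_smul]
  push_cast
  linear_combination (4 * Real.pi ^ 2 * (inner ℝ ξ m : ℂ) * (inner ℝ ξ n : ℂ) * φ ξ) * Complex.I_sq

lemma integrable_inner_mul (ξ : Plane) (Φ : 𝓢(Plane, ℂ)) :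
    Integrable fun y => ((inner ℝ ξ y : ℝ) : ℂ) * Φ y := by
  refine ((integrable_one_add_norm_sq_mul Φ).const_mul ‖ξ‖).mono'
    (AEStronglyMeasurable.mul (by fun_prop) Φ.integrable.1) (.of_forall fun y => ?_)
  rw [norm_mul, Complex.norm_real, ← mul_assoc]
  gcongr
  refine (abs_real_inner_le_norm ξ y).trans ?_
  gcongr
  nlinarith [norm_nonneg y]

lemma integral_inner_mul_lineDeriv (ξ m : Plane) (Φ : 𝓢(Plane, ℂ)) :
    ∫ y, ((inner ℝ ξ y : ℝ) : ℂ) * (∂_{m} Φ) y = -(((inner ℝ ξ m : ℝ) : ℂ) * ∫ y, Φ y) := by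
  set A : Plane →L[ℝ] ℂ := Complex.ofRealCLM.comp (innerSL ℝ ξ) with hA
  have hd : ∀ y, fderiv ℝ A y m = ((inner ℝ ξ m : ℝ) : ℂ) := fun y => by
    rw [A.fderiv]; rfl
  have i1 : Integrable fun y => fderiv ℝ A y m * Φ y := by
    simp only [hd]; exact Φ.integrable.const_mul _
  have i2 : Integrable fun y => A y * fderiv ℝ Φ y m := integrable_inner_mul ξ (∂_{m} Φ)
  have i3 : Integrable fun y => A y * Φ y := integrable_inner_mul ξ Φ
  have h := integral_mul_fderiv_eq_neg_fderiv_mul_of_integrable (μ := (volume : Measure Plane))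
    i1 i2 i3 (fun x _ => A.differentiableAt) (fun x _ => Φ.differentiableAt)
  simp only [hd] at h
  rw [integral_const_mul] at h
  exact h

section

variable {b : ℝ} {F : Plane → ℂ}

/-- Fubini applies because of the Taylor correction in `repC`. Tested against a second derivative,
the constant and linear corrections integrate to zero, and only the plane wave contributes. -/
lemma integral_repC_mul (hF : Measurable F) (hG : GradInt b F) (hb : 0 ≤ b) (hb1 : b ≤ 1)
    (m n : Plane) (φ : 𝓢(Plane, ℂ)) :
    Integrable (fun y => (∂_{m} (∂_{n} (𝓕 φ : 𝓢(Plane, ℂ)))) y * repC F y) ∧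
    ∫ y, (∂_{m} (∂_{n} (𝓕 φ : 𝓢(Plane, ℂ)))) y * repC F y =
      ∫ ξ, φ ξ * (-(4 * Real.pi ^ 2) * ((inner ℝ ξ m * inner ℝ ξ n : ℝ) : ℂ) * F ξ) := by
  set Φ : 𝓢(Plane, ℂ) := ∂_{m} (∂_{n} (𝓕 φ : 𝓢(Plane, ℂ))) with hΦ
  have hprod : Integrable (fun p : Plane × Plane => Φ p.1 *
      ((wave p.2 p.1 - 1 - 2 * Real.pi * Complex.I * (inner ℝ p.2 p.1 : ℝ)) * F p.2))
      (volume.prod volume) := by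
    refine (((integrable_one_add_norm_sq_mul Φ).const_mul (4 * Real.pi ^ 2)).mul_prod hG.2).mono'
      ?_ (.of_forall fun p => ?_)
    · exact (by have := Φ.continuous.measurable; fun_prop : Measurable _).aestronglyMeasurable
    · have h1 := norm_wave_taylor_le hb hb1 p.2 p.1
      have h2 : ‖p.1‖ ^ b * ‖p.1‖ ≤ (1 + ‖p.1‖) ^ 2 := by
        have : ‖p.1‖ ^ b ≤ 1 + ‖p.1‖ := by
          calc ‖p.1‖ ^ b ≤ (1 + ‖p.1‖) ^ b := by gcongr; linarith
            _ ≤ (1 + ‖p.1‖) ^ (1 : ℝ) :=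
              Real.rpow_le_rpow_of_exponent_le (by linarith [norm_nonneg p.1]) hb1
            _ = _ := Real.rpow_one _
        calc _ ≤ (1 + ‖p.1‖) * (1 + ‖p.1‖) := by gcongr; linarith
          _ = _ := by ring
      rw [norm_mul, norm_mul]
      rw [Real.mul_rpow (norm_nonneg _) (norm_nonneg _)] at h1
      calc _ ≤ ‖Φ p.1‖ * (4 * Real.pi ^ 2 * (‖p.2‖ ^ b * ‖p.1‖ ^ b) * (‖p.2‖ * ‖p.1‖) *
            ‖F p.2‖) := by gcongr
        _ = 4 * Real.pi ^ 2 * ((‖p.1‖ ^ b * ‖p.1‖) * ‖Φ p.1‖) *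
            (‖p.2‖ ^ b * ‖p.2‖ * ‖F p.2‖) := by ring
        _ ≤ _ := by gcongr
  have e1 : ∀ y, Φ y * repC F y = ∫ ξ, Φ y *
      ((wave ξ y - 1 - 2 * Real.pi * Complex.I * (inner ℝ ξ y : ℝ)) * F ξ) := fun y => by
    rw [integral_const_mul, repC]
  simp only [e1]
  refine ⟨hprod.integral_prod_left, ?_⟩
  rw [integral_integral_swap hprod]
  refine integral_congr_ae (.of_forall fun ξ => ?_)
  simp only
  have i1 : Integrable fun y => wave ξ y * Φ y :=
    Φ.integrable.bdd_mul (c := 1) (by fun_prop) (.of_forall fun y => by simp)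
  have i2 := integrable_inner_mul ξ Φ
  have e2 : ∀ y, Φ y * ((wave ξ y - 1 - 2 * Real.pi * Complex.I * (inner ℝ ξ y : ℝ)) * F ξ) =
      (wave ξ y * Φ y - Φ y - 2 * Real.pi * Complex.I * (((inner ℝ ξ y : ℝ) : ℂ) * Φ y)) * F ξ :=
    fun y => by ring
  simp only [e2]
  rw [integral_mul_const,
    integral_sub (f := fun y => wave ξ y * Φ y - Φ y) (i1.sub Φ.integrable) (i2.const_mul _),
    integral_sub i1 Φ.integrable, integral_const_mul, hΦ, integral_inner_mul_lineDeriv,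
    integral_lineDeriv_eq_zero, integral_lineDeriv_eq_zero]
  simp only [wave_comm ξ]
  rw [← fourierInv_eq_wave, ← SchwartzMap.fourierInv_coe,
    fourierInv_lineDeriv_lineDeriv]
  ring

lemma continuous_repC (hG : GradInt b F) (hb : 0 ≤ b) (hb1 : b ≤ 1) : Continuous (repC F) :=
  continuous_iff_continuousAt.2 fun y => by
    obtain ⟨L, hL, -⟩ := hG.hasFDerivAt_repC hb hb1 y
    exact hL.continuousAt

/-- The functions f and `repC F` have the same distributional second derivatives; f is real, so real
parts may be taken, and `ae_affine` applies to f - `rep F`. -/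
theorem ae_eq_rep_add_affine {u : 𝓢'(Plane, ℂ)} {W : (Fin 2 → Fin 2) → Plane → ℂ} {f : Plane → ℝ}
    (hu : IsFunction u (fun x => (f x : ℂ)))
    (hW : ∀ i, IsFunction (𝓕 (partialDeriv i u)) (W i)) (hF : Measurable F)
    (hFW : ∀ i, W i =ᵐ[volume] fun ξ => -(4 * Real.pi ^ 2) * ((ξ (i 0) * ξ (i 1) : ℝ) : ℂ) * F ξ)
    (hG : GradInt b F) (hb : 0 ≤ b) (hb1 : b ≤ 1) :
    ∃ (c : ℝ) (L : Plane →L[ℝ] ℝ), f =ᵐ[volume] fun y => rep F y + (c + L y) := by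
  have hfl : LocallyIntegrable fun x => (f x : ℂ) :=
    locallyIntegrable_of_schwartz fun φ => (hu.2 φ).1
  have hrl : LocallyIntegrable (repC F) := (continuous_repC hG hb hb1).locallyIntegrable
  have hv : LocallyIntegrable fun y => f y - rep F y := by
    intro x
    obtain ⟨S, hS, hi⟩ := (hfl.sub hrl) x
    refine ⟨S, hS, ?_⟩
    have := hi.re
    rw [IntegrableOn]
    simpa [rep] using this
  have key : ∀ (i j : Fin 2) (Ψ : 𝓢(Plane, ℂ)),
      Integrable (fun y => (∂_{basisVec j} (∂_{basisVec i} Ψ)) y * ((f y : ℂ) - repC F y)) ∧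
      ∫ y, (∂_{basisVec j} (∂_{basisVec i} Ψ)) y * ((f y : ℂ) - repC F y) = 0 := by
    intro i j Ψ
    obtain ⟨φ, rfl⟩ : ∃ φ : 𝓢(Plane, ℂ), Ψ = 𝓕 φ := ⟨𝓕⁻ Ψ, by simp⟩
    obtain ⟨h1, h2⟩ := integral_repC_mul hF hG hb hb1 (basisVec j) (basisVec i) φ
    obtain ⟨h3, h4⟩ := hu.2 (∂_{basisVec j} (∂_{basisVec i} (𝓕 φ : 𝓢(Plane, ℂ))))
    obtain ⟨-, h5⟩ := (hW ![i, j]).2 φ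
    have h6 : 𝓕 (partialDeriv ![i, j] u) φ =
        u (∂_{basisVec j} (∂_{basisVec i} (𝓕 φ : 𝓢(Plane, ℂ)))) := by
      have : partialDeriv ![i, j] u = ∂_{basisVec i} (∂_{basisVec j} u) := rfl
      rw [this, TemperedDistribution.fourier_apply, TemperedDistribution.lineDerivOp_apply_apply,
        TemperedDistribution.lineDerivOp_apply_apply]
      simp
    simp only [mul_sub]
    refine ⟨h3.sub h1, ?_⟩
    rw [integral_sub h3 h1, ← h4, h2, ← h6, h5, sub_eq_zero]
    refine integral_congr_ae ?_
    filter_upwards [hFW ![i, j]] with ξ hξ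
    rw [hξ, inner_basisVec, inner_basisVec]
    simp only [Matrix.cons_val_zero, Matrix.cons_val_one, mul_comm (ξ i)]
  obtain ⟨c, L, hcL⟩ := ae_affine hv fun i j σ hσ hσc => by
    have hσ1 : Differentiable ℝ σ := hσ.differentiable (by simp)
    have hσ2 : Differentiable ℝ fun z => fderiv ℝ σ z (basisVec i) :=
      ((hσ.fderiv_right (m := ↑(⊤ : ℕ∞)) (by simp)).clm_apply contDiff_const).differentiable
        (by simp)
    have hs : ∀ (g : Plane → ℝ) (_ : Differentiable ℝ g) (y m : Plane),
        fderiv ℝ (fun y => (g y : ℂ)) y m = (fderiv ℝ g y m : ℝ) := by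
      intro g hg y m
      have h1 : HasFDerivAt (fun y => (g y : ℂ)) (Complex.ofRealCLM.comp (fderiv ℝ g y)) y :=
        HasFDerivAt.comp (g := Complex.ofRealCLM) (f := g) y Complex.ofRealCLM.hasFDerivAt
          (hg y).hasFDerivAt
      rw [h1.fderiv]; rfl
    have hc1 : HasCompactSupport (Complex.ofRealCLM ∘ σ) := hσc.comp_left rfl
    have hc2 : ContDiff ℝ (↑(⊤ : ℕ∞)) (Complex.ofRealCLM ∘ σ) := Complex.ofRealCLM.contDiff.comp hσ
    set Ψ : 𝓢(Plane, ℂ) := hc1.toSchwartzMap hc2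
    have hΨ : ∀ y, (∂_{basisVec j} (∂_{basisVec i} Ψ)) y =
        ((fderiv ℝ (fun z => fderiv ℝ σ z (basisVec i)) y (basisVec j) : ℝ) : ℂ) := fun y => by
      rw [← hs _ hσ2, SchwartzMap.lineDerivOp_apply_eq_fderiv]
      congr 2
      ext z
      rw [SchwartzMap.lineDerivOp_apply_eq_fderiv, ← hs _ hσ1]
      rfl
    obtain ⟨h1, h2⟩ := key i j Ψ
    have h3 : RCLike.re (∫ y, (∂_{basisVec j} (∂_{basisVec i} Ψ)) y * ((f y : ℂ) - repC F y)) =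
        0 := by rw [h2]; simp
    rw [← integral_re h1] at h3
    rw [← h3]
    refine integral_congr_ae (.of_forall fun y => ?_)
    simp only [hΨ, RCLike.re_eq_complex_re, Complex.re_ofReal_mul, Complex.sub_re, Complex.ofReal_re, rep]
  refine ⟨c, L, ?_⟩
  filter_upwards [hcL] with y hy
  rw [← hy]; ring

end

theorem exists_rep {a : ℝ} (ha : 0 < a) (ha1 : a < 1) {f : Plane → ℝ}
    (h1 : homSobolev (2 + a / 4) f < ∞) (h2 : homSobolev (2 + a) f < ∞) :
    ∃ F : Plane → ℂ, Measurable F ∧ GradInt (a / 2) F ∧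
      dataNorm a F ≤ 2 * (homSobolev (2 + a / 4) f + homSobolev (2 + a) f) ∧
      ∃ (c : ℝ) (L : Plane →L[ℝ] ℝ), f =ᵐ[volume] fun y => rep F y + (c + L y) := by
  have hfl : ∀ c : ℝ, 0 < c → c < 1 → ⌊2 + c⌋₊ = 2 := fun c h h' => by
    rw [Nat.floor_eq_iff (by linarith)]; norm_num; constructor <;> linarith
  obtain ⟨u, hu, W, hW, e1⟩ := exists_of_homSobolev_lt_top (c := a / 4)
    (hfl _ (by linarith) (by linarith)) (by push_cast; ring) h1
  have e2 : homSobolev (2 + a) f = sobNorm 2 a W :=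
    homSobolev_eq (hfl a ha ha1) (by push_cast; ring) hu hW
  obtain ⟨F, hF, hFW⟩ := exists_density hW
  have hd : dataNorm a F ≤ 2 * (homSobolev (2 + a / 4) f + homSobolev (2 + a) f) := by
    rw [e1, e2, mul_add]
    exact add_le_add (wnorm_density_le hFW (fun i => (hW i).1) (by linarith))
      (wnorm_density_le hFW (fun i => (hW i).1) ha)
  have hG : GradInt (a / 2) F := gradInt_of_dataNorm ha hF
    (hd.trans_lt (ENNReal.mul_lt_top (by norm_num) (ENNReal.add_lt_top.2 ⟨h1, h2⟩)))
  exact ⟨F, hF, hG, hd, ae_eq_rep_add_affine hu hW hF hFW hG (by linarith) (by linarith)⟩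

/-! ### The estimate of the operator -/

lemma eLpNorm_two_pi_weight {c : ℝ} (w : Plane → ℂ) :
    eLpNorm (fun ξ : Plane => ((2 * Real.pi * ‖ξ‖) ^ c : ℝ) • w ξ) 2 volume =
      ENNReal.ofReal ((2 * Real.pi) ^ c) * wnorm c w := by
  have e : (fun ξ : Plane => ((2 * Real.pi * ‖ξ‖) ^ c : ℝ) • w ξ) =
      ((2 * Real.pi) ^ c : ℝ) • fun ξ : Plane => (‖ξ‖ ^ c : ℝ) • w ξ := by
    ext ξ
    rw [Pi.smul_apply, smul_smul, Real.mul_rpow (by positivity) (by positivity)]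
  rw [e, eLpNorm_const_smul, ← wnorm_eq_eLpNorm, Real.enorm_of_nonneg (by positivity)]

lemma sobNorm_le {m : ℕ} {c : ℝ} {W : (Fin m → Fin 2) → Plane → ℂ} {K : ℝ≥0∞}
    (h : ∀ i, wnorm c (W i) ≤ K) :
    sobNorm m c W ≤ 2 ^ m * (ENNReal.ofReal ((2 * Real.pi) ^ c) * K) := by
  set X := ENNReal.ofReal ((2 * Real.pi) ^ c) * K with hX
  have h1 : ∑ i, eLpNorm (fun ξ : Plane => ((2 * Real.pi * ‖ξ‖) ^ c : ℝ) • W i ξ) 2 volume ^ 2 ≤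
      (2 ^ m * X) ^ 2 := by
    calc _ ≤ ∑ _i : Fin m → Fin 2, X ^ 2 := by
          refine Finset.sum_le_sum fun i _ => ?_
          rw [eLpNorm_two_pi_weight]
          gcongr
          exact mul_le_mul_right (h i) _
      _ = 2 ^ m * X ^ 2 := by simp
      -- A crude bound of the number of index tuples by its square, which makes the final square
      -- root exact.
      _ ≤ (2 ^ m) ^ 2 * X ^ 2 := by
          exact mul_le_mul_left (le_self_pow₀ (one_le_pow₀ (one_le_two : (1 : ℝ≥0∞) ≤ 2))
            two_ne_zero) _
      _ = _ := by ring
  calc _ ≤ ((2 ^ m * X) ^ 2) ^ (1 / 2 : ℝ) := ENNReal.rpow_le_rpow h1 (by norm_num)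
    _ = _ := by rw [← ENNReal.rpow_natCast, ← ENNReal.rpow_mul]; norm_num

/-- The dual criterion for membership: it produces the transforms of the derivatives as functions,
rather than assuming them. -/
lemma homSobolev_le {t c : ℝ} {m : ℕ} (hm : ⌊t⌋₊ = m) (hc : t - m = c) (hc0 : 0 < c) (hc1 : c < 1)
    {f : Plane → ℝ} {u : 𝓢'(Plane, ℂ)} (hu : IsFunction u (fun x => (f x : ℂ))) {K : ℝ≥0∞}
    (hK : K ≠ ∞)
    (h : ∀ (i : Fin m → Fin 2) (φ : 𝓢(Plane, ℂ)), ‖𝓕 (partialDeriv i u) φ‖ₑ ≤ K * wnorm (-c) φ) :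
    homSobolev t f ≤ 2 ^ m * (ENNReal.ofReal ((2 * Real.pi) ^ c) * K) := by
  have h1 : ∀ i : Fin m → Fin 2, ∃ w : Plane → ℂ, IsFunction (𝓕 (partialDeriv i u)) w ∧
      wnorm c w ≤ K := fun i => by
    let ℓ : 𝓢(Plane, ℂ) →ₗ[ℂ] ℂ :=
      { toFun := fun φ => 𝓕 (partialDeriv i u) φ
        map_add' := fun φ ψ => map_add _ φ ψ
        map_smul' := fun k φ => map_smul _ k φ }
    obtain ⟨w, hw, hwℓ, hwK⟩ := exists_riesz hc0 hc1 ℓ hK (h i)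
    exact ⟨w, ⟨hw, hwℓ⟩, hwK⟩
  choose W hW hWK using h1
  rw [homSobolev_eq hm hc hu hW]
  exact sobNorm_le hWK

/-- The constant in `exists_isT`. -/
def opConst (a : ℝ) : ℝ≥0∞ :=
  4 * ENNReal.ofReal ((2 * Real.pi) ^ a) * ENNReal.ofReal (coreConst a)

/-- The C¹ representative is `rep F` plus an affine function, whose kernel is that of `rep F`; the
Hölder exponent of its gradient is a/2. -/
theorem exists_isT {a : ℝ} (ha : 0 < a) (ha1 : a < 1) (s : ℝ) {f : Plane → ℝ}
    (h1 : homSobolev (2 + a / 4) f < ∞) (h2 : homSobolev (2 + a) f < ∞) :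
    ∃ g : Plane → ℝ, ContDiff ℝ 1 g ∧ g =ᵐ[volume] f ∧ ∃ T : Plane → ℝ, IsT g (kLin s) T ∧
      homSobolev (1 + a) T ≤ opConst a * ENNReal.ofReal (s ^ 2) *
        (homSobolev (2 + a / 4) f + homSobolev (2 + a) f) := by
  obtain ⟨F, hF, hG, hd, c, L, hfe⟩ := exists_rep ha ha1 h1 h2
  have hb : 0 < a / 2 := by linarith
  have hb1 : a / 2 < 1 := by linarith
  have hH := hG.holderGrad hb hb1.le
  obtain ⟨T, K, hTm, hTK, hT, hTe⟩ := exists_limit_rep ha ha1 hF hG hb hb1 s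
  have hgc : ContDiff ℝ 1 fun y => rep F y + (c + L y) :=
    hH.contDiff.add (contDiff_const.add L.contDiff)
  have hk : ∀ y, kernel (fun y => rep F y + (c + L y)) (kLin s) y = kernel (rep F) (kLin s) y := by
    intro y
    ext α
    have hd : ∀ y, fderiv ℝ (fun y => rep F y + (c + L y)) y = fderiv ℝ (rep F) y + L := fun y =>
      (((hH.contDiff.differentiable one_ne_zero) y).hasFDerivAt.add
        (L.hasFDerivAt.const_add c)).fderiv
    rw [kernel_eq (hgc.differentiable one_ne_zero),
      kernel_eq (hH.contDiff.differentiable one_ne_zero), hd, hd, add_apply, add_apply,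
      add_sub_add_right_eq_sub]
  refine ⟨_, hgc, hfe.symm, T, ⟨fun y R => ?_, fun R => truncT (rep F) s R 0, fun y => ?_⟩, ?_⟩
  · rw [hk]; exact hH.integrableOn_kernel hb s y R
  · simp only [hk]; exact hT y
  · obtain ⟨u, hu⟩ := exists_isFunction (v := fun y => (T y : ℂ)) (K := K)
      (Complex.measurable_ofReal.comp hTm).aestronglyMeasurable
      (fun y => by rw [Complex.norm_real]; exact hTK y)
    have hfin : dataNorm a F < ∞ := hd.trans_lt
      (ENNReal.mul_lt_top (by norm_num) (ENNReal.add_lt_top.2 ⟨h1, h2⟩))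
    have hfl : ⌊1 + a⌋₊ = 1 := by
      rw [Nat.floor_eq_iff (by linarith)]; norm_num; constructor <;> linarith
    refine (homSobolev_le (c := a) hfl (by push_cast; ring) ha ha1 hu
      (K := ENNReal.ofReal (coreConst a * s ^ 2) * dataNorm a F)
      (ENNReal.mul_ne_top ENNReal.ofReal_ne_top hfin.ne) fun i φ => ?_).trans ?_
    · rw [partialDeriv_one, TemperedDistribution.fourier_apply,
        TemperedDistribution.lineDerivOp_apply_apply, map_neg, enorm_neg, (hu.2 _).2]
      simp only [mul_comm _ (T _ : ℂ)]
      exact hTe _ (by simp) φ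
    · calc _ ≤ 2 ^ 1 * (ENNReal.ofReal ((2 * Real.pi) ^ a) *
            (ENNReal.ofReal (coreConst a * s ^ 2) *
              (2 * (homSobolev (2 + a / 4) f + homSobolev (2 + a) f)))) := by gcongr
        _ = _ := by
          rw [ENNReal.ofReal_mul (coreConst_nonneg ha ha1), opConst]
          ring

/-! ### Slowly decaying functions -/

/-- The functions `q` with `|q| ≤ A / ⟨y⟩` and `|q x - q y| ≤ B |x - y| / (⟨x⟩ ⟨y⟩)`. -/
structure SymbolDecay (A B : ℝ) (q : Plane → ℝ) : Prop where
  measurable : Measurable q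
  le : ∀ y, |q y| ≤ A / jap y
  sub_le : ∀ x y, |q x - q y| ≤ B * ‖x - y‖ / (jap x * jap y)

section

variable {A B : ℝ} {q : Plane → ℝ}

/-- A bound of the differences of functions with `SymbolDecay A B`. -/
def diffBound (A B : ℝ) (y h : Plane) : ℝ := min (2 * A / jap y) (B / jap y ^ 2 * ‖h‖)

lemma SymbolDecay.nonneg (hq : SymbolDecay A B q) : 0 ≤ A := by
  have := (abs_nonneg _).trans (hq.le 0)
  have h := jap_pos 0
  rwa [le_div_iff₀ h, zero_mul] at this

lemma SymbolDecay.abs_sub_le (hq : SymbolDecay A B q) (hB : 0 ≤ B) {x y : Plane}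
    (h : jap y ≤ jap x) : |q x - q y| ≤ diffBound A B y (x - y) := by
  have hA := hq.nonneg
  have hy := jap_pos y
  have hx := jap_pos x
  refine le_min ?_ ?_
  · calc |q x - q y| ≤ A / jap x + A / jap y :=
          (abs_sub _ _).trans (add_le_add (hq.le x) (hq.le y))
      _ ≤ A / jap y + A / jap y := by gcongr
      _ = _ := by ring
  · calc _ ≤ B * ‖x - y‖ / (jap x * jap y) := hq.sub_le x y
      _ ≤ B * ‖x - y‖ / (jap y * jap y) := by gcongr
      _ = _ := by ring

/-- The decay is taken at whichever of y, y - h has the smaller bracket. Adding both bounds removes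
the case distinction, and after integration in y they coincide by translation. -/
lemma SymbolDecay.sub_sq_le (hq : SymbolDecay A B q) (hB : 0 ≤ B) (y h : Plane) :
    (q y - q (y - h)) ^ 2 ≤ diffBound A B y h ^ 2 + diffBound A B (y - h) h ^ 2 := by
  rcases le_total (jap y) (jap (y - h)) with h1 | h1
  · have := hq.abs_sub_le hB h1
    rw [abs_sub_comm] at this
    have e : diffBound A B y (y - h - y) = diffBound A B y h := by
      rw [diffBound, diffBound]; congr 2; rw [sub_sub_cancel_left, norm_neg]
    rw [e] at this
    nlinarith [sq_abs (q y - q (y - h)), abs_nonneg (q y - q (y - h)),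
      sq_nonneg (diffBound A B (y - h) h)]
  · have := hq.abs_sub_le hB h1
    rw [sub_sub_cancel] at this
    nlinarith [sq_abs (q y - q (y - h)), abs_nonneg (q y - q (y - h)),
      sq_nonneg (diffBound A B y h)]

@[fun_prop] lemma measurable_diffBound {X : Type*} [MeasurableSpace X] (A B : ℝ) {f g : X → Plane}
    (hf : Measurable f) (hg : Measurable g) : Measurable fun x => diffBound A B (f x) (g x) := by
  unfold diffBound; fun_prop

/-- The integral of `⟨y⟩ ^ (-(2 + 2 * c))`. -/
def japInt (c : ℝ) : ℝ≥0∞ := ∫⁻ y : Plane, ENNReal.ofReal (jap y ^ (-(2 + 2 * c)))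

lemma jap_rpow (y : Plane) (r : ℝ) : jap y ^ (-r) = (1 + ‖y‖ ^ 2) ^ (-r / 2) := by
  rw [jap, Real.sqrt_eq_rpow, ← Real.rpow_mul (by positivity), add_comm]
  congr 1; ring

lemma japInt_lt_top {c : ℝ} (hc : 0 < c) : japInt c < ∞ := by
  have h := integrable_rpow_neg_one_add_norm_sq (E := Plane) (μ := volume) (r := 2 + 2 * c)
    (by rw [finrank_euclideanSpace_fin]; push_cast; linarith)
  have h2 := h.2
  rw [hasFiniteIntegral_iff_norm] at h2
  refine lt_of_le_of_lt (lintegral_mono fun y => ?_) h2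
  rw [jap_rpow, Real.norm_of_nonneg (by positivity)]

/-- Interpolating A/⟨y⟩ with B|h|/⟨y⟩² in h leaves ⟨y⟩^(-(2-2c)-4c) = ⟨y⟩^(-2-2c), integrable on the
plane for c > 0. -/
lemma lintegral_diffBound_le {c : ℝ} (hc : 0 < c) (hc1 : c < 1) (hA : 0 ≤ A) (hB : 0 ≤ B) :
    ∫⁻ h : Plane, ∫⁻ y, ENNReal.ofReal (diffBound A B y h ^ 2 * ‖h‖ ^ (-(2 + 2 * c))) ≤
      ENNReal.ofReal (minConst c * ((2 * A) ^ (2 - 2 * c) * B ^ (2 * c))) * japInt c := by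
  rw [lintegral_lintegral_swap (by fun_prop), japInt, ← lintegral_const_mul _ (by fun_prop)]
  refine lintegral_mono fun y => ?_
  have hj := jap_pos y
  have hm := minConst_nonneg hc hc1
  refine (lintegral_min_le hc hc1 (A := 2 * A / jap y) (B := B / jap y ^ 2) (by positivity)
    (by positivity)).trans (le_of_eq ?_)
  rw [← ENNReal.ofReal_mul (by positivity)]
  congr 1
  have e1 : jap y ^ (-(2 + 2 * c)) = (jap y ^ (2 - 2 * c) * (jap y ^ 2) ^ (2 * c))⁻¹ := by
    rw [← Real.rpow_natCast (jap y) 2, ← Real.rpow_mul hj.le, ← Real.rpow_add hj, Real.rpow_neg hj.le]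
    congr 2; push_cast; ring
  rw [Real.div_rpow (by positivity) hj.le, Real.div_rpow hB (by positivity), e1]
  ring

lemma SymbolDecay.gag_le (hq : SymbolDecay A B q) (hB : 0 ≤ B) {c : ℝ} (hc : 0 < c) (hc1 : c < 1) :
    gag c q ≤ 2 * (ENNReal.ofReal (minConst c * ((2 * A) ^ (2 - 2 * c) * B ^ (2 * c))) *
      japInt c) := by
  have h1 := lintegral_diffBound_le (A := A) (B := B) hc hc1 hq.nonneg hB
  rw [two_mul]
  calc gag c q ≤ ∫⁻ h : Plane, ((∫⁻ y, ENNReal.ofReal (diffBound A B y h ^ 2 *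
        ‖h‖ ^ (-(2 + 2 * c)))) + ∫⁻ y, ENNReal.ofReal (diffBound A B y h ^ 2 *
        ‖h‖ ^ (-(2 + 2 * c)))) := by
        refine lintegral_mono fun h => ?_
        have e := lintegral_sub_right_eq_self (μ := (volume : Measure Plane))
          (fun y => ENNReal.ofReal (diffBound A B y h ^ 2 * ‖h‖ ^ (-(2 + 2 * c)))) h
        calc _ ≤ ∫⁻ y, (ENNReal.ofReal (diffBound A B y h ^ 2 * ‖h‖ ^ (-(2 + 2 * c))) +
              ENNReal.ofReal (diffBound A B (y - h) h ^ 2 * ‖h‖ ^ (-(2 + 2 * c)))) := by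
              refine lintegral_mono fun y => ?_
              rw [← ENNReal.ofReal_add (by positivity) (by positivity), ← add_mul]
              gcongr
              exact hq.sub_sq_le hB y h
          _ = _ := by rw [lintegral_add_left (by fun_prop), e]
    _ ≤ _ := by
        rw [lintegral_add_left (by fun_prop)]
        exact add_le_add h1 h1

/-- The new constants do not depend on ε, since ε/(1 + ε⟨x⟩) ≤ 1/⟨x⟩. -/
lemma SymbolDecay.smul_cutoff (hq : SymbolDecay A B q) {ε : ℝ} (hε : 0 < ε) :
    SymbolDecay A (A + B) (fun y => 1 / (1 + ε * jap y) * q y) := by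
  have hA := hq.nonneg
  have hχ : ∀ y, 0 < 1 + ε * jap y := fun y => by have := jap_pos y; positivity
  have hχ1 : ∀ y, 1 / (1 + ε * jap y) ≤ 1 := fun y => by
    have := jap_pos y
    rw [div_le_one (hχ y)]
    nlinarith [mul_pos hε this]
  refine ⟨by have := hq.measurable; fun_prop, fun y => ?_, fun x y => ?_⟩
  · rw [abs_mul, abs_of_pos (a := 1 / (1 + ε * jap y)) (one_div_pos.2 (hχ y))]
    exact (mul_le_of_le_one_left (abs_nonneg _) (hχ1 y)).trans (hq.le y)
  · have hx := jap_pos x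
    have hy := jap_pos y
    have h1 : |1 / (1 + ε * jap x) - 1 / (1 + ε * jap y)| ≤ ‖x - y‖ / jap x := by
      have e : 1 / (1 + ε * jap x) - 1 / (1 + ε * jap y) =
          ε / (1 + ε * jap x) * ((jap y - jap x) * (1 / (1 + ε * jap y))) := by
        have := (hχ x).ne'
        have := (hχ y).ne'
        field_simp; ring
      have h2 : ε / (1 + ε * jap x) ≤ 1 / jap x := by
        rw [div_le_div_iff₀ (hχ x) hx]; linarith
      rw [e, abs_mul, abs_mul, abs_of_pos (div_pos hε (hχ x)),
        abs_of_pos (one_div_pos.2 (hχ y)), abs_sub_comm]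
      calc _ ≤ 1 / jap x * (‖x - y‖ * 1) := by
            gcongr
            · exact abs_jap_sub_le x y
            · exact hχ1 y
        _ = _ := by ring
    have e : 1 / (1 + ε * jap x) * q x - 1 / (1 + ε * jap y) * q y =
      1 / (1 + ε * jap x) * (q x - q y) + (1 / (1 + ε * jap x) - 1 / (1 + ε * jap y)) * q y := by
      ring
    rw [e]
    refine (abs_add_le _ _).trans ?_
    rw [abs_mul, abs_mul, abs_of_pos (a := 1 / (1 + ε * jap x)) (one_div_pos.2 (hχ x))]
    calc _ ≤ 1 * (B * ‖x - y‖ / (jap x * jap y)) + ‖x - y‖ / jap x * (A / jap y) := by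
          gcongr
          · exact hχ1 x
          · exact hq.sub_le x y
          · exact hq.le y
      _ = _ := by field_simp; ring

/-- Decay like 1/⟨y⟩ just fails to be square integrable on the plane, while the duality bound
`Muskat.enorm_pairing_le` needs `L²`. The cutoff supplies one more power of ⟨y⟩. -/
lemma SymbolDecay.memLp_cutoff (hq : SymbolDecay A B q) {ε : ℝ} (hε : 0 < ε) :
    MemLp (fun y => 1 / (1 + ε * jap y) * q y) 2 := by
  have hA := hq.nonneg
  have hm : Measurable fun y => 1 / (1 + ε * jap y) * q y := by
    have := hq.measurable; fun_prop
  rw [memLp_two_iff_integrable_sq hm.aestronglyMeasurable]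
  have h := integrable_rpow_neg_one_add_norm_sq (E := Plane) (μ := volume) (r := 4)
    (by rw [finrank_euclideanSpace_fin]; norm_num)
  refine (h.const_mul ((A / ε) ^ 2)).mono' (hm.pow_const 2).aestronglyMeasurable
    (.of_forall fun y => ?_)
  have hj := jap_pos y
  rw [Real.norm_of_nonneg (by positivity), ← jap_rpow, ← sq_abs, abs_mul,
    abs_of_pos (a := 1 / (1 + ε * jap y)) (by positivity)]
  have e : jap y ^ (-4 : ℝ) = (1 / jap y ^ 2) ^ 2 := by
    rw [Real.rpow_neg hj.le, div_pow, ← pow_mul, one_pow, one_div]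
    norm_cast
  rw [e, ← mul_pow]
  refine pow_le_pow_left₀ (by positivity) ?_ 2
  calc _ ≤ 1 / (ε * jap y) * (A / jap y) := by
        gcongr
        · linarith
        · exact hq.le y
    _ = _ := by field_simp

/-- The constant in `SymbolDecay.enorm_pairing_le`. -/
def symbolConst (A B c : ℝ) : ℝ≥0∞ :=
  (ENNReal.ofReal (32 / Real.pi) * (2 * (ENNReal.ofReal
    (minConst c * ((2 * A) ^ (2 - 2 * c) * (A + B) ^ (2 * c))) * japInt c))) ^ (1 / 2 : ℝ)

lemma symbolConst_ne_top {c : ℝ} (hc : 0 < c) : symbolConst A B c ≠ ∞ := by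
  have := (japInt_lt_top hc).ne
  refine ENNReal.rpow_ne_top_of_nonneg (by norm_num) ?_
  exact ENNReal.mul_ne_top ENNReal.ofReal_ne_top
    (ENNReal.mul_ne_top (by norm_num) (ENNReal.mul_ne_top ENNReal.ofReal_ne_top this))

theorem SymbolDecay.enorm_pairing_le (hq : SymbolDecay A B q) (hB : 0 ≤ B) {c : ℝ} (hc : 0 < c)
    (hc1 : c < 1) (φ : 𝓢(Plane, ℂ)) :
    ‖∫ y, (q y : ℂ) * (𝓕 φ) y‖ₑ ≤ symbolConst A B c * wnorm (-c) φ := by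
  have hA := hq.nonneg
  set ε : ℕ → ℝ := fun n => 1 / (n + 1) with hε
  have hε0 : ∀ n, 0 < ε n := fun n => by simp only [hε]; positivity
  have hlim : Tendsto ε atTop (𝓝 0) := tendsto_one_div_add_atTop_nhds_zero_nat
  have h1 : Tendsto (fun n => ∫ y, ((1 / (1 + ε n * jap y) * q y : ℝ) : ℂ) * (𝓕 φ) y) atTop
      (𝓝 (∫ y, (q y : ℂ) * (𝓕 φ) y)) := by
    refine tendsto_integral_of_dominated_convergence (fun y => A * ‖(𝓕 φ : 𝓢(Plane, ℂ)) y‖)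
      (fun n => ?_) ((𝓕 φ : 𝓢(Plane, ℂ)).integrable.norm.const_mul A)
      (fun n => .of_forall fun y => ?_) (.of_forall fun y => ?_)
    · exact (Complex.measurable_ofReal.comp
        (hq.smul_cutoff (hε0 n)).measurable).aestronglyMeasurable.mul
        (𝓕 φ : 𝓢(Plane, ℂ)).integrable.1
    · rw [norm_mul, Complex.norm_real]
      gcongr
      exact ((hq.smul_cutoff (hε0 n)).le y).trans (div_le_self hA (one_le_jap y))
    · refine Tendsto.mul_const _ ((Complex.continuous_ofReal.tendsto _).comp ?_)
      have h2 : Tendsto (fun n => 1 / (1 + ε n * jap y)) atTop (𝓝 (1 / (1 + 0 * jap y))) :=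
        tendsto_const_nhds.div (tendsto_const_nhds.add (hlim.mul_const _)) (by simp)
      simpa using h2.mul_const (q y)
  refine le_of_tendsto ((continuous_enorm.tendsto _).comp h1) (.of_forall fun n => ?_)
  refine (Muskat.enorm_pairing_le hc (hq.memLp_cutoff (hε0 n)) φ).trans ?_
  unfold symbolConst
  gcongr
  exact (hq.smul_cutoff (hε0 n)).gag_le (by positivity) hc hc1

end


/-! ### The Sobolev norms of the profile -/

/-- The second derivatives of `kLin 1`. -/
def kHess (m n y : Plane) : ℝ :=
  inner ℝ n m / (jap y + 1) - inner ℝ (kGrad y) m * inner ℝ (kGrad y) n / jap y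

lemma hasFDerivAt_jap (y : Plane) : HasFDerivAt jap ((1 / jap y) • innerSL ℝ y) y := by
  have hq := jap_pos y
  have h1 : HasFDerivAt (fun y : Plane => ‖y‖ ^ 2 + 1) (2 • innerSL ℝ y) y :=
    (hasStrictFDerivAt_norm_sq y).hasFDerivAt.add_const 1
  refine (h1.sqrt (by positivity)).congr_fderiv ?_
  ext v
  change (1 / (2 * jap y)) * (2 • inner ℝ y v) = 1 / jap y * inner ℝ y v
  rw [nsmul_eq_mul]
  field_simp
  norm_num

lemma differentiable_inner_kGrad (m : Plane) : Differentiable ℝ fun y => inner ℝ (kGrad y) m := by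
  intro y
  have hq := jap_pos y
  have h0 : DifferentiableAt ℝ (fun y => jap y + 1) y :=
    (hasFDerivAt_jap y).differentiableAt.add_const 1
  have h1 : DifferentiableAt ℝ (fun y => 1 / (jap y + 1)) y := by
    simp only [one_div]
    exact h0.fun_inv (by positivity)
  unfold kGrad
  exact (h1.smul differentiableAt_id).inner ℝ (differentiableAt_const m)

lemma fderiv_inner_kGrad (m n y : Plane) :
    fderiv ℝ (fun y => inner ℝ (kGrad y) m) y n = kHess m n y := by
  have hq := jap_pos y
  have h0 : HasFDerivAt (fun y => jap y + 1) ((1 / jap y) • innerSL ℝ y) y :=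
    (hasFDerivAt_jap y).add_const 1
  have h1 : HasFDerivAt (fun y => (jap y + 1)⁻¹) _ y :=
    (hasDerivAt_inv (by positivity : jap y + 1 ≠ 0)).comp_hasFDerivAt y h0
  have h2 : HasFDerivAt (fun y : Plane => inner ℝ m y) (innerSL ℝ m) y :=
    (innerSL ℝ m).hasFDerivAt
  have h3 := h1.mul h2
  have e : (fun y => inner ℝ (kGrad y) m) = fun y => (jap y + 1)⁻¹ * inner ℝ m y := by
    ext y
    rw [kGrad, real_inner_smul_left, real_inner_comm, one_div]
  have h4 : fderiv ℝ (fun y => (jap y + 1)⁻¹ * inner ℝ m y) y = _ := h3.fderiv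
  rw [e, h4]
  simp only [add_apply, smul_apply, innerSL_apply_apply, smul_eq_mul, kHess, kGrad,
    real_inner_smul_left, real_inner_comm m n, real_inner_comm m y]
  field_simp
  ring

/-- Each difference is telescoped so that an undifferenced factor carries 1/⟨x⟩ and the differenced
one |x - y|/⟨y⟩; this yields the product ⟨x⟩⟨y⟩ in the denominator. -/
lemma symbolDecay_kHess {m n : Plane} (hm : ‖m‖ ≤ 1) (hn : ‖n‖ ≤ 1) :
    SymbolDecay 2 6 (kHess m n) := by
  have hin : ∀ u v : Plane, ‖v‖ ≤ 1 → |inner ℝ u v| ≤ ‖u‖ := fun u v hv =>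
    (abs_real_inner_le_norm u v).trans (mul_le_of_le_one_right (norm_nonneg _) hv)
  have hkm : ∀ y, |inner ℝ (kGrad y) m| ≤ 1 := fun y => (hin _ _ hm).trans (norm_kGrad_le y)
  have hkn : ∀ y, |inner ℝ (kGrad y) n| ≤ 1 := fun y => (hin _ _ hn).trans (norm_kGrad_le y)
  have hnm : |inner ℝ n m| ≤ 1 := (hin _ _ hm).trans hn
  refine ⟨?_, fun y => ?_, fun x y => ?_⟩
  · unfold kHess; fun_prop
  · have hy := jap_pos y
    refine (abs_sub _ _).trans ?_
    rw [abs_div, abs_div, abs_mul, abs_of_pos hy, abs_of_pos (by linarith : 0 < jap y + 1)]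
    calc _ ≤ 1 / jap y + 1 * 1 / jap y := by
          gcongr
          · linarith
          · exact hkm y
          · exact hkn y
      _ = _ := by ring
  · have hx := jap_pos x
    have hy := jap_pos y
    have hd : ∀ v : Plane, ‖v‖ ≤ 1 →
        |inner ℝ (kGrad x) v - inner ℝ (kGrad y) v| ≤ 2 * ‖x - y‖ / jap y := fun v hv => by
      rw [← inner_sub_left]
      exact (hin _ _ hv).trans (norm_kGrad_sub_le x y)
    have hj := abs_jap_sub_le y x
    rw [norm_sub_rev] at hj
    have e : kHess m n x - kHess m n y =
        inner ℝ n m * (jap y - jap x) / ((jap x + 1) * (jap y + 1)) -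
        ((inner ℝ (kGrad x) m - inner ℝ (kGrad y) m) * inner ℝ (kGrad x) n / jap x +
        inner ℝ (kGrad y) m * (inner ℝ (kGrad x) n - inner ℝ (kGrad y) n) / jap x +
        inner ℝ (kGrad y) m * inner ℝ (kGrad y) n * (jap y - jap x) / (jap x * jap y)) := by
      unfold kHess
      field_simp
      ring
    rw [e]
    refine (abs_sub _ _).trans ((add_le_add_right ((abs_add_le _ _).trans
      (add_le_add_left (abs_add_le _ _) _)) _).trans ?_)
    simp only [abs_div, abs_mul]
    rw [abs_of_pos hx, abs_of_pos hy, abs_of_pos (by linarith : 0 < jap x + 1),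
      abs_of_pos (by linarith : 0 < jap y + 1)]
    calc _ ≤ 1 * ‖x - y‖ / (jap x * jap y) + (2 * ‖x - y‖ / jap y * 1 / jap x +
          1 * (2 * ‖x - y‖ / jap y) / jap x + 1 * 1 * ‖x - y‖ / (jap x * jap y)) := by
          gcongr
          · linarith
          · linarith
          · exact hd m hm
          · exact hkn x
          · exact hkm y
          · exact hd n hn
          · exact hkm y
          · exact hkn y
      _ = _ := by field_simp; ring

lemma abs_kLin_le (s : ℝ) (y : Plane) : |kLin s y| ≤ |s| * (1 + ‖y‖) := by
  rw [kLin_eq_mul, abs_mul]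
  gcongr
  have h := abs_kLin_sub_le y 0
  have h0 : |kLin 1 0| ≤ 1 := by
    simp only [kLin, norm_zero]
    norm_num
    rw [abs_le]
    have := Real.log_two_lt_d9
    have := Real.log_two_gt_d9
    constructor <;> linarith
  rw [sub_zero] at h
  have := abs_sub_abs_le_abs_sub (kLin 1 y) (kLin 1 0)
  linarith

lemma integrable_mul_schwartz {q : Plane → ℝ} (hq : Continuous q) {K : ℝ}
    (hK : ∀ y, |q y| ≤ K * (1 + ‖y‖)) (Ψ : 𝓢(Plane, ℂ)) : Integrable fun y => (q y : ℂ) * Ψ y := by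
  refine ((integrable_one_add_norm_sq_mul Ψ).const_mul K).mono'
    ((Complex.continuous_ofReal.comp hq).mul Ψ.continuous).aestronglyMeasurable
    (.of_forall fun y => ?_)
  rw [norm_mul, Complex.norm_real, Real.norm_eq_abs, ← mul_assoc]
  have hK0 : 0 ≤ K := by
    have := (abs_nonneg _).trans (hK 0); simpa using this
  gcongr
  refine (hK y).trans ?_
  gcongr
  nlinarith [norm_nonneg y]

lemma integral_mul_lineDeriv {q : Plane → ℝ} (hq : Differentiable ℝ q) {q' : Plane → ℝ}
    (hq' : Continuous q') {m : Plane} (hqq' : ∀ y, fderiv ℝ q y m = q' y) {K K' : ℝ}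
    (hK : ∀ y, |q y| ≤ K * (1 + ‖y‖)) (hK' : ∀ y, |q' y| ≤ K' * (1 + ‖y‖)) (Ψ : 𝓢(Plane, ℂ)) :
    ∫ y, (q y : ℂ) * (∂_{m} Ψ) y = -∫ y, (q' y : ℂ) * Ψ y := by
  have hf : Differentiable ℝ fun y => (q y : ℂ) := Complex.ofRealCLM.differentiable.comp hq
  have hfd : ∀ y, fderiv ℝ (fun y => (q y : ℂ)) y m = q' y := fun y => by
    have := (HasFDerivAt.comp (g := fun x : ℝ => (x : ℂ)) (f := q) y
      Complex.ofRealCLM.hasFDerivAt (hq y).hasFDerivAt).fderiv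
    rw [Function.comp_def] at this
    rw [this]
    simp [hqq']
  have h := integral_mul_fderiv_eq_neg_fderiv_mul_of_integrable (μ := (volume : Measure Plane))
    (f := fun y => (q y : ℂ)) (g := Ψ) (v := m) (𝕜 := ℂ)
    (by simp only [hfd]; exact integrable_mul_schwartz hq' hK' Ψ)
    (integrable_mul_schwartz hq.continuous hK (∂_{m} Ψ))
    (integrable_mul_schwartz hq.continuous hK Ψ) 
    (fun y _ => hf y) (fun y _ => Ψ.differentiable y)
  simp only [hfd] at h
  exact h

lemma integral_kLin_mul (m n : Plane) (hm : ‖m‖ ≤ 1) (hn : ‖n‖ ≤ 1) (Ψ : 𝓢(Plane, ℂ)) :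
    ∫ y, (kLin 1 y : ℂ) * (∂_{m} (∂_{n} Ψ)) y = ∫ y, (kHess m n y : ℂ) * Ψ y := by
  have hone : ∀ y : Plane, 1 ≤ 1 + ‖y‖ := fun y => by linarith [norm_nonneg y]
  have hg : ∀ y, |inner ℝ (kGrad y) m| ≤ 1 * (1 + ‖y‖) := fun y => by
    rw [one_mul]
    exact (abs_real_inner_le_norm _ _).trans
      ((mul_le_one₀ (norm_kGrad_le y) (norm_nonneg _) hm).trans (hone y))
  have hc : Continuous (kHess m n) := by
    unfold kHess
    have h1 : ∀ y, jap y + 1 ≠ 0 := fun y => by linarith [jap_pos y]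
    have h2 : ∀ y, jap y ≠ 0 := fun y => (jap_pos y).ne'
    have := continuous_jap
    fun_prop (disch := assumption)
  rw [integral_mul_lineDeriv (fun y => (hasFDerivAt_kLin 1 y).differentiableAt)
    (q' := fun y => inner ℝ (kGrad y) m) (by fun_prop)
    (fun y => by rw [(hasFDerivAt_kLin 1 y).fderiv]; simp) (K := |1|) (K' := 1)
    (abs_kLin_le 1) hg,
    integral_mul_lineDeriv (differentiable_inner_kGrad m) hc (fderiv_inner_kGrad m n)
      (K := 1) (K' := 2) hg (fun y => ?_), neg_neg]
  refine ((symbolDecay_kHess hm hn).le y).trans ?_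
  rw [div_le_iff₀ (jap_pos y), mul_assoc]
  have := one_le_mul_of_one_le_of_one_le (hone y) (one_le_jap y)
  linarith

/-- Two integrations by parts move the derivatives from the test function to the profile, where the
decay of the Hessian applies. -/
theorem homSobolev_kLin_le {c : ℝ} (hc : 0 < c) (hc1 : c < 1) (s : ℝ) :
    homSobolev (2 + c) (kLin s) ≤ 2 ^ 2 * (ENNReal.ofReal ((2 * Real.pi) ^ c) *
      (ENNReal.ofReal |s| * symbolConst 2 6 c)) := by
  obtain ⟨u, hu⟩ := exists_isFunction (v := fun y => (kLin s y : ℂ)) (K := |s|)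
    (Complex.continuous_ofReal.comp (continuous_kLin s)).aestronglyMeasurable
    (fun y => by
      rw [Complex.norm_real]
      refine (abs_kLin_le s y).trans ?_
      gcongr
      nlinarith [norm_nonneg y])
  have hfl : ⌊2 + c⌋₊ = 2 := by
    rw [Nat.floor_eq_iff (by linarith)]; norm_num; constructor <;> linarith
  refine homSobolev_le (c := c) hfl (by push_cast; ring) hc hc1 hu
    (ENNReal.mul_ne_top ENNReal.ofReal_ne_top (symbolConst_ne_top hc)) fun i φ => ?_
  have h6 : 𝓕 (partialDeriv i u) φ =
      u (∂_{basisVec (i 1)} (∂_{basisVec (i 0)} (𝓕 φ : 𝓢(Plane, ℂ)))) := by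
    have : partialDeriv i u = ∂_{basisVec (i 0)} (∂_{basisVec (i 1)} u) := rfl
    rw [this, TemperedDistribution.fourier_apply, TemperedDistribution.lineDerivOp_apply_apply,
      TemperedDistribution.lineDerivOp_apply_apply]
    simp
  have h7 := integral_kLin_mul (basisVec (i 1)) (basisVec (i 0)) (by simp) (by simp)
    (𝓕 φ : 𝓢(Plane, ℂ))
  have h8 : ∀ y, (∂_{basisVec (i 1)} (∂_{basisVec (i 0)} (𝓕 φ : 𝓢(Plane, ℂ)))) y * (kLin s y : ℂ) =
      s * ((kLin 1 y : ℂ) *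
        (∂_{basisVec (i 1)} (∂_{basisVec (i 0)} (𝓕 φ : 𝓢(Plane, ℂ)))) y) := fun y => by
    rw [kLin_eq_mul s y]; push_cast; ring
  rw [h6, (hu.2 _).2]
  simp only [h8]
  rw [integral_const_mul, h7, enorm_mul, mul_assoc,
    show ‖(s : ℂ)‖ₑ = ENNReal.ofReal |s| by rw [← ofReal_norm, Complex.norm_real]; rfl]
  gcongr
  exact (symbolDecay_kHess (by simp) (by simp)).enorm_pairing_le (by norm_num) hc hc1 φ

lemma opConst_ne_top (a : ℝ) : opConst a ≠ ∞ :=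
  ENNReal.mul_ne_top (ENNReal.mul_ne_top (by norm_num) ENNReal.ofReal_ne_top) ENNReal.ofReal_ne_top

/-- A bound of the norm of `kLin 1` in `Ḣ^(2 + a / 4) ∩ Ḣ^(2 + a)`. -/
def profileConst (a : ℝ) : ℝ≥0∞ :=
  2 ^ 2 * (ENNReal.ofReal ((2 * Real.pi) ^ (a / 4)) * symbolConst 2 6 (a / 4)) +
    2 ^ 2 * (ENNReal.ofReal ((2 * Real.pi) ^ a) * symbolConst 2 6 a)

lemma profileConst_ne_top {a : ℝ} (ha : 0 < a) : profileConst a ≠ ∞ :=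
  ENNReal.add_ne_top.2
    ⟨ENNReal.mul_ne_top (by norm_num) (ENNReal.mul_ne_top ENNReal.ofReal_ne_top
      (symbolConst_ne_top (by linarith))),
    ENNReal.mul_ne_top (by norm_num) (ENNReal.mul_ne_top ENNReal.ofReal_ne_top
      (symbolConst_ne_top ha))⟩

lemma homSobolev_kLin_add_le {a : ℝ} (ha : 0 < a) (ha1 : a < 1) (s : ℝ) :
    homSobolev (2 + a / 4) (kLin s) + homSobolev (2 + a) (kLin s) ≤
      ENNReal.ofReal |s| * profileConst a := by
  refine (add_le_add (homSobolev_kLin_le (by linarith) (by linarith) s)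
    (homSobolev_kLin_le ha ha1 s)).trans (le_of_eq ?_)
  rw [profileConst]
  ring

theorem exists_isT_kLin {a : ℝ} (ha : 0 < a) (ha1 : a < 1) (s : ℝ) :
    ∃ T : Plane → ℝ, IsT (kLin s) (kLin s) T ∧
      homSobolev (1 + a) T ≤ opConst a * profileConst a * ENNReal.ofReal (|s| ^ 3) := by
  have h := homSobolev_kLin_add_le ha ha1 s
  have hfin := ENNReal.add_lt_top.1 (h.trans_lt
    (ENNReal.mul_lt_top ENNReal.ofReal_lt_top (profileConst_ne_top ha).lt_top))
  obtain ⟨g, hg, hgf, T, hT, hTe⟩ := exists_isT ha ha1 s hfin.1 hfin.2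
  -- The C¹ representative and the profile are both continuous and agree almost everywhere, so the
  -- operator is evaluated on the profile itself.
  obtain rfl : g = kLin s := (hg.continuous.ae_eq_iff_eq _ (continuous_kLin s)).1 hgf
  refine ⟨T, hT, hTe.trans ?_⟩
  calc _ ≤ opConst a * ENNReal.ofReal (s ^ 2) * (ENNReal.ofReal |s| * profileConst a) := by gcongr
    _ = opConst a * profileConst a * (ENNReal.ofReal (s ^ 2) * ENNReal.ofReal |s|) := by ring
    _ = _ := by
      rw [← ENNReal.ofReal_mul (sq_nonneg s), ← sq_abs, ← pow_succ]

end Muskat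

end

theorem mainTheorem3 (t₁ : ℝ) (ht₁ : t₁ ∈ Set.Ioo (3 / 2 : ℝ) 2) :
    ∃ t₂ ∈ Set.Ioo (2 : ℝ) (t₁ + 1), ∃ C : ℝ≥0,
      (∀ (s : ℝ) (f : Muskat.Plane → ℝ),
        Muskat.homSobolev t₂ f < ∞ → Muskat.homSobolev (t₁ + 1) f < ∞ →
          ∃ g : Muskat.Plane → ℝ, ContDiff ℝ 1 g ∧ g =ᵐ[volume] f ∧
            ∃ T : Muskat.Plane → ℝ, Muskat.IsT g (Muskat.kLin s) T ∧
              Muskat.homSobolev t₁ T ≤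
                C * ENNReal.ofReal (s ^ 2) *
                  (Muskat.homSobolev t₂ f + Muskat.homSobolev (t₁ + 1) f)) ∧
      (∀ s : ℝ, ∃ T : Muskat.Plane → ℝ, Muskat.IsT (Muskat.kLin s) (Muskat.kLin s) T ∧
        Muskat.homSobolev t₁ T ≤ C * ENNReal.ofReal (|s| ^ 3)) := by
  obtain ⟨a, rfl⟩ : ∃ a, t₁ = 1 + a := ⟨t₁ - 1, by ring⟩
  have ha : 0 < a := by linarith [ht₁.1]
  have ha1 : a < 1 := by linarith [ht₁.2]
  have e : 1 + a + 1 = 2 + a := by ring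
  rw [e]
  have hC : Muskat.opConst a * (1 + Muskat.profileConst a) ≠ ∞ :=
    ENNReal.mul_ne_top (Muskat.opConst_ne_top a)
      (ENNReal.add_ne_top.2 ⟨ENNReal.one_ne_top, Muskat.profileConst_ne_top ha⟩)
  -- The summand 1 serves the linear estimate and `profileConst a` the estimate of the profile, so
  -- that one constant covers both.
  refine ⟨2 + a / 4, ⟨by linarith, by linarith⟩,
    (Muskat.opConst a * (1 + Muskat.profileConst a)).toNNReal, fun s f h1 h2 => ?_, fun s => ?_⟩
  · obtain ⟨g, hg, hgf, T, hT, hTe⟩ := Muskat.exists_isT ha ha1 s h1 h2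
    refine ⟨g, hg, hgf, T, hT, hTe.trans ?_⟩
    rw [ENNReal.coe_toNNReal hC]
    gcongr
    exact le_mul_of_one_le_right' le_self_add
  · obtain ⟨T, hT, hTe⟩ := Muskat.exists_isT_kLin ha ha1 s
    refine ⟨T, hT, hTe.trans ?_⟩
    rw [ENNReal.coe_toNNReal hC]
    gcongr
    exact le_add_self
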